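/- Let $M$ be a (finite-dimensional, Hausdorff, second countable) smooth manifold and let $(V,\partial)$ be a cochain complex of real vector spaces of finite type ($V=\bigoplus_i V^i$ finite-dimensional, $\partial$ of degree $+1$, $\partial^2=0$). Write $\mathrm{End}^k(V)$ for the endomorphisms of degree $k$. **The crossed module.** $\mathsf{gl}^0(V)$ is the algebra of degree-$0$ cochain maps, $\mathsf{gl}^{-1}(V)=\mathrm{End}^{-1}(V)/[\partial,\mathrm{End}^{-2}(V)]$ with projection $\pi$, and $\delta(s)=[\partial,s]=\partial s+s\partial$. $\mathsf{GL}^0(V)$ is the group of automorphisms of $(V,\partial)$, and $\mathsf{GL}^{-1}(V)\subset\mathsf{gl}^{-1}(V)$ is the group of classes $s$ with $\mathrm{id}+[\partial,s]$ invertible, with product $s*t=s+t+s[\partial,t]$ and unit $0$. $\mathsf{GL}^0(V)$ acts on $\mathsf{gl}^{-1}(V)$ by $g\rhd s=gsg^{-1}$, and left translation has differential $(L_h)_*X=X+h[\partial,X]$ at the unit. **Superconnections and their truncation.** Let $\alpha=\alpha^1+\alpha^2+\cdots$, $\alpha^k\in\Omega^k(M,\mathrm{End}^{1-k}(V))$,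 be a flat superconnection, i.e. $[\partial,\alpha^n]+d\alpha^{n-1}+\sum_{i+j=n}\alpha^i\circ\alpha^j=0$ for all $n\ge1$ (with $\alpha^0=0$), where $\circ$ and the graded commutator are those of the graded algebra $\Omega(M)\otimes\mathrm{End}(V)$, $(\omega\otimes f)\circ(\eta\otimes g)=(-1)^{|f||\eta|}(\omega\wedge\eta)\otimes fg$. Put $A=\alpha^1$ and $B=-\pi\circ\alpha^2$; then $(A,B)$ is a flat $2$-connection with values in $\mathsf{gl}(V)$, i.e. $\delta B=dA+\tfrac12[A,A]$ and $dB+A\wedge^{\rhd}B=0$. **Surface holonomy.** A path is a piecewise smooth map $\gamma:[0,1]\to M$. A $2$-path is a piecewise smooth map $\Gamma:[0,1]^2\to M$, $(t,s)\mapsto\Gamma(t,s)=\Gamma_s(t)$, constant on each of the sides $t=0$ and $t=1$. (Piecewise smooth: the domain is a finite union of compact convex sets on each of which the map is smooth.) $\mathsf{Hol}(\gamma)=g_\gamma(1)\in\mathsf{GL}^0(V)$, where $g_\gamma'=-A(\dot\gamma)\,g_\gamma$, $g_\gamma(0)=1$; and $\mathsf{Hol}(\Gamma)=h(1)\in\mathsf{GL}^{-1}(V)$,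 where $$h'(s)=(L_{h(s)})_*\int_0^1 g_{\Gamma_s}(t)^{-1}\rhd B(\partial_t\Gamma,\partial_s\Gamma)\,dt,\qquad h(0)=1$$ (solutions are continuous and satisfy the equation off a finite set). **Integration.** Let $\Delta_k=\{1\ge t_1\ge\cdots\ge t_k\ge0\}$ and let $\beta=\int\alpha$. For a path $\gamma$, with $\gamma^{-1}(t)=\gamma(1-t)$ and $(\gamma^{-1})^*\alpha^1=a(t)\,dt$, $$\beta^1(\gamma)=\sum_{k\ge0}(-1)^k\int_{\Delta_k}a(t_1)\cdots a(t_k)\,dt_1\cdots dt_k .$$ For $\sigma:\Delta_2\to M$, $$\beta^2(\sigma)=\sum_{m,n\ge0}(-1)^{m+n+1}\int_{\Delta_{m+n+1}\times[0,1]}\Theta_{(m+n+1)}^*\big(p_1^*\sigma^*\alpha^1\wedge\cdots\wedge p_m^*\sigma^*\alpha^1\wedge p_{m+1}^*\sigma^*\alpha^2\wedge p_{m+2}^*\sigma^*\alpha^1\wedge\cdots\wedge p_{m+n+1}^*\sigma^*\alpha^1\big),$$ where $p_i$ is the projection of $(\Delta_2)^{m+n+1}$ to the $i$-th factor, $\Theta_{(k)}(t_1,\dots,t_k,s)=(\Theta(t_1,s),\dots,\Theta(t_k,s))$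 and $\Theta=q\circ\lambda$, with $q(t,s)=(\max\{t,s\},s)$ and $\lambda(-,s)$ the piecewise linear path $(s,1)\to(s,0)\to(0,0)$ that is at $(s,0)$ at time $1/2$. The $2$-truncation of $\beta$ is $$(\mathsf T_{\le2}\beta)(\gamma)=\beta^1(\gamma^{-1}),\qquad (\mathsf T_{\le2}\beta)(\Gamma)=\big[(\beta^2(\Gamma_b)-\beta^2(\Gamma_a))\,\beta^1(\Gamma_1^{-1})\big]\in\mathsf{GL}^{-1}(V),$$ where $\Gamma_b(t,s)=\Gamma(t,s)$ and $\Gamma_a(t,s)=\Gamma(s,t)$ for $(t,s)\in\Delta_2$. **Theorem.** For every flat superconnection $\alpha$ on $M$ with values in $(V,\partial)$, the integrals and series above converge absolutely, the differential equations have solutions with uniquely determined end values, $(\mathsf T_{\le2}\int\alpha)(\gamma)$ and $(\mathsf T_{\le2}\int\alpha)(\Gamma)$ lie in $\mathsf{GL}^0(V)$ and $\mathsf{GL}^{-1}(V)$, and $$\mathsf{Hol}_{\mathsf T_{\le2}\alpha}(\gamma)=\Big(\mathsf T_{\le2}\int\alpha\Big)(\gamma)\in\mathsf{GL}^0(V),\qquad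 \mathsf{Hol}_{\mathsf T_{\le2}\alpha}(\Gamma)=\Big(\mathsf T_{\le2}\int\alpha\Big)(\Gamma)\in\mathsf{GL}^{-1}(V)$$ for every path $\gamma$ and every $2$-path $\Gamma$ in $M$; that is, $\mathsf{Hol}\circ\mathsf T_{\le2}=\mathsf T_{\le2}\circ\int$. -/

import Mathlib

open Set MeasureTheory
open scoped Manifold ContDiff Topology

noncomputable section

namespace HigherHol

/-! ### Finite-dimensional cochain complexes and the crossed modules `gl(V)`, `GL(V)` -/

/-- A finite-type cochain complex, presented on its total space `V` (which is finite-dimensional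
wherever this structure is used; the norm of `V` only serves to name its canonical topology):
a `ℤ`-grading of `V` and a differential of degree `+1` with square zero. -/
structure FinComplex (V : Type*) [NormedAddCommGroup V] [NormedSpace ℝ V] where
  /-- the homogeneous component `V^i` -/
  comp : ℤ → Submodule ℝ V
  internal : DirectSum.IsInternal comp
  /-- the differential `∂` -/
  d : V →L[ℝ] V
  d_mem : ∀ i, ∀ v ∈ comp i, d v ∈ comp (i + 1)
  d_sq : d * d = 0

namespace FinComplex

variable {V : Type*} [NormedAddCommGroup V] [NormedSpace ℝ V] (C : FinComplex V)

/-- `End^k(V)`: the endomorphisms of degree `k`. -/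
def endDeg (k : ℤ) : Submodule ℝ (V →L[ℝ] V) where
  carrier := {f | ∀ i, ∀ v ∈ C.comp i, f v ∈ C.comp (i + k)}
  add_mem' hf hg i v hv := (C.comp (i + k)).add_mem (hf i v hv) (hg i v hv)
  zero_mem' i _ _ := (C.comp (i + k)).zero_mem
  smul_mem' c _ hf i v hv := (C.comp (i + k)).smul_mem c (hf i v hv)

theorem d_mem_endDeg : C.d ∈ C.endDeg 1 := C.d_mem

theorem mul_mem_endDeg {a b c : ℤ} (h : a + b = c) {f g : V →L[ℝ] V}
    (hf : f ∈ C.endDeg a) (hg : g ∈ C.endDeg b) : f * g ∈ C.endDeg c := by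
  intro i v hv
  have := hf _ _ (hg i v hv)
  rwa [show i + b + a = i + c by omega] at this

/-- `gl⁰(V)`: degree-zero cochain maps `V → V`. -/
def gl0 : Subalgebra ℝ (V →L[ℝ] V) where
  carrier := {f | f ∈ C.endDeg 0 ∧ C.d * f = f * C.d}
  mul_mem' {f g} hf hg :=
    ⟨C.mul_mem_endDeg (by norm_num) hf.1 hg.1, by
      rw [← mul_assoc, hf.2, mul_assoc, hg.2, mul_assoc]⟩
  add_mem' {f g} hf hg :=
    ⟨(C.endDeg 0).add_mem hf.1 hg.1, by rw [mul_add, add_mul, hf.2, hg.2]⟩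
  algebraMap_mem' r := by
    refine ⟨fun i v hv => ?_, (Algebra.commutes r C.d).symm⟩
    rw [add_zero, Algebra.algebraMap_eq_smul_one]
    exact (C.comp i).smul_mem r hv

/-- The map `h ↦ [∂, h] = ∂h - h∂` from `End⁻²(V)` to `End⁻¹(V)`. -/
def bracketD : C.endDeg (-2) →ₗ[ℝ] C.endDeg (-1) where
  toFun h := ⟨C.d * h.1 - h.1 * C.d, (C.endDeg (-1)).sub_mem
    (C.mul_mem_endDeg (by norm_num) C.d_mem_endDeg h.2)
    (C.mul_mem_endDeg (by norm_num) h.2 C.d_mem_endDeg)⟩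
  map_add' x y := by
    ext1; simp only [Submodule.coe_add, mul_add, add_mul]; abel
  map_smul' c x := by
    ext1
    simp only [Submodule.coe_smul, mul_smul_comm, smul_mul_assoc, RingHom.id_apply, smul_sub]

/-- The subspace `[∂, End⁻²(V)]` of `End⁻¹(V)`. -/
def exact : Submodule ℝ (C.endDeg (-1)) := LinearMap.range C.bracketD

instance isClosed_exact [FiniteDimensional ℝ V] :
    IsClosed ((C.exact : Submodule ℝ (C.endDeg (-1))) : Set (C.endDeg (-1))) :=
  Submodule.closed_of_finiteDimensional _

variable [FiniteDimensional ℝ V]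

/-- `gl⁻¹(V) = End⁻¹(V) / [∂, End⁻²(V)]`. -/
def glNeg : Type _ := C.endDeg (-1) ⧸ C.exact

instance : NormedAddCommGroup C.glNeg := inferInstanceAs (NormedAddCommGroup (_ ⧸ C.exact))

instance : NormedSpace ℝ C.glNeg := inferInstanceAs (NormedSpace ℝ (_ ⧸ C.exact))

/-- The projection `π : End⁻¹(V) → gl⁻¹(V)`. -/
def proj : C.endDeg (-1) →L[ℝ] C.glNeg where
  toLinearMap := C.exact.mkQ
  cont := C.exact.mkQL.cont

/-- The map `s ↦ φ s ψ` on `End⁻¹(V)`, for `φ, ψ ∈ gl⁰(V)`. -/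
def sandwichAux (φ ψ : C.gl0) : C.endDeg (-1) →ₗ[ℝ] C.endDeg (-1) where
  toFun s := ⟨φ.1 * s.1 * ψ.1,
    C.mul_mem_endDeg (add_zero _) (C.mul_mem_endDeg (zero_add _) φ.2.1 s.2) ψ.2.1⟩
  map_add' x y := by ext1; simp only [Submodule.coe_add, mul_add, add_mul]
  map_smul' c x := by
    ext1; simp only [Submodule.coe_smul, mul_smul_comm, smul_mul_assoc, RingHom.id_apply]

/-- The map `s ↦ φ s ψ` on `gl⁻¹(V)`, for `φ, ψ ∈ gl⁰(V)`. -/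
def sandwich (φ ψ : C.gl0) : C.glNeg →ₗ[ℝ] C.glNeg :=
  Submodule.mapQ C.exact C.exact (C.sandwichAux φ ψ) (by
    rintro _ ⟨h, rfl⟩
    refine ⟨⟨φ.1 * h.1 * ψ.1,
      C.mul_mem_endDeg (add_zero _) (C.mul_mem_endDeg (zero_add _) φ.2.1 h.2) ψ.2.1⟩, ?_⟩
    ext1
    simp only [bracketD, sandwichAux, LinearMap.coe_mk, AddHom.coe_mk, mul_sub, sub_mul]
    have h1 : C.d * (φ.1 * h.1 * ψ.1) = φ.1 * (C.d * h.1) * ψ.1 := by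
      rw [← mul_assoc, ← mul_assoc, φ.2.2]; simp only [mul_assoc]
    have h2 : φ.1 * h.1 * ψ.1 * C.d = φ.1 * (h.1 * C.d) * ψ.1 := by
      rw [mul_assoc, ← ψ.2.2]; simp only [mul_assoc]
    rw [h1, h2])

/-- `δ(s) = [∂, s] = ∂s + s∂` on `End⁻¹(V)`. -/
def deltaAux : C.endDeg (-1) →ₗ[ℝ] C.gl0 where
  toFun s := ⟨C.d * s.1 + s.1 * C.d, (C.endDeg 0).add_mem
    (C.mul_mem_endDeg (by norm_num) C.d_mem_endDeg s.2)
    (C.mul_mem_endDeg (by norm_num) s.2 C.d_mem_endDeg), by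
      rw [mul_add, add_mul, ← mul_assoc C.d C.d, C.d_sq, mul_assoc s.1 C.d, C.d_sq]
      simp only [zero_mul, mul_zero, zero_add, add_zero, mul_assoc]⟩
  map_add' x y := by
    apply Subtype.ext
    simp only [mul_add, add_mul, AddMemClass.coe_add]; abel
  map_smul' c x := by
    apply Subtype.ext
    simp only [Submodule.coe_smul, mul_smul_comm, smul_mul_assoc, RingHom.id_apply, smul_add,
      Subalgebra.coe_smul]

/-- The homomorphism `δ : gl⁻¹(V) → gl⁰(V)`, `δ(s) = [∂, s]`. -/
def delta : C.glNeg →ₗ[ℝ] C.gl0 :=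
  Submodule.liftQ C.exact C.deltaAux (by
    rintro _ ⟨h, rfl⟩
    rw [LinearMap.mem_ker]
    apply Subtype.ext
    simp only [deltaAux, bracketD, LinearMap.coe_mk, AddHom.coe_mk, mul_sub, sub_mul,
      ZeroMemClass.coe_zero]
    rw [← mul_assoc C.d C.d, C.d_sq, mul_assoc h.1 C.d, C.d_sq]
    simp only [zero_mul, mul_zero, mul_assoc]
    abel)

theorem delta_proj (s : C.endDeg (-1)) : C.delta (C.proj s) = C.deltaAux s := rfl

theorem sandwich_proj (φ ψ : C.gl0) (s : C.endDeg (-1)) :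
    C.sandwich φ ψ (C.proj s) = C.proj (C.sandwichAux φ ψ s) := rfl

/-- The infinitesimal action `φ ▹ s = φ s - s φ` of `gl⁰(V)` on `gl⁻¹(V)`. -/
def act (φ : C.gl0) (x : C.glNeg) : C.glNeg := C.sandwich φ 1 x - C.sandwich 1 φ x

/-- `GL⁰(V)`: the group of automorphisms of the cochain complex `(V, ∂)`. -/
def GL0 : Subgroup (V →L[ℝ] V)ˣ where
  carrier := {g | (g : V →L[ℝ] V) ∈ C.gl0 ∧ ((g⁻¹ : (V →L[ℝ] V)ˣ) : V →L[ℝ] V) ∈ C.gl0}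
  mul_mem' {f g} hf hg := by
    refine ⟨?_, ?_⟩
    · rw [Units.val_mul]; exact C.gl0.mul_mem hf.1 hg.1
    · rw [mul_inv_rev, Units.val_mul]; exact C.gl0.mul_mem hg.2 hf.2
  one_mem' := by
    refine ⟨?_, ?_⟩
    · rw [Units.val_one]; exact C.gl0.one_mem
    · rw [inv_one, Units.val_one]; exact C.gl0.one_mem
  inv_mem' {f} hf := by
    refine ⟨hf.2, ?_⟩
    rw [inv_inv]; exact hf.1

/-- The endomorphism of `V` underlying an element of `GL⁰(V)`. -/
def toEnd (g : C.GL0) : V →L[ℝ] V := ((g : (V →L[ℝ] V)ˣ) : V →L[ℝ] V)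

/-- An automorphism of the complex is in particular a degree-zero cochain map. -/
def toGl0 (g : C.GL0) : C.gl0 := ⟨C.toEnd g, g.2.1⟩

/-- The action `g ▹ s = g s g⁻¹` of `GL⁰(V)` on `gl⁻¹(V)` (and on `GL⁻¹(V)`). -/
def conj (g : C.GL0) (x : C.glNeg) : C.glNeg := C.sandwich (C.toGl0 g) (C.toGl0 g⁻¹) x

/-- `GL⁻¹(V)`: classes of `s ∈ End⁻¹(V)` with `[∂, s] + id` invertible. -/
def GLNeg : Type _ := {x : C.glNeg // IsUnit ((1 + C.delta x : C.gl0) : V →L[ℝ] V)}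

/-- The class in `gl⁻¹(V)` underlying an element of `GL⁻¹(V)`. -/
def GLNeg.toClass {C : FinComplex V} (x : C.GLNeg) : C.glNeg := x.1

/-- The unit of `GL⁻¹(V)`, the class of `s = 0`. -/
instance : One C.GLNeg :=
  ⟨⟨0, by rw [map_zero, add_zero]; exact isUnit_one⟩⟩

/-- The product `s ∗ t = s + t + s [∂, t]`. -/
def star (x y : C.glNeg) : C.glNeg := x + y + C.sandwich 1 (C.delta y) x

theorem delta_sandwich_one (φ : C.gl0) (x : C.glNeg) :
    C.delta (C.sandwich 1 φ x) = C.delta x * φ := by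
  induction x using Submodule.Quotient.induction_on with
  | _ s =>
    apply Subtype.ext
    change C.d * ((1 : V →L[ℝ] V) * s.1 * φ.1) + (1 : V →L[ℝ] V) * s.1 * φ.1 * C.d
      = (C.d * s.1 + s.1 * C.d) * φ.1
    rw [one_mul, add_mul, mul_assoc s.1 φ.1, ← φ.2.2]
    simp only [mul_assoc]

/-- `id + δ` is multiplicative for `∗`. -/
theorem one_add_delta_star (x y : C.glNeg) :
    1 + C.delta (C.star x y) = (1 + C.delta x) * (1 + C.delta y) := by
  rw [star, map_add, map_add, delta_sandwich_one]
  noncomm_ring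

/-- The multiplication of `GL⁻¹(V)`. -/
instance : Mul C.GLNeg :=
  ⟨fun x y => ⟨C.star x.1 y.1, by
    rw [one_add_delta_star, MulMemClass.coe_mul]
    exact x.2.mul y.2⟩⟩

/-- The differential at the unit of left translation by `h ∈ GL⁻¹(V)`:
`(L_h)_* X = X + h [∂, X]`, the linear part of the affine map `y ↦ h ∗ y`. -/
def leftD (h : C.GLNeg) (X : C.glNeg) : C.glNeg := X + C.sandwich 1 (C.delta X) h.toClass

theorem star_eq_add_leftD (h : C.GLNeg) (X : C.glNeg) :
    C.star h.toClass X = h.toClass + C.leftD h X := by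
  rw [star, leftD, add_assoc]

end FinComplex

/-! ### Differential forms on a manifold

The manifold `M` is modelled on the finite-dimensional space `E`. -/

section Forms

variable (E : Type*) [NormedAddCommGroup E] [NormedSpace ℝ E]
  (M : Type*) [TopologicalSpace M] [ChartedSpace E M]
  (W : Type*) [NormedAddCommGroup W] [NormedSpace ℝ W]

variable {E M W} in
/-- The expression of a `k`-form in the chart at `x₀`: its pull-back along the inverse chart. -/
def inChart {k : ℕ} (η : (x : M) → (TangentSpace 𝓘(ℝ, E) x) [⋀^Fin k]→L[ℝ] W) (x₀ : M) (y : E) :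
    E [⋀^Fin k]→L[ℝ] W :=
  (η ((extChartAt 𝓘(ℝ, E) x₀).symm y)).compContinuousLinearMap
    (mfderiv 𝓘(ℝ, E) 𝓘(ℝ, E) (extChartAt 𝓘(ℝ, E) x₀).symm y)

/-- `Ω^k(M, W)`: smooth `k`-forms on `M` with values in `W`. -/
structure DiffForm (k : ℕ) where
  /-- the alternating form on each tangent space -/
  toFun : (x : M) → (TangentSpace 𝓘(ℝ, E) x) [⋀^Fin k]→L[ℝ] W
  smooth : ∀ x₀ : M, ContDiffOn ℝ ∞ (inChart toFun x₀) (extChartAt 𝓘(ℝ, E) x₀).target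

end Forms

/-- The wedge product of an `i`-form and a `j`-form at a point, `i + j = n`, with values in an
algebra, evaluated on `v`; no Koszul sign is inserted. -/
def wedgeEval {E R : Type*} [NormedAddCommGroup E] [NormedSpace ℝ E] [NormedRing R]
    [NormedAlgebra ℝ R] {i j n : ℕ} (h : i + j = n) (ζ : E [⋀^Fin i]→L[ℝ] R)
    (η : E [⋀^Fin j]→L[ℝ] R) (v : Fin n → E) : R :=
  ((i.factorial * j.factorial : ℕ) : ℝ)⁻¹ • ∑ σ : Equiv.Perm (Fin n),
    ((Equiv.Perm.sign σ : ℤ) : ℝ) •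
      (ζ (fun a => v (σ (Fin.cast h (Fin.castAdd j a)))) *
        η (fun b => v (σ (Fin.cast h (Fin.natAdd i b)))))

/-! ### Flat superconnections and flat 2-connections -/

section Connections

variable (E : Type*) [NormedAddCommGroup E] [NormedSpace ℝ E]
  (M : Type*) [TopologicalSpace M] [ChartedSpace E M]
  {V : Type*} [NormedAddCommGroup V] [NormedSpace ℝ V]

/-- `Rep_∞(TM, V)`: flat superconnections `α = α¹ + α² + ⋯` on `M` with values in `(V, ∂)`,
`α^k ∈ Ω^k(M, End^{1-k}(V))` (and `α⁰ = 0`).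

Flatness is `[∂, α^n] + dα^{n-1} + ∑_{i+j=n} α^i ∘ α^j = 0` for `n = m + 1 ≥ 1`, where products
are taken in the graded algebra `Ω(M) ⊗ End(V)`, i.e.
`(ω ⊗ f) ∘ (η ⊗ g) = (-1)^{|f||η|} (ω ∧ η) ⊗ fg`. So `α^i ∘ α^j` carries the sign
`(-1)^{(1-i)j} = (-1)^{(i+1)j}`, and `[∂, α^n] = (1 ⊗ ∂) ∘ α^n + α^n ∘ (1 ⊗ ∂)` (both factors have
total degree one) is `(-1)^n ∂ α^n + α^n ∂`. The equation is written in the charts of `M`. -/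
structure FlatSuperconnection (C : FinComplex V) where
  /-- the component `α^k` -/
  form : (k : ℕ) → DiffForm E M (V →L[ℝ] V) k
  form_zero : ∀ x v, (form 0).toFun x v = 0
  form_mem : ∀ (k : ℕ) x v, (form k).toFun x v ∈ C.endDeg (1 - (k : ℤ))
  flat : ∀ (m : ℕ) (x₀ : M), ∀ y ∈ (extChartAt 𝓘(ℝ, E) x₀).target, ∀ v : Fin (m + 1) → E,
    ((-1 : ℝ) ^ (m + 1) • (C.d * inChart (form (m + 1)).toFun x₀ y v)
        + inChart (form (m + 1)).toFun x₀ y v * C.d)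
      + extDeriv (inChart (form m).toFun x₀) y v
      + ∑ i : Fin (m + 2), (-1 : ℝ) ^ (((i : ℕ) + 1) * (m + 1 - i)) •
          wedgeEval (show (i : ℕ) + (m + 1 - i) = m + 1 by omega)
            (inChart (form i).toFun x₀ y) (inChart (form (m + 1 - i)).toFun x₀ y) v = 0

/-- `Flat(M, gl(V))`: pairs `A ∈ Ω¹(M, gl⁰(V))`, `B ∈ Ω²(M, gl⁻¹(V))` with
`δB = dA + ½[A, A]` and `dB + A ∧^▹ B = 0`. -/
structure FlatTwoConnection [FiniteDimensional ℝ V] (C : FinComplex V) where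
  /-- the connection 1-form -/
  A : DiffForm E M (V →L[ℝ] V) 1
  /-- the 2-form -/
  B : DiffForm E M C.glNeg 2
  A_mem : ∀ x v, A.toFun x v ∈ C.gl0
  curvature : ∀ x₀ : M, ∀ y ∈ (extChartAt 𝓘(ℝ, E) x₀).target, ∀ v : Fin 2 → E,
    (C.delta (inChart B.toFun x₀ y v) : V →L[ℝ] V)
      = extDeriv (inChart A.toFun x₀) y v
        + (inChart A.toFun x₀ y ![v 0] * inChart A.toFun x₀ y ![v 1]
          - inChart A.toFun x₀ y ![v 1] * inChart A.toFun x₀ y ![v 0])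
  flat : ∀ x₀ : M, ∀ y ∈ (extChartAt 𝓘(ℝ, E) x₀).target, ∀ v : Fin 3 → E,
    extDeriv (inChart B.toFun x₀) y v
      + (C.act ⟨inChart A.toFun x₀ y ![v 0], A_mem _ _⟩ (inChart B.toFun x₀ y ![v 1, v 2])
        - C.act ⟨inChart A.toFun x₀ y ![v 1], A_mem _ _⟩ (inChart B.toFun x₀ y ![v 0, v 2])
        + C.act ⟨inChart A.toFun x₀ y ![v 2], A_mem _ _⟩ (inChart B.toFun x₀ y ![v 0, v 1])) = 0

end Connections


section Wedge

variable {E R : Type*} [NormedAddCommGroup E] [NormedSpace ℝ E] [NormedRing R] [NormedAlgebra ℝ R]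

theorem wedgeEval_zero_left {i j n : ℕ} (h : i + j = n) {ζ : E [⋀^Fin i]→L[ℝ] R}
    (hζ : ∀ w, ζ w = 0) (η : E [⋀^Fin j]→L[ℝ] R) (v : Fin n → E) : wedgeEval h ζ η v = 0 := by
  simp [wedgeEval, hζ]

theorem wedgeEval_zero_right {i j n : ℕ} (h : i + j = n) (ζ : E [⋀^Fin i]→L[ℝ] R)
    {η : E [⋀^Fin j]→L[ℝ] R} (hη : ∀ w, η w = 0) (v : Fin n → E) : wedgeEval h ζ η v = 0 := by
  simp [wedgeEval, hη]

theorem wedgeEval_one_one (ζ η : E [⋀^Fin 1]→L[ℝ] R) (v : Fin 2 → E) :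
    wedgeEval (show 1 + 1 = 2 from rfl) ζ η v = ζ ![v 0] * η ![v 1] - ζ ![v 1] * η ![v 0] := by
  have hu : (Finset.univ : Finset (Equiv.Perm (Fin 2))) = {1, Equiv.swap 0 1} := by decide
  have h1 : ∀ (w : Fin 1 → E), w = ![w 0] := fun w => by ext i; fin_cases i; rfl
  rw [wedgeEval, hu, Finset.sum_insert (by decide), Finset.sum_singleton]
  rw [h1 (fun a => v ((1 : Equiv.Perm (Fin 2)) _)), h1 (fun a => v ((1 : Equiv.Perm (Fin 2)) _)),
    h1 (fun a => v ((Equiv.swap 0 1 : Equiv.Perm (Fin 2)) _)),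
    h1 (fun a => v ((Equiv.swap 0 1 : Equiv.Perm (Fin 2)) _))]
  simp [sub_eq_add_neg]

theorem univ_perm_three : (Finset.univ : Finset (Equiv.Perm (Fin 3))) =
    {1, Equiv.swap 1 2, Equiv.swap 0 1, Equiv.swap 0 1 * Equiv.swap 1 2, Equiv.swap 0 2,
      Equiv.swap 0 2 * Equiv.swap 1 2} := by decide

theorem map_pair_swap (η : E [⋀^Fin 2]→L[ℝ] R) (a b : E) : η ![b, a] = -η ![a, b] := by
  have h := η.map_swap ![a, b] (show (0 : Fin 2) ≠ 1 by decide)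
  refine Eq.trans (congrArg η ?_) h
  ext i; fin_cases i <;> rfl

theorem sum_perm_three (f : Equiv.Perm (Fin 3) → R) :
    ∑ σ : Equiv.Perm (Fin 3), ((Equiv.Perm.sign σ : ℤ) : ℝ) • f σ =
      f 1 - f (Equiv.swap 1 2) - f (Equiv.swap 0 1) + f (Equiv.swap 0 1 * Equiv.swap 1 2)
        - f (Equiv.swap 0 2) + f (Equiv.swap 0 2 * Equiv.swap 1 2) := by
  rw [univ_perm_three, Finset.sum_insert (by decide), Finset.sum_insert (by decide),
    Finset.sum_insert (by decide), Finset.sum_insert (by decide), Finset.sum_insert (by decide),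
    Finset.sum_singleton]
  have h12 : (1 : Fin 3) ≠ 2 := by decide
  have h01 : (0 : Fin 3) ≠ 1 := by decide
  have h02 : (0 : Fin 3) ≠ 2 := by decide
  simp only [Equiv.Perm.sign_mul, Equiv.Perm.sign_swap h12, Equiv.Perm.sign_swap h01,
    Equiv.Perm.sign_swap h02, Equiv.Perm.sign_one]
  simp
  abel

theorem wedgeEval_one_two (ζ : E [⋀^Fin 1]→L[ℝ] R) (η : E [⋀^Fin 2]→L[ℝ] R) (v : Fin 3 → E) :
    wedgeEval (show 1 + 2 = 3 from rfl) ζ η v =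
      ζ ![v 0] * η ![v 1, v 2] - ζ ![v 1] * η ![v 0, v 2] + ζ ![v 2] * η ![v 0, v 1] := by
  have key : ∀ σ : Equiv.Perm (Fin 3),
      ζ (fun a => v (σ (Fin.cast (show 1 + 2 = 3 from rfl) (Fin.castAdd 2 a)))) *
        η (fun b => v (σ (Fin.cast (show 1 + 2 = 3 from rfl) (Fin.natAdd 1 b)))) =
      ζ ![v (σ 0)] * η ![v (σ 1), v (σ 2)] := fun σ => by
    congr 2
    · ext i; fin_cases i; rfl
    · ext i; fin_cases i <;> rfl
  rw [wedgeEval, Finset.sum_congr rfl (fun σ _ => by rw [key σ]), sum_perm_three]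
  have e1 : (Equiv.swap (0 : Fin 3) 1) 2 = 2 := by decide
  have e2 : (Equiv.swap (0 : Fin 3) 2) 1 = 1 := by decide
  have e3 : (Equiv.swap (1 : Fin 3) 2) 0 = 0 := by decide
  simp only [Equiv.Perm.mul_apply, Equiv.swap_apply_left, Equiv.swap_apply_right,
    Equiv.Perm.one_apply, e1, e2, e3]
  rw [map_pair_swap η (v 1) (v 2), map_pair_swap η (v 0) (v 2), map_pair_swap η (v 0) (v 1)]
  simp only [mul_neg, Nat.factorial]
  rw [inv_smul_eq_iff₀ (by norm_num)]
  norm_num [two_smul]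
  abel

theorem wedgeEval_two_one (ζ : E [⋀^Fin 2]→L[ℝ] R) (η : E [⋀^Fin 1]→L[ℝ] R) (v : Fin 3 → E) :
    wedgeEval (show 2 + 1 = 3 from rfl) ζ η v =
      ζ ![v 1, v 2] * η ![v 0] - ζ ![v 0, v 2] * η ![v 1] + ζ ![v 0, v 1] * η ![v 2] := by
  have key : ∀ σ : Equiv.Perm (Fin 3),
      ζ (fun a => v (σ (Fin.cast (show 2 + 1 = 3 from rfl) (Fin.castAdd 1 a)))) *
        η (fun b => v (σ (Fin.cast (show 2 + 1 = 3 from rfl) (Fin.natAdd 2 b)))) =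
      ζ ![v (σ 0), v (σ 1)] * η ![v (σ 2)] := fun σ => by
    congr 2
    · ext i; fin_cases i <;> rfl
    · ext i; fin_cases i; rfl
  rw [wedgeEval, Finset.sum_congr rfl (fun σ _ => by rw [key σ]), sum_perm_three]
  have e1 : (Equiv.swap (0 : Fin 3) 1) 2 = 2 := by decide
  have e2 : (Equiv.swap (0 : Fin 3) 2) 1 = 1 := by decide
  have e3 : (Equiv.swap (1 : Fin 3) 2) 0 = 0 := by decide
  simp only [Equiv.Perm.mul_apply, Equiv.swap_apply_left, Equiv.swap_apply_right,
    Equiv.Perm.one_apply, e1, e2, e3]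
  rw [map_pair_swap ζ (v 1) (v 2), map_pair_swap ζ (v 0) (v 2), map_pair_swap ζ (v 0) (v 1)]
  simp only [neg_mul, Nat.factorial]
  rw [inv_smul_eq_iff₀ (by norm_num)]
  norm_num [two_smul]
  abel

end Wedge

section Truncation

variable {E : Type*} [NormedAddCommGroup E] [NormedSpace ℝ E]
  {M : Type*} [TopologicalSpace M] [ChartedSpace E M]
  {V : Type*} [NormedAddCommGroup V] [NormedSpace ℝ V]

theorem extDeriv_clm_comp {F W : Type*} [NormedAddCommGroup F] [NormedSpace ℝ F]
    [NormedAddCommGroup W] [NormedSpace ℝ W] {k : ℕ} (L : F →L[ℝ] W)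
    {η : E → E [⋀^Fin k]→L[ℝ] F} {y : E} (hη : DifferentiableAt ℝ η y) (v : Fin (k + 1) → E) :
    extDeriv (fun z => L.compContinuousAlternatingMap (η z)) y v = L (extDeriv η y v) := by
  have h2 := (L.compContinuousAlternatingMapCLM ℝ E F W (Fin k)).hasFDerivAt.comp y hη.hasFDerivAt
  have h3 : fderiv ℝ (fun z => L.compContinuousAlternatingMap (η z)) y =
      (L.compContinuousAlternatingMapCLM ℝ E F W (Fin k)).comp (fderiv ℝ η y) := h2.fderiv
  simp only [extDeriv, ContinuousAlternatingMap.alternatizeUncurryFin_apply, h3, map_sum, map_zsmul]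
  rfl

theorem DiffForm.differentiableAt {W : Type*} [NormedAddCommGroup W] [NormedSpace ℝ W] {k : ℕ}
    (η : DiffForm E M W k) {x₀ : M} {y : E} (hy : y ∈ (extChartAt 𝓘(ℝ, E) x₀).target) :
    DifferentiableAt ℝ (inChart η.toFun x₀) y :=
  ((η.smooth x₀).differentiableOn (by simp)).differentiableAt
    ((isOpen_extChartAt_target x₀).mem_nhds hy)

theorem FinComplex.exists_negProj [FiniteDimensional ℝ V] (C : FinComplex V) :
    ∃ L : (V →L[ℝ] V) →L[ℝ] C.glNeg, ∀ s : C.endDeg (-1), L s.1 = -C.proj s := by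
  obtain ⟨r, hr⟩ := LinearMap.exists_leftInverse_of_injective (C.endDeg (-1)).subtype
    (Submodule.ker_subtype _)
  refine ⟨-(C.proj.comp (LinearMap.toContinuousLinearMap r)), fun s => ?_⟩
  have : r s.1 = s := LinearMap.congr_fun hr s
  change -(C.proj (r s.1)) = _
  rw [this]

namespace FlatSuperconnection

variable {C : FinComplex V} (α : FlatSuperconnection E M C)

theorem form_two_mem (x : M) (v) : (α.form 2).toFun x v ∈ C.endDeg (-1) := α.form_mem 2 x v

/-- The equation of degree one: `α¹` is valued in cochain maps. -/
theorem form_one_mem [IsManifold 𝓘(ℝ, E) ∞ M] (x : M) (v) : (α.form 1).toFun x v ∈ C.gl0 := by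
  have : IsManifold 𝓘(ℝ, E) 1 M := IsManifold.of_le (n := ∞) (by simp)
  refine ⟨by simpa using α.form_mem 1 x v, ?_⟩
  have hy : extChartAt 𝓘(ℝ, E) x x ∈ (extChartAt 𝓘(ℝ, E) x).target :=
    mem_extChartAt_target (I := 𝓘(ℝ, E)) x
  have hcomm : ∀ w, C.d * inChart (α.form 1).toFun x (extChartAt 𝓘(ℝ, E) x x) w
      = inChart (α.form 1).toFun x (extChartAt 𝓘(ℝ, E) x x) w * C.d := by
    intro w
    have h := α.flat 0 x _ hy w
    rw [Fin.sum_univ_two] at h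
    have h0 : ∀ z w, inChart (α.form 0).toFun x z w = 0 := fun z w => α.form_zero _ _
    have h00 : inChart (α.form 0).toFun x = fun _ => 0 := by
      funext z; ext w; rw [h0]; rfl
    change (_ • (C.d * inChart (α.form 1).toFun x _ w) + inChart (α.form 1).toFun x _ w * C.d)
      + extDeriv (inChart (α.form 0).toFun x) _ w
      + (_ • wedgeEval (show 0 + 1 = 1 from rfl) (inChart (α.form 0).toFun x _)
          (inChart (α.form 1).toFun x _) w
        + _ • wedgeEval (show 1 + 0 = 1 from rfl) (inChart (α.form 1).toFun x _)
          (inChart (α.form 0).toFun x _) w) = 0 at h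
    rw [wedgeEval_zero_left _ (h0 _), wedgeEval_zero_right _ _ (h0 _), h00] at h
    have hd : extDeriv (fun _ : E => (0 : E [⋀^Fin 0]→L[ℝ] (V →L[ℝ] V)))
        (extChartAt 𝓘(ℝ, E) x x) w = 0 := by
      simp [extDeriv, ContinuousAlternatingMap.alternatizeUncurryFin_apply]
    rw [hd] at h
    norm_num at h
    rw [neg_add_eq_zero] at h
    exact h
  have hinv := isInvertible_mfderivWithin_extChartAt_symm (I := 𝓘(ℝ, E)) (x := x) hy
  simp only [modelWithCornersSelf_coe, range_id, mfderivWithin_univ] at hinv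
  obtain ⟨e, he⟩ := hinv
  have hx : (extChartAt 𝓘(ℝ, E) x).symm (extChartAt 𝓘(ℝ, E) x x) = x := extChartAt_to_inv x
  have key : ∀ z, z = x → ∀ u : Fin 1 → E, (∀ w : Fin 1 → E, C.d * (α.form 1).toFun z w
      = (α.form 1).toFun z w * C.d) → C.d * (α.form 1).toFun x u
      = (α.form 1).toFun x u * C.d := by
    rintro z rfl u h; exact h u
  refine key _ hx v fun w => ?_
  have := hcomm (fun i => e.symm (w i))
  simp only [inChart, ← he] at this
  have hw : ((fun i => e (e.symm (w i))) : Fin 1 → E) = w := by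
    funext i; exact e.apply_symm_apply (w i)
  rw [← hw]
  exact this

/-- The form `B = -π ∘ α²`. -/
def truncB [FiniteDimensional ℝ V] (x : M) :
    (TangentSpace 𝓘(ℝ, E) x) [⋀^Fin 2]→L[ℝ] C.glNeg :=
  -(C.proj.compContinuousAlternatingMap
      (((α.form 2).toFun x).codRestrict (C.endDeg (-1)) (α.form_two_mem x)))

theorem inChart_truncB_apply [FiniteDimensional ℝ V] (x₀ : M) (y : E) (v : Fin 2 → E) :
    inChart α.truncB x₀ y v
      = -C.proj ⟨inChart (α.form 2).toFun x₀ y v, α.form_two_mem _ _⟩ := rfl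

theorem truncB_eq [FiniteDimensional ℝ V] {L : (V →L[ℝ] V) →L[ℝ] C.glNeg}
    (hL : ∀ s : C.endDeg (-1), L s.1 = -C.proj s) (x : M) :
    α.truncB x = L.compContinuousAlternatingMap ((α.form 2).toFun x) := by
  ext v
  exact (hL ⟨_, α.form_two_mem x v⟩).symm

theorem inChart_truncB [FiniteDimensional ℝ V] {L : (V →L[ℝ] V) →L[ℝ] C.glNeg}
    (hL : ∀ s : C.endDeg (-1), L s.1 = -C.proj s) (x₀ : M) :
    inChart α.truncB x₀ = fun y => L.compContinuousAlternatingMap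
      (inChart (α.form 2).toFun x₀ y) := by
  funext y
  ext v
  simp only [inChart, α.truncB_eq hL]
  rfl

/-- The 2-truncation `T_{≤2}(α) = (A, B)` with `A = α¹`, `B = -π ∘ α²`. -/
def trunc [FiniteDimensional ℝ V] [IsManifold 𝓘(ℝ, E) ∞ M] : FlatTwoConnection E M C where
  A := α.form 1
  B := ⟨α.truncB, fun x₀ => by
    obtain ⟨L, hL⟩ := C.exists_negProj
    rw [α.inChart_truncB hL]
    exact (L.compContinuousAlternatingMapCLM ℝ E _ _ (Fin 2)).contDiff.comp_contDiffOn
      ((α.form 2).smooth x₀)⟩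
  A_mem := α.form_one_mem
  curvature x₀ y hy v := by
    have h := α.flat 1 x₀ y hy v
    rw [Fin.sum_univ_three] at h
    have h0 : ∀ w, inChart (α.form 0).toFun x₀ y w = 0 := fun w => α.form_zero _ _
    change (_ • (C.d * inChart (α.form 2).toFun x₀ y v) + inChart (α.form 2).toFun x₀ y v * C.d)
      + extDeriv (inChart (α.form 1).toFun x₀) y v
      + (_ • wedgeEval (show 0 + 2 = 2 from rfl) (inChart (α.form 0).toFun x₀ y)
          (inChart (α.form 2).toFun x₀ y) v
        + (-1 : ℝ) ^ 2 • wedgeEval (show 1 + 1 = 2 from rfl) (inChart (α.form 1).toFun x₀ y)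
          (inChart (α.form 1).toFun x₀ y) v
        + _ • wedgeEval (show 2 + 0 = 2 from rfl) (inChart (α.form 2).toFun x₀ y)
          (inChart (α.form 0).toFun x₀ y) v) = 0 at h
    rw [wedgeEval_zero_left _ h0, wedgeEval_zero_right _ _ h0, wedgeEval_one_one] at h
    norm_num at h
    rw [α.inChart_truncB_apply, map_neg, C.delta_proj]
    change -(C.d * inChart (α.form 2).toFun x₀ y v + inChart (α.form 2).toFun x₀ y v * C.d) = _
    rw [neg_eq_iff_add_eq_zero, ← h]
    abel
  flat x₀ y hy v := by
    obtain ⟨L, hL⟩ := C.exists_negProj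
    have h := α.flat 2 x₀ y hy v
    rw [Fin.sum_univ_four] at h
    have h0 : ∀ w, inChart (α.form 0).toFun x₀ y w = 0 := fun w => α.form_zero _ _
    change ((-1 : ℝ) ^ 3 • (C.d * inChart (α.form 3).toFun x₀ y v)
        + inChart (α.form 3).toFun x₀ y v * C.d)
      + extDeriv (inChart (α.form 2).toFun x₀) y v
      + (_ • wedgeEval (show 0 + 3 = 3 from rfl) (inChart (α.form 0).toFun x₀ y)
          (inChart (α.form 3).toFun x₀ y) v
        + (-1 : ℝ) ^ 4 • wedgeEval (show 1 + 2 = 3 from rfl) (inChart (α.form 1).toFun x₀ y)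
          (inChart (α.form 2).toFun x₀ y) v
        + (-1 : ℝ) ^ 3 • wedgeEval (show 2 + 1 = 3 from rfl) (inChart (α.form 2).toFun x₀ y)
          (inChart (α.form 1).toFun x₀ y) v
        + _ • wedgeEval (show 3 + 0 = 3 from rfl) (inChart (α.form 3).toFun x₀ y)
          (inChart (α.form 0).toFun x₀ y) v) = 0 at h
    rw [wedgeEval_zero_left _ h0, wedgeEval_zero_right _ _ h0, wedgeEval_one_two,
      wedgeEval_two_one] at h
    norm_num at h
    have hB : extDeriv (inChart α.truncB x₀) y v = L (extDeriv (inChart (α.form 2).toFun x₀) y v) := by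
      rw [α.inChart_truncB hL, extDeriv_clm_comp L ((α.form 2).differentiableAt hy)]
    have h3 : C.proj (C.bracketD ⟨inChart (α.form 3).toFun x₀ y v, α.form_mem 3 _ _⟩) = 0 :=
      (Submodule.Quotient.mk_eq_zero _).2 ⟨_, rfl⟩
    have hact : ∀ (φ : C.gl0) (s : C.endDeg (-1)), C.act φ (-C.proj s)
        = L (φ.1 * s.1 - s.1 * φ.1) := by
      intro φ s
      have hm : φ.1 * s.1 - s.1 * φ.1 ∈ C.endDeg (-1) := (C.endDeg (-1)).sub_mem
        (C.mul_mem_endDeg (zero_add _) φ.2.1 s.2) (C.mul_mem_endDeg (add_zero _) s.2 φ.2.1)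
      rw [hL ⟨_, hm⟩, FinComplex.act, map_neg, map_neg, C.sandwich_proj, C.sandwich_proj,
        ← neg_sub_neg, neg_neg, neg_neg, ← map_sub, ← map_neg]
      congr 1
      apply Subtype.ext
      simp [FinComplex.sandwichAux]
    have h4 : L (C.d * inChart (α.form 3).toFun x₀ y v
        - inChart (α.form 3).toFun x₀ y v * C.d) = 0 := by
      refine (hL (C.bracketD ⟨inChart (α.form 3).toFun x₀ y v, α.form_mem 3 _ _⟩)).trans ?_
      rw [h3, neg_zero]
    simp only [α.inChart_truncB_apply, hact]
    rw [hB, ← map_sub, ← map_add, ← map_add, ← h4]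
    congr 1
    rw [eq_comm, ← sub_eq_zero]
    rw [← neg_eq_zero, ← h]
    abel

end FlatSuperconnection

end Truncation

/-! ### Piecewise smooth paths and 2-paths -/

section Paths

variable {E : Type*} [NormedAddCommGroup E] [NormedSpace ℝ E]
  {M : Type*} [TopologicalSpace M] [ChartedSpace E M]

variable (E) in
/-- `f` is piecewise smooth on `K`: the set `K` is a finite union of compact convex sets, on each
of which `f` is smooth up to the boundary. (Then `f` is continuous on `K`.) Values of `f` outside
`K` are irrelevant. -/
def PiecewiseSmoothOn {X : Type*} [NormedAddCommGroup X] [NormedSpace ℝ X] (f : X → M)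
    (K : Set X) : Prop :=
  ∃ S : Set (Set X), S.Finite ∧ ⋃₀ S = K ∧
    ∀ P ∈ S, IsCompact P ∧ Convex ℝ P ∧ ContMDiffOn 𝓘(ℝ, X) 𝓘(ℝ, E) ∞ f P

variable (E) in
/-- A piecewise smooth path `γ : [0,1] → M`. -/
def IsPath (γ : ℝ → M) : Prop := PiecewiseSmoothOn E γ (Icc 0 1)

variable (E) in
/-- A 2-path: a piecewise smooth map `Γ : [0,1]² → M`, `(t, s) ↦ Γ(t, s)`, which is constant on
each of the two vertical sides `t = 0` and `t = 1`. -/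
def IsTwoPath (Γ : ℝ × ℝ → M) : Prop :=
  PiecewiseSmoothOn E Γ (Icc 0 1 ×ˢ Icc 0 1) ∧
    ∀ s ∈ Icc (0 : ℝ) 1, Γ (0, s) = Γ (0, 0) ∧ Γ (1, s) = Γ (1, 0)

variable (E) in
/-- The velocity `dc/dt` of a curve. -/
def vel (c : ℝ → M) (t : ℝ) : TangentSpace 𝓘(ℝ, E) (c t) :=
  mfderiv 𝓘(ℝ, ℝ) 𝓘(ℝ, E) c t (1 : ℝ)

/-- The reversed path `γ⁻¹(t) = γ(1 - t)`. -/
def rev (γ : ℝ → M) : ℝ → M := fun t => γ (1 - t)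

variable {W : Type*} [NormedAddCommGroup W] [NormedSpace ℝ W]

/-- The coefficient `a(t)` of the pull-back `c^*η = a(t) dt` of a 1-form along a curve. -/
def DiffForm.alongPath (η : DiffForm E M W 1) (c : ℝ → M) (t : ℝ) : W :=
  η.toFun (c t) (fun _ => vel E c t)

/-- `η(∂Φ/∂t, ∂Φ/∂s)` at `(t, s)`, for a 2-form `η` and a map `Φ(t, s)`. -/
def DiffForm.alongSurface (η : DiffForm E M W 2) (Φ : ℝ × ℝ → M) (t s : ℝ) : W :=
  η.toFun (Φ (t, s)) ![vel E (fun t' => Φ (t', s)) t, vel E (fun s' => Φ (t, s')) s]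

end Paths

/-! ### Holonomies of flat 2-connections -/

namespace FlatTwoConnection

variable {E : Type*} [NormedAddCommGroup E] [NormedSpace ℝ E]
  {M : Type*} [TopologicalSpace M] [ChartedSpace E M]
  {V : Type*} [NormedAddCommGroup V] [NormedSpace ℝ V] [FiniteDimensional ℝ V]
  {C : FinComplex V} (κ : FlatTwoConnection E M C)

/-- `g : [0,1] → GL⁰(V)` solves `dg/dt = -A(dγ/dt) g`, `g(0) = 1`. As `γ` is only piecewise
smooth, `g` is continuous and the equation holds off a finite set of times. -/
def IsTransport (γ : ℝ → M) (g : ℝ → C.GL0) : Prop :=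
  g 0 = 1 ∧ ContinuousOn (fun t => C.toEnd (g t)) (Icc 0 1) ∧
    ∃ F : Finset ℝ, ∀ t ∈ Ioo (0 : ℝ) 1, t ∉ F →
      HasDerivAt (fun t' => C.toEnd (g t')) (-(κ.A.alongPath γ t * C.toEnd (g t))) t

/-- `Hol(γ) = g`: the time-one value of the transport along `γ` is `g`. -/
def HasHol (γ : ℝ → M) (g₁ : C.GL0) : Prop :=
  ∃ g : ℝ → C.GL0, κ.IsTransport γ g ∧ g 1 = g₁

/-- `Hol(Γ) = h₁`: the time-one value of the solution `h : [0,1] → GL⁻¹(V)` of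
`dh/ds = (L_h)_* ∫₀¹ g_{Γ_s}(t)⁻¹ ▹ B(∂Γ/∂t, ∂Γ/∂s) dt`, `h(0) = 1`, is `h₁`; here `g_{Γ_s}` is the
transport along `Γ_s(t) = Γ(t, s)`. -/
def HasSurfaceHol (Γ : ℝ × ℝ → M) (h₁ : C.GLNeg) : Prop :=
  ∃ g : ℝ → ℝ → C.GL0, (∀ s ∈ Icc (0 : ℝ) 1, κ.IsTransport (fun t => Γ (t, s)) (g s)) ∧
    ∃ h : ℝ → C.GLNeg, h 0 = 1 ∧ ContinuousOn (fun s => (h s).toClass) (Icc 0 1) ∧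
      (∃ F : Finset ℝ, ∀ s ∈ Ioo (0 : ℝ) 1, s ∉ F →
        HasDerivAt (fun s' => (h s').toClass)
          (C.leftD (h s) (∫ t in (0 : ℝ)..1, C.conj (g s t)⁻¹ (κ.B.alongSurface Γ t s))) s) ∧
      h 1 = h₁

end FlatTwoConnection

/-! ### Integration of flat superconnections, in simplicial degrees one and two -/

/-- The simplex `Δ_k = {1 ≥ t₁ ≥ ⋯ ≥ t_k ≥ 0}`. -/
def simplex (k : ℕ) : Set (Fin k → ℝ) := {t | (∀ i, t i ∈ Icc (0 : ℝ) 1) ∧ Antitone t}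

/-- The folding map `q(t, s) = (max{t, s}, s)` of the square onto `Δ₂`. -/
def foldMap (p : ℝ × ℝ) : ℝ × ℝ := (max p.1 p.2, p.2)

/-- `λ(-, s)` is the piecewise linear path `(s,1) → (s,0) → (0,0)`, at `(s,0)` at time `1/2`. -/
def lambdaMap (p : ℝ × ℝ) : ℝ × ℝ :=
  if p.1 ≤ 1 / 2 then (p.2, 1 - 2 * p.1) else (p.2 * (2 - 2 * p.1), 0)

/-- `Θ = q ∘ λ : I² → Δ₂`. -/
def Theta (p : ℝ × ℝ) : ℝ × ℝ := foldMap (lambdaMap p)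

/-- The components `β¹`, `β²` of a family of `End(V)`-valued cochains `β = β¹ + β² + ⋯` on the
simplicial set of simplices of `M`: a 1-simplex is a path and a 2-simplex is a map on
`Δ₂ = {1 ≥ t ≥ s ≥ 0}`. These are the components that the 2-truncation uses. -/
structure LowCochains (M V : Type*) [NormedAddCommGroup V] [NormedSpace ℝ V] where
  /-- the value of `β¹` on a 1-simplex -/
  one : (ℝ → M) → (V →L[ℝ] V)
  /-- the value of `β²` on a 2-simplex -/
  two : (ℝ × ℝ → M) → (V →L[ℝ] V)

namespace LowCochains

variable {M V : Type*} [NormedAddCommGroup V] [NormedSpace ℝ V] (β : LowCochains M V)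

/-- `T_{≤2}β` on paths: `γ ↦ β¹(γ⁻¹)`. -/
def truncPath (γ : ℝ → M) : V →L[ℝ] V := β.one (rev γ)

/-- `T_{≤2}β` on 2-paths: the class of `(β²(Γ_b) - β²(Γ_a)) β¹(Γ₁⁻¹)`, where `Γ_b(t, s) = Γ(t, s)`,
`Γ_a(t, s) = Γ(s, t)` on `Δ₂` and `Γ₁(t) = Γ(t, 1)`. -/
def truncSurface (Γ : ℝ × ℝ → M) : V →L[ℝ] V :=
  (β.two Γ - β.two (fun p => Γ (p.2, p.1))) * β.one (rev fun t => Γ (t, 1))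

end LowCochains

namespace FlatSuperconnection

variable {E : Type*} [NormedAddCommGroup E] [NormedSpace ℝ E]
  {M : Type*} [TopologicalSpace M] [ChartedSpace E M]
  {V : Type*} [NormedAddCommGroup V] [NormedSpace ℝ V] {C : FinComplex V}
  (α : FlatSuperconnection E M C)

/-- The coefficient of `dt₁ ⋯ dt_k` in `c^*α¹ ∧ ⋯ ∧ c^*α¹` (`k` factors, the `i`-th one in the
variable `t_i`), for a curve `c`. -/
def integrandOne (c : ℝ → M) (k : ℕ) (t : Fin k → ℝ) : V →L[ℝ] V :=
  (List.ofFn fun i => (α.form 1).alongPath c (t i)).prod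

/-- The coefficient of `dt₁ ⋯ dt_{m+n+1} ds` in
`p₁^*Φ^*α¹ ∧ ⋯ ∧ p_m^*Φ^*α¹ ∧ p_{m+1}^*Φ^*α² ∧ p_{m+2}^*Φ^*α¹ ∧ ⋯ ∧ p_{m+n+1}^*Φ^*α¹`
on `Δ_{m+n+1} × I`, for `Φ = Φ(t, s)`; the `i`-th factor only involves `dt_i` and `ds`. Hence the
factor `Φ^*α²` contributes its `dt_{m+1} ∧ ds` component and the others their `dt_i` component.
Moving `ds` to the right past `n` one-forms, and the degree `-1` endomorphism part of `α²` past the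
same `n` one-forms (product of `Ω ⊗ End(V)`), gives two signs `(-1)^n`, which cancel. -/
def integrandTwo (Φ : ℝ × ℝ → M) (m n : ℕ) (p : (Fin (m + n + 1) → ℝ) × ℝ) : V →L[ℝ] V :=
  (List.ofFn fun i : Fin (m + n + 1) =>
    if (i : ℕ) = m then (α.form 2).alongSurface Φ (p.1 i) p.2
    else (α.form 1).alongPath (fun t => Φ (t, p.2)) (p.1 i)).prod

/-- `∫_{Δ_k} (γ ∘ Θ₁)^*(α¹ ⋯ α¹)`, with `Θ₁(t) = 1 - t`. -/
def iterOne (γ : ℝ → M) (k : ℕ) : V →L[ℝ] V := ∫ t in simplex k, α.integrandOne (rev γ) k t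

/-- `∫_{Δ_{m+n+1} × I} Θ_{(m+n+1)}^*(σ^*α¹ ⋯ σ^*α² ⋯ σ^*α¹)`. -/
def iterTwo (σ : ℝ × ℝ → M) (m n : ℕ) : V →L[ℝ] V :=
  ∫ p in simplex (m + n + 1) ×ˢ Icc (0 : ℝ) 1, α.integrandTwo (σ ∘ Theta) m n p

/-- The components `β¹`, `β²` of `β = ∫ α`, given by iterated integrals. For `β¹(γ)` this is the
series of iterated integrals of `-α¹` along `t ↦ γ(1 - t)`. -/
def integrate : LowCochains M V where
  one γ := ∑' k : ℕ, (-1 : ℝ) ^ k • α.iterOne γ k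
  two σ := ∑' p : ℕ × ℕ, (-1 : ℝ) ^ (p.1 + p.2 + 1) • α.iterTwo σ p.1 p.2

/-- The iterated integrals defining `β¹(γ)` exist and their sum converges absolutely. -/
def ConvergesOne (γ : ℝ → M) : Prop :=
  (∀ k, IntegrableOn (α.integrandOne (rev γ) k) (simplex k)) ∧
    Summable fun k => ‖α.iterOne γ k‖

/-- The iterated integrals defining `β²(σ)` exist and their sum converges absolutely. -/
def ConvergesTwo (σ : ℝ × ℝ → M) : Prop :=
  (∀ m n, IntegrableOn (α.integrandTwo (σ ∘ Theta) m n)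
      (simplex (m + n + 1) ×ˢ Icc (0 : ℝ) 1)) ∧
    Summable fun p : ℕ × ℕ => ‖α.iterTwo σ p.1 p.2‖

end FlatSuperconnection
end HigherHol

end

set_option linter.unusedSectionVars false

namespace HigherHol

open Filter

/-! For paths, `β¹(γ⁻¹)` is the Dyson series of `-α¹` along `γ`; it solves the transport equation,
and linear equations have unique solutions (`dyson_path`, `IsSol.unique`).

For a 2-path let `g u t` be the `α¹`-transport along `t ↦ Γ(t, u)`. Put `y(t, u) = -g⁻¹ α²(∂_tΓ,
∂_uΓ) g`, `Y(x, u) = ∫₀ˣ y(t, u) dt` and `δz = ∂z + z∂`. The degree-two flatness equation says that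
the curvature of `α¹` is `-δα²`, and non-abelian Stokes turns this into `∂_u g = -α¹(∂_uΓ) g + g δY`
at the point `(x, u)` (`GoodSet.hasDerivAt_transport_field`); the left side of the square
contributes nothing because `Γ` is constant there. Let `Q` solve `∂_u Q = -(δY) Q`, `Q(x, 0) = 1`,
and let `D' = -δY(x, x) D`, `D(1) = 1`. Then `g Q` satisfies the transport equation along vertical
lines and `g D` the one along the diagonal, so that the transport along `Θ(-, x)` is explicit in
`g`, `Q` and `D`.

The double series for `β²` is a Dyson series with one inserted factor `α²`. It sums to an integral
over `x` of `-U(1) ∫ U⁻¹ α² U`, with `U` the transport along `Θ(-, x)` (`dyson_surface`). Inserting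
the explicit `U` gives `(β²(Γ_b) - β²(Γ_a)) β¹(Γ₁⁻¹) = ∫ flux + ∫ Y(x, x) D(x) dx`, where `flux(x) =
(∫₀ˣ Q⁻¹ y Q dv) Q(x, x)⁻¹ D(x)` (`truncSurface_eq`).

On the other side the surface holonomy has an explicit lift to `End⁻¹(V)`: `h(x, u) = (∫₀ᵘ Y Q) Q⁻¹`
solves `∂_u h = Y + h δY`, and `1 + δh = Q⁻¹`. The holonomy is the class of `h(1, 1)`. To compare,
differentiate `h(x, x) D(x)`. The terms `h δY D` cancel, `Y D` remains, and the variation of `h` in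
its first argument contributes an integral of `y + h δy`. Modulo `[∂, End⁻²(V)]` one has `h δy ≡
(δh) y`, hence `y + h δy ≡ (1 + δh) y = Q⁻¹ y`, which is the integrand of the flux
(`GaugeSol.map_gaugeH_one_one`).

The analytic difficulty is that `Γ` is only piecewise smooth. As `u` varies, the break points on the
horizontal lines move, and the coefficient of the transport equation jumps. Line integrals of `α¹`
are nevertheless Lipschitz and, for almost all `u`, differentiable in `u`: integration by parts
replaces differences of velocities by differences of positions. Solutions of linear equations depend
on the coefficient only through its primitive, so this is enough (`hasDerivAt_line_integral`,
`hasDerivAt_sol_of_primitive`). -/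

/-! ### Piecewise continuous functions on the unit interval -/

/-- The filter of sets containing all but finitely many points of `(0, 1)`. -/
def offFin : Filter ℝ := cofinite ⊓ 𝓟 (Ioo 0 1)

theorem eventually_offFin_iff {p : ℝ → Prop} :
    (∀ᶠ t in offFin, p t) ↔ ∃ F : Finset ℝ, ∀ t ∈ Ioo (0 : ℝ) 1, t ∉ F → p t := by
  rw [offFin, eventually_inf_principal, eventually_cofinite]
  constructor
  · intro h
    refine ⟨h.toFinset, fun t ht htF => ?_⟩
    by_contra hp
    exact htF (h.mem_toFinset.2 fun h' => hp (h' ht))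
  · rintro ⟨F, hF⟩
    refine F.finite_toSet.subset fun t ht => ?_
    by_contra htF
    exact ht fun h => hF t h htF

theorem eventually_offFin_mem : ∀ᶠ t in offFin, t ∈ Ioo (0 : ℝ) 1 :=
  mem_inf_of_right (mem_principal_self _)

theorem eventually_offFin_of_finite {s : Set ℝ} (hs : s.Finite) : ∀ᶠ t in offFin, t ∉ s :=
  mem_inf_of_left hs.compl_mem_cofinite

/-- The complement of a finite set is open. This makes finite exceptional sets more useful than null
sets: identities valid off them may be differentiated. -/
theorem eventually_offFin_nhds {p : ℝ → Prop} (h : ∀ᶠ t in offFin, p t) :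
    ∀ᶠ t in offFin, ∀ᶠ t' in 𝓝 t, p t' := by
  obtain ⟨F, hF⟩ := eventually_offFin_iff.1 h
  refine eventually_offFin_iff.2 ⟨F, fun t ht htF => ?_⟩
  have ho : IsOpen (Ioo (0 : ℝ) 1 \ F) := isOpen_Ioo.sdiff F.finite_toSet.isClosed
  filter_upwards [ho.mem_nhds ⟨ht, by simpa using htF⟩] with t' ht'
  exact hF t' ht'.1 (by simpa using ht'.2)

theorem ae_of_eventually_offFin {p : ℝ → Prop} (h : ∀ᶠ t in offFin, p t) :
    ∀ᵐ t, t ∈ Icc (0 : ℝ) 1 → p t := by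
  obtain ⟨F, hF⟩ := eventually_offFin_iff.1 h
  have hfin : ((F : Set ℝ) ∪ {0, 1}).Finite := F.finite_toSet.union (by simp)
  filter_upwards [compl_mem_ae_iff.2 (hfin.measure_zero volume)] with t ht htI
  simp only [mem_compl_iff, mem_union, mem_insert_iff, mem_singleton_iff, not_or] at ht
  exact hF t ⟨lt_of_le_of_ne htI.1 (Ne.symm ht.2.1), lt_of_le_of_ne htI.2 ht.2.2⟩
    (by simpa using ht.1)

theorem uIcc_subset_unit {x y : ℝ} (hx : x ∈ Icc (0 : ℝ) 1) (hy : y ∈ Icc (0 : ℝ) 1) :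
    uIcc x y ⊆ Icc (0 : ℝ) 1 := uIcc_subset_Icc hx hy

theorem ae_uIoc_of_eventually_offFin {p : ℝ → Prop} (h : ∀ᶠ t in offFin, p t) {x y : ℝ}
    (hx : x ∈ Icc (0 : ℝ) 1) (hy : y ∈ Icc (0 : ℝ) 1) : ∀ᵐ t, t ∈ uIoc x y → p t := by
  filter_upwards [ae_of_eventually_offFin h] with t ht htI
  exact ht (uIcc_subset_unit hx hy (uIoc_subset_uIcc htI))

theorem stronglyMeasurable_indicator_of_continuousOn {X W : Type*} [TopologicalSpace X]
    [SecondCountableTopology X] [MeasurableSpace X] [OpensMeasurableSpace X]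
    [NormedAddCommGroup W] {f : X → W} {s : Set X} (hf : ContinuousOn f s)
    (hs : MeasurableSet s) : StronglyMeasurable (s.indicator f) := by
  refine stronglyMeasurable_of_restrict_of_restrict_compl hs ?_ ?_
  · have : s.domRestrict (s.indicator f) = s.domRestrict f := by
      funext x; exact indicator_of_mem x.2 f
    rw [this]
    exact hf.domRestrict.stronglyMeasurable
  · have : sᶜ.domRestrict (s.indicator f) = fun _ => 0 := by
      funext x; exact indicator_of_notMem x.2 f
    rw [this]
    exact stronglyMeasurable_const

/-- `f` is bounded and continuous at all but finitely many points of `(0, 1)`. -/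
structure PCont {W : Type*} [NormedAddCommGroup W] (f : ℝ → W) : Prop where
  cont : ∀ᶠ t in offFin, ContinuousAt f t
  bdd : ∃ C, ∀ᶠ t in offFin, ‖f t‖ ≤ C

namespace PCont

variable {W : Type*} [NormedAddCommGroup W] {f g : ℝ → W}

theorem of_continuousOn (hf : ContinuousOn f (Icc 0 1)) : PCont f := by
  obtain ⟨C, hC⟩ := isCompact_Icc.exists_bound_of_continuousOn hf
  refine ⟨?_, C, ?_⟩
  · filter_upwards [eventually_offFin_mem] with t ht
    exact hf.continuousAt (Icc_mem_nhds ht.1 ht.2)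
  · filter_upwards [eventually_offFin_mem] with t ht
    exact hC t (Ioo_subset_Icc_self ht)

theorem congr (hf : PCont f) (h : ∀ᶠ t in offFin, g t = f t) : PCont g := by
  refine ⟨?_, hf.bdd.choose, ?_⟩
  · filter_upwards [hf.cont, eventually_offFin_nhds h] with t ht h'
    exact ht.congr (h'.mono fun _ => Eq.symm)
  · filter_upwards [hf.bdd.choose_spec, h] with t ht h'
    rwa [h']

theorem add (hf : PCont f) (hg : PCont g) : PCont fun t => f t + g t := by
  obtain ⟨C, hC⟩ := hf.bdd
  obtain ⟨D, hD⟩ := hg.bdd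
  refine ⟨by filter_upwards [hf.cont, hg.cont] with t h1 h2 using h1.add h2, C + D, ?_⟩
  filter_upwards [hC, hD] with t h1 h2 using (norm_add_le _ _).trans (add_le_add h1 h2)

theorem neg (hf : PCont f) : PCont fun t => -f t := by
  obtain ⟨C, hC⟩ := hf.bdd
  refine ⟨by filter_upwards [hf.cont] with t h1 using h1.neg, C, ?_⟩
  filter_upwards [hC] with t h1
  rwa [norm_neg]

theorem sub (hf : PCont f) (hg : PCont g) : PCont fun t => f t - g t := by
  simpa only [sub_eq_add_neg] using hf.add hg.neg

theorem const (c : W) : PCont fun _ => c := of_continuousOn continuousOn_const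

theorem clm [NormedSpace ℝ W] {W' : Type*} [NormedAddCommGroup W'] [NormedSpace ℝ W']
    (L : W →L[ℝ] W') (hf : PCont f) : PCont fun t => L (f t) := by
  obtain ⟨C, hC⟩ := hf.bdd
  refine ⟨by filter_upwards [hf.cont] with t h1 using L.continuous.continuousAt.comp h1,
    ‖L‖ * C, ?_⟩
  filter_upwards [hC] with t h1
  exact (L.le_opNorm _).trans (mul_le_mul_of_nonneg_left h1 (norm_nonneg _))

theorem mul {R : Type*} [NormedRing R] {f g : ℝ → R} (hf : PCont f) (hg : PCont g) :
    PCont fun t => f t * g t := by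
  obtain ⟨C, hC⟩ := hf.bdd
  obtain ⟨D, hD⟩ := hg.bdd
  refine ⟨by filter_upwards [hf.cont, hg.cont] with t h1 h2 using h1.mul h2, C * D, ?_⟩
  filter_upwards [hC, hD] with t h1 h2
  exact (norm_mul_le _ _).trans (mul_le_mul h1 h2 (norm_nonneg _) ((norm_nonneg _).trans h1))

/-- A piecewise continuous function agrees off a finite set with a bounded measurable one. -/
theorem exists_stronglyMeasurable (hf : PCont f) :
    ∃ f' : ℝ → W, StronglyMeasurable f' ∧ (∃ C, ∀ t, ‖f' t‖ ≤ C) ∧ ∀ᶠ t in offFin, f' t = f t := by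
  obtain ⟨C, hC⟩ := hf.bdd
  obtain ⟨F, hF⟩ := eventually_offFin_iff.1 (hf.cont.and hC)
  have ho : IsOpen (Ioo (0 : ℝ) 1 \ F) := isOpen_Ioo.sdiff F.finite_toSet.isClosed
  have hc : ContinuousOn f (Ioo (0 : ℝ) 1 \ F) := fun t ht =>
    (hF t ht.1 (by simpa using ht.2)).1.continuousWithinAt
  refine ⟨(Ioo (0 : ℝ) 1 \ F).indicator f, ?_, ⟨max C 0, ?_⟩, ?_⟩
  · exact stronglyMeasurable_indicator_of_continuousOn hc ho.measurableSet
  · intro t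
    by_cases ht : t ∈ Ioo (0 : ℝ) 1 \ F
    · rw [indicator_of_mem ht]
      exact (hF t ht.1 (by simpa using ht.2)).2.trans (le_max_left _ _)
    · rw [indicator_of_notMem ht, norm_zero]
      exact le_max_right _ _
  · refine eventually_offFin_iff.2 ⟨F, fun t ht htF => ?_⟩
    exact indicator_of_mem (show t ∈ Ioo (0 : ℝ) 1 \ F from ⟨ht, by simpa using htF⟩) f

theorem integrableOn (hf : PCont f) : IntegrableOn f (Icc 0 1) := by
  obtain ⟨f', hm, ⟨C, hC⟩, he⟩ := hf.exists_stronglyMeasurable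
  have h1 : IntegrableOn f' (Icc 0 1) :=
    Measure.integrableOn_of_bounded (by simp) hm.aestronglyMeasurable
      (Filter.Eventually.of_forall hC)
  refine h1.congr ?_
  rw [EventuallyEq, ae_restrict_iff' measurableSet_Icc]
  exact ae_of_eventually_offFin he

theorem intervalIntegrable (hf : PCont f) {x y : ℝ} (hx : x ∈ Icc (0 : ℝ) 1)
    (hy : y ∈ Icc (0 : ℝ) 1) : IntervalIntegrable f volume x y := by
  rw [intervalIntegrable_iff]
  exact hf.integrableOn.mono_set (uIoc_subset_uIcc.trans (uIcc_subset_unit hx hy))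

end PCont

/-! ### Fundamental theorem of calculus and uniqueness for linear equations, off finite sets. -/

section Calculus

variable {W : Type*} [NormedAddCommGroup W] [NormedSpace ℝ W]

theorem intervalIntegral_congr_offFin {f g : ℝ → W} (h : ∀ᶠ t in offFin, f t = g t) {x y : ℝ}
    (hx : x ∈ Icc (0 : ℝ) 1) (hy : y ∈ Icc (0 : ℝ) 1) :
    ∫ t in x..y, f t = ∫ t in x..y, g t :=
  intervalIntegral.integral_congr_ae (ae_uIoc_of_eventually_offFin h hx hy)

variable [CompleteSpace W]

theorem PCont.continuousOn_primitive {f : ℝ → W} (hf : PCont f) {c : ℝ} (hc : c ∈ Icc (0 : ℝ) 1) :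
    ContinuousOn (fun x => ∫ t in c..x, f t) (Icc 0 1) := by
  have h := intervalIntegral.continuousOn_primitive_interval' (a := c)
    (hf.intervalIntegrable (x := 0) (y := 1) (by simp) (by simp))
    (by rwa [uIcc_of_le zero_le_one])
  rwa [uIcc_of_le zero_le_one] at h

theorem PCont.hasDerivAt_primitive {f : ℝ → W} (hf : PCont f) {c : ℝ} (hc : c ∈ Icc (0 : ℝ) 1) :
    ∀ᶠ x in offFin, HasDerivAt (fun x => ∫ t in c..x, f t) (f x) x := by
  filter_upwards [hf.cont, eventually_offFin_mem] with x hx hxI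
  refine intervalIntegral.integral_hasDerivAt_right
    (hf.intervalIntegrable hc (Ioo_subset_Icc_self hxI)) ?_ hx
  refine ⟨Icc 0 1, Icc_mem_nhds hxI.1 hxI.2, ?_⟩
  exact hf.integrableOn.aestronglyMeasurable

theorem integral_eq_sub_offFin {u u' : ℝ → W} (hu : ContinuousOn u (Icc 0 1))
    (hd : ∀ᶠ t in offFin, HasDerivAt u (u' t) t) (hi : PCont u') {x y : ℝ}
    (hx : x ∈ Icc (0 : ℝ) 1) (hy : y ∈ Icc (0 : ℝ) 1) : ∫ t in x..y, u' t = u y - u x := by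
  obtain ⟨F, hF⟩ := eventually_offFin_iff.1 hd
  refine integral_eq_of_hasDerivAt_off_countable u u' (F.finite_toSet.countable)
    (hu.mono (uIcc_subset_unit hx hy)) (fun t ht => hF t ⟨?_, ?_⟩ (by simpa using ht.2))
    (hi.intervalIntegrable hx hy)
  · exact (le_min hx.1 hy.1).trans_lt ht.1.1
  · exact ht.1.2.trans_le (max_le hx.2 hy.2)

theorem eq_of_deriv_zero_offFin {u : ℝ → W} (hu : ContinuousOn u (Icc 0 1))
    (hd : ∀ᶠ t in offFin, HasDerivAt u 0 t) {x y : ℝ}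
    (hx : x ∈ Icc (0 : ℝ) 1) (hy : y ∈ Icc (0 : ℝ) 1) : u x = u y := by
  have h := integral_eq_sub_offFin hu hd (PCont.const 0) hx hy
  rw [intervalIntegral.integral_zero] at h
  exact (sub_eq_zero.1 h.symm).symm

/-- Uniqueness for linear differential equations, off finitely many points. -/
theorem eq_zero_of_norm_deriv_le_offFin {k w : ℝ → W} (hk : ContinuousOn k (Icc 0 1))
    (hd : ∀ᶠ t in offFin, HasDerivAt k (w t) t) (hw : PCont w) {C : ℝ}
    (hC : ∀ᶠ t in offFin, ‖w t‖ ≤ C * ‖k t‖) (h0 : k 0 = 0) : ∀ t ∈ Icc (0 : ℝ) 1, k t = 0 := by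
  have h01 : (0 : ℝ) ∈ Icc (0 : ℝ) 1 := by simp
  have hn : ContinuousOn (fun t => ‖k t‖) (Icc 0 1) := hk.norm
  have hnP : PCont fun t => ‖k t‖ := PCont.of_continuousOn hn
  have hkle : ∀ t ∈ Icc (0 : ℝ) 1, ‖k t‖ ≤ C * ∫ x in (0 : ℝ)..t, ‖k x‖ := by
    intro t ht
    have h1 : k t = ∫ x in (0 : ℝ)..t, w x := by
      rw [integral_eq_sub_offFin hk hd hw h01 ht, h0, sub_zero]
    rw [h1, ← intervalIntegral.integral_const_mul]
    refine intervalIntegral.norm_integral_le_of_norm_le ht.1 ?_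
      ((hnP.intervalIntegrable h01 ht).const_mul C)
    have := ae_uIoc_of_eventually_offFin hC h01 ht
    rwa [uIoc_of_le ht.1] at this
  -- Grönwall is applied to the primitive of `‖k‖`, which has a right derivative at every point of
  -- `[0, 1)`, whereas `k` itself is differentiable only off a finite set.
  have hu : ∀ t ∈ Icc (0 : ℝ) 1, ∫ x in (0 : ℝ)..t, ‖k x‖ = 0 := by
    refine eq_zero_of_abs_deriv_le_mul_abs_self_of_eq_zero_right (K := C)
      (f' := fun t => ‖k t‖) (hnP.continuousOn_primitive h01) ?_ (by simp) ?_
    · intro t ht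
      have htI : t ∈ Icc (0 : ℝ) 1 := Ico_subset_Icc_self ht
      refine intervalIntegral.integral_hasDerivWithinAt_right
        (hnP.intervalIntegrable h01 htI) ?_ ?_ (t := Ioi t)
      · refine ⟨Icc 0 1, ?_, hnP.integrableOn.aestronglyMeasurable⟩
        refine mem_of_superset (Ioo_mem_nhdsGT ht.2) fun x hx => ⟨ht.1.trans hx.1.le, hx.2.le⟩
      · refine ((hn t htI).mono_of_mem_nhdsWithin ?_)
        refine mem_of_superset (Ioo_mem_nhdsGT ht.2) fun x hx => ⟨ht.1.trans hx.1.le, hx.2.le⟩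
    · intro t ht
      have htI : t ∈ Icc (0 : ℝ) 1 := Ico_subset_Icc_self ht
      rw [norm_norm]
      refine (hkle t htI).trans_eq ?_
      rw [Real.norm_of_nonneg]
      exact intervalIntegral.integral_nonneg ht.1 fun _ _ => norm_nonneg _
  intro t ht
  have := hkle t ht
  rw [hu t ht, mul_zero] at this
  exact norm_le_zero_iff.1 this

end Calculus

/-! ### Picard iteration for `U' = -a U` -/

section Picard

variable {R : Type*} [NormedRing R] [NormedAlgebra ℝ R]

/-- The iterated integrals `w`, `∫ a w`, `∫ a ∫ a w`, ... -/
noncomputable def picard (a w : ℝ → R) : ℕ → ℝ → R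
  | 0 => w
  | m + 1 => fun T => ∫ t in (0 : ℝ)..T, a t * picard a w m t

theorem StronglyMeasurable.intervalIntegrable_of_bounded {W : Type*} [NormedAddCommGroup W]
    {f : ℝ → W} (hf : StronglyMeasurable f)
    {C : ℝ} (hC : ∀ t, ‖f t‖ ≤ C) (x y : ℝ) : IntervalIntegrable f volume x y := by
  rw [intervalIntegrable_iff]
  exact Measure.integrableOn_of_bounded (by simp) hf.aestronglyMeasurable
    (Filter.Eventually.of_forall hC)

variable {a w : ℝ → R} {C M : ℝ}

theorem mul_intervalIntegrable (ha : StronglyMeasurable a) (hC : ∀ t, ‖a t‖ ≤ C)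
    {v : ℝ → R} (hv : Continuous v) (x y : ℝ) :
    IntervalIntegrable (fun t => a t * v t) volume x y :=
  (StronglyMeasurable.intervalIntegrable_of_bounded ha hC x y).mul_continuousOn hv.continuousOn

theorem continuous_picard (ha : StronglyMeasurable a) (hC : ∀ t, ‖a t‖ ≤ C) (hw : Continuous w)
    (m : ℕ) : Continuous (picard a w m) := by
  induction m with
  | zero => exact hw
  | succ m ih =>
    exact intervalIntegral.continuous_primitive (fun x y => mul_intervalIntegrable ha hC ih x y) 0

theorem norm_picard_le (hC : ∀ t, ‖a t‖ ≤ C)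
    (hM : ∀ t ∈ Icc (0 : ℝ) 1, ‖w t‖ ≤ M) (m : ℕ) :
    ∀ T ∈ Icc (0 : ℝ) 1, ‖picard a w m T‖ ≤ M * C ^ m * T ^ m / m.factorial := by
  induction m with
  | zero => intro T hT; simpa [picard] using hM T hT
  | succ m ih =>
    intro T hT
    have hC0 : 0 ≤ C := (norm_nonneg _).trans (hC 0)
    have h1 : ‖picard a w (m + 1) T‖ ≤
        ∫ t in (0 : ℝ)..T, C * (M * C ^ m * t ^ m / m.factorial) := by
      refine intervalIntegral.norm_integral_le_of_norm_le hT.1 ?_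
        (Continuous.intervalIntegrable (by fun_prop) _ _)
      refine Filter.Eventually.of_forall fun t ht => ?_
      exact (norm_mul_le _ _).trans (mul_le_mul (hC t) (ih t ⟨ht.1.le, ht.2.trans hT.2⟩)
        (norm_nonneg _) hC0)
    refine h1.trans_eq ?_
    have : (fun t : ℝ => C * (M * C ^ m * t ^ m / m.factorial)) =
        fun t => (C * M * C ^ m / m.factorial) * t ^ m := by
      funext t; ring
    rw [this, intervalIntegral.integral_const_mul, integral_pow, Nat.factorial_succ]
    push_cast
    field_simp
    ring

theorem norm_picard_le' (hC : ∀ t, ‖a t‖ ≤ C)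
    (hM : ∀ t ∈ Icc (0 : ℝ) 1, ‖w t‖ ≤ M) (m : ℕ) {T : ℝ} (hT : T ∈ Icc (0 : ℝ) 1) :
    ‖picard a w m T‖ ≤ M * (C ^ m / m.factorial) := by
  have hC0 : 0 ≤ C := (norm_nonneg _).trans (hC 0)
  have hM0 : 0 ≤ M := (norm_nonneg _).trans (hM T hT)
  refine (norm_picard_le hC hM m T hT).trans ?_
  rw [mul_div_assoc, mul_assoc, ← mul_div_assoc]
  refine mul_le_mul_of_nonneg_left ?_ hM0
  refine div_le_div_of_nonneg_right ?_ (by positivity)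
  exact mul_le_of_le_one_right (by positivity) (pow_le_one₀ hT.1 hT.2)

theorem summable_bound (M C : ℝ) : Summable fun m : ℕ => M * (C ^ m / m.factorial) :=
  (Real.summable_pow_div_factorial C).mul_left M

variable [CompleteSpace R]

/-- The alternating sum of the Picard iterates. -/
noncomputable def picardSum (a w : ℝ → R) (T : ℝ) : R := ∑' m : ℕ, (-1 : ℝ) ^ m • picard a w m T

theorem norm_neg_one_pow_smul {W : Type*} [NormedAddCommGroup W] [NormedSpace ℝ W] (m : ℕ)
    (x : W) : ‖(-1 : ℝ) ^ m • x‖ = ‖x‖ := by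
  rw [norm_smul]; simp

theorem hasSum_picardSum (hC : ∀ t, ‖a t‖ ≤ C)
    (hM : ∀ t ∈ Icc (0 : ℝ) 1, ‖w t‖ ≤ M) {T : ℝ} (hT : T ∈ Icc (0 : ℝ) 1) :
    HasSum (fun m : ℕ => (-1 : ℝ) ^ m • picard a w m T) (picardSum a w T) := by
  refine (Summable.of_norm_bounded (summable_bound M C) fun m => ?_).hasSum
  rw [norm_neg_one_pow_smul]
  exact norm_picard_le' hC hM m hT

theorem norm_picardSum_le (hC : ∀ t, ‖a t‖ ≤ C)
    (hM : ∀ t ∈ Icc (0 : ℝ) 1, ‖w t‖ ≤ M) {T : ℝ} (hT : T ∈ Icc (0 : ℝ) 1) :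
    ‖picardSum a w T‖ ≤ M * Real.exp C := by
  refine tsum_of_norm_bounded (f := fun m : ℕ => (-1 : ℝ) ^ m • picard a w m T)
    (g := fun m : ℕ => M * (C ^ m / m.factorial)) ?_ fun m => ?_
  · rw [Real.exp_eq_exp_ℝ]
    exact (NormedSpace.expSeries_div_hasSum_exp C).mul_left M
  · rw [norm_neg_one_pow_smul]
    exact norm_picard_le' hC hM m hT

theorem continuousOn_picardSum (ha : StronglyMeasurable a) (hC : ∀ t, ‖a t‖ ≤ C)
    (hw : Continuous w) : ContinuousOn (picardSum a w) (Icc 0 1) := by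
  obtain ⟨M, hM⟩ := isCompact_Icc.exists_bound_of_continuousOn (s := Icc (0 : ℝ) 1) hw.continuousOn
  change ContinuousOn (fun T => ∑' m : ℕ, (-1 : ℝ) ^ m • picard a w m T) _
  refine continuousOn_tsum (u := fun m : ℕ => M * (C ^ m / m.factorial)) (fun m => ?_)
    (summable_bound M C) fun m T hT => ?_
  · exact ((continuous_picard ha hC hw m).const_smul _).continuousOn
  · rw [norm_neg_one_pow_smul]
    exact norm_picard_le' hC hM m hT

/-- Applying `w ↦ ∫ a w` termwise raises the index by one and flips the sign, so it reproduces the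
series up to its zeroth term `w`. The exchange of sum and integral is dominated by the exponential
series. -/
theorem picardSum_eq (ha : StronglyMeasurable a) (hC : ∀ t, ‖a t‖ ≤ C) (hw : Continuous w)
    {T : ℝ} (hT : T ∈ Icc (0 : ℝ) 1) :
    picardSum a w T = w T - ∫ t in (0 : ℝ)..T, a t * picardSum a w t := by
  obtain ⟨M, hM⟩ := isCompact_Icc.exists_bound_of_continuousOn (s := Icc (0 : ℝ) 1) hw.continuousOn
  have hM0 : 0 ≤ M := (norm_nonneg _).trans (hM 0 (by simp))
  have hC0 : 0 ≤ C := (norm_nonneg _).trans (hC 0)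
  have hsub : ∀ t ∈ uIoc 0 T, t ∈ Icc (0 : ℝ) 1 := fun t ht => by
    rw [uIoc_of_le hT.1] at ht
    exact ⟨ht.1.le, ht.2.trans hT.2⟩
  have h1 : HasSum (fun m : ℕ => ∫ t in (0 : ℝ)..T, a t * ((-1 : ℝ) ^ m • picard a w m t))
      (∫ t in (0 : ℝ)..T, a t * picardSum a w t) := by
    refine intervalIntegral.hasSum_integral_of_dominated_convergence
      (fun m _ => C * (M * (C ^ m / m.factorial))) (fun m => ?_) (fun m => ?_) ?_ ?_ ?_
    · exact (ha.mul ((continuous_picard ha hC hw m).const_smul _).stronglyMeasurable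
        ).aestronglyMeasurable
    · refine Filter.Eventually.of_forall fun t ht => (norm_mul_le _ _).trans ?_
      rw [norm_neg_one_pow_smul]
      exact mul_le_mul (hC t) (norm_picard_le' hC hM m (hsub t ht)) (norm_nonneg _) hC0
    · exact Filter.Eventually.of_forall fun t _ => (summable_bound M C).mul_left C
    · exact intervalIntegrable_const
    · exact Filter.Eventually.of_forall fun t ht =>
        (hasSum_picardSum hC hM (hsub t ht)).mul_left (a t)
  have h2 := (hasSum_picardSum hC hM hT)
  have h3 : HasSum (fun m : ℕ => (-1 : ℝ) ^ (m + 1) • picard a w (m + 1) T)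
      (-∫ t in (0 : ℝ)..T, a t * picardSum a w t) := by
    refine h1.neg.congr_fun fun m => ?_
    simp only [picard, mul_smul_comm, intervalIntegral.integral_smul]
    rw [pow_succ, mul_neg_one, neg_smul]
  have h4 := (hasSum_nat_add_iff' (f := fun m : ℕ => (-1 : ℝ) ^ m • picard a w m T) 1).2 h2
  have h5 := h4.unique h3
  simp only [Finset.range_one, Finset.sum_singleton, pow_zero, one_smul, picard] at h5
  rw [sub_eq_iff_eq_add] at h5
  rw [h5]; abel

end Picard

end HigherHol

namespace HigherHol

open Filter

/-! ### Fundamental solutions of `U' = -a U` -/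

section Solutions

variable {R : Type*} [NormedRing R] [NormedAlgebra ℝ R]

/-- `U` solves `U' = -a U`, `U(0) = 1` on `[0, 1]`, off finitely many points. -/
structure IsSol (a U : ℝ → R) : Prop where
  zero : U 0 = 1
  cont : ContinuousOn U (Icc 0 1)
  deriv : ∀ᶠ t in offFin, HasDerivAt U (-(a t * U t)) t

variable [CompleteSpace R]

theorem PCont.mul_cont {a U : ℝ → R} (ha : PCont a) (hU : ContinuousOn U (Icc 0 1)) :
    PCont fun t => a t * U t := ha.mul (PCont.of_continuousOn hU)

theorem PCont.cont_mul {a U : ℝ → R} (hU : ContinuousOn U (Icc 0 1)) (ha : PCont a) :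
    PCont fun t => U t * a t := (PCont.of_continuousOn hU).mul ha

theorem isSol_of_integral_eq {a U : ℝ → R} (ha : PCont a) (hU : ContinuousOn U (Icc 0 1))
    (h : ∀ T ∈ Icc (0 : ℝ) 1, U T = 1 - ∫ t in (0 : ℝ)..T, a t * U t) : IsSol a U := by
  have hp := ha.mul_cont hU
  refine ⟨by simpa using h 0 (by simp), hU, ?_⟩
  filter_upwards [hp.hasDerivAt_primitive (c := 0) (by simp), eventually_offFin_mem] with t ht htI
  refine (ht.const_sub 1).congr_of_eventuallyEq ?_
  filter_upwards [Icc_mem_nhds htI.1 htI.2] with T hT using h T hT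

/-- The Dyson series solves the equation. -/
theorem isSol_picardSum {a a' : ℝ → R} (ha : PCont a) (hm : StronglyMeasurable a') {C : ℝ}
    (hC : ∀ t, ‖a' t‖ ≤ C) (he : ∀ᶠ t in offFin, a' t = a t) :
    IsSol a (picardSum a' fun _ => 1) := by
  have hc := continuousOn_picardSum hm hC (w := fun _ => (1 : R)) continuous_const
  refine isSol_of_integral_eq ha hc fun T hT => ?_
  rw [picardSum_eq hm hC continuous_const hT]
  congr 1
  refine intervalIntegral_congr_offFin ?_ (by simp) hT
  filter_upwards [he] with t ht
  rw [ht]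

theorem PCont.exists_isSol {a : ℝ → R} (ha : PCont a) : ∃ U, IsSol a U := by
  obtain ⟨a', hm, ⟨C, hC⟩, he⟩ := ha.exists_stronglyMeasurable
  exact ⟨_, isSol_picardSum ha hm hC he⟩

theorem IsSol.unique {a U U' : ℝ → R} (ha : PCont a) (h : IsSol a U) (h' : IsSol a U') :
    ∀ t ∈ Icc (0 : ℝ) 1, U t = U' t := by
  obtain ⟨C, hC⟩ := ha.bdd
  have hk : ContinuousOn (fun t => U t - U' t) (Icc 0 1) := h.cont.sub h'.cont
  have := eq_zero_of_norm_deriv_le_offFin hk (w := fun t => -(a t * (U t - U' t))) (C := C)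
    ?_ (ha.mul_cont hk).neg ?_ (by simp [h.zero, h'.zero])
  · exact fun t ht => sub_eq_zero.1 (this t ht)
  · filter_upwards [h.deriv, h'.deriv] with t h1 h2
    refine (h1.sub h2).congr_deriv ?_
    rw [mul_sub]; abel
  · filter_upwards [hC] with t ht
    rw [norm_neg]
    exact (norm_mul_le _ _).trans (mul_le_mul_of_nonneg_right ht (norm_nonneg _))

/-- By uniqueness `U` is the Dyson series, which is majorized by the exponential series. The bound
depends on `C` alone, and is therefore uniform over families of coefficients. -/
theorem IsSol.norm_le {a U : ℝ → R} (ha : PCont a) (h : IsSol a U) {C : ℝ} (hC0 : 0 ≤ C)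
    (hC : ∀ᶠ t in offFin, ‖a t‖ ≤ C) :
    ∀ t ∈ Icc (0 : ℝ) 1, ‖U t‖ ≤ ‖(1 : R)‖ * Real.exp C := by
  obtain ⟨a', hm, -, he⟩ := ha.exists_stronglyMeasurable
  -- The measurable representative may exceed `C` at exceptional points; cutting it off there keeps
  -- the constant exactly `C`.
  have hset : MeasurableSet {t | ‖a' t‖ ≤ C} := hm.norm.measurable measurableSet_Iic
  have hm' := hm.indicator hset
  have hC' : ∀ t, ‖{t | ‖a' t‖ ≤ C}.indicator a' t‖ ≤ C := fun t => by
    by_cases ht : t ∈ {t | ‖a' t‖ ≤ C}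
    · rw [indicator_of_mem ht]; exact ht
    · rw [indicator_of_notMem ht, norm_zero]; exact hC0
  have he' : ∀ᶠ t in offFin, {t | ‖a' t‖ ≤ C}.indicator a' t = a t := by
    filter_upwards [he, hC] with t h1 h2
    rw [indicator_of_mem, h1]
    simpa [h1] using h2
  intro t ht
  rw [h.unique ha (isSol_picardSum ha hm' hC' he') t ht]
  exact norm_picardSum_le hC' (fun _ _ => le_rfl) ht

-- `V' = V a` is the equation `U' = -(-a) U` read in the opposite ring, which has the same norm, so
-- existence and the bound are inherited.
open MulOpposite in
theorem PCont.exists_inverse_sol {a : ℝ → R} (ha : PCont a) :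
    ∃ V : ℝ → R, V 0 = 1 ∧ ContinuousOn V (Icc 0 1) ∧
      (∀ᶠ t in offFin, HasDerivAt V (V t * a t) t) ∧
      ∀ C, 0 ≤ C → (∀ᶠ t in offFin, ‖a t‖ ≤ C) →
        ∀ t ∈ Icc (0 : ℝ) 1, ‖V t‖ ≤ ‖(1 : R)‖ * Real.exp C := by
  let e : R ≃L[ℝ] Rᵐᵒᵖ := opContinuousLinearEquiv ℝ
  have ha' : PCont fun t => -(op (a t)) := (ha.clm e.toContinuousLinearMap).neg
  obtain ⟨U, hU⟩ := ha'.exists_isSol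
  refine ⟨fun t => unop (U t), by simp [hU.zero], ?_, ?_, ?_⟩
  · exact continuous_unop.comp_continuousOn hU.cont
  · filter_upwards [hU.deriv] with t ht
    have := e.symm.toContinuousLinearMap.hasFDerivAt.comp_hasDerivAt t ht
    refine this.congr_deriv ?_
    change unop (-(-(op (a t)) * U t)) = _
    simp
  · intro C hC0 hC t ht
    have := hU.norm_le ha' hC0 (by
      filter_upwards [hC] with t ht
      rw [norm_neg]; exact ht) t ht
    exact this

/-- `V U` has derivative zero. A left inverse need not be a right inverse here, so `U V` is treated
separately: `U V - 1` solves the linear equation `k' = k a - a k` with `k(0) = 0`, and vanishes by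
uniqueness. -/
theorem IsSol.inverse_eq {a U V : ℝ → R} (ha : PCont a) (h : IsSol a U) (hV0 : V 0 = 1)
    (hVc : ContinuousOn V (Icc 0 1)) (hV : ∀ᶠ t in offFin, HasDerivAt V (V t * a t) t) :
    ∀ t ∈ Icc (0 : ℝ) 1, V t * U t = 1 ∧ U t * V t = 1 := by
  intro t ht
  constructor
  · have := eq_of_deriv_zero_offFin (u := fun t => V t * U t) (hVc.mul h.cont) ?_ ht
      (show (0 : ℝ) ∈ Icc (0 : ℝ) 1 by simp)
    · rw [this, hV0, h.zero, one_mul]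
    · filter_upwards [h.deriv, hV] with t h1 h2
      refine (h2.mul h1).congr_deriv ?_
      rw [mul_neg, mul_assoc, add_neg_cancel]
  · obtain ⟨C, hC⟩ := ha.bdd
    have hk : ContinuousOn (fun t => U t * V t - 1) (Icc 0 1) :=
      (h.cont.mul hVc).sub continuousOn_const
    have := eq_zero_of_norm_deriv_le_offFin hk
      (w := fun t => (U t * V t - 1) * a t - a t * (U t * V t - 1)) (C := C + C)
      ?_ ((PCont.cont_mul hk ha).sub (ha.mul_cont hk)) ?_ (by simp [h.zero, hV0]) t ht
    · exact sub_eq_zero.1 this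
    · filter_upwards [h.deriv, hV] with t h1 h2
      refine ((h1.mul h2).sub_const 1).congr_deriv ?_
      noncomm_ring
    · filter_upwards [hC] with t ht
      refine (norm_sub_le _ _).trans ?_
      rw [add_mul]
      refine add_le_add ((norm_mul_le _ _).trans ?_) ((norm_mul_le _ _).trans ?_)
      · rw [mul_comm]; exact mul_le_mul_of_nonneg_right ht (norm_nonneg _)
      · exact mul_le_mul_of_nonneg_right ht (norm_nonneg _)

theorem IsSol.isUnit {a U : ℝ → R} (ha : PCont a) (h : IsSol a U) {t : ℝ}
    (ht : t ∈ Icc (0 : ℝ) 1) : IsUnit (U t) := by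
  obtain ⟨V, hV0, hVc, hV, -⟩ := ha.exists_inverse_sol
  have := h.inverse_eq ha hV0 hVc hV t ht
  exact ⟨⟨U t, V t, this.2, this.1⟩, rfl⟩

theorem ringInverse_eq_of_mul_eq_one {x y : R} (h1 : x * y = 1) (h2 : y * x = 1) :
    Ring.inverse x = y :=
  Ring.inverse_unit (⟨x, y, h1, h2⟩ : Rˣ)

theorem IsSol.norm_inverse_le {a U : ℝ → R} (ha : PCont a) (h : IsSol a U) {C : ℝ} (hC0 : 0 ≤ C)
    (hC : ∀ᶠ t in offFin, ‖a t‖ ≤ C) :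
    ∀ t ∈ Icc (0 : ℝ) 1, ‖Ring.inverse (U t)‖ ≤ ‖(1 : R)‖ * Real.exp C := by
  intro t ht
  obtain ⟨V, hV0, hVc, hV, hb⟩ := ha.exists_inverse_sol
  have := h.inverse_eq ha hV0 hVc hV t ht
  rw [ringInverse_eq_of_mul_eq_one this.2 this.1]
  exact hb C hC0 hC t ht

theorem continuousOn_ringInverse {X : Type*} [TopologicalSpace X] {s : Set X} {U : X → R}
    (hU : ContinuousOn U s) (hu : ∀ x ∈ s, IsUnit (U x)) :
    ContinuousOn (fun x => Ring.inverse (U x)) s := by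
  intro x hx
  obtain ⟨u, hux⟩ := hu x hx
  have := NormedRing.inverse_continuousAt u
  rw [hux] at this
  exact this.comp_continuousWithinAt (hU x hx)

theorem IsSol.cont_inverse {a U : ℝ → R} (ha : PCont a) (h : IsSol a U) :
    ContinuousOn (fun t => Ring.inverse (U t)) (Icc 0 1) :=
  continuousOn_ringInverse h.cont fun _ ht => h.isUnit ha ht

theorem hasDerivAt_ringInverse {U : ℝ → R} {U' : R} {t : ℝ} (h : HasDerivAt U U' t)
    (hu : IsUnit (U t)) : HasDerivAt (fun t => Ring.inverse (U t))
      (-(Ring.inverse (U t) * U' * Ring.inverse (U t))) t := by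
  obtain ⟨u, hux⟩ := hu
  have h1 := hasFDerivAt_ringInverse (𝕜 := ℝ) u
  rw [hux] at h1
  refine (h1.comp_hasDerivAt t h).congr_deriv ?_
  rw [← hux, Ring.inverse_unit]
  simp

theorem IsSol.deriv_inverse {a U : ℝ → R} (ha : PCont a) (h : IsSol a U) :
    ∀ᶠ t in offFin, HasDerivAt (fun t => Ring.inverse (U t)) (Ring.inverse (U t) * a t) t := by
  filter_upwards [h.deriv, eventually_offFin_mem] with t ht htI
  have hu := h.isUnit ha (Ioo_subset_Icc_self htI)
  refine (hasDerivAt_ringInverse ht hu).congr_deriv ?_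
  rw [mul_neg, neg_mul, neg_neg, mul_assoc, mul_assoc, Ring.mul_inverse_cancel _ hu, mul_one]

/-- Variation of constants. -/
theorem eq_variation_of_constants {a U S w : ℝ → R} (ha : PCont a) (h : IsSol a U) (hw : PCont w)
    (hS0 : S 0 = 0) (hSc : ContinuousOn S (Icc 0 1))
    (hS : ∀ᶠ t in offFin, HasDerivAt S (w t - a t * S t) t) :
    ∀ T ∈ Icc (0 : ℝ) 1, S T = U T * ∫ t in (0 : ℝ)..T, Ring.inverse (U t) * w t := by
  intro T hT
  have hi := h.cont_inverse ha
  have := integral_eq_sub_offFin (u := fun t => Ring.inverse (U t) * S t)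
    (u' := fun t => Ring.inverse (U t) * w t) (hi.mul hSc) ?_ (PCont.cont_mul hi hw)
    (show (0 : ℝ) ∈ Icc (0 : ℝ) 1 by simp) hT
  · rw [this, hS0, mul_zero, sub_zero, Ring.mul_inverse_cancel_left _ _ (h.isUnit ha hT)]
  · filter_upwards [hS, h.deriv_inverse ha] with t h1 h2
    refine (h2.mul h1).congr_deriv ?_
    noncomm_ring

end Solutions

/-! ### Integrals and solutions with values in a subspace or a subalgebra. -/

section Membership

variable {W : Type*} [NormedAddCommGroup W] [NormedSpace ℝ W] [FiniteDimensional ℝ W]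

theorem intervalIntegral_mem_submodule (S : Submodule ℝ W) {f : ℝ → W} {x y : ℝ}
    (hf : ∀ᵐ t, t ∈ uIoc x y → f t ∈ S) : ∫ t in x..y, f t ∈ S := by
  by_cases hi : IntervalIntegrable f volume x y
  · obtain ⟨T, hT⟩ := S.exists_isCompl
    let q : W →L[ℝ] W :=
      LinearMap.toContinuousLinearMap (T.subtype.comp (T.projectionOnto S hT.symm))
    have hq : ∀ w, q w = 0 ↔ w ∈ S := by
      intro w
      change T.subtype (T.projectionOnto S hT.symm w) = 0 ↔ _
      simp
    rw [← hq, ← ContinuousLinearMap.intervalIntegral_comp_comm q hi]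
    have : ∫ t in x..y, q (f t) = ∫ t in x..y, (0 : W) := by
      refine intervalIntegral.integral_congr_ae ?_
      filter_upwards [hf] with t ht htI using (hq _).2 (ht htI)
    rw [this, intervalIntegral.integral_zero]
  -- A non-integrable function has integral zero by convention, so integrability need not be
  -- assumed.
  · rw [intervalIntegral.integral_undef hi]
    exact S.zero_mem

end Membership

section SolutionsMem

variable {R : Type*} [NormedRing R] [NormedAlgebra ℝ R] [FiniteDimensional ℝ R]

/-- Solutions with coefficients in a subalgebra stay in the subalgebra, as do their inverses. -/
theorem IsSol.mem_subalgebra {a U : ℝ → R} (ha : PCont a) (h : IsSol a U) (S : Subalgebra ℝ R)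
    (hS : ∀ᶠ t in offFin, a t ∈ S) : ∀ t ∈ Icc (0 : ℝ) 1, U t ∈ S := by
  have : CompleteSpace R := FiniteDimensional.complete ℝ R
  obtain ⟨a', hm, ⟨C, hC⟩, he⟩ := ha.exists_stronglyMeasurable
  -- Each term of the Dyson series lies in the subalgebra by induction, and a finite-dimensional
  -- subalgebra is closed.
  have hmem : ∀ m : ℕ, ∀ T ∈ Icc (0 : ℝ) 1, picard a' (fun _ => 1) m T ∈ S.toSubmodule := by
    intro m
    induction m with
    | zero => intro T _; exact S.one_mem
    | succ m ih =>
      intro T hT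
      refine intervalIntegral_mem_submodule _ ?_
      filter_upwards [ae_uIoc_of_eventually_offFin (he.and hS) (x := 0) (by simp) hT] with t ht htI
      have h1 := ht htI
      rw [h1.1]
      rw [uIoc_of_le hT.1] at htI
      exact S.mul_mem h1.2 (ih t ⟨htI.1.le, htI.2.trans hT.2⟩)
  intro t ht
  rw [h.unique ha (isSol_picardSum ha hm hC he) t ht]
  have hcl : IsClosed (S.toSubmodule : Set R) := Submodule.closed_of_finiteDimensional _
  exact hcl.mem_of_tendsto (hasSum_picardSum hC (M := ‖(1 : R)‖) (fun _ _ => le_rfl) ht)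
    (Eventually.of_forall fun s => S.toSubmodule.sum_mem fun m _ =>
      S.toSubmodule.smul_mem _ (hmem m t ht))

end SolutionsMem

end HigherHol

namespace HigherHol

open Filter

/-! ### Iterated integrals over simplices -/

section Iterated

variable {R : Type*} [NormedRing R] [NormedAlgebra ℝ R]

/-- The simplex `{T ≥ t₁ ≥ ⋯ ≥ t_k ≥ 0}`. -/
def simplexTo (k : ℕ) (T : ℝ) : Set (Fin k → ℝ) := {t | (∀ i, t i ∈ Icc (0 : ℝ) T) ∧ Antitone t}

/-- The iterated integral of `f₁(t₁) ⋯ f_k(t_k)` over `T ≥ t₁ ≥ ⋯ ≥ t_k ≥ 0`. -/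
noncomputable def iterInt : (k : ℕ) → (Fin k → ℝ → R) → ℝ → R
  | 0, _, _ => 1
  | k + 1, f, T => ∫ t in (0 : ℝ)..T, f 0 t * iterInt k (fun i => f i.succ) t

theorem measurableSet_simplexTo (k : ℕ) (T : ℝ) : MeasurableSet (simplexTo k T) := by
  have h : simplexTo k T = (⋂ i, {t : Fin k → ℝ | t i ∈ Icc (0 : ℝ) T}) ∩ {t | Antitone t} := by
    ext t; simp [simplexTo]
  rw [h]
  refine (IsClosed.inter (isClosed_iInter fun i => ?_) isClosed_antitone).measurableSet
  exact isClosed_Icc.preimage (continuous_apply i)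

theorem simplexTo_subset (k : ℕ) (T : ℝ) :
    simplexTo k T ⊆ Set.pi univ fun _ : Fin k => Icc (0 : ℝ) T :=
  fun _ ht i _ => ht.1 i

theorem volume_simplexTo_lt_top (k : ℕ) (T : ℝ) : volume (simplexTo k T) < ⊤ := by
  refine (measure_mono (simplexTo_subset k T)).trans_lt ?_
  rw [volume_pi_pi]
  exact ENNReal.prod_lt_top fun i _ => by simp

theorem mem_simplexTo_succ {k : ℕ} {T : ℝ} {t : Fin (k + 1) → ℝ} :
    t ∈ simplexTo (k + 1) T ↔
      t 0 ∈ Icc (0 : ℝ) T ∧ (fun i : Fin k => t i.succ) ∈ simplexTo k (t 0) := by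
  constructor
  · rintro ⟨h1, h2⟩
    exact ⟨h1 0, fun i => ⟨(h1 _).1, h2 (Fin.zero_le _)⟩, fun i j hij =>
      h2 (Fin.succ_le_succ_iff.2 hij)⟩
  · rintro ⟨h0, h1, h2⟩
    refine ⟨fun i => ?_, fun i j hij => ?_⟩
    · cases i using Fin.cases with
      | zero => exact h0
      | succ i => exact ⟨(h1 i).1, (h1 i).2.trans h0.2⟩
    · cases i using Fin.cases with
      | zero =>
        cases j using Fin.cases with
        | zero => exact le_rfl
        | succ j => exact (h1 j).2
      | succ i =>
        cases j using Fin.cases with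
        | zero => exact absurd hij (by simp)
        | succ j => exact h2 (Fin.succ_le_succ_iff.1 hij)

theorem stronglyMeasurable_ofFn_prod {X : Type*} [MeasurableSpace X] {k : ℕ} {f : Fin k → X → R}
    (hf : ∀ i, StronglyMeasurable (f i)) :
    StronglyMeasurable fun x => (List.ofFn fun i => f i x).prod := by
  induction k with
  | zero => simpa using stronglyMeasurable_const
  | succ k ih =>
    simp only [List.ofFn_succ, List.prod_cons]
    exact (hf 0).mul (ih fun i => hf i.succ)

theorem norm_ofFn_prod_le {k : ℕ} {f : Fin k → R} {C : ℝ} (hC : 0 ≤ C) (hf : ∀ i, ‖f i‖ ≤ C) :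
    ‖(List.ofFn f).prod‖ ≤ ‖(1 : R)‖ * C ^ k := by
  induction k with
  | zero => simp
  | succ k ih =>
    rw [List.ofFn_succ, List.prod_cons]
    refine (norm_mul_le _ _).trans ?_
    refine (mul_le_mul (hf 0) (ih fun i => hf i.succ) (norm_nonneg _) hC).trans_eq ?_
    ring

theorem integrableOn_ofFn_prod {X : Type*} [MeasurableSpace X] {μ : Measure X} {k : ℕ}
    {f : Fin k → X → R} (hf : ∀ i, StronglyMeasurable (f i)) {C : ℝ} (hC : 0 ≤ C)
    (hb : ∀ i x, ‖f i x‖ ≤ C) {s : Set X} (hs : μ s < ⊤) :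
    IntegrableOn (fun x => (List.ofFn fun i => f i x).prod) s μ :=
  Measure.integrableOn_of_bounded hs.ne (stronglyMeasurable_ofFn_prod hf).aestronglyMeasurable
    (Eventually.of_forall fun x => norm_ofFn_prod_le hC fun i => hb i x)

variable [CompleteSpace R]

/-- Fubini in the first variable, which is the largest: once `t₁` is fixed the other variables range
over the simplex with upper bound `t₁`, and the first factor is a constant on the left. The order of
the noncommuting factors is preserved. -/
theorem setIntegral_simplexTo {k : ℕ} {f : Fin k → ℝ → R} (hf : ∀ i, StronglyMeasurable (f i))
    {C : ℝ} (hC : 0 ≤ C) (hb : ∀ i x, ‖f i x‖ ≤ C) {T : ℝ} (hT : 0 ≤ T) :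
    ∫ t in simplexTo k T, (List.ofFn fun i => f i (t i)).prod = iterInt k f T := by
  induction k generalizing T with
  | zero =>
    have h : simplexTo 0 T = univ := by
      ext t; simp [simplexTo, Subsingleton.antitone]
    rw [h]
    -- On the one-point space of maps from `Fin 0` the product measure is a unit point mass, so the
    -- empty product integrates to `1`.
    simp [iterInt, Measure.restrict_univ, volume_pi, Measure.pi_of_empty (x := finZeroElim)]
  | succ k ih =>
    let e := MeasurableEquiv.piFinSuccAbove (fun _ : Fin (k + 1) => ℝ) 0
    let S : Set (ℝ × (Fin k → ℝ)) := {p | p.1 ∈ Icc (0 : ℝ) T ∧ p.2 ∈ simplexTo k p.1}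
    let g : ℝ × (Fin k → ℝ) → R := fun p =>
      f 0 p.1 * (List.ofFn fun i : Fin k => f i.succ (p.2 i)).prod
    have hmp := volume_preserving_piFinSuccAbove (fun _ : Fin (k + 1) => ℝ) 0
    have hS : simplexTo (k + 1) T = e ⁻¹' S := by
      ext t; exact mem_simplexTo_succ
    have hSm : MeasurableSet S := by
      rw [← e.measurableSet_preimage, ← hS]
      exact measurableSet_simplexTo _ _
    have hg : ∀ t, (List.ofFn fun i => f i (t i)).prod = g (e t) := by
      intro t
      rw [List.ofFn_succ, List.prod_cons]
      rfl
    have hgm : StronglyMeasurable g := by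
      refine ((hf 0).comp_measurable measurable_fst).mul
        (stronglyMeasurable_ofFn_prod (f := fun i (p : ℝ × (Fin k → ℝ)) => f i.succ (p.2 i))
          fun i => ?_)
      exact (hf i.succ).comp_measurable ((measurable_pi_apply i).comp measurable_snd)
    have hSv : volume S < ⊤ := by
      rw [← hmp.measure_preimage_equiv, ← hS]
      exact volume_simplexTo_lt_top _ _
    have hgi : IntegrableOn g S := by
      refine Measure.integrableOn_of_bounded hSv.ne hgm.aestronglyMeasurable
        (M := C * (‖(1 : R)‖ * C ^ k)) (Eventually.of_forall fun p => (norm_mul_le _ _).trans ?_)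
      exact mul_le_mul (hb 0 _) (norm_ofFn_prod_le hC fun i => hb _ _) (norm_nonneg _) hC
    have hgi' : Integrable (S.indicator g) ((volume : Measure ℝ).prod volume) :=
      hgi.integrable_indicator hSm
    simp_rw [hg]
    rw [hS, hmp.setIntegral_preimage_emb e.measurableEmbedding, ← integral_indicator hSm]
    change ∫ p, S.indicator g p ∂((volume : Measure ℝ).prod volume) = _
    rw [integral_prod _ hgi', iterInt, intervalIntegral.integral_of_le hT,
      ← integral_Icc_eq_integral_Ioc, ← integral_indicator measurableSet_Icc]
    refine integral_congr_ae (Eventually.of_forall fun x => ?_)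
    by_cases hx : x ∈ Icc (0 : ℝ) T
    · change _ = (Icc (0 : ℝ) T).indicator (fun t => f 0 t * iterInt k (fun i => f i.succ) t) x
      rw [indicator_of_mem hx, ← ih (fun i => hf i.succ) (fun i => hb i.succ) hx.1]
      have : (fun y => S.indicator g (x, y)) = (simplexTo k x).indicator
          (fun y => f 0 x * (List.ofFn fun i : Fin k => f i.succ (y i)).prod) := by
        funext y
        by_cases hy : y ∈ simplexTo k x
        · rw [indicator_of_mem hy, indicator_of_mem (show (x, y) ∈ S from ⟨hx, hy⟩)]
        · rw [indicator_of_notMem hy, indicator_of_notMem fun h : (x, y) ∈ S => hy h.2]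
      simp only [this]
      rw [integral_indicator (measurableSet_simplexTo _ _), integral_const_mul_of_integrable]
      exact integrableOn_ofFn_prod (f := fun i (y : Fin k → ℝ) => f i.succ (y i))
        (fun i => (hf i.succ).comp_measurable (measurable_pi_apply i)) hC (fun i y => hb _ _)
        (volume_simplexTo_lt_top k x)
    · change _ = (Icc (0 : ℝ) T).indicator (fun t => f 0 t * iterInt k (fun i => f i.succ) t) x
      rw [indicator_of_notMem hx]
      have : (fun y => S.indicator g (x, y)) = fun _ => 0 := by
        funext y
        exact indicator_of_notMem (fun h : (x, y) ∈ S => hx h.1) _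
      simp only [this, integral_zero]

theorem simplex_eq_simplexTo (k : ℕ) : simplex k = simplexTo k 1 := rfl

theorem iterInt_const (a : ℝ → R) (k : ℕ) :
    iterInt k (fun _ => a) = picard a (fun _ => 1) k := by
  induction k with
  | zero => rfl
  | succ k ih => funext T; simp only [iterInt, picard, ih]

/-- The factor `b` in position `m`, followed by `n` factors `a`, serves as starting function for `m`
further Picard steps. Keeping `k` as a variable with an equation avoids casts between types `Fin k`
in the induction. -/
theorem iterInt_insert (a b : ℝ → R) (n : ℕ) (m : ℕ) : ∀ k, k = m + n + 1 →
    iterInt k (fun i => if (i : ℕ) = m then b else a) =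
      picard a (fun T => ∫ t in (0 : ℝ)..T, b t * picard a (fun _ => 1) n t) m := by
  induction m with
  | zero =>
    intro k hk
    obtain rfl : k = n + 1 := by omega
    funext T
    have h : (fun i : Fin n => if (i.succ : ℕ) = 0 then b else a) = fun _ => a := by
      funext i; simp
    change ∫ t in (0 : ℝ)..T, b t * iterInt n (fun i => if (i.succ : ℕ) = 0 then b else a) t = _
    rw [h, iterInt_const]
    rfl
  | succ m ih =>
    intro k hk
    obtain rfl : k = (m + n + 1) + 1 := by omega
    funext T
    have h : (fun i : Fin (m + n + 1) => if (i.succ : ℕ) = m + 1 then b else a) =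
        fun i : Fin (m + n + 1) => if (i : ℕ) = m then b else a := by
      funext i; simp
    change ∫ t in (0 : ℝ)..T, a t * iterInt (m + n + 1)
      (fun i => if (i.succ : ℕ) = m + 1 then b else a) t = _
    rw [h, ih (m + n + 1) rfl]
    rfl

end Iterated

/-! ### Dyson series, without and with one inserted factor. -/

section Dyson

variable {R : Type*} [NormedRing R] [NormedAlgebra ℝ R] [CompleteSpace R]

theorem ae_pi_of_eventually_offFin {p : ℝ → Prop} (h : ∀ᶠ t in offFin, p t) (k : ℕ) :
    ∀ᵐ t : Fin k → ℝ, t ∈ simplex k → ∀ i, p (t i) := by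
  have h1 : ∀ i : Fin k, ∀ᵐ t : Fin k → ℝ, t i ∈ Icc (0 : ℝ) 1 → p (t i) := fun i =>
    (Measure.quasiMeasurePreserving_eval (fun _ : Fin k => (volume : Measure ℝ)) i).ae
      (ae_of_eventually_offFin h)
  filter_upwards [ae_all_iff.2 h1] with t ht hts i using ht i (hts.1 i)

theorem measurableSet_simplex (k : ℕ) : MeasurableSet (simplex k) := measurableSet_simplexTo k 1

/-- The Dyson series of a piecewise continuous coefficient. -/
theorem dyson_path {a : ℝ → R} (ha : PCont a) :
    (∀ k, IntegrableOn (fun t : Fin k → ℝ => (List.ofFn fun i => a (t i)).prod) (simplex k)) ∧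
    (Summable fun k : ℕ => ‖∫ t in simplex k, (List.ofFn fun i => a (t i)).prod‖) ∧
    ∀ U, IsSol a U →
      ∑' k : ℕ, (-1 : ℝ) ^ k • ∫ t in simplex k, (List.ofFn fun i => a (t i)).prod = U 1 := by
  obtain ⟨a', hm, ⟨C, hC⟩, he⟩ := ha.exists_stronglyMeasurable
  have hC0 : 0 ≤ C := (norm_nonneg _).trans (hC 0)
  have hae : ∀ k, (fun t : Fin k → ℝ => (List.ofFn fun i => a' (t i)).prod)
      =ᵐ[volume.restrict (simplex k)] fun t => (List.ofFn fun i => a (t i)).prod := by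
    intro k
    rw [EventuallyEq, ae_restrict_iff' (measurableSet_simplex k)]
    filter_upwards [ae_pi_of_eventually_offFin he k] with t ht hts
    simp only [ht hts]
  have hint : ∀ k, ∫ t in simplex k, (List.ofFn fun i => a (t i)).prod
      = picard a' (fun _ => 1) k 1 := by
    intro k
    rw [← integral_congr_ae (hae k), simplex_eq_simplexTo, ← iterInt_const]
    exact setIntegral_simplexTo (fun _ => hm) hC0 (fun _ => hC) zero_le_one
  refine ⟨fun k => ?_, ?_, fun U hU => ?_⟩
  · refine Integrable.congr ?_ (hae k)
    exact integrableOn_ofFn_prod (f := fun i (t : Fin k → ℝ) => a' (t i))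
      (fun i => hm.comp_measurable (measurable_pi_apply i)) hC0 (fun i t => hC _)
      (volume_simplexTo_lt_top k 1)
  · simp only [hint]
    exact Summable.of_nonneg_of_le (fun _ => norm_nonneg _)
      (fun k => norm_picard_le' hC (M := ‖(1 : R)‖) (fun _ _ => le_rfl) k (by simp))
      (summable_bound _ C)
  · simp only [hint]
    exact (hU.unique ha (isSol_picardSum ha hm hC he) 1 (by simp)).symm

theorem norm_primitive_mul_picard_le {a b : ℝ → R} {C : ℝ} (hCa : ∀ t, ‖a t‖ ≤ C)
    (hCb : ∀ t, ‖b t‖ ≤ C) (n : ℕ) {T : ℝ} (hT : T ∈ Icc (0 : ℝ) 1) :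
    ‖∫ t in (0 : ℝ)..T, b t * picard a (fun _ => 1) n t‖ ≤
      C * ‖(1 : R)‖ * (C ^ n / n.factorial) := by
  have hC0 : 0 ≤ C := (norm_nonneg _).trans (hCa 0)
  have : ‖∫ t in (0 : ℝ)..T, b t * picard a (fun _ => 1) n t‖ ≤
      C * (‖(1 : R)‖ * (C ^ n / n.factorial)) * |T - 0| := by
    refine intervalIntegral.norm_integral_le_of_norm_le_const fun t ht => ?_
    rw [uIoc_of_le hT.1] at ht
    exact (norm_mul_le _ _).trans (mul_le_mul (hCb t) (norm_picard_le' hCa (fun _ _ => le_rfl) n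
      ⟨ht.1.le, ht.2.trans hT.2⟩) (norm_nonneg _) hC0)
  refine this.trans ?_
  rw [sub_zero, abs_of_nonneg hT.1, ← mul_assoc]
  exact mul_le_of_le_one_right (by positivity) hT.2

theorem norm_picard_insert_le {a b : ℝ → R} {C : ℝ} (hCa : ∀ t, ‖a t‖ ≤ C)
    (hCb : ∀ t, ‖b t‖ ≤ C) (m n : ℕ) :
    ‖picard a (fun T => ∫ t in (0 : ℝ)..T, b t * picard a (fun _ => 1) n t) m 1‖ ≤
      C * ‖(1 : R)‖ * (C ^ n / n.factorial) * (C ^ m / m.factorial) :=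
  norm_picard_le' hCa (fun _ hT => norm_primitive_mul_picard_le hCa hCb n hT) m (by simp)

theorem summable_insert_bound {C : ℝ} (hC0 : 0 ≤ C) (M : ℝ) (hM : 0 ≤ M) :
    Summable fun p : ℕ × ℕ =>
      C * M * (C ^ p.2 / p.2.factorial) * (C ^ p.1 / p.1.factorial) := by
  have := Summable.mul_of_nonneg (Real.summable_pow_div_factorial C) (summable_bound (C * M) C)
    (fun _ => by positivity) (fun _ => by positivity)
  refine this.congr fun p => ?_
  rw [mul_comm]

/-- The two-parameter Dyson series with one insertion of `b`, for a fixed slice. -/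
theorem hasSum_insert {a b a' b' U : ℝ → R} (ha : PCont a) (hb : PCont b) (hU : IsSol a U)
    (hma : StronglyMeasurable a') (hmb : StronglyMeasurable b') {C : ℝ} (hCa : ∀ t, ‖a' t‖ ≤ C)
    (hCb : ∀ t, ‖b' t‖ ≤ C) (hea : ∀ᶠ t in offFin, a' t = a t)
    (heb : ∀ᶠ t in offFin, b' t = b t) :
    HasSum (fun p : ℕ × ℕ => (-1 : ℝ) ^ (p.1 + p.2 + 1) •
        picard a' (fun T => ∫ t in (0 : ℝ)..T, b' t * picard a' (fun _ => 1) p.2 t) p.1 1)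
      (-(U 1 * ∫ t in (0 : ℝ)..1, Ring.inverse (U t) * (b t * U t))) := by
  have hC0 : 0 ≤ C := (norm_nonneg _).trans (hCa 0)
  have h01 : (0 : ℝ) ∈ Icc (0 : ℝ) 1 := by simp
  have h11 : (1 : ℝ) ∈ Icc (0 : ℝ) 1 := by simp
  set J : ℕ → ℝ → R := picard a' (fun _ => 1) with hJ
  have hJc : ∀ n, Continuous (J n) := continuous_picard hma hCa continuous_const
  have hJb : ∀ n, ∀ t ∈ Icc (0 : ℝ) 1, ‖J n t‖ ≤ ‖(1 : R)‖ * (C ^ n / n.factorial) := fun n t ht =>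
    norm_picard_le' hCa (fun _ _ => le_rfl) n ht
  set w : ℕ → ℝ → R := fun n T => ∫ t in (0 : ℝ)..T, b' t * J n t with hw
  have hwc : ∀ n, Continuous (w n) := fun n =>
    intervalIntegral.continuous_primitive (mul_intervalIntegrable hmb hCb (hJc n)) 0
  have hwb : ∀ n, ∀ T ∈ Icc (0 : ℝ) 1, ‖w n T‖ ≤ C * ‖(1 : R)‖ * (C ^ n / n.factorial) :=
    fun n T hT => norm_primitive_mul_picard_le hCa hCb n hT
  -- For fixed `n`, the alternating sum over `m` solves `S' = b J_n - a S` with `S(0) = 0`, so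
  -- variation of constants evaluates it.
  have hS : ∀ n, picardSum a' (w n) 1 =
      U 1 * ∫ t in (0 : ℝ)..1, Ring.inverse (U t) * (b t * J n t) := by
    intro n
    have hSc := continuousOn_picardSum hma hCa (hwc n)
    have hbJ : PCont fun t => b t * J n t := hb.mul_cont (hJc n).continuousOn
    refine eq_variation_of_constants (S := picardSum a' (w n)) ha hU hbJ ?_ hSc ?_ 1 h11
    · rw [picardSum_eq hma hCa (hwc n) h01]; simp [hw]
    · have hS' : ∀ T ∈ Icc (0 : ℝ) 1, picardSum a' (w n) T =
          (∫ t in (0 : ℝ)..T, b t * J n t) - ∫ t in (0 : ℝ)..T, a t * picardSum a' (w n) t := by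
        intro T hT
        rw [picardSum_eq hma hCa (hwc n) hT]
        congr 1
        · refine intervalIntegral_congr_offFin ?_ h01 hT
          filter_upwards [heb] with t ht
          rw [ht]
        · refine intervalIntegral_congr_offFin ?_ h01 hT
          filter_upwards [hea] with t ht
          rw [ht]
      filter_upwards [hbJ.hasDerivAt_primitive h01,
        (ha.mul_cont hSc).hasDerivAt_primitive h01, eventually_offFin_mem] with t h1 h2 htI
      refine (h1.sub h2).congr_of_eventuallyEq ?_
      filter_upwards [Icc_mem_nhds htI.1 htI.2] with T hT using hS' T hT
  have hsum : Summable fun p : ℕ × ℕ => (-1 : ℝ) ^ (p.1 + p.2 + 1) • picard a' (w p.2) p.1 1 := by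
    refine Summable.of_norm_bounded (summable_insert_bound hC0 _ (norm_nonneg (1 : R))) fun p => ?_
    rw [norm_neg_one_pow_smul]
    exact norm_picard_insert_le hCa hCb _ _
  have hfib : ∀ n, HasSum (fun m : ℕ => (-1 : ℝ) ^ (m + n + 1) • picard a' (w n) m 1)
      ((-1 : ℝ) ^ (n + 1) • picardSum a' (w n) 1) := by
    intro n
    have := (hasSum_picardSum hCa (hwb n) h11).const_smul ((-1 : ℝ) ^ (n + 1))
    refine this.congr_fun fun m => ?_
    rw [smul_smul, ← pow_add]
    congr 2; omega
  -- The remaining sum over `n` is taken under the integral, where the alternating sum of the `J_n`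
  -- is `U` itself.
  have hn : HasSum (fun n : ℕ => (-1 : ℝ) ^ (n + 1) • picardSum a' (w n) 1)
      (-(U 1 * ∫ t in (0 : ℝ)..1, Ring.inverse (U t) * (b t * U t))) := by
    have hi := hU.cont_inverse ha
    obtain ⟨D, hD⟩ := isCompact_Icc.exists_bound_of_continuousOn hi
    obtain ⟨B, hB⟩ := hb.bdd
    have hUJ : ∀ t ∈ Icc (0 : ℝ) 1, HasSum (fun n : ℕ => (-1 : ℝ) ^ n • J n t) (U t) := by
      intro t ht
      rw [hU.unique ha (isSol_picardSum ha hma hCa hea) t ht]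
      exact hasSum_picardSum hCa (M := ‖(1 : R)‖) (fun _ _ => le_rfl) ht
    have hmain : HasSum (fun n : ℕ => ∫ t in (0 : ℝ)..1,
        Ring.inverse (U t) * (b t * ((-1 : ℝ) ^ n • J n t)))
        (∫ t in (0 : ℝ)..1, Ring.inverse (U t) * (b t * U t)) := by
      refine intervalIntegral.hasSum_integral_of_dominated_convergence
        (fun n _ => D * (B * (‖(1 : R)‖ * (C ^ n / n.factorial)))) (fun n => ?_) (fun n => ?_)
        ?_ ?_ ?_
      · have : PCont fun t => Ring.inverse (U t) * (b t * ((-1 : ℝ) ^ n • J n t)) :=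
          PCont.cont_mul hi (hb.mul_cont ((hJc n).const_smul _).continuousOn)
        exact (this.intervalIntegrable h01 h11).aestronglyMeasurable_restrict_uIoc
      · filter_upwards [ae_uIoc_of_eventually_offFin hB h01 h11] with t ht htI
        have htI' : t ∈ Icc (0 : ℝ) 1 := by
          rw [uIoc_of_le zero_le_one] at htI
          exact ⟨htI.1.le, htI.2⟩
        have hD' := hD t htI'
        have hB' := ht htI
        refine (norm_mul_le _ _).trans (mul_le_mul hD' ((norm_mul_le _ _).trans
          (mul_le_mul hB' ?_ (norm_nonneg _) ((norm_nonneg _).trans hB'))) (norm_nonneg _)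
          ((norm_nonneg _).trans hD'))
        rw [norm_neg_one_pow_smul]
        exact hJb n t htI'
      · exact Eventually.of_forall fun t _ => ((summable_bound _ C).mul_left B).mul_left D
      · exact intervalIntegrable_const
      · refine Eventually.of_forall fun t htI => ?_
        have htI' : t ∈ Icc (0 : ℝ) 1 := by
          rw [uIoc_of_le zero_le_one] at htI
          exact ⟨htI.1.le, htI.2⟩
        exact ((hUJ t htI').mul_left _).mul_left _
    refine (hmain.mul_left (U 1)).neg.congr_fun fun n => ?_
    rw [hS]
    simp only [mul_smul_comm, intervalIntegral.integral_smul]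
    rw [pow_succ, mul_neg_one, neg_smul]
  have h1 := ((Equiv.prodComm ℕ ℕ).hasSum_iff.2 hsum.hasSum).prod_fiberwise hfib
  rw [← h1.unique hn]
  exact hsum.hasSum

/-- The Dyson series with one insertion of `b`, integrated over a parameter `s ∈ [0, 1]`. -/
theorem dyson_surface {a b : ℝ → ℝ → R} {G : Set (ℝ × ℝ)} (hG : IsOpen G)
    (hs : ∀ᶠ s in offFin, ∀ᶠ t in offFin, (t, s) ∈ G)
    (ha : ContinuousOn (fun p : ℝ × ℝ => a p.1 p.2) G)
    (hb : ContinuousOn (fun p : ℝ × ℝ => b p.1 p.2) G) {C : ℝ}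
    (hCa : ∀ p ∈ G, ‖a p.1 p.2‖ ≤ C) (hCb : ∀ p ∈ G, ‖b p.1 p.2‖ ≤ C) :
    (∀ m n, IntegrableOn (fun p : (Fin (m + n + 1) → ℝ) × ℝ =>
      (List.ofFn fun i : Fin (m + n + 1) =>
        if (i : ℕ) = m then b (p.1 i) p.2 else a (p.1 i) p.2).prod)
      (simplex (m + n + 1) ×ˢ Icc (0 : ℝ) 1)) ∧
    (Summable fun q : ℕ × ℕ => ‖∫ p in simplex (q.1 + q.2 + 1) ×ˢ Icc (0 : ℝ) 1,
      (List.ofFn fun i : Fin (q.1 + q.2 + 1) =>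
        if (i : ℕ) = q.1 then b (p.1 i) p.2 else a (p.1 i) p.2).prod‖) ∧
    ∀ U : ℝ → ℝ → R, (∀ᶠ s in offFin, IsSol (fun t => a t s) (U s)) →
      ∑' q : ℕ × ℕ, (-1 : ℝ) ^ (q.1 + q.2 + 1) •
        ∫ p in simplex (q.1 + q.2 + 1) ×ˢ Icc (0 : ℝ) 1,
          (List.ofFn fun i : Fin (q.1 + q.2 + 1) =>
            if (i : ℕ) = q.1 then b (p.1 i) p.2 else a (p.1 i) p.2).prod =
      ∫ s in (0 : ℝ)..1, -(U s 1 * ∫ t in (0 : ℝ)..1,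
        Ring.inverse (U s t) * (b t s * U s t)) := by
  have hC0 : 0 ≤ max C 0 := le_max_right _ _
  -- Extension by zero outside the open set `G` gives functions which are measurable and bounded
  -- everywhere, so that Fubini applies without further care.
  set a' : ℝ × ℝ → R := G.indicator fun p => a p.1 p.2 with ha'
  set b' : ℝ × ℝ → R := G.indicator fun p => b p.1 p.2 with hb'
  have hma : StronglyMeasurable a' :=
    stronglyMeasurable_indicator_of_continuousOn ha hG.measurableSet
  have hmb : StronglyMeasurable b' :=
    stronglyMeasurable_indicator_of_continuousOn hb hG.measurableSet
  have hind : ∀ (f : ℝ × ℝ → R), (∀ p ∈ G, ‖f p‖ ≤ C) → ∀ p, ‖G.indicator f p‖ ≤ max C 0 := by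
    intro f hf p
    by_cases hp : p ∈ G
    · rw [indicator_of_mem hp]; exact (hf p hp).trans (le_max_left _ _)
    · rw [indicator_of_notMem hp, norm_zero]; exact hC0
  have hCa' := hind _ hCa
  have hCb' := hind _ hCb
  set f' : (m n : ℕ) → Fin (m + n + 1) → ((Fin (m + n + 1) → ℝ) × ℝ) → R := fun m n i p =>
    if (i : ℕ) = m then b' (p.1 i, p.2) else a' (p.1 i, p.2) with hf'
  have hfm : ∀ m n i, StronglyMeasurable (f' m n i) := by
    intro m n i
    have hp : Measurable fun p : (Fin (m + n + 1) → ℝ) × ℝ => (p.1 i, p.2) :=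
      ((measurable_pi_apply i).comp measurable_fst).prodMk measurable_snd
    by_cases h : (i : ℕ) = m
    · simp only [hf', h, if_true]; exact hmb.comp_measurable hp
    · simp only [hf', h, if_false]; exact hma.comp_measurable hp
  have hfb : ∀ m n i p, ‖f' m n i p‖ ≤ max C 0 := by
    intro m n i p
    by_cases h : (i : ℕ) = m
    · simp only [hf', h, if_true]; exact hCb' _
    · simp only [hf', h, if_false]; exact hCa' _
  have hms : ∀ k, MeasurableSet (simplex k ×ˢ Icc (0 : ℝ) 1) := fun k =>
    (measurableSet_simplex k).prod measurableSet_Icc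
  have hGs : ∀ᶠ s in offFin, ∀ᶠ t in offFin, a' (t, s) = a t s ∧ b' (t, s) = b t s := by
    filter_upwards [hs] with s hs
    filter_upwards [hs] with t ht
    exact ⟨indicator_of_mem ht _, indicator_of_mem ht _⟩
  -- Points with some `(t_i, s)` outside `G` form a null set: for almost every `s` the bad `t` are
  -- finitely many, so each coordinate `t_i` avoids them almost surely.
  have hnull : ∀ k, ∀ᵐ p : (Fin k → ℝ) × ℝ, p ∈ simplex k ×ˢ Icc (0 : ℝ) 1 →
      ∀ i, (p.1 i, p.2) ∈ G := by
    intro k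
    have hmeas : MeasurableSet {p : (Fin k → ℝ) × ℝ | p ∈ simplex k ×ˢ Icc (0 : ℝ) 1 →
        ∀ i, (p.1 i, p.2) ∈ G} := by
      have : {p : (Fin k → ℝ) × ℝ | p ∈ simplex k ×ˢ Icc (0 : ℝ) 1 → ∀ i, (p.1 i, p.2) ∈ G} =
          (simplex k ×ˢ Icc (0 : ℝ) 1)ᶜ ∪ ⋂ i, (fun p => (p.1 i, p.2)) ⁻¹' G := by
        ext p
        simp only [mem_ofPred_eq, mem_union, mem_compl_iff, mem_iInter, mem_preimage]
        tauto
      rw [this]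
      refine (hms k).compl.union (MeasurableSet.iInter fun i => ?_)
      exact (((measurable_pi_apply i).comp measurable_fst).prodMk measurable_snd) hG.measurableSet
    have hsw : ∀ᵐ q : ℝ × (Fin k → ℝ), q.swap ∈ simplex k ×ˢ Icc (0 : ℝ) 1 →
        ∀ i, (q.2 i, q.1) ∈ G := by
      refine (Measure.ae_prod_iff_ae_ae (measurable_swap hmeas)).2 ?_
      filter_upwards [ae_of_eventually_offFin hs] with s hs
      by_cases hsI : s ∈ Icc (0 : ℝ) 1
      · filter_upwards [ae_pi_of_eventually_offFin (hs hsI) k] with t ht hts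
        exact ht hts.1
      · exact Eventually.of_forall fun t ht => absurd ht.2 hsI
    exact (Measure.measurePreserving_swap (μ := (volume : Measure (Fin k → ℝ)))
      (ν := (volume : Measure ℝ))).quasiMeasurePreserving.ae hsw
  have hae : ∀ m n, (fun p => (List.ofFn fun i => f' m n i p).prod)
      =ᵐ[volume.restrict (simplex (m + n + 1) ×ˢ Icc (0 : ℝ) 1)] fun p =>
        (List.ofFn fun i : Fin (m + n + 1) =>
          if (i : ℕ) = m then b (p.1 i) p.2 else a (p.1 i) p.2).prod := by
    intro m n
    rw [EventuallyEq, ae_restrict_iff' (hms _)]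
    filter_upwards [hnull (m + n + 1)] with p hp hpS
    have := hp hpS
    congr 2
    funext i
    simp only [hf', ha', hb', indicator_of_mem (this i)]
  have hvol : ∀ k, volume (simplex k ×ˢ Icc (0 : ℝ) 1) < ⊤ := by
    intro k
    rw [Measure.volume_eq_prod, Measure.prod_prod]
    exact ENNReal.mul_lt_top (volume_simplexTo_lt_top k 1) (by simp)
  have hint' : ∀ m n, IntegrableOn (fun p => (List.ofFn fun i => f' m n i p).prod)
      (simplex (m + n + 1) ×ˢ Icc (0 : ℝ) 1) := fun m n =>
    integrableOn_ofFn_prod (hfm m n) hC0 (hfb m n) (hvol _)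
  set Kmn : ℕ → ℕ → ℝ → R := fun m n s => picard (fun t => a' (t, s))
    (fun T => ∫ t in (0 : ℝ)..T, b' (t, s) * picard (fun t => a' (t, s)) (fun _ => 1) n t) m 1
    with hK
  have hsec : ∀ {f : ℝ × ℝ → R}, StronglyMeasurable f → ∀ s, StronglyMeasurable fun t => f (t, s) :=
    fun hf s => hf.comp_measurable (measurable_id.prodMk measurable_const)
  have hslice : ∀ m n s, ∫ t in simplex (m + n + 1), (List.ofFn fun i => f' m n i (t, s)).prod =
      Kmn m n s := by
    intro m n s
    have h1 := setIntegral_simplexTo (k := m + n + 1) (T := 1)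
      (f := fun i => if (i : ℕ) = m then fun t => b' (t, s) else fun t => a' (t, s))
      (fun i => by
        by_cases h : (i : ℕ) = m
        · simp only [h, if_true]; exact hsec hmb s
        · simp only [h, if_false]; exact hsec hma s) hC0
      (fun i x => by
        by_cases h : (i : ℕ) = m
        · simp only [h, if_true]; exact hCb' _
        · simp only [h, if_false]; exact hCa' _) zero_le_one
    rw [iterInt_insert _ _ n m _ rfl] at h1
    rw [simplex_eq_simplexTo, hK]
    simp only
    rw [← h1]
    congr 1
    funext t
    congr 2
    funext i
    simp only [hf']
    split_ifs <;> rfl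
  have hK1 : ∀ m n, ∫ p in simplex (m + n + 1) ×ˢ Icc (0 : ℝ) 1,
      (List.ofFn fun i : Fin (m + n + 1) =>
        if (i : ℕ) = m then b (p.1 i) p.2 else a (p.1 i) p.2).prod =
      ∫ s in (0 : ℝ)..1, Kmn m n s := by
    intro m n
    rw [← integral_congr_ae (hae m n), Measure.volume_eq_prod, ← setIntegral_prod_swap,
      setIntegral_prod]
    · rw [intervalIntegral.integral_of_le zero_le_one, ← integral_Icc_eq_integral_Ioc]
      congr 1
      funext s
      exact hslice m n s
    · exact (hint' m n).swap
  have hKsm : ∀ m n, AEStronglyMeasurable (Kmn m n) (volume.restrict (uIoc (0 : ℝ) 1)) := by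
    intro m n
    have : Kmn m n = fun s =>
        ∫ t in simplex (m + n + 1), (List.ofFn fun i => f' m n i (t, s)).prod := by
      funext s; exact (hslice m n s).symm
    rw [this]
    have h2 := (stronglyMeasurable_ofFn_prod (hfm m n)).comp_measurable
      (measurable_swap (α := ℝ) (β := Fin (m + n + 1) → ℝ))
    exact (h2.integral_prod_right' (ν := volume.restrict (simplex (m + n + 1)))
      ).aestronglyMeasurable
  have hPC : ∀ {f : ℝ → ℝ → R}, ContinuousOn (fun p : ℝ × ℝ => f p.1 p.2) G →
      (∀ p ∈ G, ‖f p.1 p.2‖ ≤ C) → ∀ᶠ s in offFin, PCont fun t => f t s := by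
    intro f hf hC
    filter_upwards [hs] with s hs
    refine ⟨?_, C, ?_⟩
    · filter_upwards [hs] with t ht
      have h1 := hf.continuousAt (hG.mem_nhds ht)
      exact h1.comp (f := fun t => (t, s)) (by fun_prop)
    · filter_upwards [hs] with t ht using hC _ ht
  have hKb : ∀ m n, ∀ s, ‖Kmn m n s‖ ≤
      max C 0 * ‖(1 : R)‖ * (max C 0 ^ n / n.factorial) * (max C 0 ^ m / m.factorial) :=
    fun m n s => norm_picard_insert_le (fun _ => hCa' _) (fun _ => hCb' _) m n
  refine ⟨fun m n => (hint' m n).congr (hae m n), ?_, fun U hU => ?_⟩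
  · simp only [hK1]
    refine Summable.of_nonneg_of_le (fun _ => norm_nonneg _) (fun q => ?_)
      (summable_insert_bound hC0 _ (norm_nonneg (1 : R)))
    refine (intervalIntegral.norm_integral_le_of_norm_le_const fun s _ => hKb q.1 q.2 s).trans ?_
    simp
  · simp only [hK1]
    have := intervalIntegral.hasSum_integral_of_dominated_convergence
      (F := fun (q : ℕ × ℕ) s => (-1 : ℝ) ^ (q.1 + q.2 + 1) • Kmn q.1 q.2 s)
      (f := fun s => -(U s 1 * ∫ t in (0 : ℝ)..1, Ring.inverse (U s t) * (b t s * U s t)))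
      (μ := volume) (a := 0) (b := 1)
      (fun q _ => max C 0 * ‖(1 : R)‖ * (max C 0 ^ q.2 / q.2.factorial) *
        (max C 0 ^ q.1 / q.1.factorial)) (fun q => (hKsm q.1 q.2).const_smul _)
      (fun q => Eventually.of_forall fun s _ => by
        rw [norm_neg_one_pow_smul]; exact hKb _ _ _)
      (Eventually.of_forall fun s _ => summable_insert_bound hC0 _ (norm_nonneg (1 : R)))
      intervalIntegrable_const ?_
    · simp only [intervalIntegral.integral_smul] at this
      exact this.tsum_eq
    · refine ae_uIoc_of_eventually_offFin ?_ (by simp) (by simp)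
      filter_upwards [hPC ha hCa, hPC hb hCb, hU, hGs] with s h1 h2 h3 h4
      exact hasSum_insert h1 h2 h3 (hsec hma s) (hsec hmb s) (fun _ => hCa' _) (fun _ => hCb' _)
        (h4.mono fun _ h => h.1) (h4.mono fun _ h => h.2)

end Dyson

end HigherHol

namespace HigherHol

open Filter

/-! ### Slices of planar compact convex sets -/

/-- The segment from `(m, s)` to `(M, s)` spans a triangle with `p` below it and another with `q`
above it; their union is a neighbourhood of `(t, s)`. -/
theorem mem_interior_of_convex {P : Set (ℝ × ℝ)} (hv : Convex ℝ P) {m M t s : ℝ} {p q : ℝ × ℝ}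
    (hm : (m, s) ∈ P) (hM : (M, s) ∈ P) (hp : p ∈ P) (hq : q ∈ P) (hps : p.2 < s) (hqs : s < q.2)
    (hmt : m < t) (htM : t < M) : (t, s) ∈ interior P := by
  -- Project `x` from the vertex `r` to the line at height `s`. The image `(u, s)` is near `(t, s)`,
  -- hence on the segment, and `x` is a convex combination of `r` and `(u, s)` when it lies on the
  -- same side as `r`.
  have key : ∀ r ∈ P, r.2 ≠ s → ∀ᶠ x in 𝓝 (t, s), 0 ≤ (x.2 - s) / (r.2 - s) → x ∈ P := by
    intro r hr hrs
    have hrs' : r.2 - s ≠ 0 := sub_ne_zero.2 hrs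
    have h1 : ContinuousAt (fun x : ℝ × ℝ => (x.2 - s) / (r.2 - s)) (t, s) := by fun_prop
    have h2 : ContinuousAt (fun x : ℝ × ℝ => (x.1 - (x.2 - s) / (r.2 - s) * r.1) /
        (1 - (x.2 - s) / (r.2 - s))) (t, s) := by
      refine ContinuousAt.div (by fun_prop) (by fun_prop) ?_
      simp
    have e1 := h1.eventually_lt_const (show (((t, s) : ℝ × ℝ).2 - s) / (r.2 - s) < 1 by simp)
    have e2 := h2.eventually_const_lt (u := m) (by simpa using hmt)
    have e3 := h2.eventually_lt_const (u := M) (by simpa using htM)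
    filter_upwards [e1, e2, e3] with x h1 h2 h3 h0
    set lam := (x.2 - s) / (r.2 - s) with hlam
    set u := (x.1 - lam * r.1) / (1 - lam) with hu
    have hlam1 : (1 - lam) ≠ 0 := by linarith
    have huP : (u, s) ∈ P := by
      have hMm : 0 < M - m := by linarith
      have := hv hm hM (a := (M - u) / (M - m)) (b := (u - m) / (M - m))
        (div_nonneg (by linarith) hMm.le) (div_nonneg (by linarith) hMm.le)
        (by field_simp; ring)
      convert! this using 1
      ext
      · simp only [Prod.fst_add, Prod.smul_fst, smul_eq_mul]; field_simp; ring
      · simp only [Prod.snd_add, Prod.smul_snd, smul_eq_mul]; field_simp; ring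
    have := hv hr huP h0 (by linarith : 0 ≤ 1 - lam) (by ring)
    convert! this using 1
    ext
    · simp only [Prod.fst_add, Prod.smul_fst, smul_eq_mul, hu]; field_simp; ring
    · simp only [Prod.snd_add, Prod.smul_snd, smul_eq_mul, hlam]; field_simp; ring
  rw [mem_interior_iff_mem_nhds]
  filter_upwards [key p hp hps.ne, key q hq hqs.ne'] with x h1 h2
  rcases le_total x.2 s with h | h
  · exact h1 (div_nonneg_of_nonpos (by linarith) (by linarith))
  · exact h2 (div_nonneg (by linarith) (by linarith))

/-- The exceptional heights are the minimal and the maximal one on `P`. At any other height, only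
the two ends of the slice can fail to be interior points. -/
theorem exists_finset_slice {P : Set (ℝ × ℝ)} (hc : IsCompact P) (hv : Convex ℝ P) :
    ∃ F : Finset ℝ, ∀ s ∉ F, {t | (t, s) ∈ P ∧ (t, s) ∉ interior P}.Finite := by
  rcases P.eq_empty_or_nonempty with rfl | hne
  · exact ⟨∅, fun s _ => by simp⟩
  obtain ⟨p, hp, hpm⟩ := hc.exists_isMinOn hne continuous_snd.continuousOn
  obtain ⟨q, hq, hqm⟩ := hc.exists_isMaxOn hne continuous_snd.continuousOn
  refine ⟨{p.2, q.2}, fun s hs => ?_⟩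
  simp only [Finset.mem_insert, Finset.mem_singleton, not_or] at hs
  have hcl : IsCompact {t | (t, s) ∈ P} := by
    have h1 : IsCompact (Prod.fst '' (P ∩ {x | x.2 = s})) :=
      (hc.inter_right (isClosed_eq continuous_snd continuous_const)).image continuous_fst
    convert! h1 using 1
    ext t
    simp only [mem_ofPred_eq, mem_image, mem_inter_iff]
    exact ⟨fun h => ⟨(t, s), ⟨h, rfl⟩, rfl⟩, by rintro ⟨⟨a, b⟩, ⟨h2, rfl⟩, rfl⟩; exact h2⟩
  rcases {t | (t, s) ∈ P}.eq_empty_or_nonempty with he | hne'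
  · refine (finite_empty (α := ℝ)).subset fun t ht => ?_
    rw [← he]; exact ht.1
  obtain ⟨m, hm, hmm⟩ := hcl.exists_isMinOn hne' continuousOn_id
  obtain ⟨M, hM, hMM⟩ := hcl.exists_isMaxOn hne' continuousOn_id
  refine (toFinite {m, M}).subset fun t ht => ?_
  by_contra hcon
  simp only [mem_insert_iff, mem_singleton_iff, not_or] at hcon
  refine ht.2 (mem_interior_of_convex hv hm hM hp hq ?_ ?_ ?_ ?_)
  · exact lt_of_le_of_ne (hpm hm) fun h => hs.1 h.symm
  · exact lt_of_le_of_ne (hqm hm) fun h => hs.2 h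
  · exact lt_of_le_of_ne (hmm ht.1) fun h => hcon.1 h.symm
  · exact lt_of_le_of_ne (hMM ht.1) hcon.2

theorem finite_sdiff_interior {P : Set ℝ} (hc : IsCompact P) (hv : Convex ℝ P) :
    (P \ interior P).Finite := by
  rcases P.eq_empty_or_nonempty with rfl | hne
  · simp
  have : P = Icc (sInf P) (sSup P) :=
    eq_Icc_of_connected_compact ⟨hne, hv.isPreconnected⟩ hc
  rw [this, interior_Icc]
  refine (toFinite {sInf P, sSup P}).subset fun t ht => ?_
  by_contra hcon
  simp only [mem_insert_iff, mem_singleton_iff, not_or] at hcon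
  exact ht.2 ⟨lt_of_le_of_ne ht.1.1 (Ne.symm hcon.1), lt_of_le_of_ne ht.1.2 hcon.2⟩

theorem eventually_mem_interior_of_cover {S : Set (Set ℝ)} (hS : S.Finite)
    (hU : Icc 0 1 ⊆ ⋃₀ S) (hP : ∀ P ∈ S, IsCompact P ∧ Convex ℝ P) :
    ∀ᶠ t in offFin, ∃ P ∈ S, t ∈ interior P := by
  have hfin : (⋃ P ∈ S, P \ interior P).Finite :=
    hS.biUnion fun P h => finite_sdiff_interior (hP P h).1 (hP P h).2
  filter_upwards [eventually_offFin_of_finite hfin, eventually_offFin_mem] with t ht htI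
  obtain ⟨P, hPS, htP⟩ := hU (Ioo_subset_Icc_self htI)
  refine ⟨P, hPS, ?_⟩
  by_contra hcon
  exact ht (mem_biUnion hPS ⟨htP, hcon⟩)

theorem eventually_slice_mem_interior {S : Set (Set (ℝ × ℝ))} (hS : S.Finite)
    (hU : Icc 0 1 ×ˢ Icc 0 1 ⊆ ⋃₀ S) (hP : ∀ P ∈ S, IsCompact P ∧ Convex ℝ P) :
    ∀ᶠ s in offFin, ∀ᶠ t in offFin, ∃ P ∈ S, (t, s) ∈ interior P := by
  choose! F hF using fun P h => exists_finset_slice (hP P h).1 (hP P h).2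
  have hfin : (⋃ P ∈ S, (F P : Set ℝ)).Finite := hS.biUnion fun P _ => (F P).finite_toSet
  filter_upwards [eventually_offFin_of_finite hfin, eventually_offFin_mem] with s hs hsI
  have hfin' : (⋃ P ∈ S, {t | (t, s) ∈ P ∧ (t, s) ∉ interior P}).Finite := by
    refine hS.biUnion fun P h => hF P h s fun hmem => hs ?_
    exact mem_biUnion h hmem
  filter_upwards [eventually_offFin_of_finite hfin', eventually_offFin_mem] with t ht htI
  obtain ⟨P, hPS, htP⟩ := hU (⟨Ioo_subset_Icc_self htI, Ioo_subset_Icc_self hsI⟩ :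
    (t, s) ∈ Icc (0 : ℝ) 1 ×ˢ Icc (0 : ℝ) 1)
  refine ⟨P, hPS, ?_⟩
  by_contra hcon
  exact ht (mem_biUnion hPS ⟨htP, hcon⟩)

theorem eventually_slice_mem_interior' {S : Set (Set (ℝ × ℝ))} (hS : S.Finite)
    (hU : Icc 0 1 ×ˢ Icc 0 1 ⊆ ⋃₀ S) (hP : ∀ P ∈ S, IsCompact P ∧ Convex ℝ P) :
    ∀ᶠ t in offFin, ∀ᶠ s in offFin, ∃ P ∈ S, (t, s) ∈ interior P := by
  have h := eventually_slice_mem_interior (S := (fun P => Prod.swap ⁻¹' P) '' S) (hS.image _) ?_ ?_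
  · filter_upwards [h] with t ht
    filter_upwards [ht] with s hs
    obtain ⟨_, ⟨P, hPS, rfl⟩, hs⟩ := hs
    refine ⟨P, hPS, ?_⟩
    have := (Homeomorph.prodComm ℝ ℝ).preimage_interior P
    change Prod.swap ⁻¹' interior P = interior (Prod.swap ⁻¹' P) at this
    rw [← this] at hs
    exact hs
  · intro p hp
    obtain ⟨P, hPS, hpP⟩ := hU (⟨hp.2, hp.1⟩ : p.swap ∈ Icc (0 : ℝ) 1 ×ˢ Icc (0 : ℝ) 1)
    exact ⟨_, ⟨P, hPS, rfl⟩, hpP⟩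
  · rintro _ ⟨P, hPS, rfl⟩
    refine ⟨(Homeomorph.prodComm ℝ ℝ).isCompact_preimage.2 (hP P hPS).1, ?_⟩
    exact (hP P hPS).2.linear_preimage (LinearEquiv.prodComm ℝ ℝ ℝ).toLinearMap

/-! ### Piecewise smooth maps: affine reparametrization and continuity. -/

section PiecewiseSmooth

variable {E : Type*} [NormedAddCommGroup E] [NormedSpace ℝ E]
  {M : Type*} [TopologicalSpace M] [ChartedSpace E M]
  {X X' : Type*} [NormedAddCommGroup X] [NormedSpace ℝ X] [NormedAddCommGroup X'] [NormedSpace ℝ X']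

theorem PiecewiseSmoothOn.comp_affine {f : X → M} {K : Set X} (hf : PiecewiseSmoothOn E f K)
    {i : X' → X} (hi : ContDiff ℝ ∞ i)
    (hia : ∀ x y (a b : ℝ), a + b = 1 → i (a • x + b • y) = a • i x + b • i y) {K' : Set X'}
    (hc : IsCompact K') (hv : Convex ℝ K') (hm : MapsTo i K' K) :
    PiecewiseSmoothOn E (fun x => f (i x)) K' := by
  obtain ⟨S, hS, hU, hP⟩ := hf
  refine ⟨(fun P => K' ∩ i ⁻¹' P) '' S, hS.image _, ?_, ?_⟩
  · ext x
    simp only [mem_sUnion, mem_image, exists_exists_and_eq_and]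
    constructor
    · rintro ⟨P, _, hx, _⟩; exact hx
    · intro hx
      have := hm hx
      rw [← hU] at this
      obtain ⟨P, hPS, hxP⟩ := this
      exact ⟨P, hPS, hx, hxP⟩
  · rintro _ ⟨P, hPS, rfl⟩
    obtain ⟨h1, h2, h3⟩ := hP P hPS
    refine ⟨hc.inter_right (h1.isClosed.preimage hi.continuous), hv.inter ?_, ?_⟩
    · intro x hx y hy a b ha hb hab
      rw [mem_preimage, hia x y a b hab]
      exact h2 hx hy ha hb hab
    · exact h3.comp hi.contMDiff.contMDiffOn fun x hx => hx.2

theorem PiecewiseSmoothOn.continuousOn {f : X → M} {K : Set X} (hf : PiecewiseSmoothOn E f K) :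
    ContinuousOn f K := by
  obtain ⟨S, hS, hU, hP⟩ := hf
  rw [← hU, sUnion_eq_iUnion]
  have : Finite S := hS
  exact (locallyFinite_of_finite _).continuousOn_iUnion (fun P => (hP P P.2).1.isClosed)
    fun P => (hP P P.2).2.2.continuousOn

end PiecewiseSmooth

/-! ### Forms evaluated on a differential, computed in a chart. -/

section Charts

variable {E : Type*} [NormedAddCommGroup E] [NormedSpace ℝ E]
  {M : Type*} [TopologicalSpace M] [ChartedSpace E M]
  {W : Type*} [NormedAddCommGroup W] [NormedSpace ℝ W]
  {X : Type*} [NormedAddCommGroup X] [NormedSpace ℝ X]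

theorem DiffForm.toFun_congr {k : ℕ} (η : DiffForm E M W k) {x y : M} (h : x = y)
    (v : Fin k → E) : η.toFun x v = η.toFun y v := by
  subst h; rfl

variable [IsManifold 𝓘(ℝ, E) ∞ M]

/-- Evaluation of a form on the image of a differential, in a chart. -/
theorem DiffForm.apply_mfderiv {k : ℕ} (η : DiffForm E M W k) {f : X → M} {p : X} (x₀ : M)
    (hf : MDifferentiableAt 𝓘(ℝ, X) 𝓘(ℝ, E) f p) (hp : f p ∈ (extChartAt 𝓘(ℝ, E) x₀).source)
    (v : Fin k → X) :
    η.toFun (f p) (fun i => mfderiv 𝓘(ℝ, X) 𝓘(ℝ, E) f p (v i)) =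
      inChart η.toFun x₀ (extChartAt 𝓘(ℝ, E) x₀ (f p))
        (fun i => fderiv ℝ (fun q => extChartAt 𝓘(ℝ, E) x₀ (f q)) p (v i)) := by
  have : IsManifold 𝓘(ℝ, E) 1 M := IsManifold.of_le (n := ∞) (by simp)
  set χ := extChartAt 𝓘(ℝ, E) x₀ with hχ
  have h1 : MDifferentiableAt 𝓘(ℝ, E) 𝓘(ℝ, E) χ (f p) :=
    mdifferentiableAt_extChartAt (by rwa [← extChartAt_source 𝓘(ℝ, E)])
  have h2 : MDifferentiableAt 𝓘(ℝ, X) 𝓘(ℝ, E) (fun q => χ (f q)) p := h1.comp p hf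
  have h3 : MDifferentiableAt 𝓘(ℝ, E) 𝓘(ℝ, E) χ.symm (χ (f p)) := by
    have := mdifferentiableWithinAt_extChartAt_symm (I := 𝓘(ℝ, E)) (x := x₀) (χ.map_source hp)
    simpa only [modelWithCornersSelf_coe, range_id, mdifferentiableWithinAt_univ] using this
  have h4 : mfderiv 𝓘(ℝ, X) 𝓘(ℝ, E) (fun q => χ.symm (χ (f q))) p =
      (mfderiv 𝓘(ℝ, E) 𝓘(ℝ, E) χ.symm (χ (f p))).comp
        (mfderiv 𝓘(ℝ, X) 𝓘(ℝ, E) (fun q => χ (f q)) p) := mfderiv_comp p h3 h2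
  have h5 : (fun q => χ.symm (χ (f q))) =ᶠ[𝓝 p] f := by
    have : ∀ᶠ q in 𝓝 p, f q ∈ χ.source :=
      hf.continuousAt.eventually ((isOpen_extChartAt_source x₀).mem_nhds hp)
    filter_upwards [this] with q hq using χ.left_inv hq
  rw [h5.mfderiv_eq, mfderiv_eq_fderiv (f := fun q => χ (f q))] at h4
  refine (η.toFun_congr (χ.left_inv hp) _).symm.trans ?_
  refine congrArg (η.toFun (χ.symm (χ (f p)))) (funext fun i => ?_)
  exact DFunLike.congr_fun h4 (v i)

end Charts

end HigherHol

namespace HigherHol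

open Filter

/-! ### Bounds and continuity of forms along smooth maps. -/

section FormsAlongMaps

variable {E : Type*} [NormedAddCommGroup E] [NormedSpace ℝ E]
  {M : Type*} [TopologicalSpace M] [ChartedSpace E M]
  {W : Type*} [NormedAddCommGroup W] [NormedSpace ℝ W]
  {X : Type*} [NormedAddCommGroup X] [NormedSpace ℝ X]

theorem contDiffWithinAt_chart {f : X → M} {P : Set X} {p : X}
    (hf : ContMDiffWithinAt 𝓘(ℝ, X) 𝓘(ℝ, E) ∞ f P p) :
    ContDiffWithinAt ℝ ∞ (fun q => extChartAt 𝓘(ℝ, E) (f p) (f q)) P p :=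
  contMDiffWithinAt_iff_contDiffWithinAt.1 (contMDiffWithinAt_iff_target.1 hf).2

theorem eventually_mem_chart_source {f : X → M} {P : Set X} {p : X} (hf : ContinuousWithinAt f P p) :
    ∀ᶠ q in 𝓝[P] p, f q ∈ (extChartAt 𝓘(ℝ, E) (f p)).source :=
  hf.eventually ((isOpen_extChartAt_source (f p)).mem_nhds (mem_extChartAt_source (f p)))

theorem DiffForm.continuousAt_inChart {k : ℕ} (η : DiffForm E M W k) {x₀ : M} {y : E}
    (hy : y ∈ (extChartAt 𝓘(ℝ, E) x₀).target) : ContinuousAt (inChart η.toFun x₀) y :=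
  (η.differentiableAt hy).continuousAt

/-- The value of a `k`-form on the images of `v₁, …, v_k` under the differential of `f`. -/
noncomputable def DiffForm.along {k : ℕ} (η : DiffForm E M W k) (f : X → M) (v : Fin k → X)
    (p : X) : W :=
  η.toFun (f p) (fun i => mfderiv 𝓘(ℝ, X) 𝓘(ℝ, E) f p (v i))

theorem vel_comp {Y : Type*} [NormedAddCommGroup Y] [NormedSpace ℝ Y] {f : Y → M} {c : ℝ → Y}
    {t : ℝ} {v : Y} (hf : MDifferentiableAt 𝓘(ℝ, Y) 𝓘(ℝ, E) f (c t)) (hc : HasDerivAt c v t) :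
    vel E (fun t => f (c t)) t = mfderiv 𝓘(ℝ, Y) 𝓘(ℝ, E) f (c t) v := by
  have h := mfderiv_comp t (g := f) (f := c) hf hc.differentiableAt.mdifferentiableAt
  have h1 : mfderiv 𝓘(ℝ, ℝ) 𝓘(ℝ, Y) c t (1 : ℝ) = v := by
    rw [mfderiv_eq_fderiv]
    change fderiv ℝ c t 1 = v
    rw [hc.hasFDerivAt.fderiv]
    simp
  change mfderiv 𝓘(ℝ, ℝ) 𝓘(ℝ, E) (f ∘ c) t (1 : ℝ) = _
  rw [h]
  exact congrArg (mfderiv 𝓘(ℝ, Y) 𝓘(ℝ, E) f (c t)) h1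

theorem DiffForm.alongPath_comp (η : DiffForm E M W 1) {Y : Type*} [NormedAddCommGroup Y]
    [NormedSpace ℝ Y] {f : Y → M} {c : ℝ → Y} {t : ℝ} {v : Y}
    (hf : MDifferentiableAt 𝓘(ℝ, Y) 𝓘(ℝ, E) f (c t)) (hc : HasDerivAt c v t) :
    η.alongPath (fun t => f (c t)) t = η.along f (fun _ => v) (c t) := by
  rw [DiffForm.alongPath, vel_comp hf hc]
  rfl

theorem DiffForm.alongPath_eq_along (η : DiffForm E M W 1) (c : ℝ → M) (t : ℝ) :
    η.alongPath c t = η.along c (fun _ => (1 : ℝ)) t := rfl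

theorem DiffForm.alongSurface_comp (η : DiffForm E M W 2) {Y : Type*} [NormedAddCommGroup Y]
    [NormedSpace ℝ Y] {f : Y → M} {c : ℝ × ℝ → Y} {t s : ℝ} {v w : Y}
    (hf : MDifferentiableAt 𝓘(ℝ, Y) 𝓘(ℝ, E) f (c (t, s)))
    (hv : HasDerivAt (fun t' => c (t', s)) v t) (hw : HasDerivAt (fun s' => c (t, s')) w s) :
    η.alongSurface (fun p => f (c p)) t s = η.along f ![v, w] (c (t, s)) := by
  rw [DiffForm.alongSurface, DiffForm.along]
  refine congrArg (η.toFun (f (c (t, s)))) (funext fun i => ?_)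
  fin_cases i
  · exact vel_comp (f := f) (c := fun t' => c (t', s)) hf hv
  · exact vel_comp (f := f) (c := fun s' => c (t, s')) hf hw

theorem vel_congr {c c' : ℝ → M} {t : ℝ} (h : c =ᶠ[𝓝 t] c') : (vel E c t : E) = vel E c' t := by
  have h1 : (mfderiv 𝓘(ℝ, ℝ) 𝓘(ℝ, E) c t : ℝ →L[ℝ] E) = mfderiv 𝓘(ℝ, ℝ) 𝓘(ℝ, E) c' t := h.mfderiv_eq
  exact DFunLike.congr_fun h1 1

theorem DiffForm.alongPath_congr (η : DiffForm E M W 1) {c c' : ℝ → M} {t : ℝ}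
    (h : c =ᶠ[𝓝 t] c') : η.alongPath c t = η.alongPath c' t := by
  rw [DiffForm.alongPath, DiffForm.alongPath]
  exact (η.toFun_congr h.eq_of_nhds _).trans
    (congrArg (η.toFun (c' t)) (funext fun _ => vel_congr h))

theorem DiffForm.alongSurface_congr (η : DiffForm E M W 2) {f g : ℝ × ℝ → M} {t s : ℝ}
    (h : f =ᶠ[𝓝 (t, s)] g) : η.alongSurface f t s = η.alongSurface g t s := by
  have h1 : (fun t' => f (t', s)) =ᶠ[𝓝 t] fun t' => g (t', s) :=
    h.comp_tendsto (Continuous.tendsto (f := fun t' : ℝ => (t', s)) (by fun_prop) t)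
  have h2 : (fun s' => f (t, s')) =ᶠ[𝓝 s] fun s' => g (t, s') :=
    h.comp_tendsto (Continuous.tendsto (f := fun s' : ℝ => (t, s')) (by fun_prop) s)
  rw [DiffForm.alongSurface, DiffForm.alongSurface]
  refine (η.toFun_congr h.eq_of_nhds _).trans (congrArg (η.toFun (g (t, s))) (funext fun i => ?_))
  fin_cases i
  · exact vel_congr h1
  · exact vel_congr h2

variable [IsManifold 𝓘(ℝ, E) ∞ M]

theorem DiffForm.along_eq_chart {k : ℕ} (η : DiffForm E M W k) {f : X → M} {p : X} (x₀ : M)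
    (hf : MDifferentiableAt 𝓘(ℝ, X) 𝓘(ℝ, E) f p) (hp : f p ∈ (extChartAt 𝓘(ℝ, E) x₀).source)
    (v : Fin k → X) : η.along f v p = inChart η.toFun x₀ (extChartAt 𝓘(ℝ, E) x₀ (f p))
        (fun i => fderiv ℝ (fun q => extChartAt 𝓘(ℝ, E) x₀ (f q)) p (v i)) :=
  η.apply_mfderiv x₀ hf hp v

theorem ContMDiffOn.contMDiffAt_of_interior {f : X → M} {P : Set X} {p : X}
    (hf : ContMDiffOn 𝓘(ℝ, X) 𝓘(ℝ, E) ∞ f P) (hp : p ∈ interior P) :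
    ContMDiffAt 𝓘(ℝ, X) 𝓘(ℝ, E) ∞ f p :=
  (hf p (interior_subset hp)).contMDiffAt (mem_interior_iff_mem_nhds.1 hp)

/-- A form is bounded along a map that is smooth on a compact convex set. -/
theorem DiffForm.exists_bound_along {k : ℕ} (η : DiffForm E M W k) {f : X → M} {P : Set X}
    (hc : IsCompact P) (hv : Convex ℝ P) (hf : ContMDiffOn 𝓘(ℝ, X) 𝓘(ℝ, E) ∞ f P) :
    ∃ C, 0 ≤ C ∧ ∀ p ∈ interior P, ∀ v : Fin k → X, ‖η.along f v p‖ ≤ C * ∏ i, ‖v i‖ := by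
  have key : ∃ C, 0 ≤ C ∧ ∀ p ∈ P, p ∈ interior P → ∀ v : Fin k → X,
      ‖η.along f v p‖ ≤ C * ∏ i, ‖v i‖ := by
    refine hc.induction_on (p := fun s => ∃ C, 0 ≤ C ∧ ∀ p ∈ s, p ∈ interior P →
      ∀ v : Fin k → X, ‖η.along f v p‖ ≤ C * ∏ i, ‖v i‖) ?_ ?_ ?_ ?_
    · exact ⟨0, le_rfl, fun p hp => absurd hp (notMem_empty p)⟩
    · rintro s t hst ⟨C, hC0, hC⟩
      exact ⟨C, hC0, fun p hp => hC p (hst hp)⟩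
    · rintro s t ⟨C, hC0, hC⟩ ⟨D, hD0, hD⟩
      refine ⟨C + D, add_nonneg hC0 hD0, fun p hp hpi v => ?_⟩
      have hpr : 0 ≤ ∏ i, ‖v i‖ := Finset.prod_nonneg fun i _ => norm_nonneg _
      rw [add_mul]
      rcases hp with hp | hp
      · exact (hC p hp hpi v).trans (le_add_of_nonneg_right (mul_nonneg hD0 hpr))
      · exact (hD p hp hpi v).trans (le_add_of_nonneg_left (mul_nonneg hC0 hpr))
    · intro p₀ hp₀
      set χ := extChartAt 𝓘(ℝ, E) (f p₀) with hχ
      have hcd := contDiffWithinAt_chart (hf p₀ hp₀)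
      -- `f` is smooth only within `P`, so its differential is not continuous up to the boundary as
      -- it stands. A local Lipschitz constant of `f` in the chart, available because `P` is convex,
      -- bounds it at interior points arbitrarily close to the boundary.
      obtain ⟨L, u, hu, hL⟩ := (hcd.of_le (by simp : (1 : WithTop ℕ∞) ≤ ∞)).exists_lipschitzOnWith hv
      have hsrc := eventually_mem_chart_source (E := E) (hf p₀ hp₀).continuousWithinAt
      have hη : ContinuousAt (inChart η.toFun (f p₀)) (χ (f p₀)) :=
        η.continuousAt_inChart (mem_extChartAt_target (f p₀))
      have hη' := (ContinuousAt.comp_continuousWithinAt (f := fun q => χ (f q)) hη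
        hcd.continuousWithinAt).norm.eventually_lt_const
          (lt_add_one ‖inChart η.toFun (f p₀) (χ (f p₀))‖)
      set C₁ := ‖inChart η.toFun (f p₀) (χ (f p₀))‖ + 1 with hC₁
      have hC₁0 : 0 ≤ C₁ := by positivity
      have hall := (eventually_mem_set.2 hu).and (hsrc.and hη')
      obtain ⟨O, hO, hp₀O, hOP⟩ := mem_nhdsWithin.1 hall
      refine ⟨O ∩ P, inter_comm P O ▸ inter_mem_nhdsWithin P (hO.mem_nhds hp₀O), C₁ * (L : ℝ) ^ k,
        by positivity, fun p hp hpi v => ?_⟩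
      obtain ⟨h1, h2, h3⟩ := hOP hp
      have hsm := ContMDiffOn.contMDiffAt_of_interior hf hpi
      rw [η.along_eq_chart (f p₀) (hsm.mdifferentiableAt (by simp)) h2]
      have hfd : ‖fderiv ℝ (fun q => χ (f q)) p‖ ≤ L := by
        refine norm_fderiv_le_of_lipschitzOn ℝ (s := O ∩ interior P)
          ((hO.inter isOpen_interior).mem_nhds ⟨hp.1, hpi⟩) (hL.mono fun q hq => ?_)
        exact (hOP ⟨hq.1, interior_subset hq.2⟩).1
      refine (ContinuousAlternatingMap.le_opNorm _ _).trans ?_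
      rw [mul_assoc]
      refine mul_le_mul (le_of_lt h3) ?_ (Finset.prod_nonneg fun i _ => norm_nonneg _) hC₁0
      calc ∏ i, ‖fderiv ℝ (fun q => χ (f q)) p (v i)‖ ≤ ∏ i, (L : ℝ) * ‖v i‖ := by
            refine Finset.prod_le_prod (fun i _ => norm_nonneg _) fun i _ => ?_
            exact (ContinuousLinearMap.le_opNorm _ _).trans
              (mul_le_mul_of_nonneg_right hfd (norm_nonneg _))
        _ = (L : ℝ) ^ k * ∏ i, ‖v i‖ := by
            rw [Finset.prod_mul_distrib]; simp
  obtain ⟨C, hC0, hC⟩ := key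
  exact ⟨C, hC0, fun p hp => hC p (interior_subset hp) hp⟩

theorem DiffForm.continuousAt_along {k : ℕ} (η : DiffForm E M W k) {f : X → M} {p : X}
    (hf : ContMDiffAt 𝓘(ℝ, X) 𝓘(ℝ, E) ∞ f p) (v : Fin k → X) :
    ContinuousAt (η.along f v) p := by
  set χ := extChartAt 𝓘(ℝ, E) (f p) with hχ
  have hcd : ContDiffAt ℝ ∞ (fun q => χ (f q)) p := contDiffWithinAt_chart hf
  have hsrc : ∀ᶠ q in 𝓝 p, f q ∈ χ.source := by
    have := eventually_mem_chart_source (E := E) (P := univ) hf.continuousAt.continuousWithinAt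
    rwa [nhdsWithin_univ] at this
  have hne : ∀ᶠ q in 𝓝 p, ContMDiffAt 𝓘(ℝ, X) 𝓘(ℝ, E) 1 f q :=
    (contMDiffAt_iff_contMDiffAt_nhds (by simp)).1
      (hf.of_le (by simp : (1 : WithTop ℕ∞) ≤ ∞))
  have heq : η.along f v =ᶠ[𝓝 p] fun q => inChart η.toFun (f p) (χ (f q))
      (fun i => fderiv ℝ (fun q => χ (f q)) q (v i)) := by
    filter_upwards [hsrc, hne] with q h1 h2
    exact η.along_eq_chart (f p) (h2.mdifferentiableAt (by simp)) h1 v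
  refine ContinuousAt.congr ?_ heq.symm
  have h1 : ContinuousAt (fun q => inChart η.toFun (f p) (χ (f q))) p :=
    ContinuousAt.comp (f := fun q => χ (f q))
      (η.continuousAt_inChart (mem_extChartAt_target (f p))) hcd.continuousAt
  have h2 : ContinuousAt (fun q => fun i => fderiv ℝ (fun q => χ (f q)) q (v i)) p := by
    refine continuousAt_pi.2 fun i => ?_
    exact (hcd.continuousAt_fderiv (by simp)).clm_apply continuousAt_const
  have h3 : ContinuousAt (fun q => (inChart η.toFun (f p) (χ (f q))).toContinuousMultilinearMap)
      p := ContinuousAt.comp (g := ContinuousAlternatingMap.toContinuousMultilinearMap)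
        ContinuousAlternatingMap.continuous_toContinuousMultilinearMap.continuousAt h1
  exact h3.eval h2

end FormsAlongMaps

/-! ### Piecewise smooth paths and squares, and their good sets. -/

section Paths

variable {E : Type*} [NormedAddCommGroup E] [NormedSpace ℝ E]
  {M : Type*} [TopologicalSpace M] [ChartedSpace E M] [IsManifold 𝓘(ℝ, E) ∞ M]
  {W : Type*} [NormedAddCommGroup W] [NormedSpace ℝ W]

theorem IsPath.eventually_contMDiffAt {γ : ℝ → M} (h : IsPath E γ) :
    ∀ᶠ t in offFin, ContMDiffAt 𝓘(ℝ, ℝ) 𝓘(ℝ, E) ∞ γ t := by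
  obtain ⟨S, hS, hU, hP⟩ := h
  filter_upwards [eventually_mem_interior_of_cover hS hU.ge fun P h => ⟨(hP P h).1, (hP P h).2.1⟩]
    with t ht
  obtain ⟨P, hPS, htP⟩ := ht
  exact ContMDiffOn.contMDiffAt_of_interior (hP P hPS).2.2 htP

theorem IsPath.pCont_along {γ : ℝ → M} (h : IsPath E γ) {k : ℕ} (η : DiffForm E M W k)
    (v : Fin k → ℝ) : PCont (η.along γ v) := by
  refine ⟨?_, ?_⟩
  · filter_upwards [h.eventually_contMDiffAt] with t ht using η.continuousAt_along ht v
  · obtain ⟨S, hS, hU, hP⟩ := h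
    choose! C hC0 hC using fun P h =>
      η.exists_bound_along (hP P h).1 (hP P h).2.1 (hP P h).2.2
    refine ⟨∑ P ∈ hS.toFinset, C P * ∏ i, ‖v i‖, ?_⟩
    filter_upwards [eventually_mem_interior_of_cover hS hU.ge
      fun P h => ⟨(hP P h).1, (hP P h).2.1⟩] with t ht
    obtain ⟨P, hPS, htP⟩ := ht
    refine (hC P hPS t htP v).trans ?_
    exact Finset.single_le_sum (f := fun P => C P * ∏ i, ‖v i‖)
      (fun Q hQ => mul_nonneg (hC0 Q (hS.mem_toFinset.1 hQ))
        (Finset.prod_nonneg fun _ _ => norm_nonneg _)) (hS.mem_toFinset.2 hPS)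

theorem IsPath.pCont_alongPath {γ : ℝ → M} (h : IsPath E γ) (η : DiffForm E M W 1) :
    PCont (η.alongPath γ) := h.pCont_along η fun _ => 1

variable (E) in
/-- An open set of points of the unit square near which `Γ` is smooth, with bounded derivatives,
and which is cofinite in almost all horizontal and vertical slices. -/
structure GoodSet (Γ : ℝ × ℝ → M) (G : Set (ℝ × ℝ)) : Prop where
  isOpen : IsOpen G
  subset : G ⊆ Ioo (0 : ℝ) 1 ×ˢ Ioo (0 : ℝ) 1
  slice : ∀ᶠ s in offFin, ∀ᶠ t in offFin, (t, s) ∈ G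
  slice' : ∀ᶠ t in offFin, ∀ᶠ s in offFin, (t, s) ∈ G
  pieces : ∃ S : Set (Set (ℝ × ℝ)), S.Finite ∧ (∀ P ∈ S, IsCompact P ∧ Convex ℝ P ∧
    ContMDiffOn 𝓘(ℝ, ℝ × ℝ) 𝓘(ℝ, E) ∞ Γ P) ∧ ∀ p ∈ G, ∃ P ∈ S, p ∈ interior P

theorem PiecewiseSmoothOn.exists_goodSet {Γ : ℝ × ℝ → M}
    (h : PiecewiseSmoothOn E Γ (Icc 0 1 ×ˢ Icc 0 1)) : ∃ G, GoodSet E Γ G := by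
  obtain ⟨S, hS, hU, hP⟩ := h
  have hP' : ∀ P ∈ S, IsCompact P ∧ Convex ℝ P := fun P h => ⟨(hP P h).1, (hP P h).2.1⟩
  refine ⟨(Ioo (0 : ℝ) 1 ×ˢ Ioo (0 : ℝ) 1) ∩ ⋃ P ∈ S, interior P, ?_, inter_subset_left,
    ?_, ?_, S, hS, hP, ?_⟩
  · exact (isOpen_Ioo.prod isOpen_Ioo).inter (isOpen_biUnion fun P _ => isOpen_interior)
  · filter_upwards [eventually_slice_mem_interior hS hU.ge hP', eventually_offFin_mem] with s hs hsI
    filter_upwards [hs, eventually_offFin_mem] with t ht htI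
    obtain ⟨P, hPS, htP⟩ := ht
    exact ⟨⟨htI, hsI⟩, mem_biUnion hPS htP⟩
  · filter_upwards [eventually_slice_mem_interior' hS hU.ge hP', eventually_offFin_mem] with t ht htI
    filter_upwards [ht, eventually_offFin_mem] with s hs hsI
    obtain ⟨P, hPS, htP⟩ := hs
    exact ⟨⟨htI, hsI⟩, mem_biUnion hPS htP⟩
  · rintro p ⟨_, hp⟩
    simpa using hp

namespace GoodSet

variable {Γ : ℝ × ℝ → M} {G : Set (ℝ × ℝ)}

theorem contMDiffAt (h : GoodSet E Γ G) {p : ℝ × ℝ} (hp : p ∈ G) :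
    ContMDiffAt 𝓘(ℝ, ℝ × ℝ) 𝓘(ℝ, E) ∞ Γ p := by
  obtain ⟨S, hS, hP, hG⟩ := h.pieces
  obtain ⟨P, hPS, hpP⟩ := hG p hp
  exact ContMDiffOn.contMDiffAt_of_interior (hP P hPS).2.2 hpP

theorem mdifferentiableAt (h : GoodSet E Γ G) {p : ℝ × ℝ} (hp : p ∈ G) :
    MDifferentiableAt 𝓘(ℝ, ℝ × ℝ) 𝓘(ℝ, E) Γ p := (h.contMDiffAt hp).mdifferentiableAt (by simp)

theorem continuousOn_along (h : GoodSet E Γ G) {k : ℕ} (η : DiffForm E M W k)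
    (v : Fin k → ℝ × ℝ) : ContinuousOn (η.along Γ v) G := fun _ hp =>
  (η.continuousAt_along (h.contMDiffAt hp) v).continuousWithinAt

theorem exists_bound (h : GoodSet E Γ G) {k : ℕ} (η : DiffForm E M W k) (v : Fin k → ℝ × ℝ) :
    ∃ C, ∀ p ∈ G, ‖η.along Γ v p‖ ≤ C := by
  obtain ⟨S, hS, hP, hG⟩ := h.pieces
  choose! C hC0 hC using fun P h => η.exists_bound_along (hP P h).1 (hP P h).2.1 (hP P h).2.2
  refine ⟨∑ P ∈ hS.toFinset, C P * ∏ i, ‖v i‖, fun p hp => ?_⟩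
  obtain ⟨P, hPS, htP⟩ := hG p hp
  refine (hC P hPS p htP v).trans ?_
  exact Finset.single_le_sum (f := fun P => C P * ∏ i, ‖v i‖)
    (fun Q hQ => mul_nonneg (hC0 Q (hS.mem_toFinset.1 hQ))
      (Finset.prod_nonneg fun _ _ => norm_nonneg _)) (hS.mem_toFinset.2 hPS)

theorem alongPath_fst (h : GoodSet E Γ G) (η : DiffForm E M W 1) {t s : ℝ} (hp : (t, s) ∈ G) :
    η.alongPath (fun t => Γ (t, s)) t = η.along Γ (fun _ => (1, 0)) (t, s) :=
  η.alongPath_comp (f := Γ) (c := fun t => (t, s)) (h.mdifferentiableAt hp)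
    ((hasDerivAt_id t).prodMk (hasDerivAt_const t s))

theorem alongPath_snd (h : GoodSet E Γ G) (η : DiffForm E M W 1) {t s : ℝ} (hp : (t, s) ∈ G) :
    η.alongPath (fun s => Γ (t, s)) s = η.along Γ (fun _ => (0, 1)) (t, s) :=
  η.alongPath_comp (f := Γ) (c := fun s => (t, s)) (h.mdifferentiableAt hp)
    ((hasDerivAt_const s t).prodMk (hasDerivAt_id s))

theorem alongSurface (h : GoodSet E Γ G) (η : DiffForm E M W 2) {t s : ℝ} (hp : (t, s) ∈ G) :
    η.alongSurface Γ t s = η.along Γ ![(1, 0), (0, 1)] (t, s) :=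
  η.alongSurface_comp (f := Γ) (c := fun p => p) (h.mdifferentiableAt hp)
    ((hasDerivAt_id t).prodMk (hasDerivAt_const t s))
    ((hasDerivAt_const s t).prodMk (hasDerivAt_id s))

end GoodSet

theorem PiecewiseSmoothOn.isPath_comp {Γ : ℝ × ℝ → M}
    (h : PiecewiseSmoothOn E Γ (Icc 0 1 ×ˢ Icc 0 1)) {p v : ℝ × ℝ}
    (hm : MapsTo (fun t : ℝ => p + t • v) (Icc 0 1) (Icc 0 1 ×ˢ Icc 0 1)) :
    IsPath E fun t : ℝ => Γ (p + t • v) := by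
  refine h.comp_affine (i := fun t : ℝ => p + t • v) (by fun_prop) ?_ isCompact_Icc
    (convex_Icc _ _) hm
  intro x y a b hab
  have : p = (a + b) • p := by rw [hab, one_smul]
  nth_rewrite 1 [this]
  module

theorem PiecewiseSmoothOn.isPath_fst {Γ : ℝ × ℝ → M}
    (h : PiecewiseSmoothOn E Γ (Icc 0 1 ×ˢ Icc 0 1)) {s : ℝ} (hs : s ∈ Icc (0 : ℝ) 1) :
    IsPath E fun t => Γ (t, s) := by
  have := h.isPath_comp (p := (0, s)) (v := (1, 0)) fun t ht => ⟨by simpa using ht, by simpa using hs⟩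
  simpa using this

theorem PiecewiseSmoothOn.isPath_snd {Γ : ℝ × ℝ → M}
    (h : PiecewiseSmoothOn E Γ (Icc 0 1 ×ˢ Icc 0 1)) {t : ℝ} (ht : t ∈ Icc (0 : ℝ) 1) :
    IsPath E fun s => Γ (t, s) := by
  have := h.isPath_comp (p := (t, 0)) (v := (0, 1)) fun s hs => ⟨by simpa using ht, by simpa using hs⟩
  simpa using this

theorem PiecewiseSmoothOn.isPath_diag {Γ : ℝ × ℝ → M}
    (h : PiecewiseSmoothOn E Γ (Icc 0 1 ×ˢ Icc 0 1)) : IsPath E fun t => Γ (t, t) := by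
  have := h.isPath_comp (p := (0, 0)) (v := (1, 1)) fun s hs => ⟨by simpa using hs, by simpa using hs⟩
  simpa using this

theorem PiecewiseSmoothOn.swap {Γ : ℝ × ℝ → M}
    (h : PiecewiseSmoothOn E Γ (Icc 0 1 ×ˢ Icc 0 1)) :
    PiecewiseSmoothOn E (fun p => Γ (p.2, p.1)) (Icc 0 1 ×ˢ Icc 0 1) :=
  h.comp_affine (i := fun p : ℝ × ℝ => (p.2, p.1)) (by fun_prop) (fun x y a b _ => by ext <;> simp)
    (isCompact_Icc.prod isCompact_Icc) ((convex_Icc _ _).prod (convex_Icc _ _))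
    fun p hp => ⟨hp.2, hp.1⟩

end Paths

end HigherHol

namespace HigherHol

open Filter

/-! ### Line integrals of one-forms along Lipschitz curves. -/

section LineIntegrals

/-- A map on an interval that satisfies a Lipschitz bound on each member of a finite closed cover
satisfies it globally. -/
theorem dist_le_of_finite_closed_cover {Y : Type*} [PseudoMetricSpace Y] {g : ℝ → Y} {L : ℝ}
    (S : Finset (Set ℝ)) : ∀ a b : ℝ, a ≤ b → Icc a b ⊆ ⋃ P ∈ S, P → (∀ P ∈ S, IsClosed P) →
      (∀ P ∈ S, ∀ x ∈ P ∩ Icc a b, ∀ y ∈ P ∩ Icc a b, x ≤ y → dist (g x) (g y) ≤ L * (y - x)) →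
      dist (g a) (g b) ≤ L * (b - a) := by
  induction S using Finset.induction_on with
  | empty =>
    intro a b hab h
    simp only [Finset.notMem_empty, iUnion_of_empty, iUnion_empty, subset_empty_iff,
      Icc_eq_empty_iff] at h
    exact absurd hab h
  | insert P S _ ih =>
    intro a b hab hU hcl hL
    have hcl' : ∀ Q ∈ S, IsClosed Q := fun Q hQ => hcl Q (Finset.mem_insert_of_mem hQ)
    have hPc : IsCompact (P ∩ Icc a b) :=
      isCompact_Icc.inter_left (hcl P (Finset.mem_insert_self _ _))
    have hSc : IsClosed (⋃ Q ∈ S, Q) := S.finite_toSet.isClosed_biUnion hcl'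
    rcases (P ∩ Icc a b).eq_empty_or_nonempty with he | hne
    · refine ih a b hab (fun x hx => ?_) hcl'
        fun Q hQ => hL Q (Finset.mem_insert_of_mem hQ)
      have := hU hx
      rw [Finset.set_biUnion_insert] at this
      refine this.resolve_left fun hxP => ?_
      have : x ∈ P ∩ Icc a b := ⟨hxP, hx⟩
      rw [he] at this
      exact this
    -- `c` and `d` are the first and the last point of `P` in `[a, b]`. The pair `c, d` is handled
    -- by the bound on `P` itself, and the intervals `[a, c]` and `[d, b]` are covered by the
    -- remaining sets.
    · obtain ⟨c, hc, hcm⟩ := hPc.exists_isMinOn hne continuousOn_id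
      obtain ⟨d, hd, hdm⟩ := hPc.exists_isMaxOn hne continuousOn_id
      have hcd : c ≤ d := hcm hd
      have hside : ∀ x y, x ≤ y → Icc x y ⊆ Icc a b → (∀ t ∈ Ioo x y, t ∉ P) →
          dist (g x) (g y) ≤ L * (y - x) := by
        intro x y hxy hsub hn
        rcases hxy.eq_or_lt with rfl | hlt
        · simp
        refine ih x y hxy ?_ hcl' fun Q hQ u hu v hv => hL Q (Finset.mem_insert_of_mem hQ) u
          ⟨hu.1, hsub hu.2⟩ v ⟨hv.1, hsub hv.2⟩
        -- Only the open interval is known to avoid `P`; its end points are recovered because the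
        -- remaining sets are closed.
        rw [← closure_Ioo hlt.ne]
        refine closure_minimal (fun t ht => ?_) hSc
        have := hU (hsub (Ioo_subset_Icc_self ht))
        rw [Finset.set_biUnion_insert] at this
        exact this.resolve_left (hn t ht)
      have h1 := hside a c hc.2.1 (Icc_subset_Icc_right hc.2.2) fun t ht htP =>
        absurd (hcm (⟨htP, ht.1.le, ht.2.le.trans hc.2.2⟩ : t ∈ P ∩ Icc a b)) (not_le.2 ht.2)
      have h2 := hL P (Finset.mem_insert_self _ _) c hc d hd hcd
      have h3 := hside d b hd.2.2 (Icc_subset_Icc_left hd.2.1) fun t ht htP =>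
        absurd (hdm (⟨htP, hd.2.1.trans ht.1.le, ht.2.le⟩ : t ∈ P ∩ Icc a b)) (not_le.2 ht.1)
      have h4 := dist_triangle4 (g a) (g c) (g d) (g b)
      linarith

variable {E R : Type*} [NormedAddCommGroup E] [NormedSpace ℝ E] [NormedAddCommGroup R]
  [NormedSpace ℝ R]

/-- The product of a differentiable function vanishing at a point and a continuous function. -/
theorem hasDerivAt_bilin_of_eq_zero {F₁ F₂ F₃ : Type*} [NormedAddCommGroup F₁] [NormedSpace ℝ F₁]
    [NormedAddCommGroup F₂] [NormedSpace ℝ F₂] [NormedAddCommGroup F₃] [NormedSpace ℝ F₃]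
    (B : F₁ →L[ℝ] F₂ →L[ℝ] F₃) {u : ℝ → F₁} {v : ℝ → F₂} {u' : F₁} {s₀ : ℝ} (h0 : u s₀ = 0)
    (hu : HasDerivAt u u' s₀) (hv : ContinuousAt v s₀) :
    HasDerivAt (fun s => B (u s) (v s)) (B u' (v s₀)) s₀ := by
  rw [hasDerivAt_iff_tendsto_slope] at hu ⊢
  have h1 : Tendsto (fun s => B (slope u s₀ s) (v s)) (𝓝[≠] s₀) (𝓝 (B u' (v s₀))) :=
    ((show Continuous fun x : F₁ × F₂ => B x.1 x.2 by fun_prop).tendsto _).comp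
      (hu.prodMk_nhds (hv.tendsto.mono_left nhdsWithin_le_nhds))
  refine h1.congr fun s => ?_
  simp [slope, h0]

/-- Differentiation under the integral sign at one parameter value. -/
theorem hasDerivAt_intervalIntegral_of_lip {J : ℝ → ℝ → R} {j : ℝ → R} {a b s₀ C : ℝ}
    (h0 : ∀ t, J s₀ t = 0)
    (hm : ∀ᶠ s in 𝓝 s₀, AEStronglyMeasurable (J s) (volume.restrict (uIoc a b)))
    (hC : ∀ᶠ s in 𝓝 s₀, ∀ᵐ t, t ∈ uIoc a b → ‖J s t‖ ≤ C * |s - s₀|)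
    (hj : ∀ᵐ t, t ∈ uIoc a b → HasDerivAt (fun s => J s t) (j t) s₀) :
    HasDerivAt (fun s => ∫ t in a..b, J s t) (∫ t in a..b, j t) s₀ := by
  rw [hasDerivAt_iff_tendsto_slope]
  have h1 : Tendsto (fun s => ∫ t in a..b, (s - s₀)⁻¹ • J s t) (𝓝[≠] s₀)
      (𝓝 (∫ t in a..b, j t)) := by
    refine intervalIntegral.tendsto_integral_filter_of_dominated_convergence (fun _ => C) ?_ ?_
      (by simp) ?_
    · filter_upwards [nhdsWithin_le_nhds hm] with s hs using hs.const_smul _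
    · filter_upwards [nhdsWithin_le_nhds hC, self_mem_nhdsWithin] with s hs hne
      have hne' : 0 < |s - s₀| := abs_pos.2 (sub_ne_zero.2 hne)
      filter_upwards [hs] with t ht htI
      rw [norm_smul, norm_inv, Real.norm_eq_abs, inv_mul_le_iff₀ hne', mul_comm]
      exact ht htI
    · filter_upwards [hj] with t ht htI
      have := hasDerivAt_iff_tendsto_slope.1 (ht htI)
      refine this.congr fun s => ?_
      simp [slope, h0]
  refine h1.congr fun s => ?_
  rw [intervalIntegral.integral_smul]
  simp [slope, h0]

/-- `p` is a Lipschitz curve on the interval between `a` and `b`, differentiable off a finite set. -/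
structure LipCurve (L : NNReal) (p : ℝ → E) (a b : ℝ) : Prop where
  lip : LipschitzOnWith L p (uIcc a b)
  diff : ∃ F : Finset ℝ, ∀ t ∈ Ioo (min a b) (max a b), t ∉ F → DifferentiableAt ℝ p t

theorem ae_uIoc_mem_Ioo (F : Finset ℝ) (a b : ℝ) :
    ∀ᵐ t, t ∈ uIoc a b → t ∈ Ioo (min a b) (max a b) ∧ t ∉ F := by
  have hfin : ((F : Set ℝ) ∪ {max a b}).Finite := F.finite_toSet.union (by simp)
  filter_upwards [compl_mem_ae_iff.2 (hfin.measure_zero volume)] with t ht htI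
  simp only [mem_compl_iff, mem_union, mem_singleton_iff, not_or] at ht
  exact ⟨⟨htI.1, lt_of_le_of_ne htI.2 ht.2⟩, by simpa using ht.1⟩

namespace LipCurve

variable {L : NNReal} {p q : ℝ → E} {a b : ℝ}

theorem norm_deriv_le (hp : LipCurve L p a b) {t : ℝ} (ht : t ∈ Ioo (min a b) (max a b)) :
    ‖deriv p t‖ ≤ L :=
  norm_deriv_le_of_lipschitzOn (Icc_mem_nhds ht.1 ht.2) hp.lip

theorem ae_norm_deriv_le (hp : LipCurve L p a b) : ∀ᵐ t, t ∈ uIoc a b → ‖deriv p t‖ ≤ L := by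
  filter_upwards [ae_uIoc_mem_Ioo ∅ a b] with t ht htI using hp.norm_deriv_le (ht htI).1

variable [CompleteSpace E]

theorem aestronglyMeasurable_apply {k : ℝ → E →L[ℝ] R} (hk : ContinuousOn k (uIcc a b)) :
    AEStronglyMeasurable (fun t => k t (deriv p t)) (volume.restrict (uIoc a b)) := by
  have h1 : AEStronglyMeasurable k (volume.restrict (uIoc a b)) :=
    (hk.mono uIoc_subset_uIcc).aestronglyMeasurable measurableSet_uIoc
  exact ContinuousLinearMap.aestronglyMeasurable_comp₂ (ContinuousLinearMap.id ℝ (E →L[ℝ] R)) h1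
    (stronglyMeasurable_deriv p).aestronglyMeasurable

theorem intervalIntegrable_apply (hp : LipCurve L p a b) {k : ℝ → E →L[ℝ] R}
    (hk : ContinuousOn k (uIcc a b)) :
    IntervalIntegrable (fun t => k t (deriv p t)) volume a b := by
  obtain ⟨C, hC⟩ := isCompact_uIcc.exists_bound_of_continuousOn hk
  have : IsFiniteMeasure (volume.restrict (uIoc a b)) := ⟨by simp [uIoc]⟩
  refine intervalIntegrable_iff.2 (Integrable.of_bound (C := C * L)
    (aestronglyMeasurable_apply hk) ?_)
  rw [ae_restrict_iff' measurableSet_uIoc]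
  filter_upwards [hp.ae_norm_deriv_le] with t ht htI
  exact (ContinuousLinearMap.le_opNorm _ _).trans (mul_le_mul (hC t (uIoc_subset_uIcc htI)) (ht htI)
    (norm_nonneg _) ((norm_nonneg _).trans (hC t (uIoc_subset_uIcc htI))))

variable [CompleteSpace R]

/-- Integration by parts for the difference of two line integrals of a one-form. -/
theorem line_integral_sub (hp : LipCurve L p a b) (hq : LipCurve L q a b) {B : Set E}
    (hB : IsOpen B) {θ : E → E →L[ℝ] R} (hθ : ContDiffOn ℝ 1 θ B) (hpB : MapsTo p (uIcc a b) B)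
    (hqB : MapsTo q (uIcc a b) B) :
    (∫ t in a..b, θ (p t) (deriv p t)) - ∫ t in a..b, θ (q t) (deriv q t) =
      (∫ t in a..b, ((θ (p t) - θ (q t)) (deriv p t) - fderiv ℝ θ (q t) (deriv q t) (p t - q t))) +
        (θ (q b) (p b - q b) - θ (q a) (p a - q a)) := by
  have hθp : ContinuousOn (fun t => θ (p t)) (uIcc a b) :=
    hθ.continuousOn.comp hp.lip.continuousOn hpB
  have hθq : ContinuousOn (fun t => θ (q t)) (uIcc a b) :=
    hθ.continuousOn.comp hq.lip.continuousOn hqB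
  have hD : ContinuousOn (fun t => (fderiv ℝ θ (q t)).flip (p t - q t)) (uIcc a b) := by
    have h1 : ContinuousOn (fun t => fderiv ℝ θ (q t)) (uIcc a b) :=
      (hθ.continuousOn_fderiv_of_isOpen hB le_rfl).comp hq.lip.continuousOn hqB
    have h2 := (ContinuousLinearMap.flipₗᵢ ℝ E E R).continuous.comp_continuousOn h1
    exact h2.clm_apply (hp.lip.continuousOn.sub hq.lip.continuousOn)
  have i1 := hp.intervalIntegrable_apply hθp
  have i2 := hq.intervalIntegrable_apply hθq
  have i3 : IntervalIntegrable (fun t => (θ (p t) - θ (q t)) (deriv p t)) volume a b :=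
    hp.intervalIntegrable_apply (hθp.sub hθq)
  have i4 : IntervalIntegrable (fun t => fderiv ℝ θ (q t) (deriv q t) (p t - q t)) volume a b :=
    hq.intervalIntegrable_apply hD
  have i5 := hp.intervalIntegrable_apply hθq
  -- Integrating the derivative of `θ(q)(p - q)` removes the term `θ(q)(p' - q')`. What remains
  -- contains `p - q` but no difference of velocities.
  have ftc : ∫ t in a..b, (fderiv ℝ θ (q t) (deriv q t) (p t - q t)
      + θ (q t) (deriv p t - deriv q t)) = θ (q b) (p b - q b) - θ (q a) (p a - q a) := by
    obtain ⟨F₁, h1⟩ := hp.diff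
    obtain ⟨F₂, h2⟩ := hq.diff
    refine integral_eq_of_hasDerivAt_off_countable (fun t => θ (q t) (p t - q t)) _
      (s := (F₁ : Set ℝ) ∪ F₂) (F₁.finite_toSet.union F₂.finite_toSet).countable
      (hθq.clm_apply (hp.lip.continuousOn.sub hq.lip.continuousOn)) ?_ ?_
    · rintro t ⟨ht, htF⟩
      simp only [mem_union, Finset.mem_coe, not_or] at htF
      have d1 := (h1 t ht htF.1).hasDerivAt
      have d2 := (h2 t ht htF.2).hasDerivAt
      have htI : t ∈ uIcc a b := Ioo_subset_Icc_self ht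
      have d3 : HasFDerivAt θ (fderiv ℝ θ (q t)) (q t) :=
        ((hθ.differentiableOn (by simp)).differentiableAt (hB.mem_nhds (hqB htI))).hasFDerivAt
      exact (d3.comp_hasDerivAt t d2).clm_apply (d1.sub d2)
    · refine i4.add ((i5.sub i2).congr fun t _ => ?_)
      simp
  rw [← ftc, ← intervalIntegral.integral_add (i3.sub i4) (i4.add ((i5.sub i2).congr fun t _ => by
    simp)), ← intervalIntegral.integral_sub i1 i2]
  refine intervalIntegral.integral_congr fun t _ => ?_
  simp only [sub_apply, map_sub]
  abel

/-- Velocities of nearby piecewise smooth curves may differ by a fixed amount near a break point.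
After integration by parts only uniform closeness of the curves and a common Lipschitz constant
matter. -/
theorem norm_line_integral_sub_le (hp : LipCurve L p a b) (hq : LipCurve L q a b) {B : Set E}
    (hB : IsOpen B) (hBc : Convex ℝ B) {θ : E → E →L[ℝ] R} (hθ : ContDiffOn ℝ 1 θ B) {C : ℝ}
    (hC : ∀ y ∈ B, ‖θ y‖ ≤ C ∧ ‖fderiv ℝ θ y‖ ≤ C) (hpB : MapsTo p (uIcc a b) B)
    (hqB : MapsTo q (uIcc a b) B) {ε : ℝ} (hε : ∀ t ∈ uIcc a b, ‖p t - q t‖ ≤ ε)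
    (hab : |b - a| ≤ 1) :
    ‖(∫ t in a..b, θ (p t) (deriv p t)) - ∫ t in a..b, θ (q t) (deriv q t)‖ ≤
      (2 * C * L + 2 * C) * ε := by
  have hC0 : 0 ≤ C := (norm_nonneg _).trans (hC _ (hpB left_mem_uIcc)).1
  have hε0 : 0 ≤ ε := (norm_nonneg _).trans (hε _ left_mem_uIcc)
  rw [hp.line_integral_sub hq hB hθ hpB hqB]
  have hlip : ∀ t ∈ uIcc a b, ‖θ (p t) - θ (q t)‖ ≤ C * ε := fun t ht =>
    (hBc.norm_image_sub_le_of_norm_fderiv_le (𝕜 := ℝ)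
      (fun y hy => (hθ.differentiableOn (by simp)).differentiableAt (hB.mem_nhds hy))
      (fun y hy => (hC y hy).2) (hqB ht) (hpB ht)).trans
      (mul_le_mul_of_nonneg_left (hε t ht) hC0)
  have h1 : ‖∫ t in a..b, ((θ (p t) - θ (q t)) (deriv p t)
      - fderiv ℝ θ (q t) (deriv q t) (p t - q t))‖ ≤ (2 * C * L * ε) * |b - a| := by
    refine intervalIntegral.norm_integral_le_of_norm_le_const_ae ?_
    filter_upwards [hp.ae_norm_deriv_le, hq.ae_norm_deriv_le] with t h1 h2 ht
    have ht' := uIoc_subset_uIcc ht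
    have e1 : ‖(θ (p t) - θ (q t)) (deriv p t)‖ ≤ C * ε * L :=
      ContinuousLinearMap.le_of_opNorm_le_of_le _ (hlip t ht') (h1 ht)
    have e2 : ‖fderiv ℝ θ (q t) (deriv q t) (p t - q t)‖ ≤ C * L * ε :=
      ContinuousLinearMap.le_of_opNorm_le_of_le _
        (ContinuousLinearMap.le_of_opNorm_le_of_le _ (hC _ (hqB ht')).2 (h2 ht)) (hε t ht')
    refine (norm_sub_le _ _).trans ?_
    linarith
  have h2 : ∀ t ∈ uIcc a b, ‖θ (q t) (p t - q t)‖ ≤ C * ε := fun t ht =>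
    ContinuousLinearMap.le_of_opNorm_le_of_le _ (hC _ (hqB ht)).1 (hε t ht)
  have h3 := h2 a left_mem_uIcc
  have h4 := h2 b right_mem_uIcc
  have h5 : (2 * C * L * ε) * |b - a| ≤ 2 * C * L * ε :=
    mul_le_of_le_one_right (by positivity) hab
  refine (norm_add_le _ _).trans ((add_le_add h1 (norm_sub_le _ _)).trans ?_)
  linarith

end LipCurve

theorem hasDerivAt_zero_of_norm_le_sq {r : ℝ → R} {s₀ K : ℝ}
    (h : ∀ᶠ s in 𝓝 s₀, ‖r s‖ ≤ K * |s - s₀| ^ 2) : HasDerivAt r 0 s₀ := by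
  have h1 : r =O[𝓝 s₀] fun s => ‖s - s₀‖ ^ 2 := by
    refine Asymptotics.IsBigO.of_bound K ?_
    filter_upwards [h] with s hs
    simpa using hs
  simpa using (h1.hasFDerivAt (𝕜 := ℝ) one_lt_two).hasDerivAt

/-- The derivative of the line integral of a one-form with respect to the curve, whose end point
may move. -/
theorem hasDerivAt_line_integral [CompleteSpace E] [CompleteSpace R] {L : NNReal} {B : Set E}
    (hB : IsOpen B) (hBc : Convex ℝ B) {θ : E → E →L[ℝ] R} (hθ : ContDiffOn ℝ 1 θ B) {C : ℝ}
    (hC : ∀ y ∈ B, ‖θ y‖ ≤ C ∧ ‖fderiv ℝ θ y‖ ≤ C) {Z : ℝ → ℝ → E} {w : ℝ → E} {τ : ℝ → ℝ}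
    {t₁ t₀ s₀ : ℝ} {w₁ w₀ : E}
    (h1 : ∀ᶠ s in 𝓝 s₀, LipCurve L (Z s) t₁ t₀ ∧ MapsTo (Z s) (uIcc t₁ t₀) B ∧
      ∀ t ∈ uIcc t₁ t₀, ‖Z s t - Z s₀ t‖ ≤ L * |s - s₀|)
    (h2 : ∀ᵐ t, t ∈ uIoc t₁ t₀ →
      HasDerivAt (fun s => Z s t) (w t) s₀ ∧ ContinuousAt (fun s => deriv (Z s) t) s₀)
    (hw₁ : HasDerivAt (fun s => Z s t₁) w₁ s₀)
    (h3 : ∀ᶠ s in 𝓝 s₀, |τ s - t₀| ≤ |s - s₀| ∧ LipCurve L (Z s) t₀ (τ s) ∧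
      MapsTo (Z s) (uIcc t₀ (τ s)) B)
    (hw₀ : HasDerivAt (fun s => Z s (τ s)) w₀ s₀) :
    HasDerivAt (fun s => (∫ t in t₁..t₀, θ (Z s t) (deriv (Z s) t))
        + ∫ t in t₀..τ s, θ (Z s t) (deriv (Z s) t))
      (θ (Z s₀ t₀) w₀ - θ (Z s₀ t₁) w₁
        - ∫ t in t₁..t₀, (fderiv ℝ θ (Z s₀ t) (deriv (Z s₀) t) (w t)
          - fderiv ℝ θ (Z s₀ t) (w t) (deriv (Z s₀) t))) s₀ := by
  obtain ⟨hq, hqB, -⟩ := h1.self_of_nhds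
  have hC0 : 0 ≤ C := (norm_nonneg _).trans (hC _ (hqB left_mem_uIcc)).1
  have hdθ : ∀ y ∈ B, DifferentiableAt ℝ θ y := fun y hy =>
    (hθ.differentiableOn (by simp)).differentiableAt (hB.mem_nhds hy)
  have hlip : ∀ x ∈ B, ∀ y ∈ B, ‖θ y - θ x‖ ≤ C * ‖y - x‖ := fun x hx y hy =>
    hBc.norm_image_sub_le_of_norm_fderiv_le (𝕜 := ℝ) hdθ (fun y hy => (hC y hy).2) hx hy
  -- The integrand left after integration by parts. It vanishes at `s = s₀` and is Lipschitz in `s`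
  -- uniformly in `t`, so it can be differentiated under the integral sign at `s₀`.
  set J : ℝ → ℝ → R := fun s t => (θ (Z s t) - θ (Z s₀ t)) (deriv (Z s) t)
    - fderiv ℝ θ (Z s₀ t) (deriv (Z s₀) t) (Z s t - Z s₀ t) with hJ
  have dJ : HasDerivAt (fun s => ∫ t in t₁..t₀, J s t)
      (∫ t in t₁..t₀, (fderiv ℝ θ (Z s₀ t) (w t) (deriv (Z s₀) t)
        - fderiv ℝ θ (Z s₀ t) (deriv (Z s₀) t) (w t))) s₀ := by
    refine hasDerivAt_intervalIntegral_of_lip (C := C * L * L + C * L * L) ?_ ?_ ?_ ?_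
    · intro t; simp [hJ]
    · filter_upwards [h1] with s hs
      have c1 : ContinuousOn (fun t => θ (Z s t) - θ (Z s₀ t)) (uIcc t₁ t₀) :=
        (hθ.continuousOn.comp hs.1.lip.continuousOn hs.2.1).sub
          (hθ.continuousOn.comp hq.lip.continuousOn hqB)
      have c2 : ContinuousOn (fun t => (fderiv ℝ θ (Z s₀ t)).flip (Z s t - Z s₀ t))
          (uIcc t₁ t₀) := by
        have h1 : ContinuousOn (fun t => fderiv ℝ θ (Z s₀ t)) (uIcc t₁ t₀) :=
          (hθ.continuousOn_fderiv_of_isOpen hB le_rfl).comp hq.lip.continuousOn hqB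
        have h2 := (ContinuousLinearMap.flipₗᵢ ℝ E E R).continuous.comp_continuousOn h1
        exact h2.clm_apply (hs.1.lip.continuousOn.sub hq.lip.continuousOn)
      exact (LipCurve.aestronglyMeasurable_apply c1).sub (LipCurve.aestronglyMeasurable_apply c2)
    · filter_upwards [h1] with s hs
      filter_upwards [hs.1.ae_norm_deriv_le, hq.ae_norm_deriv_le] with t e1 e2 ht
      have ht' := uIoc_subset_uIcc ht
      have b1 : ‖θ (Z s t) - θ (Z s₀ t)‖ ≤ C * (L * |s - s₀|) :=
        (hlip _ (hqB ht') _ (hs.2.1 ht')).trans (mul_le_mul_of_nonneg_left (hs.2.2 t ht') hC0)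
      have b2 := ContinuousLinearMap.le_of_opNorm_le_of_le _ b1 (e1 ht)
      have b3 := ContinuousLinearMap.le_of_opNorm_le_of_le _
        (ContinuousLinearMap.le_of_opNorm_le_of_le _ (hC _ (hqB ht')).2 (e2 ht)) (hs.2.2 t ht')
      refine (norm_sub_le _ _).trans ((add_le_add b2 b3).trans (le_of_eq ?_))
      ring
    · filter_upwards [h2] with t e ht
      obtain ⟨e1, e2⟩ := e ht
      have ht' := uIoc_subset_uIcc ht
      have d1 : HasDerivAt (fun s => θ (Z s t) - θ (Z s₀ t)) (fderiv ℝ θ (Z s₀ t) (w t)) s₀ :=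
        ((hdθ _ (hqB ht')).hasFDerivAt.comp_hasDerivAt s₀ e1).sub_const _
      have d2 := hasDerivAt_bilin_of_eq_zero (ContinuousLinearMap.id ℝ (E →L[ℝ] R))
        (sub_self _) d1 e2
      have d3 := (fderiv ℝ θ (Z s₀ t) (deriv (Z s₀) t)).hasFDerivAt.comp_hasDerivAt s₀
        (e1.sub_const (Z s₀ t))
      exact d2.sub d3
  -- The error of freezing `θ` at the end point on the short interval from `t₀` to `τ s`. Length of
  -- the interval and variation of `θ` are both of first order, so the error is quadratic.
  set r : ℝ → R := fun s => ∫ t in t₀..τ s, (θ (Z s t) - θ (Z s₀ t₀)) (deriv (Z s) t) with hr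
  have dr : HasDerivAt r 0 s₀ := by
    refine hasDerivAt_zero_of_norm_le_sq (K := C * (L + L) * L) ?_
    filter_upwards [h1, h3] with s e1 e3
    have e4 : ‖r s‖ ≤ C * ((L + L) * |s - s₀|) * L * |τ s - t₀| := by
      refine intervalIntegral.norm_integral_le_of_norm_le_const_ae ?_
      filter_upwards [e3.2.1.ae_norm_deriv_le] with t e5 ht
      have ht' := uIoc_subset_uIcc ht
      refine ContinuousLinearMap.le_of_opNorm_le_of_le _ ?_ (e5 ht)
      refine (hlip _ (hqB right_mem_uIcc) _ (e3.2.2 ht')).trans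
        (mul_le_mul_of_nonneg_left ?_ hC0)
      have b1 := e3.2.1.lip.norm_sub_le ht' left_mem_uIcc
      have b2 := e1.2.2 t₀ right_mem_uIcc
      have b3 : ‖t - t₀‖ ≤ |s - s₀| := (abs_sub_left_of_mem_uIcc ht').trans e3.1
      have b4 := mul_le_mul_of_nonneg_left b3 L.2
      have b5 := norm_sub_le_norm_sub_add_norm_sub (Z s t) (Z s t₀) (Z s₀ t₀)
      change (L : ℝ) * _ ≤ (L : ℝ) * _ at b4
      linarith
    refine e4.trans ((mul_le_mul_of_nonneg_left e3.1 (by positivity)).trans (le_of_eq ?_))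
    ring
  have dA : HasDerivAt (fun s => θ (Z s₀ t₀) (Z s (τ s) - Z s₀ t₀)) (θ (Z s₀ t₀) w₀) s₀ :=
    (θ (Z s₀ t₀)).hasFDerivAt.comp_hasDerivAt s₀ (hw₀.sub_const _)
  have dB : HasDerivAt (fun s => θ (Z s₀ t₁) (Z s t₁ - Z s₀ t₁)) (θ (Z s₀ t₁) w₁) s₀ :=
    (θ (Z s₀ t₁)).hasFDerivAt.comp_hasDerivAt s₀ (hw₁.sub_const _)
  have key := (((dJ.add dA).sub dB).add dr).add_const
    (∫ t in t₁..t₀, θ (Z s₀ t) (deriv (Z s₀) t))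
  have hval : θ (Z s₀ t₀) w₀ - θ (Z s₀ t₁) w₁
        - ∫ t in t₁..t₀, (fderiv ℝ θ (Z s₀ t) (deriv (Z s₀) t) (w t)
          - fderiv ℝ θ (Z s₀ t) (w t) (deriv (Z s₀) t)) =
      (∫ t in t₁..t₀, (fderiv ℝ θ (Z s₀ t) (w t) (deriv (Z s₀) t)
        - fderiv ℝ θ (Z s₀ t) (deriv (Z s₀) t) (w t))) + θ (Z s₀ t₀) w₀ - θ (Z s₀ t₁) w₁ + 0 := by
    rw [add_zero, ← neg_add_eq_sub, ← intervalIntegral.integral_neg]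
    simp only [neg_sub]
    abel
  rw [hval]
  refine key.congr_of_eventuallyEq ?_
  filter_upwards [h1, h3] with s e1 e3
  have f1 := e1.1.line_integral_sub hq hB hθ e1.2.1 hqB
  have c1 : ContinuousOn (fun t => θ (Z s t)) (uIcc t₀ (τ s)) :=
    hθ.continuousOn.comp e3.2.1.lip.continuousOn e3.2.2
  have i1 := e3.2.1.intervalIntegrable_apply c1
  have i2 := e3.2.1.intervalIntegrable_apply (k := fun _ => θ (Z s₀ t₀)) continuousOn_const
  have f2 : r s = (∫ t in t₀..τ s, θ (Z s t) (deriv (Z s) t))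
      - θ (Z s₀ t₀) (Z s (τ s) - Z s t₀) := by
    have f3 : ∫ t in t₀..τ s, θ (Z s₀ t₀) (deriv (Z s) t) = θ (Z s₀ t₀) (Z s (τ s) - Z s t₀) := by
      obtain ⟨F, hF⟩ := e3.2.1.diff
      rw [map_sub]
      refine integral_eq_of_hasDerivAt_off_countable (fun t => θ (Z s₀ t₀) (Z s t)) _
        F.finite_toSet.countable
        ((θ (Z s₀ t₀)).continuous.comp_continuousOn e3.2.1.lip.continuousOn) ?_ i2
      rintro t ⟨ht, htF⟩
      exact (θ (Z s₀ t₀)).hasFDerivAt.comp_hasDerivAt t (hF t ht (by simpa using htF)).hasDerivAt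
    rw [← f3, ← intervalIntegral.integral_sub i1 i2]
    rfl
  rw [sub_eq_iff_eq_add] at f1
  simp only [Pi.add_apply, Pi.sub_apply, f1, f2, hJ, map_sub]
  abel

end LineIntegrals

end HigherHol

namespace HigherHol

open Filter

/-! ### One-forms and piecewise smooth squares in a single chart. -/

section LocalCharts

variable {E : Type*} [NormedAddCommGroup E] [NormedSpace ℝ E]
  {M : Type*} [TopologicalSpace M] [ChartedSpace E M]
  {W : Type*} [NormedAddCommGroup W] [NormedSpace ℝ W]

/-- A one-form in the chart at `x₀`, as a field of linear maps. -/
noncomputable def DiffForm.linInChart (A : DiffForm E M W 1) (x₀ : M) (y : E) : E →L[ℝ] W :=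
  (ContinuousAlternatingMap.ofSubsingletonLIE (𝕜 := ℝ) (E := E) (F := W) (0 : Fin 1)).symm
    (inChart A.toFun x₀ y)

theorem DiffForm.linInChart_apply (A : DiffForm E M W 1) (x₀ : M) (y v : E) :
    A.linInChart x₀ y v = inChart A.toFun x₀ y (fun _ => v) := rfl

theorem DiffForm.contDiffOn_linInChart (A : DiffForm E M W 1) (x₀ : M) :
    ContDiffOn ℝ ∞ (A.linInChart x₀) (extChartAt 𝓘(ℝ, E) x₀).target :=
  (ContinuousAlternatingMap.ofSubsingletonLIE (𝕜 := ℝ) (E := E) (F := W)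
    (0 : Fin 1)).symm.contDiff.comp_contDiffOn (A.smooth x₀)

theorem DiffForm.extDeriv_eq (A : DiffForm E M W 1) {x₀ : M} {y : E}
    (hy : y ∈ (extChartAt 𝓘(ℝ, E) x₀).target) (v : Fin 2 → E) :
    extDeriv (inChart A.toFun x₀) y v = fderiv ℝ (A.linInChart x₀) y (v 0) (v 1)
      - fderiv ℝ (A.linInChart x₀) y (v 1) (v 0) := by
  set e := (ContinuousAlternatingMap.ofSubsingletonLIE (𝕜 := ℝ) (E := E) (F := W)
    (0 : Fin 1)).symm.toContinuousLinearEquiv with he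
  have h1 : fderiv ℝ (A.linInChart x₀) y = (e : _ →L[ℝ] _).comp
      (fderiv ℝ (inChart A.toFun x₀) y) :=
    (e.hasFDerivAt.comp y (A.differentiableAt hy).hasFDerivAt).fderiv
  have h2 : ∀ u w : E, fderiv ℝ (A.linInChart x₀) y u w
      = fderiv ℝ (inChart A.toFun x₀) y u (fun _ => w) := fun u w => by
    rw [h1]; rfl
  rw [extDeriv, ContinuousAlternatingMap.alternatizeUncurryFin_apply, Fin.sum_univ_two, h2, h2]
  have e0 : (Fin.removeNth 0 v : Fin 1 → E) = fun _ => v 1 := by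
    funext i; fin_cases i; rfl
  have e1 : (Fin.removeNth 1 v : Fin 1 → E) = fun _ => v 0 := by
    funext i; fin_cases i; rfl
  rw [e0, e1]
  simp [sub_eq_add_neg]

/-- The unit square. -/
abbrev unitSquare : Set (ℝ × ℝ) := Icc 0 1 ×ˢ Icc 0 1

/-- Uniform bounds for `Γ` and the one-form `A` in the chart at `Γ p`, near the point `p` of the
unit square. -/
structure ChartBounds (Γ : ℝ × ℝ → M) (A : DiffForm E M W 1) (p : ℝ × ℝ) (r : ℝ) (L : NNReal)
    (C : ℝ) (B : Set E) : Prop where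
  isOpen : IsOpen B
  convex : Convex ℝ B
  subset : B ⊆ (extChartAt 𝓘(ℝ, E) (Γ p)).target
  bound : ∀ y ∈ B, ‖A.linInChart (Γ p) y‖ ≤ C ∧ ‖fderiv ℝ (A.linInChart (Γ p)) y‖ ≤ C
  mem : ∀ q ∈ unitSquare ∩ Metric.ball p r,
    Γ q ∈ (extChartAt 𝓘(ℝ, E) (Γ p)).source ∧ extChartAt 𝓘(ℝ, E) (Γ p) (Γ q) ∈ B
  lip : LipschitzOnWith L (fun q => extChartAt 𝓘(ℝ, E) (Γ p) (Γ q))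
    (unitSquare ∩ Metric.ball p r)

/-- Each piece is Lipschitz in the chart near `p`. The straight segment between two nearby points of
the square is covered by finitely many pieces, and `dist_le_of_finite_closed_cover` then makes the
sum of the constants a Lipschitz constant for the whole map. -/
theorem PiecewiseSmoothOn.exists_chartBounds {Γ : ℝ × ℝ → M}
    (hΓ : PiecewiseSmoothOn E Γ unitSquare) (A : DiffForm E M W 1) {p : ℝ × ℝ}
    (hp : p ∈ unitSquare) : ∃ r > 0, ∃ L C B, ChartBounds Γ A p r L C B := by
  have hcont := hΓ.continuousOn p hp
  obtain ⟨S, hS, hU, hP⟩ := hΓ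
  set χ := extChartAt 𝓘(ℝ, E) (Γ p) with hχ
  set y₀ := χ (Γ p) with hy₀
  have hty : y₀ ∈ χ.target := mem_extChartAt_target (Γ p)
  have hto : χ.target ∈ 𝓝 y₀ := (isOpen_extChartAt_target (Γ p)).mem_nhds hty
  have hθ := A.contDiffOn_linInChart (Γ p)
  have hθ0 : ContinuousAt (A.linInChart (Γ p)) y₀ := hθ.continuousOn.continuousAt hto
  have hθ1 : ContinuousAt (fderiv ℝ (A.linInChart (Γ p))) y₀ :=
    (hθ.continuousOn_fderiv_of_isOpen (isOpen_extChartAt_target (Γ p)) (by simp)).continuousAt hto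
  have hθ2 : ContinuousAt (fun y => ‖fderiv ℝ (A.linInChart (Γ p)) y‖) y₀ :=
    (continuous_norm (E := E →L[ℝ] E →L[ℝ] W)).continuousAt.comp hθ1
  obtain ⟨ρ, hρ, hρB⟩ := Metric.mem_nhds_iff.1 ((eventually_mem_set.2 hto).and
    ((hθ0.norm.eventually_lt_const (lt_add_one _)).and
      (hθ2.eventually_lt_const (lt_add_one _))))
  have hmem : ∀ᶠ q in 𝓝[unitSquare] p, Γ q ∈ χ.source ∧ χ (Γ q) ∈ Metric.ball y₀ ρ := by
    have h1 := eventually_mem_chart_source (E := E) hcont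
    have h2 : ContinuousWithinAt (fun q => χ (Γ q)) unitSquare p :=
      (continuousAt_extChartAt (I := 𝓘(ℝ, E)) (Γ p)).comp_continuousWithinAt hcont
    exact h1.and (h2.eventually (Metric.ball_mem_nhds y₀ hρ))
  have hLip : ∀ P ∈ S, ∃ L : NNReal, ∃ u ∈ 𝓝 p,
      LipschitzOnWith L (fun q => χ (Γ q)) (P ∩ u) := by
    intro P hPS
    by_cases hpP : p ∈ P
    · have hcd := contDiffWithinAt_chart ((hP P hPS).2.2 p hpP)
      obtain ⟨L, u, hu, hL⟩ :=
        (hcd.of_le (by simp : (1 : WithTop ℕ∞) ≤ ∞)).exists_lipschitzOnWith (hP P hPS).2.1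
      obtain ⟨O, hO, hpO, hOP⟩ := mem_nhdsWithin.1 hu
      exact ⟨L, O, hO.mem_nhds hpO, hL.mono fun q hq => hOP ⟨hq.2, hq.1⟩⟩
    -- A piece that does not contain `p` is removed by shrinking the neighbourhood.
    · refine ⟨0, Pᶜ, (hP P hPS).1.isClosed.isOpen_compl.mem_nhds hpP, ?_⟩
      rw [inter_compl_self]
      exact fun x hx => absurd hx (notMem_empty x)
  choose! L u hu hL using hLip
  obtain ⟨r₁, hr₁, h1⟩ := Metric.mem_nhds_iff.1 ((biInter_mem hS).2 hu)
  obtain ⟨r₂, hr₂, h2⟩ := Metric.mem_nhdsWithin_iff.1 hmem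
  set Λ : NNReal := ∑ P ∈ hS.toFinset, L P with hΛ
  have hball : Convex ℝ (unitSquare ∩ Metric.ball p (min r₁ r₂)) :=
    ((convex_Icc _ _).prod (convex_Icc _ _)).inter (convex_ball _ _)
  refine ⟨min r₁ r₂, lt_min hr₁ hr₂, Λ, max (‖A.linInChart (Γ p) y₀‖ + 1)
    (‖fderiv ℝ (A.linInChart (Γ p)) y₀‖ + 1), Metric.ball y₀ ρ, Metric.isOpen_ball,
    convex_ball _ _, fun y hy => (hρB hy).1, fun y hy => ?_, fun q hq => ?_, ?_⟩
  · exact ⟨(hρB hy).2.1.le.trans (le_max_left _ _), (hρB hy).2.2.le.trans (le_max_right _ _)⟩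
  · exact h2 ⟨Metric.ball_subset_ball (min_le_right _ _) hq.2, hq.1⟩
  · refine LipschitzOnWith.of_dist_le_mul fun x hx y hy => ?_
    have hseg : ∀ t ∈ Icc (0 : ℝ) 1, x + t • (y - x) ∈ unitSquare ∩ Metric.ball p (min r₁ r₂) :=
      fun t ht => hball.add_smul_sub_mem hx hy ht
    have hcl : Continuous fun t : ℝ => x + t • (y - x) := by fun_prop
    have key := dist_le_of_finite_closed_cover (g := fun t : ℝ => χ (Γ (x + t • (y - x))))
      (L := Λ * dist x y)
      (hS.toFinset.image fun P => (fun t : ℝ => x + t • (y - x)) ⁻¹' P) 0 1 zero_le_one ?_ ?_ ?_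
    · simpa only [zero_smul, add_zero, one_smul, add_sub_cancel, sub_zero, mul_one] using key
    · intro t ht
      have := (hseg t ht).1
      rw [← hU] at this
      obtain ⟨P, hPS, htP⟩ := this
      simp only [Finset.mem_image, Finite.mem_toFinset, iUnion_exists, mem_iUnion]
      exact ⟨_, P, ⟨hPS, rfl⟩, htP⟩
    · intro Q hQ
      obtain ⟨P, hPS, rfl⟩ := Finset.mem_image.1 hQ
      exact (hP P (hS.mem_toFinset.1 hPS)).1.isClosed.preimage hcl
    · intro Q hQ t ht t' ht' htt
      obtain ⟨P, hPS, rfl⟩ := Finset.mem_image.1 hQ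
      have hPS' := hS.mem_toFinset.1 hPS
      have hmem' : ∀ t ∈ Icc (0 : ℝ) 1, x + t • (y - x) ∈ u P := fun t ht =>
        mem_iInter₂.1 (h1 (Metric.ball_subset_ball (min_le_left _ _) (hseg t ht).2)) P hPS'
      have h3 := (hL P hPS').dist_le_mul _ ⟨ht.1, hmem' t ht.2⟩ _ ⟨ht'.1, hmem' t' ht'.2⟩
      have h4 : dist (x + t • (y - x)) (x + t' • (y - x)) = (t' - t) * dist x y := by
        rw [dist_add_left, dist_eq_norm, ← sub_smul, norm_smul, Real.norm_eq_abs, abs_sub_comm,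
          abs_of_nonneg (sub_nonneg.2 htt), dist_comm, dist_eq_norm]
      have h5 : (L P : ℝ) ≤ Λ := by
        exact_mod_cast Finset.single_le_sum (f := L) (fun _ _ => zero_le) hPS
      rw [h4] at h3
      refine h3.trans ((mul_le_mul_of_nonneg_right h5
        (mul_nonneg (sub_nonneg.2 htt) dist_nonneg)).trans (le_of_eq ?_))
      ring

end LocalCharts

end HigherHol

namespace HigherHol

open Filter

theorem exists_near_of_eventually_offFin {p : ℝ → Prop} (h : ∀ᶠ t in offFin, p t) {y : ℝ}
    (hy : y ∈ Icc (0 : ℝ) 1) {r : ℝ} (hr : 0 < r) :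
    ∃ t ∈ Icc (0 : ℝ) 1 ∩ Metric.ball y r, p t := by
  obtain ⟨F, hF⟩ := eventually_offFin_iff.1 h
  have hlt : max 0 (y - r) < min 1 (y + r) := by
    have h1 := hy.1
    have h2 := hy.2
    rw [max_lt_iff, lt_min_iff, lt_min_iff]
    refine ⟨⟨by norm_num, by linarith⟩, by linarith, by linarith⟩
  obtain ⟨t, ht, htF⟩ := ((Ioo_infinite hlt).sdiff F.finite_toSet).nonempty
  rw [mem_Ioo, max_lt_iff, lt_min_iff] at ht
  refine ⟨t, ⟨⟨ht.1.1.le, ht.2.1.le⟩, ?_⟩, hF t ⟨ht.1.1, ht.2.1⟩ (by simpa using htF)⟩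
  rw [Metric.mem_ball, Real.dist_eq, abs_lt]
  exact ⟨by linarith [ht.1.2], by linarith [ht.2.2]⟩

/-! ### Horizontal line integrals inside one chart. -/

section LineIntegralsAlongSurfaces

variable {E : Type*} [NormedAddCommGroup E] [NormedSpace ℝ E] [FiniteDimensional ℝ E]
  {M : Type*} [TopologicalSpace M] [ChartedSpace E M] [IsManifold 𝓘(ℝ, E) ∞ M]
  {W : Type*} [NormedAddCommGroup W] [NormedSpace ℝ W] [CompleteSpace W]
  {X : Type*} [NormedAddCommGroup X] [NormedSpace ℝ X]

theorem contDiffAt_chart {f : X → M} {q : X} {x₀ : M} (hf : ContMDiffAt 𝓘(ℝ, X) 𝓘(ℝ, E) ∞ f q)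
    (hq : f q ∈ (extChartAt 𝓘(ℝ, E) x₀).source) :
    ContDiffAt ℝ ∞ (fun q => extChartAt 𝓘(ℝ, E) x₀ (f q)) q :=
  contMDiffAt_iff_contDiffAt.1 (((contMDiffAt_extChartAt' (n := ∞)
    (by rwa [extChartAt_source] at hq)).comp q hf))

theorem differentiableAt_chart {f : X → M} {q : X} {x₀ : M}
    (hf : MDifferentiableAt 𝓘(ℝ, X) 𝓘(ℝ, E) f q) (hq : f q ∈ (extChartAt 𝓘(ℝ, E) x₀).source) :
    DifferentiableAt ℝ (fun q => extChartAt 𝓘(ℝ, E) x₀ (f q)) q := by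
  have : IsManifold 𝓘(ℝ, E) 1 M := IsManifold.of_le (n := ∞) (by simp)
  exact mdifferentiableAt_iff_differentiableAt.1
    ((mdifferentiableAt_extChartAt (by rwa [extChartAt_source] at hq)).comp q hf)

theorem DiffForm.alongPath_eq_chart (A : DiffForm E M W 1) {c : ℝ → M} {t : ℝ} {x₀ : M}
    (hc : MDifferentiableAt 𝓘(ℝ, ℝ) 𝓘(ℝ, E) c t) (ht : c t ∈ (extChartAt 𝓘(ℝ, E) x₀).source) :
    A.alongPath c t = A.linInChart x₀ (extChartAt 𝓘(ℝ, E) x₀ (c t))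
      (deriv (fun t => extChartAt 𝓘(ℝ, E) x₀ (c t)) t) := by
  rw [A.alongPath_eq_along, A.along_eq_chart x₀ hc ht, A.linInChart_apply]
  simp only [fderiv_apply_one_eq_deriv]

/-- The line integral of `A` along the horizontal curve `t ↦ Γ(t, s)` from `t₁` to `t₂`. -/
noncomputable def hInt (A : DiffForm E M W 1) (Γ : ℝ × ℝ → M) (t₁ t₂ s : ℝ) : W :=
  ∫ t in t₁..t₂, A.alongPath (fun t => Γ (t, s)) t

variable {Γ : ℝ × ℝ → M} {A : DiffForm E M W 1}

theorem PiecewiseSmoothOn.intervalIntegrable_alongPath (hΓ : PiecewiseSmoothOn E Γ unitSquare)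
    (A : DiffForm E M W 1) {s t₁ t₂ : ℝ} (hs : s ∈ Icc (0 : ℝ) 1) (h₁ : t₁ ∈ Icc (0 : ℝ) 1)
    (h₂ : t₂ ∈ Icc (0 : ℝ) 1) :
    IntervalIntegrable (A.alongPath fun t => Γ (t, s)) volume t₁ t₂ :=
  ((hΓ.isPath_fst hs).pCont_alongPath A).intervalIntegrable h₁ h₂

theorem PiecewiseSmoothOn.hInt_add (hΓ : PiecewiseSmoothOn E Γ unitSquare)
    (A : DiffForm E M W 1) {s t₁ t₂ t₃ : ℝ} (hs : s ∈ Icc (0 : ℝ) 1) (h₁ : t₁ ∈ Icc (0 : ℝ) 1)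
    (h₂ : t₂ ∈ Icc (0 : ℝ) 1) (h₃ : t₃ ∈ Icc (0 : ℝ) 1) :
    hInt A Γ t₁ t₂ s + hInt A Γ t₂ t₃ s = hInt A Γ t₁ t₃ s :=
  intervalIntegral.integral_add_adjacent_intervals
    (hΓ.intervalIntegrable_alongPath A hs h₁ h₂) (hΓ.intervalIntegrable_alongPath A hs h₂ h₃)

namespace ChartBounds

variable {p : ℝ × ℝ} {r : ℝ} {L : NNReal} {C : ℝ} {B : Set E}

theorem uIcc_subset {x : ℝ} {t₁ t₂ : ℝ} (h₁ : t₁ ∈ Icc (0 : ℝ) 1 ∩ Metric.ball x r)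
    (h₂ : t₂ ∈ Icc (0 : ℝ) 1 ∩ Metric.ball x r) : uIcc t₁ t₂ ⊆ Icc (0 : ℝ) 1 ∩ Metric.ball x r := by
  have : Convex ℝ (Icc (0 : ℝ) 1 ∩ Metric.ball x r) := (convex_Icc _ _).inter (convex_ball _ _)
  exact this.ordConnected.uIcc_subset h₁ h₂

theorem mem_square {t s : ℝ} (ht : t ∈ Icc (0 : ℝ) 1 ∩ Metric.ball p.1 r)
    (hs : s ∈ Icc (0 : ℝ) 1 ∩ Metric.ball p.2 r) : (t, s) ∈ unitSquare ∩ Metric.ball p r :=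
  ⟨⟨ht.1, hs.1⟩, by rw [Metric.mem_ball, Prod.dist_eq]; exact max_lt ht.2 hs.2⟩

theorem lipCurve (h : ChartBounds Γ A p r L C B)
    (hΓ : PiecewiseSmoothOn E Γ unitSquare) {s t₁ t₂ : ℝ} (hs : s ∈ Icc (0 : ℝ) 1 ∩ Metric.ball p.2 r)
    (h₁ : t₁ ∈ Icc (0 : ℝ) 1 ∩ Metric.ball p.1 r) (h₂ : t₂ ∈ Icc (0 : ℝ) 1 ∩ Metric.ball p.1 r) :
    LipCurve L (fun t => extChartAt 𝓘(ℝ, E) (Γ p) (Γ (t, s))) t₁ t₂ := by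
  have hsub := uIcc_subset h₁ h₂
  refine ⟨LipschitzOnWith.of_dist_le_mul fun x hx y hy => ?_, ?_⟩
  · refine (h.lip.dist_le_mul _ (mem_square (hsub hx) hs) _ (mem_square (hsub hy) hs)).trans
      (le_of_eq ?_)
    rw [Prod.dist_eq, dist_self, max_eq_left dist_nonneg]
  · obtain ⟨F, hF⟩ := eventually_offFin_iff.1 (hΓ.isPath_fst hs.1).eventually_contMDiffAt
    refine ⟨F, fun t ht htF => ?_⟩
    have ht' : t ∈ Ioo (0 : ℝ) 1 :=
      ⟨(le_min h₁.1.1 h₂.1.1).trans_lt ht.1, ht.2.trans_le (max_le h₁.1.2 h₂.1.2)⟩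
    exact differentiableAt_chart ((hF t ht' htF).mdifferentiableAt (by simp))
      (h.mem _ (mem_square (hsub (Ioo_subset_Icc_self ht)) hs)).1

theorem mapsTo (h : ChartBounds Γ A p r L C B) {s t₁ t₂ : ℝ} (hs : s ∈ Icc (0 : ℝ) 1 ∩ Metric.ball p.2 r)
    (h₁ : t₁ ∈ Icc (0 : ℝ) 1 ∩ Metric.ball p.1 r) (h₂ : t₂ ∈ Icc (0 : ℝ) 1 ∩ Metric.ball p.1 r) :
    MapsTo (fun t => extChartAt 𝓘(ℝ, E) (Γ p) (Γ (t, s))) (uIcc t₁ t₂) B := fun _ ht =>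
  (h.mem _ (mem_square (uIcc_subset h₁ h₂ ht) hs)).2

theorem norm_sub_le (h : ChartBounds Γ A p r L C B) {s s' t : ℝ} (hs : s ∈ Icc (0 : ℝ) 1 ∩ Metric.ball p.2 r)
    (hs' : s' ∈ Icc (0 : ℝ) 1 ∩ Metric.ball p.2 r) (ht : t ∈ Icc (0 : ℝ) 1 ∩ Metric.ball p.1 r) :
    ‖extChartAt 𝓘(ℝ, E) (Γ p) (Γ (t, s)) - extChartAt 𝓘(ℝ, E) (Γ p) (Γ (t, s'))‖
      ≤ L * |s - s'| := by
  refine (h.lip.norm_sub_le (mem_square ht hs) (mem_square ht hs')).trans (le_of_eq ?_)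
  rw [← dist_eq_norm, Prod.dist_eq, dist_self, max_eq_right dist_nonneg]
  rfl

theorem hInt_eq (h : ChartBounds Γ A p r L C B)
    (hΓ : PiecewiseSmoothOn E Γ unitSquare) {s t₁ t₂ : ℝ} (hs : s ∈ Icc (0 : ℝ) 1 ∩ Metric.ball p.2 r)
    (h₁ : t₁ ∈ Icc (0 : ℝ) 1 ∩ Metric.ball p.1 r) (h₂ : t₂ ∈ Icc (0 : ℝ) 1 ∩ Metric.ball p.1 r) :
    hInt A Γ t₁ t₂ s = ∫ t in t₁..t₂,
      A.linInChart (Γ p) (extChartAt 𝓘(ℝ, E) (Γ p) (Γ (t, s)))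
        (deriv (fun t => extChartAt 𝓘(ℝ, E) (Γ p) (Γ (t, s))) t) := by
  refine intervalIntegral.integral_congr_ae ?_
  filter_upwards [ae_uIoc_of_eventually_offFin (hΓ.isPath_fst hs.1).eventually_contMDiffAt
    h₁.1 h₂.1] with t ht htI
  exact A.alongPath_eq_chart ((ht htI).mdifferentiableAt (by simp))
    (h.mem _ (mem_square (uIcc_subset h₁ h₂ (uIoc_subset_uIcc htI)) hs)).1

theorem norm_hInt_sub_le (h : ChartBounds Γ A p r L C B)
    (hΓ : PiecewiseSmoothOn E Γ unitSquare) {s s' t₁ t₂ : ℝ} (hs : s ∈ Icc (0 : ℝ) 1 ∩ Metric.ball p.2 r)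
    (hs' : s' ∈ Icc (0 : ℝ) 1 ∩ Metric.ball p.2 r)
    (h₁ : t₁ ∈ Icc (0 : ℝ) 1 ∩ Metric.ball p.1 r) (h₂ : t₂ ∈ Icc (0 : ℝ) 1 ∩ Metric.ball p.1 r) :
    ‖hInt A Γ t₁ t₂ s - hInt A Γ t₁ t₂ s'‖ ≤ (2 * C * L + 2 * C) * (L * |s - s'|) := by
  rw [h.hInt_eq hΓ hs h₁ h₂, h.hInt_eq hΓ hs' h₁ h₂]
  refine (h.lipCurve hΓ hs h₁ h₂).norm_line_integral_sub_le (h.lipCurve hΓ hs' h₁ h₂) h.isOpen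
    h.convex (((A.contDiffOn_linInChart (Γ p)).mono h.subset).of_le (by simp)) h.bound
    (h.mapsTo hs h₁ h₂) (h.mapsTo hs' h₁ h₂)
    (fun t ht => h.norm_sub_le hs hs' (uIcc_subset h₁ h₂ ht)) ?_
  rw [abs_le]
  constructor <;> linarith [h₁.1.1, h₁.1.2, h₂.1.1, h₂.1.2]

/-- The derivative of horizontal line integrals inside one chart. -/
theorem hasDerivAt_hInt (h : ChartBounds Γ A p r L C B)
    (hΓ : PiecewiseSmoothOn E Γ unitSquare) {G : Set (ℝ × ℝ)} (hG : GoodSet E Γ G) (hr : 0 < r)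
    (hs₀ : p.2 ∈ Ioo (0 : ℝ) 1) (hsl : ∀ᶠ t in offFin, (t, p.2) ∈ G) {φ : ℝ → W}
    (hφ : ∀ t, (t, p.2) ∈ G → ∀ x₀, Γ (t, p.2) ∈ (extChartAt 𝓘(ℝ, E) x₀).source →
      φ t = extDeriv (inChart A.toFun x₀) (extChartAt 𝓘(ℝ, E) x₀ (Γ (t, p.2)))
        ![fderiv ℝ (fun q => extChartAt 𝓘(ℝ, E) x₀ (Γ q)) (t, p.2) (1, 0),
          fderiv ℝ (fun q => extChartAt 𝓘(ℝ, E) x₀ (Γ q)) (t, p.2) (0, 1)])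
    {t₁ t₀ : ℝ} (h₁ : t₁ ∈ Icc (0 : ℝ) 1 ∩ Metric.ball p.1 r)
    (h₀ : t₀ ∈ Icc (0 : ℝ) 1 ∩ Metric.ball p.1 r)
    (hd₁ : MDifferentiableAt 𝓘(ℝ, ℝ) 𝓘(ℝ, E) (fun s => Γ (t₁, s)) p.2) {τ : ℝ → ℝ}
    (hτ : ∀ᶠ s in 𝓝 p.2, |τ s - t₀| ≤ |s - p.2| ∧ τ s ∈ Icc (0 : ℝ) 1)
    (hd₀ : MDifferentiableAt 𝓘(ℝ, ℝ) 𝓘(ℝ, E) (fun s => Γ (τ s, s)) p.2) :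
    HasDerivAt (fun s => hInt A Γ t₁ t₀ s + hInt A Γ t₀ (τ s) s)
      (A.alongPath (fun s => Γ (τ s, s)) p.2 - A.alongPath (fun s => Γ (t₁, s)) p.2
        - ∫ t in t₁..t₀, φ t) p.2 := by
  set s₀ := p.2 with hs₀'
  have hτ₀ : τ s₀ = t₀ := by
    have := hτ.self_of_nhds.1
    simp only [sub_self, abs_zero] at this
    exact sub_eq_zero.1 (abs_nonpos_iff.1 this)
  have hs₀m : s₀ ∈ Icc (0 : ℝ) 1 ∩ Metric.ball p.2 r :=
    ⟨Ioo_subset_Icc_self hs₀, Metric.mem_ball_self hr⟩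
  have hsn : ∀ᶠ s in 𝓝 s₀, s ∈ Icc (0 : ℝ) 1 ∩ Metric.ball p.2 r :=
    inter_mem (Icc_mem_nhds hs₀.1 hs₀.2) (Metric.ball_mem_nhds _ hr)
  have hτm : ∀ᶠ s in 𝓝 s₀, τ s ∈ Icc (0 : ℝ) 1 ∩ Metric.ball p.1 r := by
    have h1 : Tendsto τ (𝓝 s₀) (𝓝 t₀) := by
      rw [tendsto_iff_dist_tendsto_zero]
      have h2 : Tendsto (fun s => |s - s₀|) (𝓝 s₀) (𝓝 0) := by
        have : Continuous fun s : ℝ => |s - s₀| := by fun_prop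
        simpa using this.tendsto s₀
      exact squeeze_zero' (Eventually.of_forall fun _ => dist_nonneg)
        (hτ.mono fun s hs => hs.1) h2
    filter_upwards [hτ, h1.eventually (Metric.isOpen_ball.mem_nhds h₀.2)] with s h1 h2
    exact ⟨h1.2, h2⟩
  have hae : ∀ᵐ t, t ∈ uIoc t₁ t₀ → (t, s₀) ∈ G := ae_uIoc_of_eventually_offFin hsl h₁.1 h₀.1
  have hsrc : ∀ t ∈ uIcc t₁ t₀, Γ (t, s₀) ∈ (extChartAt 𝓘(ℝ, E) (Γ p)).source := fun t ht =>
    (h.mem _ (mem_square (uIcc_subset h₁ h₀ ht) hs₀m)).1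
  have hsm : ∀ t ∈ uIcc t₁ t₀, (t, s₀) ∈ G → ContDiffAt ℝ ∞
      (fun q => extChartAt 𝓘(ℝ, E) (Γ p) (Γ q)) (t, s₀) := fun t ht htG =>
    contDiffAt_chart (hG.contMDiffAt htG) (hsrc t ht)
  have hdt : ∀ t s, DifferentiableAt ℝ (fun q => extChartAt 𝓘(ℝ, E) (Γ p) (Γ q)) (t, s) →
      HasDerivAt (fun t => extChartAt 𝓘(ℝ, E) (Γ p) (Γ (t, s)))
        (fderiv ℝ (fun q => extChartAt 𝓘(ℝ, E) (Γ p) (Γ q)) (t, s) (1, 0)) t := fun t s hd =>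
    HasFDerivAt.comp_hasDerivAt (f := fun t => (t, s)) t hd.hasFDerivAt
      ((hasDerivAt_id' t).prodMk (hasDerivAt_const t s))
  have hds : ∀ t s, DifferentiableAt ℝ (fun q => extChartAt 𝓘(ℝ, E) (Γ p) (Γ q)) (t, s) →
      HasDerivAt (fun s => extChartAt 𝓘(ℝ, E) (Γ p) (Γ (t, s)))
        (fderiv ℝ (fun q => extChartAt 𝓘(ℝ, E) (Γ p) (Γ q)) (t, s) (0, 1)) s := fun t s hd =>
    HasFDerivAt.comp_hasDerivAt (f := fun s => (t, s)) s hd.hasFDerivAt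
      ((hasDerivAt_const s t).prodMk (hasDerivAt_id' s))
  have key := hasDerivAt_line_integral (L := L) h.isOpen h.convex
    (((A.contDiffOn_linInChart (Γ p)).mono h.subset).of_le (by simp)) h.bound
    (Z := fun s t => extChartAt 𝓘(ℝ, E) (Γ p) (Γ (t, s)))
    (w := fun t => fderiv ℝ (fun q => extChartAt 𝓘(ℝ, E) (Γ p) (Γ q)) (t, s₀) (0, 1))
    (τ := τ) (t₁ := t₁) (t₀ := t₀) (s₀ := s₀) ?_ ?_
    (differentiableAt_chart (x₀ := Γ p) hd₁ (hsrc t₁ left_mem_uIcc)).hasDerivAt ?_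
    (differentiableAt_chart (x₀ := Γ p) hd₀ ?_).hasDerivAt
  · have e1 := A.alongPath_eq_chart (x₀ := Γ p) hd₁ (hsrc t₁ left_mem_uIcc)
    have e0 := A.alongPath_eq_chart (x₀ := Γ p) hd₀
      (show Γ (τ s₀, s₀) ∈ _ by rw [hτ₀]; exact hsrc t₀ right_mem_uIcc)
    have e2 : ∫ t in t₁..t₀, φ t = ∫ t in t₁..t₀,
        (fderiv ℝ (A.linInChart (Γ p)) (extChartAt 𝓘(ℝ, E) (Γ p) (Γ (t, s₀)))
          (deriv (fun t => extChartAt 𝓘(ℝ, E) (Γ p) (Γ (t, s₀))) t)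
          (fderiv ℝ (fun q => extChartAt 𝓘(ℝ, E) (Γ p) (Γ q)) (t, s₀) (0, 1))
        - fderiv ℝ (A.linInChart (Γ p)) (extChartAt 𝓘(ℝ, E) (Γ p) (Γ (t, s₀)))
          (fderiv ℝ (fun q => extChartAt 𝓘(ℝ, E) (Γ p) (Γ q)) (t, s₀) (0, 1))
          (deriv (fun t => extChartAt 𝓘(ℝ, E) (Γ p) (Γ (t, s₀))) t)) := by
      refine intervalIntegral.integral_congr_ae ?_
      filter_upwards [hae] with t ht htI
      have ht' := uIoc_subset_uIcc htI
      rw [hφ t (ht htI) (Γ p) (hsrc t ht'), A.extDeriv_eq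
        (h.subset (h.mem _ (mem_square (uIcc_subset h₁ h₀ ht') hs₀m)).2),
        (hdt t s₀ ((hsm t ht' (ht htI)).differentiableAt (by simp))).deriv]
      rfl
    rw [e1, e0, e2]
    simp only [hτ₀]
    refine key.congr_of_eventuallyEq ?_
    filter_upwards [hsn, hτm] with s hs hτs
    rw [h.hInt_eq hΓ hs h₁ h₀, h.hInt_eq hΓ hs h₀ hτs]
  · filter_upwards [hsn] with s hs
    exact ⟨h.lipCurve hΓ hs h₁ h₀, h.mapsTo hs h₁ h₀,
      fun t ht => h.norm_sub_le hs hs₀m (uIcc_subset h₁ h₀ ht)⟩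
  · filter_upwards [hae] with t ht htI
    have hcd := hsm t (uIoc_subset_uIcc htI) (ht htI)
    refine ⟨hds t s₀ (hcd.differentiableAt (by simp)), ?_⟩
    have hc : ContinuousAt (fun s => fderiv ℝ (fun q => extChartAt 𝓘(ℝ, E) (Γ p) (Γ q)) (t, s)
        (1, 0)) s₀ :=
      ContinuousAt.clm_apply (ContinuousAt.comp (f := fun s : ℝ => (t, s))
        (hcd.continuousAt_fderiv (by simp)) (by fun_prop)) continuousAt_const
    refine hc.congr ?_
    have hev : ∀ᶠ q in 𝓝 (t, s₀), DifferentiableAt ℝ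
        (fun q => extChartAt 𝓘(ℝ, E) (Γ p) (Γ q)) q :=
      ((hcd.of_le (by simp : (1 : WithTop ℕ∞) ≤ ∞)).eventually (by simp)).mono
        fun q hq => hq.differentiableAt (by simp)
    have hev' := (Continuous.tendsto (f := fun s : ℝ => (t, s)) (by fun_prop) s₀).eventually hev
    filter_upwards [hev'] with s hs
    exact (hdt t s hs).deriv.symm
  · filter_upwards [hsn, hτm, hτ] with s hs hτs hs'
    exact ⟨hs'.1, h.lipCurve hΓ hs h₀ hτs, h.mapsTo hs h₀ hτs⟩
  · rw [hτ₀]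
    exact hsrc t₀ right_mem_uIcc

end ChartBounds

end LineIntegralsAlongSurfaces

end HigherHol

namespace HigherHol

open Filter

/-! ### Dependence of solutions on the primitive of the coefficient. -/

section Perturbation

variable {R : Type*} [NormedRing R] [NormedAlgebra ℝ R] [CompleteSpace R]

theorem intervalIntegral_mul_left {f : ℝ → R} {x y : ℝ} (hf : IntervalIntegrable f volume x y)
    (c : R) : ∫ t in x..y, c * f t = c * ∫ t in x..y, f t :=
  (ContinuousLinearMap.mul ℝ R c).intervalIntegral_comp_comm hf

theorem intervalIntegral_mul_right {f : ℝ → R} {x y : ℝ} (hf : IntervalIntegrable f volume x y)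
    (c : R) : ∫ t in x..y, f t * c = (∫ t in x..y, f t) * c :=
  ((ContinuousLinearMap.mul ℝ R).flip c).intervalIntegral_comp_comm hf

theorem PCont.aestronglyMeasurable {W : Type*} [NormedAddCommGroup W] {f : ℝ → W} (hf : PCont f)
    {x y : ℝ} (hx : x ∈ Icc (0 : ℝ) 1) (hy : y ∈ Icc (0 : ℝ) 1) :
    AEStronglyMeasurable f (volume.restrict (uIoc x y)) :=
  (intervalIntegrable_iff.1 (hf.intervalIntegrable hx hy)).aestronglyMeasurable

theorem IsSol.sub_eq_integral {a U : ℝ → R} (ha : PCont a) (h : IsSol a U) {x y : ℝ}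
    (hx : x ∈ Icc (0 : ℝ) 1) (hy : y ∈ Icc (0 : ℝ) 1) :
    U y - U x = -∫ t in x..y, a t * U t := by
  rw [← integral_eq_sub_offFin h.cont h.deriv (ha.mul_cont h.cont).neg hx hy,
    intervalIntegral.integral_neg]

theorem IsSol.norm_sub_le {a U : ℝ → R} (ha : PCont a) (h : IsSol a U) {C K : ℝ}
    (hC : ∀ᶠ t in offFin, ‖a t‖ ≤ C) (hK : ∀ t ∈ Icc (0 : ℝ) 1, ‖U t‖ ≤ K) {x y : ℝ}
    (hx : x ∈ Icc (0 : ℝ) 1) (hy : y ∈ Icc (0 : ℝ) 1) : ‖U y - U x‖ ≤ C * K * |y - x| := by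
  rw [h.sub_eq_integral ha hx hy, norm_neg]
  refine intervalIntegral.norm_integral_le_of_norm_le_const_ae ?_
  filter_upwards [ae_uIoc_of_eventually_offFin hC hx hy] with t ht htI
  exact (norm_mul_le _ _).trans (mul_le_mul (ht htI)
    (hK t (uIcc_subset_unit hx hy (uIoc_subset_uIcc htI))) (norm_nonneg _)
    ((norm_nonneg _).trans (ht htI)))

/-- Comparison of two solutions in terms of the difference of the primitives of the coefficients. -/
theorem IsSol.inverse_mul_eq {a₀ a₁ U₀ U₁ f : ℝ → R} (ha₀ : PCont a₀) (ha₁ : PCont a₁)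
    (h₀ : IsSol a₀ U₀) (h₁ : IsSol a₁ U₁) (hf0 : f 0 = 0) (hfc : ContinuousOn f (Icc 0 1))
    (hf : ∀ᶠ t in offFin, HasDerivAt f (a₁ t - a₀ t) t) {t : ℝ} (ht : t ∈ Icc (0 : ℝ) 1) :
    U₁ t = U₀ t - f t * U₁ t + U₀ t * ∫ x in (0 : ℝ)..t,
      Ring.inverse (U₀ x) * (a₀ x * f x - f x * a₁ x) * U₁ x := by
  have hic := h₀.cont_inverse ha₀
  have hfp := PCont.of_continuousOn hfc
  -- The function `U₀⁻¹ (1 + f) U₁` has derivative `U₀⁻¹ (a₀ f - f a₁) U₁`: the derivative `a₁ - a₀`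
  -- of `f` cancels the difference of the coefficients.
  have key := integral_eq_sub_offFin
    (u := fun x => Ring.inverse (U₀ x) * U₁ x + Ring.inverse (U₀ x) * (f x * U₁ x))
    (u' := fun x => Ring.inverse (U₀ x) * (a₀ x * f x - f x * a₁ x) * U₁ x)
    ((hic.mul h₁.cont).add (hic.mul (hfc.mul h₁.cont))) ?_
    (((PCont.cont_mul hic ((ha₀.mul hfp).sub (hfp.mul ha₁))).mul_cont h₁.cont))
    (show (0 : ℝ) ∈ Icc (0 : ℝ) 1 by simp) ht
  · rw [key, h₀.zero, h₁.zero, hf0, Ring.inverse_one, mul_sub, mul_add, ← mul_assoc, ← mul_assoc,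
      Ring.mul_inverse_cancel _ (h₀.isUnit ha₀ ht)]
    noncomm_ring
  · filter_upwards [h₀.deriv_inverse ha₀, h₁.deriv, hf] with x d0 d1 df
    refine ((d0.mul d1).add (d0.mul (df.mul d1))).congr_deriv ?_
    simp only [Pi.mul_apply]
    noncomm_ring

/-- Two solutions are close as soon as the primitives of the coefficients are uniformly close. The
coefficients themselves may differ by a fixed amount on short intervals, which happens when the
break points of a piecewise smooth family move. -/
theorem IsSol.norm_sub_le_of_primitive {a₀ a₁ U₀ U₁ f : ℝ → R} (ha₀ : PCont a₀) (ha₁ : PCont a₁)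
    (h₀ : IsSol a₀ U₀) (h₁ : IsSol a₁ U₁) (hf0 : f 0 = 0) (hfc : ContinuousOn f (Icc 0 1))
    (hf : ∀ᶠ t in offFin, HasDerivAt f (a₁ t - a₀ t) t) {C K ε : ℝ} (hC0 : 0 ≤ C)
    (hC₀ : ∀ᶠ t in offFin, ‖a₀ t‖ ≤ C) (hC₁ : ∀ᶠ t in offFin, ‖a₁ t‖ ≤ C)
    (hK₀ : ∀ t ∈ Icc (0 : ℝ) 1, ‖U₀ t‖ ≤ K) (hK₁ : ∀ t ∈ Icc (0 : ℝ) 1, ‖U₁ t‖ ≤ K)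
    (hKi : ∀ t ∈ Icc (0 : ℝ) 1, ‖Ring.inverse (U₀ t)‖ ≤ K)
    (hε : ∀ t ∈ Icc (0 : ℝ) 1, ‖f t‖ ≤ ε) {t : ℝ} (ht : t ∈ Icc (0 : ℝ) 1) :
    ‖U₁ t - U₀ t‖ ≤ (K + K * (K * (2 * C) * K)) * ε := by
  have hK0 : 0 ≤ K := (norm_nonneg _).trans (hK₀ t ht)
  have hε0 : 0 ≤ ε := (norm_nonneg _).trans (hε t ht)
  have h01 : (0 : ℝ) ∈ Icc (0 : ℝ) 1 := by simp
  have hi : ‖∫ x in (0 : ℝ)..t, Ring.inverse (U₀ x) * (a₀ x * f x - f x * a₁ x) * U₁ x‖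
      ≤ K * (2 * C * ε) * K := by
    refine (intervalIntegral.norm_integral_le_of_norm_le_const_ae
      (C := K * (2 * C * ε) * K) ?_).trans
      (mul_le_of_le_one_right (by positivity) ?_)
    · filter_upwards [ae_uIoc_of_eventually_offFin hC₀ h01 ht,
        ae_uIoc_of_eventually_offFin hC₁ h01 ht] with x e0 e1 hx
      have hx' := uIcc_subset_unit h01 ht (uIoc_subset_uIcc hx)
      have b1 : ‖a₀ x * f x - f x * a₁ x‖ ≤ 2 * C * ε := by
        refine (_root_.norm_sub_le _ _).trans ?_
        have c1 := (norm_mul_le (a₀ x) (f x)).trans (mul_le_mul (e0 hx) (hε x hx')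
          (norm_nonneg _) hC0)
        have c2 := (norm_mul_le (f x) (a₁ x)).trans (mul_le_mul (hε x hx') (e1 hx)
          (norm_nonneg _) hε0)
        linarith
      have b2 := (norm_mul_le (Ring.inverse (U₀ x)) (a₀ x * f x - f x * a₁ x)).trans
        (mul_le_mul (hKi x hx') b1 (norm_nonneg _) hK0)
      exact (norm_mul_le _ _).trans (mul_le_mul b2 (hK₁ x hx') (norm_nonneg _) (by positivity))
    · rw [sub_zero, abs_of_nonneg ht.1]; exact ht.2
  have heq : U₁ t - U₀ t = -(f t * U₁ t) + U₀ t * ∫ x in (0 : ℝ)..t,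
      Ring.inverse (U₀ x) * (a₀ x * f x - f x * a₁ x) * U₁ x := by
    conv_lhs => rw [IsSol.inverse_mul_eq ha₀ ha₁ h₀ h₁ hf0 hfc hf ht]
    abel
  rw [heq]
  refine (norm_add_le _ _).trans ?_
  rw [norm_neg]
  have c1 := (norm_mul_le (f t) (U₁ t)).trans (mul_le_mul (hε t ht) (hK₁ t ht) (norm_nonneg _) hε0)
  have c2 := (norm_mul_le (U₀ t) _).trans (mul_le_mul (hK₀ t ht) hi (norm_nonneg _) hK0)
  refine (add_le_add c1 c2).trans (le_of_eq ?_)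
  ring

/-- Derivative of the solution of a linear differential equation with respect to a parameter, when
only the primitive of the coefficient is differentiable in the parameter. -/
theorem hasDerivAt_sol_of_primitive {a g : ℝ → ℝ → R} {f' : ℝ → R} {f₁ : R} {τ : ℝ → ℝ}
    {s₀ t₀ C K : ℝ} (hC0 : 0 ≤ C) (ht₀ : t₀ ∈ Icc (0 : ℝ) 1)
    (h : ∀ᶠ s in 𝓝 s₀, PCont (a s) ∧ IsSol (a s) (g s) ∧ (∀ᶠ t in offFin, ‖a s t‖ ≤ C) ∧
      (∀ t ∈ Icc (0 : ℝ) 1, ‖g s t‖ ≤ K) ∧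
      ∀ t ∈ Icc (0 : ℝ) 1, ‖(∫ x in (0 : ℝ)..t, a s x) - ∫ x in (0 : ℝ)..t, a s₀ x‖ ≤
        C * |s - s₀|)
    (hKi : ∀ t ∈ Icc (0 : ℝ) 1, ‖Ring.inverse (g s₀ t)‖ ≤ K)
    (hd : ∀ᶠ t in offFin, HasDerivAt (fun s => ∫ x in (0 : ℝ)..t, a s x) (f' t) s₀ ∧
      ContinuousAt (fun s => a s t) s₀)
    (hτ : ∀ᶠ s in 𝓝 s₀, |τ s - t₀| ≤ |s - s₀| ∧ τ s ∈ Icc (0 : ℝ) 1)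
    (hd₁ : HasDerivAt (fun s => (∫ x in (0 : ℝ)..t₀, a s x) + ∫ x in t₀..τ s, a s x) f₁ s₀) :
    HasDerivAt (fun s => g s (τ s)) (-(f₁ * g s₀ t₀) + g s₀ t₀ * ∫ t in (0 : ℝ)..t₀,
      Ring.inverse (g s₀ t) * (a s₀ t * f' t - f' t * a s₀ t) * g s₀ t) s₀ := by
  obtain ⟨ha₀, hg₀, hC₀, hK₀, -⟩ := h.self_of_nhds
  have h01 : (0 : ℝ) ∈ Icc (0 : ℝ) 1 := by simp
  have hK0 : 0 ≤ K := (norm_nonneg _).trans (hK₀ 0 h01)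
  have hτ₀ : τ s₀ = t₀ := by
    have := hτ.self_of_nhds.1
    simp only [sub_self, abs_zero] at this
    exact sub_eq_zero.1 (abs_nonpos_iff.1 this)
  set Δ : ℝ → ℝ → R := fun s t => (∫ x in (0 : ℝ)..t, a s x) - ∫ x in (0 : ℝ)..t, a s₀ x with hΔ
  have hΔ0 : ∀ t, Δ s₀ t = 0 := fun t => sub_self _
  have hΔc : ∀ s, PCont (a s) → ContinuousOn (Δ s) (Icc 0 1) := fun s hs =>
    (hs.continuousOn_primitive h01).sub (ha₀.continuousOn_primitive h01)
  have hΔd : ∀ s, PCont (a s) → ∀ᶠ t in offFin, HasDerivAt (Δ s) (a s t - a s₀ t) t := by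
    intro s hs
    filter_upwards [hs.hasDerivAt_primitive h01, ha₀.hasDerivAt_primitive h01] with t e1 e2
    exact e1.sub e2
  set K' := (K + K * (K * (2 * C) * K)) * C with hK'
  have hK'0 : 0 ≤ K' := by positivity
  have hgs : ∀ᶠ s in 𝓝 s₀, ∀ t ∈ Icc (0 : ℝ) 1, ‖g s t - g s₀ t‖ ≤ K' * |s - s₀| := by
    filter_upwards [h] with s hs t ht
    refine (IsSol.norm_sub_le_of_primitive ha₀ hs.1 hg₀ hs.2.1 (by simp [hΔ]) (hΔc s hs.1)
      (hΔd s hs.1) hC0 hC₀ hs.2.2.1 hK₀ hs.2.2.2.1 hKi hs.2.2.2.2 ht).trans (le_of_eq ?_)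
    ring
  have hgc : ∀ t ∈ Icc (0 : ℝ) 1, ContinuousAt (fun s => g s t) s₀ := by
    intro t ht
    rw [ContinuousAt, tendsto_iff_norm_sub_tendsto_zero]
    have h2 : Tendsto (fun s => K' * |s - s₀|) (𝓝 s₀) (𝓝 0) := by
      have : Continuous fun s : ℝ => K' * |s - s₀| := by fun_prop
      simpa using this.tendsto s₀
    exact squeeze_zero' (Eventually.of_forall fun _ => norm_nonneg _)
      (hgs.mono fun s hs => hs t ht) h2
  set J : ℝ → ℝ → R := fun s t =>
    Ring.inverse (g s₀ t) * (a s₀ t * Δ s t - Δ s t * a s t) * g s t with hJ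
  have hic := hg₀.cont_inverse ha₀
  have dJ : HasDerivAt (fun s => ∫ t in (0 : ℝ)..t₀, J s t) (∫ t in (0 : ℝ)..t₀,
      Ring.inverse (g s₀ t) * (a s₀ t * f' t - f' t * a s₀ t) * g s₀ t) s₀ := by
    refine hasDerivAt_intervalIntegral_of_lip (C := K * (2 * C * C) * K) ?_ ?_ ?_ ?_
    · intro t; simp [hJ, hΔ0]
    · filter_upwards [h] with s hs
      have hΔp := PCont.of_continuousOn (hΔc s hs.1)
      exact ((PCont.cont_mul hic ((ha₀.mul hΔp).sub (hΔp.mul hs.1))).mul_cont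
        hs.2.1.cont).aestronglyMeasurable h01 ht₀
    · filter_upwards [h] with s hs
      filter_upwards [ae_uIoc_of_eventually_offFin hC₀ h01 ht₀,
        ae_uIoc_of_eventually_offFin hs.2.2.1 h01 ht₀] with x e0 e1 hx
      have hx' := uIcc_subset_unit h01 ht₀ (uIoc_subset_uIcc hx)
      have hε := hs.2.2.2.2 x hx'
      have b1 : ‖a s₀ x * Δ s x - Δ s x * a s x‖ ≤ 2 * C * (C * |s - s₀|) := by
        refine (_root_.norm_sub_le _ _).trans ?_
        have c1 := (norm_mul_le (a s₀ x) (Δ s x)).trans (mul_le_mul (e0 hx) hε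
          (norm_nonneg _) hC0)
        have c2 := (norm_mul_le (Δ s x) (a s x)).trans (mul_le_mul hε (e1 hx)
          (norm_nonneg _) (by positivity))
        linarith
      have b2 := (norm_mul_le (Ring.inverse (g s₀ x)) (a s₀ x * Δ s x - Δ s x * a s x)).trans
        (mul_le_mul (hKi x hx') b1 (norm_nonneg _) hK0)
      refine ((norm_mul_le _ _).trans (mul_le_mul b2 (hs.2.2.2.1 x hx') (norm_nonneg _)
        (by positivity))).trans (le_of_eq ?_)
      ring
    · filter_upwards [ae_uIoc_of_eventually_offFin hd h01 ht₀] with t ht htI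
      have htu := uIcc_subset_unit h01 ht₀ (uIoc_subset_uIcc htI)
      obtain ⟨d1, c1⟩ := ht htI
      have d2 : HasDerivAt (fun s => Δ s t) (f' t) s₀ := d1.sub_const _
      have e1 := hasDerivAt_bilin_of_eq_zero (u := fun s => Δ s t)
        (ContinuousLinearMap.mul ℝ R) (hΔ0 t) d2 (hgc t htu)
      have e2 := hasDerivAt_bilin_of_eq_zero (u := fun s => Δ s t)
        (ContinuousLinearMap.mul ℝ R) (hΔ0 t) d2
        (c1.mul (hgc t htu))
      simp only [ContinuousLinearMap.mul_apply'] at e1 e2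
      refine (((e1.const_mul (a s₀ t)).sub e2).const_mul (Ring.inverse (g s₀ t))).congr_of_eventuallyEq
        (Eventually.of_forall fun s => ?_) |>.congr_deriv ?_
      · simp only [hJ, Pi.sub_apply]
        noncomm_ring
      · noncomm_ring
  -- The remainder: every term is a product of two quantities of order `|s - s₀|`, so it does not
  -- contribute to the derivative.
  set r : ℝ → R := fun s => -(Δ s t₀ * (g s t₀ - g s₀ t₀))
    - ∫ t in t₀..τ s, a s t * (g s t - g s₀ t₀) with hr
  have dr : HasDerivAt r 0 s₀ := by
    refine hasDerivAt_zero_of_norm_le_sq (K := C * K' + C * (C * K + K')) ?_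
    filter_upwards [h, hgs, hτ] with s hs hg hτs
    have b1 : ‖Δ s t₀ * (g s t₀ - g s₀ t₀)‖ ≤ C * |s - s₀| * (K' * |s - s₀|) :=
      (norm_mul_le _ _).trans (mul_le_mul (hs.2.2.2.2 t₀ ht₀) (hg t₀ ht₀) (norm_nonneg _)
        (by positivity))
    have b2 : ‖∫ t in t₀..τ s, a s t * (g s t - g s₀ t₀)‖ ≤
        C * ((C * K + K') * |s - s₀|) * |τ s - t₀| := by
      refine intervalIntegral.norm_integral_le_of_norm_le_const_ae ?_
      filter_upwards [ae_uIoc_of_eventually_offFin hs.2.2.1 ht₀ hτs.2] with t e1 ht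
      have ht' := uIoc_subset_uIcc ht
      have htu := uIcc_subset_unit ht₀ hτs.2 ht'
      refine (norm_mul_le _ _).trans (mul_le_mul (e1 ht) ?_ (norm_nonneg _) hC0)
      have c1 := hs.2.1.norm_sub_le hs.1 hs.2.2.1 hs.2.2.2.1 ht₀ htu
      have c2 := hg t₀ ht₀
      have c3 : |t - t₀| ≤ |s - s₀| := (abs_sub_left_of_mem_uIcc ht').trans hτs.1
      have c4 := mul_le_mul_of_nonneg_left c3 (mul_nonneg hC0 hK0)
      have c5 := norm_sub_le_norm_sub_add_norm_sub (g s t) (g s t₀) (g s₀ t₀)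
      linarith
    have b3 : C * ((C * K + K') * |s - s₀|) * |τ s - t₀| ≤
        C * ((C * K + K') * |s - s₀|) * |s - s₀| :=
      mul_le_mul_of_nonneg_left hτs.1 (by positivity)
    refine (_root_.norm_sub_le _ _).trans ?_
    rw [norm_neg]
    refine (add_le_add b1 (b2.trans b3)).trans (le_of_eq ?_)
    ring
  have key := (((hd₁.mul_const (g s₀ t₀)).neg.add (dJ.const_mul (g s₀ t₀))).add dr).add_const
    ((∫ x in (0 : ℝ)..t₀, a s₀ x) * g s₀ t₀ + g s₀ t₀)
  rw [add_zero] at key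
  refine key.congr_of_eventuallyEq ?_
  filter_upwards [h, hτ] with s hs hτs
  have e1 := IsSol.inverse_mul_eq ha₀ hs.1 hg₀ hs.2.1 (by simp [hΔ]) (hΔc s hs.1)
    (hΔd s hs.1) ht₀
  have e2 := hs.2.1.sub_eq_integral hs.1 ht₀ hτs.2
  have i1 := (hs.1.mul_cont hs.2.1.cont).intervalIntegrable ht₀ hτs.2
  have i2 := (hs.1.mul (PCont.const (g s₀ t₀))).intervalIntegrable ht₀ hτs.2
  have e3 : ∫ t in t₀..τ s, a s t * (g s t - g s₀ t₀) =
      (∫ t in t₀..τ s, a s t * g s t) - (∫ t in t₀..τ s, a s t) * g s₀ t₀ := by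
    rw [← intervalIntegral_mul_right (hs.1.intervalIntegrable ht₀ hτs.2),
      ← intervalIntegral.integral_sub i1 i2]
    simp only [mul_sub]
  have e4 : ∫ t in t₀..τ s, a s t * g s t = g s t₀ - g s (τ s) := by
    rw [← neg_sub, e2, neg_neg]
  change g s (τ s) = -(((∫ x in (0 : ℝ)..t₀, a s x) + ∫ x in t₀..τ s, a s x) * g s₀ t₀)
    + g s₀ t₀ * (∫ t in (0 : ℝ)..t₀, J s t)
    + (-(Δ s t₀ * (g s t₀ - g s₀ t₀)) - ∫ t in t₀..τ s, a s t * (g s t - g s₀ t₀))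
    + ((∫ x in (0 : ℝ)..t₀, a s₀ x) * g s₀ t₀ + g s₀ t₀)
  have e5 : g s₀ t₀ * (∫ t in (0 : ℝ)..t₀, J s t) = g s t₀ - g s₀ t₀ + Δ s t₀ * g s t₀ := by
    rw [eq_comm, sub_add_eq_add_sub, sub_eq_iff_eq_add, ← eq_sub_iff_add_eq]
    conv_lhs => rw [e1]
    abel
  rw [e3, e4, e5]
  simp only [hΔ]
  noncomm_ring

/-- `Φ` conjugated by a solution, for a primitive `Φ` of `φ`. -/
theorem IsSol.conj_primitive {a U φ : ℝ → R} (ha : PCont a) (h : IsSol a U) (hφ : PCont φ) {t : ℝ}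
    (ht : t ∈ Icc (0 : ℝ) 1) :
    (∫ x in (0 : ℝ)..t, φ x) * U t = U t * ∫ x in (0 : ℝ)..t, Ring.inverse (U x) *
      (a x * (∫ y in (0 : ℝ)..x, φ y) - (∫ y in (0 : ℝ)..x, φ y) * a x + φ x) * U x := by
  have h01 : (0 : ℝ) ∈ Icc (0 : ℝ) 1 := by simp
  have hic := h.cont_inverse ha
  have hΦ := hφ.continuousOn_primitive h01
  have hΦp := PCont.of_continuousOn hΦ
  have key := integral_eq_sub_offFin
    (u := fun x => Ring.inverse (U x) * ((∫ y in (0 : ℝ)..x, φ y) * U x))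
    (u' := fun x => Ring.inverse (U x) *
      (a x * (∫ y in (0 : ℝ)..x, φ y) - (∫ y in (0 : ℝ)..x, φ y) * a x + φ x) * U x)
    (hic.mul (hΦ.mul h.cont)) ?_
    ((PCont.cont_mul hic (((ha.mul hΦp).sub (hΦp.mul ha)).add hφ)).mul_cont h.cont) h01 ht
  · rw [key, intervalIntegral.integral_same, zero_mul, mul_zero, sub_zero, ← mul_assoc,
      Ring.mul_inverse_cancel _ (h.isUnit ha ht), one_mul]
  · filter_upwards [h.deriv_inverse ha, h.deriv, hφ.hasDerivAt_primitive h01] with x d0 d1 df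
    refine (d0.mul (df.mul d1)).congr_deriv ?_
    simp only [Pi.mul_apply]
    noncomm_ring

end Perturbation

end HigherHol

namespace HigherHol

open Filter

/-! ### Horizontal line integrals across several charts. -/

section Global

variable {E : Type*} [NormedAddCommGroup E] [NormedSpace ℝ E] [FiniteDimensional ℝ E]
  {M : Type*} [TopologicalSpace M] [ChartedSpace E M] [IsManifold 𝓘(ℝ, E) ∞ M]
  {W : Type*} [NormedAddCommGroup W] [NormedSpace ℝ W] [CompleteSpace W]
  {Γ : ℝ × ℝ → M}

/-- Horizontal line integrals are Lipschitz in the vertical parameter. -/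
theorem PiecewiseSmoothOn.exists_norm_hInt_sub_le (hΓ : PiecewiseSmoothOn E Γ unitSquare)
    (A : DiffForm E M W 1) {s₀ : ℝ} (hs₀ : s₀ ∈ Icc (0 : ℝ) 1) :
    ∃ r > 0, ∃ C, 0 ≤ C ∧ ∀ t ∈ Icc (0 : ℝ) 1, ∀ s ∈ Icc (0 : ℝ) 1 ∩ Metric.ball s₀ r,
      ∀ s' ∈ Icc (0 : ℝ) 1 ∩ Metric.ball s₀ r,
        ‖hInt A Γ 0 t s - hInt A Γ 0 t s'‖ ≤ C * |s - s'| := by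
  have h01 : (0 : ℝ) ∈ Icc (0 : ℝ) 1 := by simp
  -- The estimate for end points near `x` and `y`. It is local when `x` and `y` are close, since one
  -- chart suffices, and transitive because line integrals are additive; connectedness of `[0, 1]`
  -- gives it for all pairs.
  set P : ℝ → ℝ → Prop := fun x y => ∃ r > 0, ∃ C, 0 ≤ C ∧
    ∀ t₁ ∈ Icc (0 : ℝ) 1 ∩ Metric.ball x r, ∀ t₂ ∈ Icc (0 : ℝ) 1 ∩ Metric.ball y r,
    ∀ s ∈ Icc (0 : ℝ) 1 ∩ Metric.ball s₀ r, ∀ s' ∈ Icc (0 : ℝ) 1 ∩ Metric.ball s₀ r,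
      ‖hInt A Γ t₁ t₂ s - hInt A Γ t₁ t₂ s'‖ ≤ C * |s - s'| with hP
  have hloc : ∀ x ∈ Icc (0 : ℝ) 1, ∃ r > 0, ∀ y ∈ Metric.ball x r, P x y ∧ P y x := by
    intro x hx
    obtain ⟨r, hr, L, C, B, h⟩ := hΓ.exists_chartBounds A (p := (x, s₀)) ⟨hx, hs₀⟩
    have hC0 : 0 ≤ C := by
      have hm := h.mem (x, s₀) ⟨⟨hx, hs₀⟩, Metric.mem_ball_self hr⟩
      exact (norm_nonneg _).trans (h.bound _ hm.2).1
    refine ⟨r / 2, half_pos hr, fun y hy => ?_⟩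
    have hsub : ∀ z ∈ Metric.ball x (r / 2), Metric.ball z (r / 2) ⊆ Metric.ball x r := by
      intro z hz
      refine Metric.ball_subset_ball' ?_
      have : dist z x < r / 2 := hz
      linarith
    have hself : x ∈ Metric.ball x (r / 2) := Metric.mem_ball_self (half_pos hr)
    have hs2 : Metric.ball s₀ (r / 2) ⊆ Metric.ball s₀ r :=
      Metric.ball_subset_ball (by linarith)
    have : ∀ x' ∈ Metric.ball x (r / 2), ∀ y' ∈ Metric.ball x (r / 2), P x' y' := by
      intro x' hx' y' hy'
      refine ⟨r / 2, half_pos hr, (2 * C * L + 2 * C) * L, by positivity,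
        fun t₁ h₁ t₂ h₂ s hs s' hs' => ?_⟩
      rw [mul_assoc]
      exact h.norm_hInt_sub_le hΓ ⟨hs.1, hs2 hs.2⟩ ⟨hs'.1, hs2 hs'.2⟩ ⟨h₁.1, hsub x' hx' h₁.2⟩
        ⟨h₂.1, hsub y' hy' h₂.2⟩
    exact ⟨this x hself y hy, this y hy x hself⟩
  have hall : ∀ y ∈ Icc (0 : ℝ) 1, P 0 y := by
    intro y hy
    refine isPreconnected_Icc.induction₂' P (fun x hx => ?_) ?_ h01 hy
    · obtain ⟨r, hr, h⟩ := hloc x hx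
      filter_upwards [nhdsWithin_le_nhds (Metric.ball_mem_nhds x hr)] with y hy using h y hy
    · rintro x y z - hy - ⟨r, hr, C, hC, h⟩ ⟨r', hr', C', hC', h'⟩
      refine ⟨min r r', lt_min hr hr', C + C', add_nonneg hC hC', fun t₁ h₁ t₂ h₂ s hs s' hs' => ?_⟩
      have b1 := Metric.ball_subset_ball (x := s₀) (min_le_left r r')
      have b2 := Metric.ball_subset_ball (x := s₀) (min_le_right r r')
      have e1 := h t₁ ⟨h₁.1, Metric.ball_subset_ball (min_le_left r r') h₁.2⟩ y
        ⟨hy, Metric.mem_ball_self hr⟩ s ⟨hs.1, b1 hs.2⟩ s' ⟨hs'.1, b1 hs'.2⟩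
      have e2 := h' y ⟨hy, Metric.mem_ball_self hr'⟩ t₂
        ⟨h₂.1, Metric.ball_subset_ball (min_le_right r r') h₂.2⟩ s ⟨hs.1, b2 hs.2⟩ s'
        ⟨hs'.1, b2 hs'.2⟩
      rw [← hΓ.hInt_add A hs.1 h₁.1 hy h₂.1, ← hΓ.hInt_add A hs'.1 h₁.1 hy h₂.1,
        add_sub_add_comm, add_mul]
      exact (norm_add_le _ _).trans (add_le_add e1 e2)
  -- Compactness of `[0, 1]` makes the radius and the constant independent of the end point.
  have hcpt := isCompact_Icc (a := (0 : ℝ)) (b := 1) |>.induction_on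
    (p := fun S => ∃ r > 0, ∃ C, 0 ≤ C ∧ ∀ t ∈ S, t ∈ Icc (0 : ℝ) 1 →
      ∀ s ∈ Icc (0 : ℝ) 1 ∩ Metric.ball s₀ r, ∀ s' ∈ Icc (0 : ℝ) 1 ∩ Metric.ball s₀ r,
        ‖hInt A Γ 0 t s - hInt A Γ 0 t s'‖ ≤ C * |s - s'|) ?_ ?_ ?_ ?_
  · obtain ⟨r, hr, C, hC, h⟩ := hcpt
    exact ⟨r, hr, C, hC, fun t ht => h t ht ht⟩
  · exact ⟨1, one_pos, 0, le_rfl, fun t ht => absurd ht (notMem_empty t)⟩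
  · rintro S S' hSS ⟨r, hr, C, hC, h⟩
    exact ⟨r, hr, C, hC, fun t ht => h t (hSS ht)⟩
  · rintro S S' ⟨r, hr, C, hC, h⟩ ⟨r', hr', C', hC', h'⟩
    refine ⟨min r r', lt_min hr hr', C + C', add_nonneg hC hC', fun t ht htI s hs s' hs' => ?_⟩
    have b1 := Metric.ball_subset_ball (x := s₀) (min_le_left r r')
    have b2 := Metric.ball_subset_ball (x := s₀) (min_le_right r r')
    rw [add_mul]
    rcases ht with ht | ht
    · exact (h t ht htI s ⟨hs.1, b1 hs.2⟩ s' ⟨hs'.1, b1 hs'.2⟩).trans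
        (le_add_of_nonneg_right (by positivity))
    · exact (h' t ht htI s ⟨hs.1, b2 hs.2⟩ s' ⟨hs'.1, b2 hs'.2⟩).trans
        (le_add_of_nonneg_left (by positivity))
  · intro y hy
    obtain ⟨r, hr, C, hC, h⟩ := hall y hy
    exact ⟨Metric.ball y r, nhdsWithin_le_nhds (Metric.ball_mem_nhds y hr), r, hr, C, hC,
      fun t ht htI => h 0 ⟨h01, Metric.mem_ball_self hr⟩ t ⟨htI, ht⟩⟩

theorem DiffForm.alongPath_const (A : DiffForm E M W 1) {c : ℝ → M} {x : M} {t : ℝ}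
    (h : c =ᶠ[𝓝 t] fun _ => x) : A.alongPath c t = 0 := by
  rw [A.alongPath_congr h, DiffForm.alongPath]
  have : vel E (fun _ : ℝ => x) t = 0 := by
    rw [vel, mfderiv_const]; rfl
  rw [this]
  exact ContinuousAlternatingMap.map_coord_zero _ 0 rfl

/-- The derivative of horizontal line integrals with respect to the vertical parameter. -/
theorem GoodSet.hasDerivAt_hInt {G : Set (ℝ × ℝ)} (hG : GoodSet E Γ G)
    (hΓ : PiecewiseSmoothOn E Γ unitSquare) (h0 : ∀ s ∈ Icc (0 : ℝ) 1, Γ (0, s) = Γ (0, 0))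
    (A : DiffForm E M W 1) {s₀ : ℝ}
    (hs₀ : s₀ ∈ Ioo (0 : ℝ) 1) (hsl : ∀ᶠ t in offFin, (t, s₀) ∈ G) {φ : ℝ → W} (hφp : PCont φ)
    (hφ : ∀ t, (t, s₀) ∈ G → ∀ x₀, Γ (t, s₀) ∈ (extChartAt 𝓘(ℝ, E) x₀).source →
      φ t = extDeriv (inChart A.toFun x₀) (extChartAt 𝓘(ℝ, E) x₀ (Γ (t, s₀)))
        ![fderiv ℝ (fun q => extChartAt 𝓘(ℝ, E) x₀ (Γ q)) (t, s₀) (1, 0),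
          fderiv ℝ (fun q => extChartAt 𝓘(ℝ, E) x₀ (Γ q)) (t, s₀) (0, 1)])
    {t₀ : ℝ} (ht₀ : t₀ ∈ Icc (0 : ℝ) 1) {τ : ℝ → ℝ}
    (hτ : ∀ᶠ s in 𝓝 s₀, |τ s - t₀| ≤ |s - s₀| ∧ τ s ∈ Icc (0 : ℝ) 1)
    (hd₀ : MDifferentiableAt 𝓘(ℝ, ℝ) 𝓘(ℝ, E) (fun s => Γ (τ s, s)) s₀) :
    HasDerivAt (fun s => hInt A Γ 0 t₀ s + hInt A Γ t₀ (τ s) s)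
      (A.alongPath (fun s => Γ (τ s, s)) s₀ - ∫ t in (0 : ℝ)..t₀, φ t) s₀ := by
  have h01 : (0 : ℝ) ∈ Icc (0 : ℝ) 1 := by simp
  have hsI : s₀ ∈ Icc (0 : ℝ) 1 := Ioo_subset_Icc_self hs₀
  have hsn : ∀ᶠ s in 𝓝 s₀, s ∈ Icc (0 : ℝ) 1 := Icc_mem_nhds hs₀.1 hs₀.2
  -- The abscissae at which the vertical curve is differentiable at height `s₀`. Only there do the
  -- boundary terms of the derivative formula make sense, and all but finitely many abscissae
  -- qualify.
  set T : Set ℝ := {t | MDifferentiableAt 𝓘(ℝ, ℝ) 𝓘(ℝ, E) (fun s => Γ (t, s)) s₀} with hT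
  have hTev : ∀ᶠ t in offFin, t ∈ T := by
    filter_upwards [hsl] with t ht
    have h1 : MDifferentiableAt 𝓘(ℝ, ℝ) 𝓘(ℝ, ℝ × ℝ) (fun s : ℝ => (t, s)) s₀ :=
      DifferentiableAt.mdifferentiableAt (by fun_prop)
    exact (hG.mdifferentiableAt ht).comp s₀ h1
  set D : ℝ → ℝ → Prop := fun t₁ t₂ => HasDerivAt (fun s => hInt A Γ t₁ t₂ s)
    (A.alongPath (fun s => Γ (t₂, s)) s₀ - A.alongPath (fun s => Γ (t₁, s)) s₀
      - ∫ t in t₁..t₂, φ t) s₀ with hD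
  have hDadd : ∀ {t₁ t₂ t₃}, t₁ ∈ Icc (0 : ℝ) 1 → t₂ ∈ Icc (0 : ℝ) 1 → t₃ ∈ Icc (0 : ℝ) 1 →
      D t₁ t₂ → D t₂ t₃ → D t₁ t₃ := by
    intro t₁ t₂ t₃ h₁ h₂ h₃ d1 d2
    refine ((d1.add d2).congr_of_eventuallyEq ?_).congr_deriv ?_
    · filter_upwards [hsn] with s hs using (hΓ.hInt_add A hs h₁ h₂ h₃).symm
    · rw [← intervalIntegral.integral_add_adjacent_intervals (hφp.intervalIntegrable h₁ h₂)
        (hφp.intervalIntegrable h₂ h₃)]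
      abel
  have hloc : ∀ x ∈ Icc (0 : ℝ) 1, ∃ r > 0, ∀ t₁ ∈ Icc (0 : ℝ) 1 ∩ Metric.ball x r, t₁ ∈ T →
      ∀ t₂ ∈ Icc (0 : ℝ) 1 ∩ Metric.ball x r, ∀ τ : ℝ → ℝ,
      (∀ᶠ s in 𝓝 s₀, |τ s - t₂| ≤ |s - s₀| ∧ τ s ∈ Icc (0 : ℝ) 1) →
      MDifferentiableAt 𝓘(ℝ, ℝ) 𝓘(ℝ, E) (fun s => Γ (τ s, s)) s₀ →
      HasDerivAt (fun s => hInt A Γ t₁ t₂ s + hInt A Γ t₂ (τ s) s)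
        (A.alongPath (fun s => Γ (τ s, s)) s₀ - A.alongPath (fun s => Γ (t₁, s)) s₀
          - ∫ t in t₁..t₂, φ t) s₀ := by
    intro x hx
    obtain ⟨r, hr, L, C, B, h⟩ := hΓ.exists_chartBounds A (p := (x, s₀)) ⟨hx, hsI⟩
    exact ⟨r, hr, fun t₁ h₁ hT₁ t₂ h₂ τ hτ hd => h.hasDerivAt_hInt hΓ hG hr hs₀ hsl hφ h₁ h₂ hT₁
      hτ hd⟩
  have hlocD : ∀ x ∈ Icc (0 : ℝ) 1, ∃ r > 0, ∀ t₁ ∈ Icc (0 : ℝ) 1 ∩ Metric.ball x r, t₁ ∈ T →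
      ∀ t₂ ∈ Icc (0 : ℝ) 1 ∩ Metric.ball x r, t₂ ∈ T → D t₁ t₂ := by
    intro x hx
    obtain ⟨r, hr, h⟩ := hloc x hx
    refine ⟨r, hr, fun t₁ h₁ hT₁ t₂ h₂ hT₂ => ?_⟩
    have := h t₁ h₁ hT₁ t₂ h₂ (fun _ => t₂) (Eventually.of_forall fun s => ⟨by simp, h₂.1⟩) hT₂
    simpa [hInt, hD] using this
  have hglob : ∀ x ∈ Icc (0 : ℝ) 1, ∀ y ∈ Icc (0 : ℝ) 1, ∃ r > 0,
      ∀ t₁ ∈ Icc (0 : ℝ) 1 ∩ Metric.ball x r, t₁ ∈ T →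
      ∀ t₂ ∈ Icc (0 : ℝ) 1 ∩ Metric.ball y r, t₂ ∈ T → D t₁ t₂ := by
    intro x hx y hy
    refine isPreconnected_Icc.induction₂' (fun x y => ∃ r > 0,
      ∀ t₁ ∈ Icc (0 : ℝ) 1 ∩ Metric.ball x r, t₁ ∈ T →
      ∀ t₂ ∈ Icc (0 : ℝ) 1 ∩ Metric.ball y r, t₂ ∈ T → D t₁ t₂) (fun x hx => ?_) ?_ hx hy
    · obtain ⟨r, hr, h⟩ := hlocD x hx
      have hsub : ∀ z ∈ Metric.ball x (r / 2), Metric.ball z (r / 2) ⊆ Metric.ball x r := by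
        intro z hz
        refine Metric.ball_subset_ball' ?_
        have : dist z x < r / 2 := hz
        linarith
      have hself := hsub x (Metric.mem_ball_self (half_pos hr))
      filter_upwards [nhdsWithin_le_nhds (Metric.ball_mem_nhds x (half_pos hr))] with y hy
      exact ⟨⟨r / 2, half_pos hr, fun t₁ h₁ hT₁ t₂ h₂ hT₂ => h t₁ ⟨h₁.1, hself h₁.2⟩ hT₁ t₂
          ⟨h₂.1, hsub y hy h₂.2⟩ hT₂⟩,
        ⟨r / 2, half_pos hr, fun t₁ h₁ hT₁ t₂ h₂ hT₂ => h t₁ ⟨h₁.1, hsub y hy h₁.2⟩ hT₁ t₂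
          ⟨h₂.1, hself h₂.2⟩ hT₂⟩⟩
    · rintro x y z - hy - ⟨r, hr, h⟩ ⟨r', hr', h'⟩
      -- The prescribed point `y` may fail to lie in `T`, so the interval is subdivided at a nearby
      -- point of `T` instead; the boundary terms at that point cancel.
      obtain ⟨m, hm, hmT⟩ := exists_near_of_eventually_offFin hTev hy (lt_min hr hr')
      refine ⟨min r r', lt_min hr hr', fun t₁ h₁ hT₁ t₂ h₂ hT₂ => ?_⟩
      exact hDadd h₁.1 hm.1 h₂.1
        (h t₁ ⟨h₁.1, Metric.ball_subset_ball (min_le_left r r') h₁.2⟩ hT₁ m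
          ⟨hm.1, Metric.ball_subset_ball (min_le_left r r') hm.2⟩ hmT)
        (h' m ⟨hm.1, Metric.ball_subset_ball (min_le_right r r') hm.2⟩ hmT t₂
          ⟨h₂.1, Metric.ball_subset_ball (min_le_right r r') h₂.2⟩ hT₂)
  have hconst : (fun s => Γ (0, s)) =ᶠ[𝓝 s₀] fun _ => Γ (0, 0) := by
    filter_upwards [hsn] with s hs using h0 s hs
  have h0T : (0 : ℝ) ∈ T := (mdifferentiableAt_const).congr_of_eventuallyEq hconst
  obtain ⟨r, hr, h⟩ := hloc t₀ ht₀
  obtain ⟨m, hm, hmT⟩ := exists_near_of_eventually_offFin hTev ht₀ hr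
  obtain ⟨r', hr', h'⟩ := hglob 0 h01 m hm.1
  have d1 := h' 0 ⟨h01, Metric.mem_ball_self hr'⟩ h0T m ⟨hm.1, Metric.mem_ball_self hr'⟩ hmT
  have d2 := h m hm hmT t₀ ⟨ht₀, Metric.mem_ball_self hr⟩ τ hτ hd₀
  refine ((d1.add d2).congr_of_eventuallyEq ?_).congr_deriv ?_
  · filter_upwards [hsn] with s hs
    change hInt A Γ 0 t₀ s + hInt A Γ t₀ (τ s) s
      = hInt A Γ 0 m s + (hInt A Γ m t₀ s + hInt A Γ t₀ (τ s) s)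
    rw [← hΓ.hInt_add A hs h01 hm.1 ht₀, add_assoc]
  · rw [← intervalIntegral.integral_add_adjacent_intervals (hφp.intervalIntegrable h01 hm.1)
        (hφp.intervalIntegrable hm.1 ht₀), A.alongPath_const hconst]
    abel

end Global

end HigherHol

namespace HigherHol

open Filter

/-! ### Horizontal transport as a function of the height. -/

section TransportFamily

variable {E : Type*} [NormedAddCommGroup E] [NormedSpace ℝ E] [FiniteDimensional ℝ E]
  {M : Type*} [TopologicalSpace M] [ChartedSpace E M] [IsManifold 𝓘(ℝ, E) ∞ M]
  {W : Type*} [NormedAddCommGroup W] [NormedSpace ℝ W]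
  {R : Type*} [NormedRing R] [NormedAlgebra ℝ R] [CompleteSpace R]
  {Γ : ℝ × ℝ → M}

/-- The bound on the good set serves all but finitely many slices; each remaining slice is a
piecewise smooth path with a bound of its own. -/
theorem PiecewiseSmoothOn.exists_uniform_bound (hΓ : PiecewiseSmoothOn E Γ unitSquare)
    (A : DiffForm E M W 1) : ∃ C, 0 ≤ C ∧ ∀ s ∈ Icc (0 : ℝ) 1, ∀ᶠ t in offFin,
      ‖A.alongPath (fun t => Γ (t, s)) t‖ ≤ C := by
  obtain ⟨G, hG⟩ := hΓ.exists_goodSet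
  obtain ⟨C₀, hC₀⟩ := hG.exists_bound A (fun _ => (1, 0))
  obtain ⟨F, hF⟩ := eventually_offFin_iff.1 hG.slice
  choose! c hc using fun s (hs : s ∈ Icc (0 : ℝ) 1) => ((hΓ.isPath_fst hs).pCont_alongPath A).bdd
  have hsum : ∀ S : Finset ℝ, 0 ≤ ∑ s ∈ S, |c s| := fun S =>
    Finset.sum_nonneg fun _ _ => abs_nonneg _
  classical
  set S : Finset ℝ := F ∪ {0, 1} with hS
  refine ⟨|C₀| + ∑ s ∈ S, |c s|, add_nonneg (abs_nonneg _) (hsum _), fun s hs => ?_⟩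
  by_cases hsF : s ∈ S
  · filter_upwards [hc s hs] with t ht
    have h1 := Finset.single_le_sum (f := fun s => |c s|) (fun _ _ => abs_nonneg _) hsF
    have h2 := le_abs_self (c s)
    have h3 := abs_nonneg C₀
    linarith
  · simp only [hS, Finset.mem_union, Finset.mem_insert, Finset.mem_singleton, not_or] at hsF
    have hsI : s ∈ Ioo (0 : ℝ) 1 :=
      ⟨lt_of_le_of_ne hs.1 (Ne.symm hsF.2.1), lt_of_le_of_ne hs.2 hsF.2.2⟩
    filter_upwards [hF s hsI hsF.1] with t ht
    rw [hG.alongPath_fst A ht]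
    exact (hC₀ _ ht).trans ((le_abs_self _).trans (le_add_of_nonneg_right (hsum _)))

theorem IsSol.exists_uniform_bound {a g : ℝ → ℝ → R} {S : Set ℝ} (ha : ∀ s ∈ S, PCont (a s))
    (hg : ∀ s ∈ S, IsSol (a s) (g s)) {C : ℝ} (hC0 : 0 ≤ C)
    (hC : ∀ s ∈ S, ∀ᶠ t in offFin, ‖a s t‖ ≤ C) : ∃ K, 0 ≤ K ∧ ∀ s ∈ S, ∀ t ∈ Icc (0 : ℝ) 1,
      ‖g s t‖ ≤ K ∧ ‖Ring.inverse (g s t)‖ ≤ K :=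
  ⟨‖(1 : R)‖ * Real.exp C, by positivity, fun s hs t ht =>
    ⟨(hg s hs).norm_le (ha s hs) hC0 (hC s hs) t ht,
      (hg s hs).norm_inverse_le (ha s hs) hC0 (hC s hs) t ht⟩⟩

theorem PiecewiseSmoothOn.exists_transport_norm_sub_le (hΓ : PiecewiseSmoothOn E Γ unitSquare)
    (A : DiffForm E M R 1) {g : ℝ → ℝ → R}
    (hg : ∀ s ∈ Icc (0 : ℝ) 1, IsSol (A.alongPath fun t => Γ (t, s)) (g s)) {s₀ : ℝ}
    (hs₀ : s₀ ∈ Icc (0 : ℝ) 1) : ∃ r > 0, ∃ C, ∀ t ∈ Icc (0 : ℝ) 1,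
      ∀ s ∈ Icc (0 : ℝ) 1 ∩ Metric.ball s₀ r, ‖g s t - g s₀ t‖ ≤ C * |s - s₀| := by
  have ha : ∀ s ∈ Icc (0 : ℝ) 1, PCont (A.alongPath fun t => Γ (t, s)) := fun s hs =>
    (hΓ.isPath_fst hs).pCont_alongPath A
  obtain ⟨C, hC0, hC⟩ := hΓ.exists_uniform_bound A
  obtain ⟨K, hK0, hK⟩ := IsSol.exists_uniform_bound ha hg hC0 hC
  obtain ⟨r, hr, c, hc0, hc⟩ := hΓ.exists_norm_hInt_sub_le A hs₀
  have h01 : (0 : ℝ) ∈ Icc (0 : ℝ) 1 := by simp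
  refine ⟨r, hr, (K + K * (K * (2 * C) * K)) * c, fun t ht s hs => ?_⟩
  rw [mul_assoc]
  refine IsSol.norm_sub_le_of_primitive (f := fun t => hInt A Γ 0 t s - hInt A Γ 0 t s₀)
    (ha s₀ hs₀) (ha s hs.1) (hg s₀ hs₀) (hg s hs.1) (by simp [hInt])
    (((ha s hs.1).continuousOn_primitive h01).sub ((ha s₀ hs₀).continuousOn_primitive h01)) ?_
    hC0 (hC s₀ hs₀) (hC s hs.1) (fun t ht => (hK s₀ hs₀ t ht).1) (fun t ht => (hK s hs.1 t ht).1)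
    (fun t ht => (hK s₀ hs₀ t ht).2)
    (fun t ht => hc t ht s hs s₀ ⟨hs₀, Metric.mem_ball_self hr⟩) ht
  filter_upwards [(ha s hs.1).hasDerivAt_primitive h01, (ha s₀ hs₀).hasDerivAt_primitive h01]
    with t e1 e2
  exact e1.sub e2

theorem PiecewiseSmoothOn.continuousOn_transport (hΓ : PiecewiseSmoothOn E Γ unitSquare)
    (A : DiffForm E M R 1) {g : ℝ → ℝ → R}
    (hg : ∀ s ∈ Icc (0 : ℝ) 1, IsSol (A.alongPath fun t => Γ (t, s)) (g s)) :
    ContinuousOn (fun p : ℝ × ℝ => g p.2 p.1) unitSquare := by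
  rintro ⟨t₀, s₀⟩ ⟨ht₀, hs₀⟩
  obtain ⟨r, hr, C, hC⟩ := hΓ.exists_transport_norm_sub_le A hg hs₀
  have h1 : ContinuousWithinAt (fun p : ℝ × ℝ => g s₀ p.1) unitSquare (t₀, s₀) :=
    ContinuousWithinAt.comp (t := Icc 0 1) ((hg s₀ hs₀).cont t₀ ht₀)
      continuous_fst.continuousWithinAt fun p hp => hp.1
  have h2 : Tendsto (fun p : ℝ × ℝ => g p.2 p.1 - g s₀ p.1) (𝓝[unitSquare] (t₀, s₀)) (𝓝 0) := by
    have h3 : Tendsto (fun p : ℝ × ℝ => C * |p.2 - s₀|) (𝓝[unitSquare] (t₀, s₀)) (𝓝 0) := by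
      have : Continuous fun p : ℝ × ℝ => C * |p.2 - s₀| := by fun_prop
      have h4 := this.tendsto (t₀, s₀)
      simp only [sub_self, abs_zero, mul_zero] at h4
      exact h4.mono_left nhdsWithin_le_nhds
    refine squeeze_zero_norm' ?_ h3
    have h5 : ∀ᶠ p : ℝ × ℝ in 𝓝[unitSquare] (t₀, s₀), p.2 ∈ Metric.ball s₀ r :=
      nhdsWithin_le_nhds (continuous_snd.continuousAt.eventually (Metric.ball_mem_nhds s₀ hr))
    filter_upwards [self_mem_nhdsWithin, h5] with p hp hpb
    exact hC p.1 hp.1 p.2 ⟨hp.2, hpb⟩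
  have h6 := h2.add h1
  simp only [sub_add_cancel, zero_add] at h6
  exact h6

/-- The covariant derivative of the horizontal transport in the vertical direction. -/
theorem GoodSet.hasDerivAt_transport {G : Set (ℝ × ℝ)} (hG : GoodSet E Γ G)
    (hΓ : PiecewiseSmoothOn E Γ unitSquare) (h0 : ∀ s ∈ Icc (0 : ℝ) 1, Γ (0, s) = Γ (0, 0))
    (A : DiffForm E M R 1) {g : ℝ → ℝ → R}
    (hg : ∀ s ∈ Icc (0 : ℝ) 1, IsSol (A.alongPath fun t => Γ (t, s)) (g s)) {s₀ : ℝ}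
    (hs₀ : s₀ ∈ Ioo (0 : ℝ) 1) (hsl : ∀ᶠ t in offFin, (t, s₀) ∈ G) {F : ℝ → R} (hFp : PCont F)
    (hF : ∀ t, (t, s₀) ∈ G → ∀ x₀, Γ (t, s₀) ∈ (extChartAt 𝓘(ℝ, E) x₀).source →
      F t = extDeriv (inChart A.toFun x₀) (extChartAt 𝓘(ℝ, E) x₀ (Γ (t, s₀)))
        ![fderiv ℝ (fun q => extChartAt 𝓘(ℝ, E) x₀ (Γ q)) (t, s₀) (1, 0),
          fderiv ℝ (fun q => extChartAt 𝓘(ℝ, E) x₀ (Γ q)) (t, s₀) (0, 1)]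
        + (A.along Γ (fun _ => (1, 0)) (t, s₀) * A.along Γ (fun _ => (0, 1)) (t, s₀)
          - A.along Γ (fun _ => (0, 1)) (t, s₀) * A.along Γ (fun _ => (1, 0)) (t, s₀)))
    {t₀ : ℝ} (ht₀ : t₀ ∈ Icc (0 : ℝ) 1) {τ : ℝ → ℝ}
    (hτ : ∀ᶠ s in 𝓝 s₀, |τ s - t₀| ≤ |s - s₀| ∧ τ s ∈ Icc (0 : ℝ) 1)
    (hd₀ : MDifferentiableAt 𝓘(ℝ, ℝ) 𝓘(ℝ, E) (fun s => Γ (τ s, s)) s₀) :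
    HasDerivAt (fun s => g s (τ s)) (-(A.alongPath (fun s => Γ (τ s, s)) s₀ * g s₀ t₀)
      + g s₀ t₀ * ∫ t in (0 : ℝ)..t₀, Ring.inverse (g s₀ t) * F t * g s₀ t) s₀ := by
  have h01 : (0 : ℝ) ∈ Icc (0 : ℝ) 1 := by simp
  have hsI : s₀ ∈ Icc (0 : ℝ) 1 := Ioo_subset_Icc_self hs₀
  have hsn : ∀ᶠ s in 𝓝 s₀, s ∈ Icc (0 : ℝ) 1 := Icc_mem_nhds hs₀.1 hs₀.2
  have ha : ∀ s ∈ Icc (0 : ℝ) 1, PCont (A.alongPath fun t => Γ (t, s)) := fun s hs =>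
    (hΓ.isPath_fst hs).pCont_alongPath A
  obtain ⟨C, hC0, hC⟩ := hΓ.exists_uniform_bound A
  obtain ⟨K, hK0, hK⟩ := IsSol.exists_uniform_bound ha hg hC0 hC
  obtain ⟨r, hr, c, hc0, hc⟩ := hΓ.exists_norm_hInt_sub_le A hsI
  set e : ℝ → R := fun t => A.along Γ (fun _ => (0, 1)) (t, s₀) with he
  set a : ℝ → R := fun t => A.along Γ (fun _ => (1, 0)) (t, s₀) with hadef
  have hslice : ∀ v : Fin 1 → ℝ × ℝ, PCont fun t => A.along Γ v (t, s₀) := by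
    intro v
    obtain ⟨c, hc⟩ := hG.exists_bound A v
    refine ⟨?_, c, ?_⟩
    · filter_upwards [hsl] with t ht
      exact ContinuousAt.comp (f := fun t : ℝ => (t, s₀))
        ((hG.continuousOn_along A v).continuousAt (hG.isOpen.mem_nhds ht)) (by fun_prop)
    · filter_upwards [hsl] with t ht using hc _ ht
  have hep : PCont e := hslice _
  have hap : PCont a := hslice _
  -- `φ` is the `dA` part of the curvature, obtained by removing the commutator from `F`.
  set φ : ℝ → R := fun t => F t - (a t * e t - e t * a t) with hφdef
  have hφp : PCont φ := hFp.sub ((hap.mul hep).sub (hep.mul hap))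
  have hφ : ∀ t, (t, s₀) ∈ G → ∀ x₀, Γ (t, s₀) ∈ (extChartAt 𝓘(ℝ, E) x₀).source →
      φ t = extDeriv (inChart A.toFun x₀) (extChartAt 𝓘(ℝ, E) x₀ (Γ (t, s₀)))
        ![fderiv ℝ (fun q => extChartAt 𝓘(ℝ, E) x₀ (Γ q)) (t, s₀) (1, 0),
          fderiv ℝ (fun q => extChartAt 𝓘(ℝ, E) x₀ (Γ q)) (t, s₀) (0, 1)] := by
    intro t ht x₀ hx
    simp only [hφdef, hF t ht x₀ hx, he, hadef]
    abel
  -- In the parameter, the primitive of the coefficient has derivative `e(t) - ∫₀ᵗ φ`: the boundary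
  -- term at `t` minus the integral of `dA`, the left side being constant.
  have key := hasDerivAt_sol_of_primitive
    (a := fun s => A.alongPath fun t => Γ (t, s)) (g := g)
    (f' := fun t => e t - ∫ x in (0 : ℝ)..t, φ x) (s₀ := s₀) (C := max C c) (K := K)
    (le_max_of_le_left hC0) ht₀ ?_ (fun t ht => (hK s₀ hsI t ht).2) ?_ hτ
    (hG.hasDerivAt_hInt hΓ h0 A hs₀ hsl hφp hφ ht₀ hτ hd₀)
  · refine key.congr_deriv ?_
    have hΦ := hφp.continuousOn_primitive h01
    have hΦp := PCont.of_continuousOn hΦ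
    -- With `Φ` the primitive of `φ`, the term `Φ g` equals `g ∫ g⁻¹ ([a, Φ] + φ) g`. Added to `g ∫
    -- g⁻¹ [a, e - Φ] g`, the brackets with `Φ` cancel and `φ + [a, e] = F` remains.
    have e1 := (hg s₀ hsI).conj_primitive (ha s₀ hsI) hφp ht₀
    have hic := (hg s₀ hsI).cont_inverse (ha s₀ hsI)
    have i1 := ((PCont.cont_mul hic (((ha s₀ hsI).mul (hep.sub hΦp)).sub ((hep.sub hΦp).mul
      (ha s₀ hsI)))).mul_cont (hg s₀ hsI).cont).intervalIntegrable h01 ht₀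
    have i2 := ((PCont.cont_mul hic ((((ha s₀ hsI).mul hΦp).sub (hΦp.mul (ha s₀ hsI))).add
      hφp)).mul_cont (hg s₀ hsI).cont).intervalIntegrable h01 ht₀
    rw [sub_mul, e1, neg_sub, sub_add_eq_add_sub, ← mul_add,
      ← intervalIntegral.integral_add i2 i1, neg_add_eq_sub]
    congr 2
    refine intervalIntegral_congr_offFin ?_ h01 ht₀
    filter_upwards [hsl] with t ht
    have e2 : A.alongPath (fun t => Γ (t, s₀)) t = a t := hG.alongPath_fst A ht
    simp only [e2, hφdef]
    noncomm_ring
  · filter_upwards [hsn, Metric.ball_mem_nhds s₀ hr] with s hs hsb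
    refine ⟨ha s hs, hg s hs, (hC s hs).mono fun t ht => ht.trans (le_max_left _ _),
      fun t ht => (hK s hs t ht).1, fun t ht => ?_⟩
    exact (hc t ht s ⟨hs, hsb⟩ s₀ ⟨hsI, Metric.mem_ball_self hr⟩).trans
      (mul_le_mul_of_nonneg_right (le_max_right _ _) (abs_nonneg _))
  · filter_upwards [hsl, eventually_offFin_mem] with t ht htI
    have hdt : MDifferentiableAt 𝓘(ℝ, ℝ) 𝓘(ℝ, E) (fun s => Γ (t, s)) s₀ := by
      have h1 : MDifferentiableAt 𝓘(ℝ, ℝ) 𝓘(ℝ, ℝ × ℝ) (fun s : ℝ => (t, s)) s₀ :=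
        DifferentiableAt.mdifferentiableAt (by fun_prop)
      exact (hG.mdifferentiableAt ht).comp s₀ h1
    refine ⟨?_, ?_⟩
    · have := hG.hasDerivAt_hInt hΓ h0 A hs₀ hsl hφp hφ (Ioo_subset_Icc_self htI)
        (τ := fun _ => t) (Eventually.of_forall fun s => ⟨by simp, Ioo_subset_Icc_self htI⟩) hdt
      rw [hG.alongPath_snd A ht] at this
      simpa [hInt] using this
    · have hc : ContinuousAt (fun s => A.along Γ (fun _ => (1, 0)) (t, s)) s₀ :=
        ContinuousAt.comp (f := fun s : ℝ => (t, s))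
          ((hG.continuousOn_along A _).continuousAt (hG.isOpen.mem_nhds ht)) (by fun_prop)
      refine hc.congr ?_
      have : ∀ᶠ s in 𝓝 s₀, (t, s) ∈ G :=
        (Continuous.tendsto (f := fun s : ℝ => (t, s)) (by fun_prop) s₀).eventually
          (hG.isOpen.mem_nhds ht)
      filter_upwards [this] with s hs using (hG.alongPath_fst A hs).symm

end TransportFamily

end HigherHol

namespace HigherHol

open Filter

theorem PCont.hasDerivAt_primitive_of_continuousAt {W : Type*} [NormedAddCommGroup W]
    [NormedSpace ℝ W] [CompleteSpace W] {f : ℝ → W} (hf : PCont f) {c x : ℝ}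
    (hc : c ∈ Icc (0 : ℝ) 1) (hxI : x ∈ Ioo (0 : ℝ) 1) (hx : ContinuousAt f x) :
    HasDerivAt (fun x => ∫ t in c..x, f t) (f x) x :=
  intervalIntegral.integral_hasDerivAt_right (hf.intervalIntegrable hc (Ioo_subset_Icc_self hxI))
    ⟨Icc 0 1, Icc_mem_nhds hxI.1 hxI.2, hf.integrableOn.aestronglyMeasurable⟩ hx

/-- The integral equation yields the derivative at every continuity point of the coefficient. For a
family of coefficients this keeps the exceptional set independent of the parameter. -/
theorem IsSol.hasDerivAt_of_continuousAt {R : Type*} [NormedRing R] [NormedAlgebra ℝ R]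
    [CompleteSpace R] {a U : ℝ → R} (ha : PCont a) (h : IsSol a U) {t : ℝ}
    (htI : t ∈ Ioo (0 : ℝ) 1) (ht : ContinuousAt a t) : HasDerivAt U (-(a t * U t)) t := by
  have h01 : (0 : ℝ) ∈ Icc (0 : ℝ) 1 := by simp
  have hc : ContinuousAt U t := h.cont.continuousAt (Icc_mem_nhds htI.1 htI.2)
  have h1 := ((ha.mul_cont h.cont).hasDerivAt_primitive_of_continuousAt h01 htI
    (ht.mul hc)).neg.add_const 1
  refine h1.congr_of_eventuallyEq ?_
  filter_upwards [Icc_mem_nhds htI.1 htI.2] with x hx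
  have := h.sub_eq_integral ha h01 hx
  rw [h.zero, sub_eq_iff_eq_add] at this
  rw [this]
  rfl

/-- Left multiplication by a unit `x` is injective on the finite-dimensional space `S`, hence
surjective, so the inverse is found inside `S`. For a non-unit the default value is `0`. -/
theorem Subalgebra.ringInverse_mem {R : Type*} [Ring R] [Algebra ℝ R] [FiniteDimensional ℝ R]
    (S : Subalgebra ℝ R) {x : R} (hx : x ∈ S) : Ring.inverse x ∈ S := by
  by_cases hu : IsUnit x
  · let m : S →ₗ[ℝ] S := LinearMap.mulLeft ℝ (⟨x, hx⟩ : S)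
    have hinj : Function.Injective m := by
      intro p q hpq
      have h1 : x * p.1 = x * q.1 := congrArg Subtype.val hpq
      exact Subtype.ext (hu.mul_left_cancel h1)
    have : FiniteDimensional ℝ S := FiniteDimensional.finiteDimensional_subalgebra S
    obtain ⟨z, hz⟩ := (LinearMap.injective_iff_surjective.1 hinj) 1
    have h2 : x * z.1 = 1 := congrArg Subtype.val hz
    have h3 : Ring.inverse x = z.1 := by
      rw [← one_mul z.1, ← Ring.inverse_mul_cancel x hu, mul_assoc, h2, mul_one]
    rw [h3]
    exact z.2
  · rw [Ring.inverse_non_unit _ hu]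
    exact S.zero_mem

/-! ### Moving the differential through products. -/

namespace FinComplex

variable {V : Type*} [NormedAddCommGroup V] [NormedSpace ℝ V] (C : FinComplex V)

/-- `z ↦ ∂z + z∂` on all endomorphisms. -/
noncomputable def deltaL : (V →L[ℝ] V) →L[ℝ] (V →L[ℝ] V) :=
  ContinuousLinearMap.mul ℝ _ C.d + (ContinuousLinearMap.mul ℝ _).flip C.d

theorem deltaL_apply (z : V →L[ℝ] V) : C.deltaL z = C.d * z + z * C.d := rfl

theorem deltaL_mul {z ψ : V →L[ℝ] V} (hψ : ψ ∈ C.gl0) : C.deltaL (z * ψ) = C.deltaL z * ψ := by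
  rw [C.deltaL_apply, C.deltaL_apply, add_mul, mul_assoc z ψ, ← hψ.2]
  simp only [mul_assoc]

theorem deltaL_mem {z : V →L[ℝ] V} (hz : z ∈ C.endDeg (-1)) : C.deltaL z ∈ C.gl0 :=
  (C.deltaAux ⟨z, hz⟩).2

theorem mul_mem_endDeg_left {n : ℤ} {ψ z : V →L[ℝ] V} (hψ : ψ ∈ C.gl0) (hz : z ∈ C.endDeg n) :
    ψ * z ∈ C.endDeg n := C.mul_mem_endDeg (zero_add n) hψ.1 hz

theorem mul_mem_endDeg_right {n : ℤ} {ψ z : V →L[ℝ] V} (hz : z ∈ C.endDeg n) (hψ : ψ ∈ C.gl0) :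
    z * ψ ∈ C.endDeg n := C.mul_mem_endDeg (add_zero n) hz hψ.1

/-- Since `ψ` commutes with `∂`, one has `[∂, z w ψ] = (δz) w ψ - z (δw) ψ`. Modulo exact terms `δ`
can thus be moved from one factor to the other. This is why the comparison holds only in the
quotient `gl⁻¹(V)`. -/
theorem map_mul_deltaL {X : Type*} [NormedAddCommGroup X] [NormedSpace ℝ X]
    {P : (V →L[ℝ] V) →L[ℝ] X} (hP : ∀ m ∈ C.endDeg (-2), P (C.d * m - m * C.d) = 0)
    {z w ψ : V →L[ℝ] V} (hz : z ∈ C.endDeg (-1)) (hw : w ∈ C.endDeg (-1)) (hψ : ψ ∈ C.gl0) :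
    P (z * C.deltaL w * ψ) = P (C.deltaL z * w * ψ) := by
  have h1 := hP (z * w * ψ) (C.mul_mem_endDeg_right (C.mul_mem_endDeg (by norm_num) hz hw) hψ)
  rw [← sub_eq_zero, ← map_sub, ← neg_eq_zero, ← map_neg, ← h1]
  congr 1
  rw [C.deltaL_apply, C.deltaL_apply, mul_assoc (z * w) ψ C.d, ← hψ.2]
  noncomm_ring

end FinComplex

/-! ### The explicit lift `h(x, u)` of the surface holonomy. -/

section Gauge

variable {V : Type*} [NormedAddCommGroup V] [NormedSpace ℝ V] [FiniteDimensional ℝ V]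

/-- A family `Y(x, u)` of endomorphisms of degree `-1`, with `x`-derivative `y(x, u)`. -/
structure GaugeData (C : FinComplex V) (Y y : ℝ → ℝ → (V →L[ℝ] V)) (B : ℝ) : Prop where
  nonneg : 0 ≤ B
  zero : ∀ u, Y 0 u = 0
  pCont : ∀ x ∈ Icc (0 : ℝ) 1, PCont (Y x)
  cont : ∀ᶠ u in offFin, ∀ x ∈ Icc (0 : ℝ) 1, ContinuousAt (Y x) u
  pCont_diag : PCont fun u => Y u u
  lip : ∀ᶠ u in offFin, ∀ x ∈ Icc (0 : ℝ) 1, ∀ x' ∈ Icc (0 : ℝ) 1,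
    ‖Y x' u - Y x u‖ ≤ B * |x' - x|
  deriv : ∀ᶠ x in offFin, ∀ᶠ u in offFin, HasDerivAt (fun x => Y x u) (y x u) x
  pCont_deriv : ∀ᶠ x in offFin, PCont (y x)
  cont_deriv : ∀ᶠ x in offFin, ∀ᶠ u in offFin, ContinuousAt (fun x => y x u) x
  bound : ∀ᶠ x in offFin, ∀ᶠ u in offFin, ‖y x u‖ ≤ B
  mem : ∀ x ∈ Icc (0 : ℝ) 1, ∀ u ∈ Icc (0 : ℝ) 1, Y x u ∈ C.endDeg (-1)
  mem_deriv : ∀ᶠ x in offFin, ∀ᶠ u in offFin, y x u ∈ C.endDeg (-1)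

/-- Solutions of `∂Q/∂u = -δY Q`, `Q(x, 0) = 1`, and of `D'(x) = -δY(x, x) D(x)`, `D(1) = 1`. -/
structure GaugeSol (C : FinComplex V) (Y Q : ℝ → ℝ → (V →L[ℝ] V)) (D : ℝ → (V →L[ℝ] V)) :
    Prop where
  sol : ∀ x ∈ Icc (0 : ℝ) 1, IsSol (fun u => C.deltaL (Y x u)) (Q x)
  one : D 1 = 1
  cont : ContinuousOn D (Icc 0 1)
  deriv : ∀ᶠ x in offFin, HasDerivAt D (-(C.deltaL (Y x x) * D x)) x
  mem : ∀ x ∈ Icc (0 : ℝ) 1, D x ∈ C.gl0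
  isUnit : ∀ x ∈ Icc (0 : ℝ) 1, IsUnit (D x)

variable {C : FinComplex V} {Y y Q : ℝ → ℝ → (V →L[ℝ] V)} {B : ℝ} {D : ℝ → (V →L[ℝ] V)}

theorem GaugeData.exists_sol (hY : GaugeData C Y y B) : ∃ Q D, GaugeSol C Y Q D := by
  choose! Q hQ using fun x hx => ((hY.pCont x hx).clm C.deltaL).exists_isSol
  have hd := hY.pCont_diag.clm C.deltaL
  obtain ⟨D, hD⟩ := hd.exists_isSol
  have h11 : (1 : ℝ) ∈ Icc (0 : ℝ) 1 := by simp
  have hmem := hD.mem_subalgebra hd C.gl0 (by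
    filter_upwards [eventually_offFin_mem] with u hu
    exact C.deltaL_mem (hY.mem u (Ioo_subset_Icc_self hu) u (Ioo_subset_Icc_self hu)))
  have hu := hD.isUnit hd h11
  -- Right multiplication by a constant preserves `D' = -(δY) D`, so it moves the normalization from
  -- `0` to `1`, the corner where the path `Θ(-, x)` starts.
  refine ⟨Q, fun x => D x * Ring.inverse (D 1), hQ, Ring.mul_inverse_cancel _ hu,
    hD.cont.mul continuousOn_const, ?_, fun x hx => C.gl0.mul_mem (hmem x hx)
      (Subalgebra.ringInverse_mem _ (hmem 1 h11)), fun x hx => (hD.isUnit hd hx).mul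
      (IsUnit.ringInverse hu)⟩
  filter_upwards [hD.deriv] with x hx
  rw [← mul_assoc, ← neg_mul]
  exact hx.mul_const _

/-- The solution `h(x, u)` of `∂h/∂u = Y + h δY`, `h(x, 0) = 0`. -/
noncomputable def gaugeH (Y Q : ℝ → ℝ → (V →L[ℝ] V)) (x u : ℝ) : V →L[ℝ] V :=
  (∫ v in (0 : ℝ)..u, Y x v * Q x v) * Ring.inverse (Q x u)

namespace GaugeSol

theorem norm_Y_le (hY : GaugeData C Y y B) :
    ∀ᶠ u in offFin, ∀ x ∈ Icc (0 : ℝ) 1, ‖Y x u‖ ≤ B := by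
  filter_upwards [hY.lip] with u hu x hx
  have := hu 0 (by simp) x hx
  rw [hY.zero, sub_zero, sub_zero, abs_of_nonneg hx.1] at this
  exact this.trans (mul_le_of_le_one_right hY.nonneg hx.2)

theorem pCont_delta (hY : GaugeData C Y y B) {x : ℝ} (hx : x ∈ Icc (0 : ℝ) 1) :
    PCont fun u => C.deltaL (Y x u) := (hY.pCont x hx).clm C.deltaL

theorem exists_bound (hQ : GaugeSol C Y Q D) (hY : GaugeData C Y y B) :
    ∃ K, 0 ≤ K ∧ ∀ x ∈ Icc (0 : ℝ) 1, ∀ u ∈ Icc (0 : ℝ) 1,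
      ‖Q x u‖ ≤ K ∧ ‖Ring.inverse (Q x u)‖ ≤ K :=
  IsSol.exists_uniform_bound (fun _ hx => pCont_delta hY hx) hQ.sol
    (C := ‖C.deltaL‖ * B) (mul_nonneg C.deltaL.opNorm_nonneg hY.nonneg) fun x hx => by
      filter_upwards [norm_Y_le hY] with u hu
      exact C.deltaL.le_opNorm_of_le (hu x hx)

theorem mem_gl0 (hQ : GaugeSol C Y Q D) (hY : GaugeData C Y y B) {x u : ℝ}
    (hx : x ∈ Icc (0 : ℝ) 1) (hu : u ∈ Icc (0 : ℝ) 1) : Q x u ∈ C.gl0 :=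
  (hQ.sol x hx).mem_subalgebra (pCont_delta hY hx) C.gl0 (by
    filter_upwards [eventually_offFin_mem] with u hu
    exact C.deltaL_mem (hY.mem x hx u (Ioo_subset_Icc_self hu))) u hu

theorem isUnit_Q (hQ : GaugeSol C Y Q D) (hY : GaugeData C Y y B) {x u : ℝ}
    (hx : x ∈ Icc (0 : ℝ) 1) (hu : u ∈ Icc (0 : ℝ) 1) : IsUnit (Q x u) :=
  (hQ.sol x hx).isUnit (pCont_delta hY hx) hu

theorem gaugeH_zero (x : ℝ) : gaugeH Y Q x 0 = 0 := by simp [gaugeH]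

theorem gaugeH_mem (hQ : GaugeSol C Y Q D) (hY : GaugeData C Y y B) {x u : ℝ}
    (hx : x ∈ Icc (0 : ℝ) 1) (hu : u ∈ Icc (0 : ℝ) 1) : gaugeH Y Q x u ∈ C.endDeg (-1) := by
  refine C.mul_mem_endDeg_right (intervalIntegral_mem_submodule _ ?_)
    (Subalgebra.ringInverse_mem _ (hQ.mem_gl0 hY hx hu))
  refine Eventually.of_forall fun v hv => ?_
  have hv' := uIcc_subset_unit (by simp) hu (uIoc_subset_uIcc hv)
  exact C.mul_mem_endDeg_right (hY.mem x hx v hv') (hQ.mem_gl0 hY hx hv')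

theorem continuousOn_gaugeH (hQ : GaugeSol C Y Q D) (hY : GaugeData C Y y B) {x : ℝ}
    (hx : x ∈ Icc (0 : ℝ) 1) : ContinuousOn (gaugeH Y Q x) (Icc 0 1) :=
  (((hY.pCont x hx).mul_cont (hQ.sol x hx).cont).continuousOn_primitive (by simp)).mul
    ((hQ.sol x hx).cont_inverse (pCont_delta hY hx))

theorem hasDerivAt_gaugeH (hQ : GaugeSol C Y Q D) (hY : GaugeData C Y y B) {x u : ℝ}
    (hx : x ∈ Icc (0 : ℝ) 1) (hu : u ∈ Ioo (0 : ℝ) 1) (hc : ContinuousAt (Y x) u) :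
    HasDerivAt (gaugeH Y Q x) (Y x u + gaugeH Y Q x u * C.deltaL (Y x u)) u := by
  have huI := Ioo_subset_Icc_self hu
  have hQu := hQ.isUnit_Q hY hx huI
  have hQc : ContinuousAt (Q x) u := (hQ.sol x hx).cont.continuousAt (Icc_mem_nhds hu.1 hu.2)
  have d1 := ((hY.pCont x hx).mul_cont (hQ.sol x hx).cont).hasDerivAt_primitive_of_continuousAt
    (c := 0) (by simp) hu (hc.mul hQc)
  have d2 := hasDerivAt_ringInverse ((hQ.sol x hx).hasDerivAt_of_continuousAt
    (pCont_delta hY hx) hu (C.deltaL.continuous.continuousAt.comp hc)) hQu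
  refine (d1.mul d2).congr_deriv ?_
  simp only [gaugeH]
  have h3 : -(Ring.inverse (Q x u) * -(C.deltaL (Y x u) * Q x u) * Ring.inverse (Q x u))
      = Ring.inverse (Q x u) * C.deltaL (Y x u) := by
    rw [mul_neg, neg_mul, neg_neg, mul_assoc, mul_assoc, Ring.mul_inverse_cancel _ hQu, mul_one]
  rw [h3, mul_assoc (Y x u), Ring.mul_inverse_cancel _ hQu, mul_one, ← mul_assoc]

/-- `Q` is a cochain map, so `δ ∫ Y Q = ∫ (δY) Q = 1 - Q`; dividing by `Q` gives the identity. It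
puts the class of `h` in `GL⁻¹(V)` and later turns `(1 + δh) y` into `Q⁻¹ y`. -/
theorem one_add_delta_gaugeH (hQ : GaugeSol C Y Q D) (hY : GaugeData C Y y B) {x u : ℝ}
    (hx : x ∈ Icc (0 : ℝ) 1) (hu : u ∈ Icc (0 : ℝ) 1) :
    1 + C.deltaL (gaugeH Y Q x u) = Ring.inverse (Q x u) := by
  have h01 : (0 : ℝ) ∈ Icc (0 : ℝ) 1 := by simp
  have h1 : C.deltaL (∫ v in (0 : ℝ)..u, Y x v * Q x v) = 1 - Q x u := by
    rw [← ContinuousLinearMap.intervalIntegral_comp_comm _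
      (((hY.pCont x hx).mul_cont (hQ.sol x hx).cont).intervalIntegrable h01 hu)]
    have h2 := (hQ.sol x hx).sub_eq_integral (pCont_delta hY hx) h01 hu
    rw [(hQ.sol x hx).zero] at h2
    rw [← neg_sub, h2, neg_neg]
    refine intervalIntegral.integral_congr fun v hv => ?_
    exact C.deltaL_mul (hQ.mem_gl0 hY hx (uIcc_subset_unit h01 hu hv))
  rw [gaugeH, C.deltaL_mul (Subalgebra.ringInverse_mem _ (hQ.mem_gl0 hY hx hu)), h1, sub_mul,
    one_mul, Ring.mul_inverse_cancel _ (hQ.isUnit_Q hY hx hu)]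
  abel

theorem norm_gaugeH_le (hY : GaugeData C Y y B) {K : ℝ} (hK0 : 0 ≤ K)
    (hK : ∀ x ∈ Icc (0 : ℝ) 1, ∀ u ∈ Icc (0 : ℝ) 1, ‖Q x u‖ ≤ K ∧ ‖Ring.inverse (Q x u)‖ ≤ K)
    {x u : ℝ} (hx : x ∈ Icc (0 : ℝ) 1) (hu : u ∈ Icc (0 : ℝ) 1) :
    ‖gaugeH Y Q x u‖ ≤ B * K * K := by
  have h01 : (0 : ℝ) ∈ Icc (0 : ℝ) 1 := by simp
  have hB := hY.nonneg
  have h1 : ‖∫ v in (0 : ℝ)..u, Y x v * Q x v‖ ≤ B * K := by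
    refine (intervalIntegral.norm_integral_le_of_norm_le_const_ae (C := B * K) ?_).trans
      (mul_le_of_le_one_right (by positivity) ?_)
    · filter_upwards [ae_uIoc_of_eventually_offFin (norm_Y_le hY) h01 hu] with v hv hvI
      exact (norm_mul_le _ _).trans (mul_le_mul (hv hvI x hx)
        (hK x hx v (uIcc_subset_unit h01 hu (uIoc_subset_uIcc hvI))).1 (norm_nonneg _) hB)
    · rw [sub_zero, abs_of_nonneg hu.1]; exact hu.2
  exact (norm_mul_le _ _).trans (mul_le_mul h1 (hK x hx u hu).2 (norm_nonneg _) (by positivity))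

/-- The variation of `h(x, u)` in `x`. -/
theorem gaugeH_sub (hQ : GaugeSol C Y Q D) (hY : GaugeData C Y y B) {x x' u : ℝ}
    (hx : x ∈ Icc (0 : ℝ) 1) (hx' : x' ∈ Icc (0 : ℝ) 1) (hu : u ∈ Icc (0 : ℝ) 1) :
    gaugeH Y Q x' u - gaugeH Y Q x u = (∫ v in (0 : ℝ)..u, ((Y x' v - Y x v)
      + gaugeH Y Q x' v * C.deltaL (Y x' v - Y x v)) * Q x v) * Ring.inverse (Q x u) := by
  have h01 : (0 : ℝ) ∈ Icc (0 : ℝ) 1 := by simp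
  have hΔ : PCont fun v => Y x' v - Y x v := (hY.pCont x' hx').sub (hY.pCont x hx)
  -- `Q x` is an integrating factor: in the derivative of `(h(x', v) - h(x, v)) Q(x, v)` all terms
  -- containing the unknown difference cancel.
  have key := integral_eq_sub_offFin
    (u := fun v => (gaugeH Y Q x' v - gaugeH Y Q x v) * Q x v)
    (u' := fun v => ((Y x' v - Y x v) + gaugeH Y Q x' v * C.deltaL (Y x' v - Y x v)) * Q x v)
    (((hQ.continuousOn_gaugeH hY hx').sub (hQ.continuousOn_gaugeH hY hx)).mul (hQ.sol x hx).cont)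
    ?_ ((hΔ.add (PCont.cont_mul (hQ.continuousOn_gaugeH hY hx') (hΔ.clm C.deltaL))).mul_cont
      (hQ.sol x hx).cont) h01 hu
  · rw [key]
    simp only [gaugeH_zero, sub_self, zero_mul, sub_zero]
    rw [mul_assoc, Ring.mul_inverse_cancel _ (hQ.isUnit_Q hY hx hu), mul_one]
  · filter_upwards [hY.cont, eventually_offFin_mem, (hQ.sol x hx).deriv] with v hv hvI d3
    have d1 := hQ.hasDerivAt_gaugeH hY hx' hvI (hv x' hx')
    have d2 := hQ.hasDerivAt_gaugeH hY hx hvI (hv x hx)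
    refine ((d1.sub d2).mul d3).congr_deriv ?_
    simp only [map_sub, Pi.sub_apply]
    noncomm_ring

theorem exists_norm_gaugeH_sub_le (hQ : GaugeSol C Y Q D) (hY : GaugeData C Y y B) :
    ∃ Λ, 0 ≤ Λ ∧ ∀ x ∈ Icc (0 : ℝ) 1, ∀ x' ∈ Icc (0 : ℝ) 1,
      (∀ᶠ v in offFin, ‖((Y x' v - Y x v) + gaugeH Y Q x' v * C.deltaL (Y x' v - Y x v)) * Q x v‖
        ≤ Λ * |x' - x|) ∧
      ∀ u ∈ Icc (0 : ℝ) 1, ‖gaugeH Y Q x' u - gaugeH Y Q x u‖ ≤ Λ * |x' - x| := by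
  obtain ⟨K, hK0, hK⟩ := hQ.exists_bound hY
  have h01 : (0 : ℝ) ∈ Icc (0 : ℝ) 1 := by simp
  have hB := hY.nonneg
  set N := (B + B * K * K * (‖C.deltaL‖ * B)) * K with hN
  have hN0 : 0 ≤ N := by positivity
  have h1 : ∀ x ∈ Icc (0 : ℝ) 1, ∀ x' ∈ Icc (0 : ℝ) 1, ∀ᶠ v in offFin,
      ‖((Y x' v - Y x v) + gaugeH Y Q x' v * C.deltaL (Y x' v - Y x v)) * Q x v‖
        ≤ N * |x' - x| := by
    intro x hx x' hx'
    filter_upwards [hY.lip, eventually_offFin_mem] with v hv hvI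
    have hvI' := Ioo_subset_Icc_self hvI
    have e1 := hv x hx x' hx'
    have e2 := C.deltaL.le_opNorm_of_le e1
    have e3 := (norm_mul_le (gaugeH Y Q x' v) (C.deltaL (Y x' v - Y x v))).trans
      (mul_le_mul (norm_gaugeH_le hY hK0 hK hx' hvI') e2 (norm_nonneg _) (by positivity))
    refine (norm_mul_le _ _).trans ((mul_le_mul ((norm_add_le _ _).trans (add_le_add e1 e3))
      (hK x hx v hvI').1 (norm_nonneg _) (by positivity)).trans (le_of_eq ?_))
    rw [hN]; ring
  refine ⟨N + N * K, by positivity, fun x hx x' hx' => ⟨?_, fun u hu => ?_⟩⟩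
  · filter_upwards [h1 x hx x' hx'] with v hv
    refine hv.trans (mul_le_mul_of_nonneg_right ?_ (abs_nonneg _))
    exact le_add_of_nonneg_right (by positivity)
  · rw [hQ.gaugeH_sub hY hx hx' hu]
    have h2 := (intervalIntegral.norm_integral_le_of_norm_le_const_ae
      (ae_uIoc_of_eventually_offFin (h1 x hx x' hx') h01 hu)).trans
      (mul_le_of_le_one_right (by positivity)
        (by rw [sub_zero, abs_of_nonneg hu.1]; exact hu.2))
    refine (norm_mul_le _ _).trans ((mul_le_mul h2 (hK x hx u hu).2 (norm_nonneg _)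
      (by positivity)).trans ?_)
    have : 0 ≤ N * |x' - x| := by positivity
    linarith

theorem continuousWithinAt_of_lip {W : Type*} [NormedAddCommGroup W] {f : ℝ → ℝ → W} {Λ : ℝ}
    (hf : ∀ x ∈ Icc (0 : ℝ) 1, ∀ x' ∈ Icc (0 : ℝ) 1, ∀ u ∈ Icc (0 : ℝ) 1,
      ‖f x' u - f x u‖ ≤ Λ * |x' - x|) (hc : ∀ x ∈ Icc (0 : ℝ) 1, ContinuousOn (f x) (Icc 0 1)) :
    ContinuousOn (fun p : ℝ × ℝ => f p.1 p.2) unitSquare := by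
  rintro ⟨x, u⟩ ⟨hx, hu⟩
  have h1 : ContinuousWithinAt (fun p : ℝ × ℝ => f x p.2) unitSquare (x, u) :=
    ContinuousWithinAt.comp (t := Icc 0 1) (hc x hx u hu)
      continuous_snd.continuousWithinAt fun p hp => hp.2
  have h2 : Tendsto (fun p : ℝ × ℝ => f p.1 p.2 - f x p.2) (𝓝[unitSquare] (x, u)) (𝓝 0) := by
    have h3 : Tendsto (fun p : ℝ × ℝ => Λ * |p.1 - x|) (𝓝[unitSquare] (x, u)) (𝓝 0) := by
      have : Continuous fun p : ℝ × ℝ => Λ * |p.1 - x| := by fun_prop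
      have h4 := this.tendsto (x, u)
      simp only [sub_self, abs_zero, mul_zero] at h4
      exact h4.mono_left nhdsWithin_le_nhds
    refine squeeze_zero_norm' ?_ h3
    filter_upwards [self_mem_nhdsWithin] with p hp using hf x hx p.1 hp.1 p.2 hp.2
  have h6 := h2.add h1
  simp only [sub_add_cancel, zero_add] at h6
  exact h6

theorem continuousOn_gaugeH₂ (hQ : GaugeSol C Y Q D) (hY : GaugeData C Y y B) :
    ContinuousOn (fun p : ℝ × ℝ => gaugeH Y Q p.1 p.2) unitSquare := by
  obtain ⟨Λ, -, hΛ⟩ := hQ.exists_norm_gaugeH_sub_le hY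
  exact continuousWithinAt_of_lip (fun x hx x' hx' => (hΛ x hx x' hx').2)
    fun x hx => hQ.continuousOn_gaugeH hY hx

/-- Joint continuity is known for `h` from its Lipschitz bound in `x`; it passes to `Q⁻¹ = 1 + δh`,
and then to `Q` by inversion. -/
theorem continuousOn_Q (hQ : GaugeSol C Y Q D) (hY : GaugeData C Y y B) :
    ContinuousOn (fun p : ℝ × ℝ => Q p.1 p.2) unitSquare ∧
      ContinuousOn (fun p : ℝ × ℝ => Ring.inverse (Q p.1 p.2)) unitSquare := by
  have h1 : ContinuousOn (fun p : ℝ × ℝ => Ring.inverse (Q p.1 p.2)) unitSquare := by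
    refine ContinuousOn.congr (f := fun p : ℝ × ℝ => 1 + C.deltaL (gaugeH Y Q p.1 p.2))
      (continuousOn_const.add (C.deltaL.continuous.comp_continuousOn (hQ.continuousOn_gaugeH₂ hY)))
      fun p hp => (hQ.one_add_delta_gaugeH hY hp.1 hp.2).symm
  refine ⟨?_, h1⟩
  refine (continuousOn_ringInverse h1 fun p hp =>
    IsUnit.ringInverse (hQ.isUnit_Q hY hp.1 hp.2)).congr fun p hp => ?_
  obtain ⟨w, hw⟩ := hQ.isUnit_Q hY hp.1 hp.2
  change Q p.1 p.2 = Ring.inverse (Ring.inverse (Q p.1 p.2))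
  rw [← hw, Ring.inverse_unit, Ring.inverse_unit, inv_inv]

end GaugeSol

end Gauge

end HigherHol

namespace HigherHol

open Filter

/-! ### Differentiation of the lift along the diagonal. -/

section Gauge

variable {V : Type*} [NormedAddCommGroup V] [NormedSpace ℝ V] [FiniteDimensional ℝ V]
  {C : FinComplex V} {Y y Q : ℝ → ℝ → (V →L[ℝ] V)} {B : ℝ} {D : ℝ → (V →L[ℝ] V)}

namespace GaugeSol

/-- Write `h(x', x') = h(x, x') + (h(x', x') - h(x, x'))`. The first term is differentiated by its
equation in `u`. The second is the integral of `gaugeH_sub`, whose integrand vanishes at `x' = x`,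
so the motion of its upper limit is of second order. -/
theorem hasDerivAt_gaugeH_diag (hQ : GaugeSol C Y Q D) (hY : GaugeData C Y y B) :
    ∀ᶠ x in offFin, HasDerivAt (fun x => gaugeH Y Q x x)
      (Y x x + gaugeH Y Q x x * C.deltaL (Y x x)
        + (∫ v in (0 : ℝ)..x, (y x v + gaugeH Y Q x v * C.deltaL (y x v)) * Q x v)
          * Ring.inverse (Q x x)) x := by
  obtain ⟨Λ, hΛ0, hΛ⟩ := hQ.exists_norm_gaugeH_sub_le hY
  filter_upwards [hY.deriv, hY.cont, eventually_offFin_mem] with x hd hc hxI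
  have hx := Ioo_subset_Icc_self hxI
  have h01 : (0 : ℝ) ∈ Icc (0 : ℝ) 1 := by simp
  have hnhds : ∀ᶠ x' in 𝓝 x, x' ∈ Icc (0 : ℝ) 1 := Icc_mem_nhds hxI.1 hxI.2
  set J : ℝ → ℝ → (V →L[ℝ] V) := fun x' v =>
    ((Y x' v - Y x v) + gaugeH Y Q x' v * C.deltaL (Y x' v - Y x v)) * Q x v with hJ
  have hJx : ∀ v, J x v = 0 := fun v => by simp [hJ]
  have hJp : ∀ x' ∈ Icc (0 : ℝ) 1, PCont (J x') := fun x' hx' => by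
    have hΔ : PCont fun v => Y x' v - Y x v := (hY.pCont x' hx').sub (hY.pCont x hx)
    exact (hΔ.add (PCont.cont_mul (hQ.continuousOn_gaugeH hY hx') (hΔ.clm C.deltaL))).mul_cont
      (hQ.sol x hx).cont
  have d1 : HasDerivAt (fun x' => ∫ v in (0 : ℝ)..x, J x' v)
      (∫ v in (0 : ℝ)..x, (y x v + gaugeH Y Q x v * C.deltaL (y x v)) * Q x v) x := by
    refine hasDerivAt_intervalIntegral_of_lip (C := Λ) hJx ?_ ?_ ?_
    · filter_upwards [hnhds] with x' hx' using (hJp x' hx').aestronglyMeasurable h01 hx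
    · filter_upwards [hnhds] with x' hx'
      exact ae_uIoc_of_eventually_offFin (hΛ x hx x' hx').1 h01 hx
    · refine ae_uIoc_of_eventually_offFin ?_ h01 hx
      filter_upwards [hd, eventually_offFin_mem] with v hv hvI
      have e1 : HasDerivAt (fun x' => Y x' v - Y x v) (y x v) x := hv.sub_const _
      have e2 : HasDerivAt (fun x' => C.deltaL (Y x' v - Y x v)) (C.deltaL (y x v)) x :=
        C.deltaL.hasFDerivAt.comp_hasDerivAt x e1
      have e3 : ContinuousAt (fun x' => gaugeH Y Q x' v) x :=
        ContinuousAt.comp (f := fun x' : ℝ => (x', v)) (g := fun p : ℝ × ℝ => gaugeH Y Q p.1 p.2)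
          ((hQ.continuousOn_gaugeH₂ hY).continuousAt (prod_mem_nhds (Icc_mem_nhds hxI.1 hxI.2)
            (Icc_mem_nhds hvI.1 hvI.2))) (by fun_prop)
      -- `h` is only known to be continuous in its first argument; this suffices because the other
      -- factor vanishes at `x' = x`.
      have e4 := hasDerivAt_bilin_of_eq_zero (ContinuousLinearMap.mul ℝ (V →L[ℝ] V)).flip
        (by simp) e2 e3
      exact (e1.add e4).mul_const _
  have d2 : HasDerivAt (fun x' => ∫ v in x..x', J x' v) 0 x := by
    refine hasDerivAt_zero_of_norm_le_sq (K := Λ) ?_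
    filter_upwards [hnhds] with x' hx'
    refine (intervalIntegral.norm_integral_le_of_norm_le_const_ae
      (ae_uIoc_of_eventually_offFin (hΛ x hx x' hx').1 hx hx')).trans (le_of_eq (by ring))
  have d3 : HasDerivAt (fun x' => ∫ v in (0 : ℝ)..x', J x' v)
      (∫ v in (0 : ℝ)..x, (y x v + gaugeH Y Q x v * C.deltaL (y x v)) * Q x v) x := by
    have := d1.add d2
    rw [add_zero] at this
    refine this.congr_of_eventuallyEq ?_
    filter_upwards [hnhds] with x' hx'
    exact (intervalIntegral.integral_add_adjacent_intervals
      ((hJp x' hx').intervalIntegrable h01 hx) ((hJp x' hx').intervalIntegrable hx hx')).symm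
  have hinv : ContinuousAt (fun x' => Ring.inverse (Q x x')) x :=
    ((hQ.sol x hx).cont_inverse (pCont_delta hY hx)).continuousAt (Icc_mem_nhds hxI.1 hxI.2)
  have d4 := hasDerivAt_bilin_of_eq_zero (ContinuousLinearMap.mul ℝ (V →L[ℝ] V))
    (by simp [hJx]) d3 hinv
  refine ((hQ.hasDerivAt_gaugeH hY hx hxI (hc x hx)).add d4).congr_of_eventuallyEq ?_
  filter_upwards [hnhds] with x' hx'
  have := hQ.gaugeH_sub hY hx hx' hx'
  rw [sub_eq_iff_eq_add'] at this
  exact this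

/-- The integral of `Q⁻¹ y Q` over a horizontal segment up to the diagonal, transported. -/
noncomputable def flux (y Q : ℝ → ℝ → (V →L[ℝ] V)) (D : ℝ → (V →L[ℝ] V)) (x : ℝ) : V →L[ℝ] V :=
  (∫ v in (0 : ℝ)..x, Ring.inverse (Q x v) * y x v * Q x v) * (Ring.inverse (Q x x) * D x)

theorem continuousOn_diag_inverse (hQ : GaugeSol C Y Q D) (hY : GaugeData C Y y B) :
    ContinuousOn (fun x => Ring.inverse (Q x x) * D x) (Icc 0 1) :=
  ((hQ.continuousOn_Q hY).2.comp (f := fun x : ℝ => (x, x)) (by fun_prop)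
    fun _ hx => ⟨hx, hx⟩).mul hQ.cont

theorem pCont_conj (hQ : GaugeSol C Y Q D) (hY : GaugeData C Y y B) :
    ∀ᶠ x in offFin, PCont fun v => Ring.inverse (Q x v) * y x v * Q x v := by
  filter_upwards [hY.pCont_deriv, eventually_offFin_mem] with x hx hxI
  have hxI' := Ioo_subset_Icc_self hxI
  exact (PCont.cont_mul ((hQ.sol x hxI').cont_inverse (pCont_delta hY hxI')) hx).mul_cont
    (hQ.sol x hxI').cont

theorem pCont_flux (hQ : GaugeSol C Y Q D) (hY : GaugeData C Y y B) : PCont (flux y Q D) := by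
  obtain ⟨K, hK0, hK⟩ := hQ.exists_bound hY
  have h01 : (0 : ℝ) ∈ Icc (0 : ℝ) 1 := by simp
  have hB := hY.nonneg
  have hbd : ∀ᶠ x in offFin, ∀ᶠ v in offFin,
      ‖Ring.inverse (Q x v) * y x v * Q x v‖ ≤ K * B * K := by
    filter_upwards [hY.bound, eventually_offFin_mem] with x hx hxI
    filter_upwards [hx, eventually_offFin_mem] with v hv hvI
    have := hK x (Ioo_subset_Icc_self hxI) v (Ioo_subset_Icc_self hvI)
    exact (norm_mul_le _ _).trans (mul_le_mul ((norm_mul_le _ _).trans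
      (mul_le_mul this.2 hv (norm_nonneg _) hK0)) this.1 (norm_nonneg _) (by positivity))
  refine PCont.mul_cont ?_ (hQ.continuousOn_diag_inverse hY)
  constructor
  · filter_upwards [eventually_offFin_nhds hbd, eventually_offFin_nhds (hQ.pCont_conj hY),
      hY.cont_deriv, eventually_offFin_mem] with x hb hp hc hxI
    have hx := Ioo_subset_Icc_self hxI
    have hnhds : ∀ᶠ x' in 𝓝 x, x' ∈ Icc (0 : ℝ) 1 := Icc_mem_nhds hxI.1 hxI.2
    have c1 : ContinuousAt (fun x' => ∫ v in (0 : ℝ)..x, Ring.inverse (Q x' v) * y x' v * Q x' v)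
        x := by
      refine intervalIntegral.continuousAt_of_dominated_interval (bound := fun _ => K * B * K)
        ?_ ?_ (by simp) ?_
      · filter_upwards [hp] with x' hx' using hx'.aestronglyMeasurable h01 hx
      · filter_upwards [hb] with x' hx' using ae_uIoc_of_eventually_offFin hx' h01 hx
      · refine ae_uIoc_of_eventually_offFin ?_ h01 hx
        filter_upwards [hc, eventually_offFin_mem] with v hv hvI
        have hm : unitSquare ∈ 𝓝 (x, v) := prod_mem_nhds (Icc_mem_nhds hxI.1 hxI.2)
          (Icc_mem_nhds hvI.1 hvI.2)
        have hq := (hQ.continuousOn_Q hY).1.continuousAt hm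
        have hq' := (hQ.continuousOn_Q hY).2.continuousAt hm
        have hl : ContinuousAt (fun x' : ℝ => (x', v)) x := by fun_prop
        exact ((ContinuousAt.comp (f := fun x' : ℝ => (x', v)) hq' hl).mul hv).mul
          (ContinuousAt.comp (f := fun x' : ℝ => (x', v)) hq hl)
    have c2 : ContinuousAt (fun x' => ∫ v in x..x', Ring.inverse (Q x' v) * y x' v * Q x' v)
        x := by
      rw [ContinuousAt, intervalIntegral.integral_same]
      have h3 : Tendsto (fun x' : ℝ => K * B * K * |x' - x|) (𝓝 x) (𝓝 0) := by
        have : Continuous fun x' : ℝ => K * B * K * |x' - x| := by fun_prop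
        simpa using this.tendsto x
      refine squeeze_zero_norm' ?_ h3
      filter_upwards [hb, hnhds] with x' hx' hxI'
      exact intervalIntegral.norm_integral_le_of_norm_le_const_ae
        (ae_uIoc_of_eventually_offFin hx' hx hxI')
    refine (c1.add c2).congr ?_
    filter_upwards [hp, hnhds] with x' hx' hxI'
    exact intervalIntegral.integral_add_adjacent_intervals (hx'.intervalIntegrable h01 hx)
      (hx'.intervalIntegrable hx hxI')
  · refine ⟨K * B * K, ?_⟩
    filter_upwards [hbd, eventually_offFin_mem] with x hx hxI
    refine (intervalIntegral.norm_integral_le_of_norm_le_const_ae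
      (ae_uIoc_of_eventually_offFin hx h01 (Ioo_subset_Icc_self hxI))).trans
      (mul_le_of_le_one_right (by positivity) ?_)
    rw [sub_zero, abs_of_pos hxI.1]
    exact hxI.2.le

/-- The two ways of integrating the gauge field over the square agree modulo exact terms. -/
theorem map_gaugeH_one_one (hQ : GaugeSol C Y Q D) (hY : GaugeData C Y y B) {X : Type*}
    [NormedAddCommGroup X] [NormedSpace ℝ X] [CompleteSpace X] {P : (V →L[ℝ] V) →L[ℝ] X}
    (hP : ∀ m ∈ C.endDeg (-2), P (C.d * m - m * C.d) = 0) :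
    P (gaugeH Y Q 1 1) = P ((∫ x in (0 : ℝ)..1, flux y Q D x) + ∫ x in (0 : ℝ)..1, Y x x * D x) := by
  have h01 : (0 : ℝ) ∈ Icc (0 : ℝ) 1 := by simp
  have h11 : (1 : ℝ) ∈ Icc (0 : ℝ) 1 := by simp
  have hYD : PCont fun x => Y x x * D x := hY.pCont_diag.mul_cont hQ.cont
  have key := integral_eq_sub_offFin
    (u := fun x => P (gaugeH Y Q x x * D x - ∫ r in (1 : ℝ)..x, Y r r * D r))
    (u' := fun x => P (flux y Q D x)) ?_ ?_ ((hQ.pCont_flux hY).clm P) h01 h11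
  · rw [P.intervalIntegral_comp_comm ((hQ.pCont_flux hY).intervalIntegrable h01 h11)] at key
    rw [map_add, key]
    simp only [hQ.one, mul_one, intervalIntegral.integral_same, sub_zero, gaugeH_zero, zero_mul,
      zero_sub]
    rw [intervalIntegral.integral_symm (0 : ℝ) 1, neg_neg]
    abel
  · refine P.continuous.comp_continuousOn (ContinuousOn.sub (ContinuousOn.mul ?_ hQ.cont)
      (hYD.continuousOn_primitive h11))
    exact (hQ.continuousOn_gaugeH₂ hY).comp (f := fun x : ℝ => (x, x)) (by fun_prop)
      fun _ hx => ⟨hx, hx⟩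
  · filter_upwards [hQ.hasDerivAt_gaugeH_diag hY, hQ.deriv, hYD.hasDerivAt_primitive h11,
      eventually_offFin_mem, hY.pCont_deriv, hY.mem_deriv] with x d1 d2 d3 hxI hy hm
    have hx := Ioo_subset_Icc_self hxI
    have d4 := P.hasFDerivAt.comp_hasDerivAt x ((d1.mul d2).sub d3)
    refine d4.congr_deriv ?_
    set ψ := Ring.inverse (Q x x) * D x with hψ
    have hψm : ψ ∈ C.gl0 := C.gl0.mul_mem (Subalgebra.ringInverse_mem _ (hQ.mem_gl0 hY hx hx))
      (hQ.mem x hx)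
    -- The terms `h δY D` cancel by the choice of `D`, and `Y D` cancels against the subtracted
    -- primitive. Only the variation of `h` in its first argument survives.
    have e1 : ∀ I : V →L[ℝ] V, (Y x x + gaugeH Y Q x x * C.deltaL (Y x x)
        + I * Ring.inverse (Q x x)) * D x
        + gaugeH Y Q x x * -(C.deltaL (Y x x) * D x) - Y x x * D x = I * ψ := by
      intro I
      rw [hψ]
      noncomm_ring
    rw [e1, flux, ← hψ]
    have i1 : PCont fun v => (y x v + gaugeH Y Q x v * C.deltaL (y x v)) * Q x v :=
      (hy.add (PCont.cont_mul (hQ.continuousOn_gaugeH hY hx) (hy.clm C.deltaL))).mul_cont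
        (hQ.sol x hx).cont
    have i2 : PCont fun v => Ring.inverse (Q x v) * y x v * Q x v :=
      (PCont.cont_mul ((hQ.sol x hx).cont_inverse (pCont_delta hY hx)) hy).mul_cont
        (hQ.sol x hx).cont
    have e2 : ∀ f : ℝ → (V →L[ℝ] V), PCont f → P ((∫ v in (0 : ℝ)..x, f v) * ψ)
        = ∫ v in (0 : ℝ)..x, P (f v * ψ) := fun f hf =>
      ((P.comp ((ContinuousLinearMap.mul ℝ (V →L[ℝ] V)).flip ψ)).intervalIntegral_comp_comm
        (hf.intervalIntegrable h01 hx)).symm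
    rw [e2 _ i1, e2 _ i2]
    refine intervalIntegral_congr_offFin ?_ h01 hx
    filter_upwards [hm, eventually_offFin_mem] with v hv hvI
    have hvI' := Ioo_subset_Icc_self hvI
    have hQψ : Q x v * ψ ∈ C.gl0 := C.gl0.mul_mem (hQ.mem_gl0 hY hx hvI') hψm
    -- Modulo exact terms `h δy` may be replaced by `(δh) y`, which turns `y + h δy` into `(1 + δh)
    -- y = Q⁻¹ y`, the integrand of the flux.
    have e3 := C.map_mul_deltaL hP (hQ.gaugeH_mem hY hx hvI') hv hQψ
    rw [← hQ.one_add_delta_gaugeH hY hx hvI']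
    simp only [add_mul, one_mul, map_add, mul_assoc] at e3 ⊢
    rw [e3]

end GaugeSol

end Gauge

end HigherHol

namespace HigherHol

open Filter

/-! ### Gauge data from a field that is continuous on a good set. -/

section GaugeOfField

variable {V : Type*} [NormedAddCommGroup V] [NormedSpace ℝ V] [FiniteDimensional ℝ V]
  {C : FinComplex V} {y : ℝ → ℝ → (V →L[ℝ] V)} {B : ℝ}

/-- If the horizontal slice at height `u` meets the complement of `G` in finitely many points,
dominated convergence gives continuity of `Y(x, ·)` at `u` for all `x` at once. The vertical slices
are needed for the statements about `y(x, ·)` at fixed `x`. -/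
theorem GaugeData.of_integral {G : Set (ℝ × ℝ)} (hG : IsOpen G)
    (hsl : ∀ᶠ u in offFin, ∀ᶠ t in offFin, (t, u) ∈ G)
    (hsl' : ∀ᶠ t in offFin, ∀ᶠ u in offFin, (t, u) ∈ G)
    (hc : ContinuousOn (fun p : ℝ × ℝ => y p.1 p.2) G) (hB0 : 0 ≤ B)
    (hB : ∀ p ∈ G, ‖y p.1 p.2‖ ≤ B)
    (hm : ∀ t ∈ Icc (0 : ℝ) 1, ∀ u ∈ Icc (0 : ℝ) 1, y t u ∈ C.endDeg (-1)) :
    GaugeData C (fun x u => ∫ t in (0 : ℝ)..x, y t u) y B := by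
  have h01 : (0 : ℝ) ∈ Icc (0 : ℝ) 1 := by simp
  have hc1 : ∀ t u, (t, u) ∈ G → ContinuousAt (fun t => y t u) t := fun t u h =>
    ContinuousAt.comp (f := fun t : ℝ => (t, u)) (g := fun p : ℝ × ℝ => y p.1 p.2)
      (hc.continuousAt (hG.mem_nhds h)) (by fun_prop)
  have hc2 : ∀ t u, (t, u) ∈ G → ContinuousAt (fun u => y t u) u := fun t u h =>
    ContinuousAt.comp (f := fun u : ℝ => (t, u)) (g := fun p : ℝ × ℝ => y p.1 p.2)
      (hc.continuousAt (hG.mem_nhds h)) (by fun_prop)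
  have hp : ∀ u, (∀ᶠ t in offFin, (t, u) ∈ G) → PCont fun t => y t u := fun u hu =>
    ⟨by filter_upwards [hu] with t ht using hc1 t u ht,
      B, by filter_upwards [hu] with t ht using hB _ ht⟩
  have hlip : ∀ u, (∀ᶠ t in offFin, (t, u) ∈ G) → ∀ x ∈ Icc (0 : ℝ) 1, ∀ x' ∈ Icc (0 : ℝ) 1,
      ‖(∫ t in (0 : ℝ)..x', y t u) - ∫ t in (0 : ℝ)..x, y t u‖ ≤ B * |x' - x| := by
    intro u hu x hx x' hx'
    rw [intervalIntegral.integral_interval_sub_left ((hp u hu).intervalIntegrable h01 hx')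
      ((hp u hu).intervalIntegrable h01 hx)]
    refine intervalIntegral.norm_integral_le_of_norm_le_const_ae
      (ae_uIoc_of_eventually_offFin ?_ hx hx')
    filter_upwards [hu] with t ht using hB _ ht
  have hbd : ∀ u, (∀ᶠ t in offFin, (t, u) ∈ G) → ∀ x ∈ Icc (0 : ℝ) 1,
      ‖∫ t in (0 : ℝ)..x, y t u‖ ≤ B := by
    intro u hu x hx
    have := hlip u hu 0 h01 x hx
    rw [intervalIntegral.integral_same, sub_zero, sub_zero, abs_of_nonneg hx.1] at this
    exact this.trans (mul_le_of_le_one_right hB0 hx.2)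
  have hcont : ∀ᶠ u in offFin, ∀ x ∈ Icc (0 : ℝ) 1,
      ContinuousAt (fun u => ∫ t in (0 : ℝ)..x, y t u) u := by
    filter_upwards [hsl, eventually_offFin_nhds hsl] with u hu hu' x hx
    refine intervalIntegral.continuousAt_of_dominated_interval (bound := fun _ => B)
      ?_ ?_ (by simp) ?_
    · filter_upwards [hu'] with v hv using (hp v hv).aestronglyMeasurable h01 hx
    · filter_upwards [hu'] with v hv
      refine ae_uIoc_of_eventually_offFin ?_ h01 hx
      filter_upwards [hv] with t ht using hB _ ht
    · refine ae_uIoc_of_eventually_offFin ?_ h01 hx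
      filter_upwards [hu] with t ht using hc2 t u ht
  refine ⟨hB0, fun u => by simp, fun x hx => ⟨?_, B, ?_⟩, hcont, ⟨?_, B, ?_⟩, ?_, ?_, ?_, ?_, ?_,
    ?_, ?_⟩
  · filter_upwards [hcont] with u hu using hu x hx
  · filter_upwards [hsl] with u hu using hbd u hu x hx
  · filter_upwards [hcont, eventually_offFin_nhds hsl, eventually_offFin_mem] with u hu hu' huI
    have hI := Ioo_subset_Icc_self huI
    have h3 : Tendsto (fun v : ℝ => B * |v - u|) (𝓝 u) (𝓝 0) := by
      have : Continuous fun v : ℝ => B * |v - u| := by fun_prop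
      simpa using this.tendsto u
    have h4 : Tendsto (fun v => (∫ t in (0 : ℝ)..v, y t v) - ∫ t in (0 : ℝ)..u, y t v) (𝓝 u)
        (𝓝 0) := by
      refine squeeze_zero_norm' ?_ h3
      filter_upwards [hu', Icc_mem_nhds huI.1 huI.2] with v hv hvI using hlip v hv u hI v hvI
    have h5 := h4.add (hu u hI)
    simp only [sub_add_cancel, zero_add] at h5
    exact h5
  · filter_upwards [hsl, eventually_offFin_mem] with u hu huI
    exact hbd u hu u (Ioo_subset_Icc_self huI)
  · filter_upwards [hsl] with u hu using hlip u hu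
  · filter_upwards [hsl', eventually_offFin_mem] with x hx hxI
    filter_upwards [hx, hsl] with u hu hu'
    exact (hp u hu').hasDerivAt_primitive_of_continuousAt h01 hxI (hc1 x u hu)
  · filter_upwards [hsl'] with x hx
    exact ⟨by filter_upwards [hx] with u hu using hc2 x u hu,
      B, by filter_upwards [hx] with u hu using hB _ hu⟩
  · filter_upwards [hsl'] with x hx
    filter_upwards [hx] with u hu using hc1 x u hu
  · filter_upwards [hsl'] with x hx
    filter_upwards [hx] with u hu using hB _ hu
  · intro x hx u hu
    refine intervalIntegral_mem_submodule _ (Eventually.of_forall fun t ht => ?_)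
    exact hm t (uIcc_subset_unit h01 hx (uIoc_subset_uIcc ht)) u hu
  · filter_upwards [eventually_offFin_mem] with x hx
    filter_upwards [eventually_offFin_mem] with u hu
    exact hm x (Ioo_subset_Icc_self hx) u (Ioo_subset_Icc_self hu)

end GaugeOfField

theorem FinComplex.deltaL_mul_left {V : Type*} [NormedAddCommGroup V] [NormedSpace ℝ V]
    (C : FinComplex V) {z ψ : V →L[ℝ] V} (hψ : ψ ∈ C.gl0) :
    C.deltaL (ψ * z) = ψ * C.deltaL z := by
  rw [C.deltaL_apply, C.deltaL_apply, mul_add, ← mul_assoc C.d, hψ.2]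
  simp only [mul_assoc]

/-! ### The transported field `y` and non-abelian Stokes. -/

section Field

variable {E : Type*} [NormedAddCommGroup E] [NormedSpace ℝ E] [FiniteDimensional ℝ E]
  {M : Type*} [TopologicalSpace M] [ChartedSpace E M] [IsManifold 𝓘(ℝ, E) ∞ M]
  {V : Type*} [NormedAddCommGroup V] [NormedSpace ℝ V] [FiniteDimensional ℝ V]
  {C : FinComplex V} (α : FlatSuperconnection E M C) {Γ : ℝ × ℝ → M} {g : ℝ → ℝ → (V →L[ℝ] V)}

/-- The pull-back of `-α²` to the square, transported to the starting point. -/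
noncomputable def FlatSuperconnection.field (Γ : ℝ × ℝ → M) (g : ℝ → ℝ → (V →L[ℝ] V))
    (t u : ℝ) : V →L[ℝ] V :=
  -(Ring.inverse (g u t) * (α.form 2).alongSurface Γ t u * g u t)

/-- The integral of the field over a horizontal segment. -/
noncomputable def FlatSuperconnection.fieldInt (Γ : ℝ × ℝ → M) (g : ℝ → ℝ → (V →L[ℝ] V))
    (x u : ℝ) : V →L[ℝ] V := ∫ t in (0 : ℝ)..x, α.field Γ g t u

theorem IsSol.mem_gl0 {γ : ℝ → M} (hγ : IsPath E γ) {U : ℝ → (V →L[ℝ] V)}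
    (hU : IsSol ((α.form 1).alongPath γ) U) {t : ℝ} (ht : t ∈ Icc (0 : ℝ) 1) : U t ∈ C.gl0 :=
  hU.mem_subalgebra (hγ.pCont_alongPath _) C.gl0 (Eventually.of_forall fun _ =>
    α.form_one_mem _ _) t ht

theorem transport_mem_gl0 (hΓ : PiecewiseSmoothOn E Γ unitSquare)
    (hg : ∀ s ∈ Icc (0 : ℝ) 1, IsSol ((α.form 1).alongPath fun t => Γ (t, s)) (g s))
    {s t : ℝ} (hs : s ∈ Icc (0 : ℝ) 1) (ht : t ∈ Icc (0 : ℝ) 1) : g s t ∈ C.gl0 :=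
  IsSol.mem_gl0 α (hΓ.isPath_fst hs) (hg s hs) ht

theorem transport_isUnit (hΓ : PiecewiseSmoothOn E Γ unitSquare)
    (hg : ∀ s ∈ Icc (0 : ℝ) 1, IsSol ((α.form 1).alongPath fun t => Γ (t, s)) (g s))
    {s t : ℝ} (hs : s ∈ Icc (0 : ℝ) 1) (ht : t ∈ Icc (0 : ℝ) 1) : IsUnit (g s t) :=
  (hg s hs).isUnit ((hΓ.isPath_fst hs).pCont_alongPath _) ht

theorem exists_gaugeData (hΓ : PiecewiseSmoothOn E Γ unitSquare)
    (hg : ∀ s ∈ Icc (0 : ℝ) 1, IsSol ((α.form 1).alongPath fun t => Γ (t, s)) (g s)) :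
    ∃ B, GaugeData C (α.fieldInt Γ g) (α.field Γ g) B := by
  obtain ⟨G, hG⟩ := hΓ.exists_goodSet
  obtain ⟨Cb, hCb⟩ := hG.exists_bound (α.form 2) ![(1, 0), (0, 1)]
  obtain ⟨C₁, hC₁, hC₁'⟩ := hΓ.exists_uniform_bound (α.form 1)
  obtain ⟨K, hK0, hK⟩ := IsSol.exists_uniform_bound
    (fun s hs => (hΓ.isPath_fst hs).pCont_alongPath (α.form 1)) hg hC₁ hC₁'
  have hsq : ∀ p ∈ G, p.1 ∈ Icc (0 : ℝ) 1 ∧ p.2 ∈ Icc (0 : ℝ) 1 := fun p hp =>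
    ⟨Ioo_subset_Icc_self (hG.subset hp).1, Ioo_subset_Icc_self (hG.subset hp).2⟩
  have hcg : ContinuousOn (fun p : ℝ × ℝ => g p.2 p.1) unitSquare :=
    hΓ.continuousOn_transport (α.form 1) hg
  have hci : ContinuousOn (fun p : ℝ × ℝ => Ring.inverse (g p.2 p.1)) unitSquare :=
    continuousOn_ringInverse hcg fun p hp => transport_isUnit α hΓ hg hp.2 hp.1
  refine ⟨K * |Cb| * K, GaugeData.of_integral hG.isOpen hG.slice hG.slice' ?_ (by positivity)
    ?_ ?_⟩
  · have hb : ContinuousOn (fun p : ℝ × ℝ => (α.form 2).alongSurface Γ p.1 p.2) G :=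
      (hG.continuousOn_along (α.form 2) ![(1, 0), (0, 1)]).congr fun p hp =>
        hG.alongSurface (α.form 2) hp
    have hss : G ⊆ unitSquare := fun p hp => hsq p hp
    exact (((hci.mono hss).mul hb).mul (hcg.mono hss)).neg
  · intro p hp
    have h1 := hK p.2 (hsq p hp).2 p.1 (hsq p hp).1
    have h2 := (hCb p hp).trans (le_abs_self _)
    rw [FlatSuperconnection.field, norm_neg, hG.alongSurface (α.form 2) hp]
    exact (norm_mul_le _ _).trans (mul_le_mul ((norm_mul_le _ _).trans
      (mul_le_mul h1.2 h2 (norm_nonneg _) hK0)) h1.1 (norm_nonneg _) (by positivity))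
  · intro t ht u hu
    have h1 := transport_mem_gl0 α hΓ hg hu ht
    exact (C.endDeg (-1)).neg_mem (C.mul_mem_endDeg_right (C.mul_mem_endDeg_left
      (Subalgebra.ringInverse_mem _ h1) (α.form_two_mem _ _)) h1)

/-- Non-abelian Stokes: the covariant vertical derivative of the horizontal transport is the
integral of the transported curvature, and the curvature of `α¹` is `-δα²`. The moving end point `τ`
is later specialized to a constant, for vertical lines, and to `τ(s) = s`, for the diagonal. -/
theorem GoodSet.hasDerivAt_transport_field {G : Set (ℝ × ℝ)} (hG : GoodSet E Γ G)
    (hΓ : IsTwoPath E Γ)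
    (hg : ∀ s ∈ Icc (0 : ℝ) 1, IsSol ((α.form 1).alongPath fun t => Γ (t, s)) (g s))
    {s₀ : ℝ} (hs₀ : s₀ ∈ Ioo (0 : ℝ) 1) (hsl : ∀ᶠ t in offFin, (t, s₀) ∈ G) {t₀ : ℝ}
    (ht₀ : t₀ ∈ Icc (0 : ℝ) 1) {τ : ℝ → ℝ}
    (hτ : ∀ᶠ s in 𝓝 s₀, |τ s - t₀| ≤ |s - s₀| ∧ τ s ∈ Icc (0 : ℝ) 1)
    (hd₀ : MDifferentiableAt 𝓘(ℝ, ℝ) 𝓘(ℝ, E) (fun s => Γ (τ s, s)) s₀) :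
    HasDerivAt (fun s => g s (τ s))
      (-((α.form 1).alongPath (fun s => Γ (τ s, s)) s₀ * g s₀ t₀)
        + g s₀ t₀ * C.deltaL (α.fieldInt Γ g t₀ s₀)) s₀ := by
  have h01 : (0 : ℝ) ∈ Icc (0 : ℝ) 1 := by simp
  have hs₀' := Ioo_subset_Icc_self hs₀
  obtain ⟨Cb, hCb⟩ := hG.exists_bound (α.form 2) ![(1, 0), (0, 1)]
  have hb : PCont fun t => (α.form 2).alongSurface Γ t s₀ := by
    refine PCont.congr (f := fun t => (α.form 2).along Γ ![(1, 0), (0, 1)] (t, s₀)) ⟨?_, Cb, ?_⟩ ?_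
    · filter_upwards [hsl] with t ht
      exact ContinuousAt.comp (f := fun t : ℝ => (t, s₀))
        ((hG.continuousOn_along (α.form 2) ![(1, 0), (0, 1)]).continuousAt (hG.isOpen.mem_nhds ht))
        (by fun_prop)
    · filter_upwards [hsl] with t ht using hCb _ ht
    · filter_upwards [hsl] with t ht using hG.alongSurface _ ht
  have key := hG.hasDerivAt_transport hΓ.1 (fun s hs => (hΓ.2 s hs).1) (α.form 1) hg hs₀ hsl
    (F := fun t => -C.deltaL ((α.form 2).alongSurface Γ t s₀)) (hb.clm C.deltaL).neg ?_ ht₀ hτ hd₀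
  · refine key.congr_deriv ?_
    congr 2
    have hp : PCont (fun t => α.field Γ g t s₀) :=
      ((PCont.cont_mul ((hg s₀ hs₀').cont_inverse ((hΓ.1.isPath_fst hs₀').pCont_alongPath _))
        hb).mul_cont (hg s₀ hs₀').cont).neg
    rw [FlatSuperconnection.fieldInt,
      ← C.deltaL.intervalIntegral_comp_comm (hp.intervalIntegrable h01 ht₀)]
    refine intervalIntegral.integral_congr fun t ht => ?_
    have hgm := transport_mem_gl0 α hΓ.1 hg hs₀' (uIcc_subset_unit h01 ht₀ ht)
    simp only [FlatSuperconnection.field, map_neg]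
    rw [C.deltaL_mul hgm, C.deltaL_mul_left (Subalgebra.ringInverse_mem _ hgm), mul_neg, neg_mul]
  · intro t ht x₀ hx₀
    have hmd := hG.mdifferentiableAt ht
    -- The equation `δB = dA + ½[A, A]` with `B = -α²` identifies the chosen `F` with the curvature
    -- in the chart.
    have hcurv := α.trunc.curvature x₀ _ ((extChartAt 𝓘(ℝ, E) x₀).map_source hx₀)
      ![fderiv ℝ (fun q => extChartAt 𝓘(ℝ, E) x₀ (Γ q)) (t, s₀) (1, 0),
        fderiv ℝ (fun q => extChartAt 𝓘(ℝ, E) x₀ (Γ q)) (t, s₀) (0, 1)]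
    change (C.delta (inChart α.truncB x₀ _ _) : V →L[ℝ] V)
      = extDeriv (inChart (α.form 1).toFun x₀) _ _ + (inChart (α.form 1).toFun x₀ _ _
        * inChart (α.form 1).toFun x₀ _ _ - inChart (α.form 1).toFun x₀ _ _
        * inChart (α.form 1).toFun x₀ _ _) at hcurv
    rw [α.inChart_truncB_apply, map_neg, C.delta_proj] at hcurv
    rw [hG.alongSurface (α.form 2) ht, (α.form 2).along_eq_chart x₀ hmd hx₀,
      (α.form 1).along_eq_chart x₀ hmd hx₀, (α.form 1).along_eq_chart x₀ hmd hx₀]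
    have e2 : (fun i => fderiv ℝ (fun q => extChartAt 𝓘(ℝ, E) x₀ (Γ q)) (t, s₀)
        ((![(1, 0), (0, 1)] : Fin 2 → ℝ × ℝ) i))
        = ![fderiv ℝ (fun q => extChartAt 𝓘(ℝ, E) x₀ (Γ q)) (t, s₀) (1, 0),
          fderiv ℝ (fun q => extChartAt 𝓘(ℝ, E) x₀ (Γ q)) (t, s₀) (0, 1)] := by
      funext i; fin_cases i <;> rfl
    have e1 : ∀ z : E, (fun _ : Fin 1 => z) = ![z] := fun z => by
      funext i; fin_cases i; rfl
    rw [e2, e1, e1]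
    exact hcurv

end Field

end HigherHol

/-! ### Pull-back of forms along `Θ`. -/

namespace HigherHol

open Filter

theorem eventually_offFin_comp {f : ℝ → ℝ} (hf : Function.Injective f) {p : ℝ → Prop}
    (h : ∀ᶠ r in offFin, p r) : ∀ᶠ t in offFin, f t ∈ Ioo (0 : ℝ) 1 → p (f t) := by
  obtain ⟨F, hF⟩ := eventually_offFin_iff.1 h
  have h1 : (f ⁻¹' (F : Set ℝ)).Finite := F.finite_toSet.preimage hf.injOn
  filter_upwards [eventually_offFin_of_finite h1] with t ht htI
  exact hF _ htI ht

theorem eventually_offFin_ne (c : ℝ) : ∀ᶠ t in offFin, t ≠ c :=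
  eventually_offFin_of_finite (finite_singleton c)

theorem eventually_offFin_one_sub_two_mul {p : ℝ → Prop} (h : ∀ᶠ r in offFin, p r) :
    ∀ᶠ t in offFin, t < 1 / 2 → p (1 - 2 * t) := by
  filter_upwards [eventually_offFin_comp (f := fun t => 1 - 2 * t)
    (fun a b hab => by simpa using hab) h, eventually_offFin_mem] with t ht htI h2
  exact ht ⟨by linarith, by linarith [htI.1]⟩

theorem eventually_offFin_mul_two_sub {p : ℝ → Prop} (h : ∀ᶠ r in offFin, p r) {s : ℝ}
    (hs : s ∈ Ioo (0 : ℝ) 1) : ∀ᶠ t in offFin, 1 / 2 < t → p (s * (2 - 2 * t)) := by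
  filter_upwards [eventually_offFin_comp (f := fun t => s * (2 - 2 * t))
    (fun a b hab => by simpa [hs.1.ne'] using hab) h, eventually_offFin_mem] with t ht htI h2
  refine ht ⟨mul_pos hs.1 (by linarith [htI.2]), ?_⟩
  calc s * (2 - 2 * t) < s * 1 := mul_lt_mul_of_pos_left (by linarith) hs.1
    _ < 1 := by linarith [hs.2]

/-- For fixed `s` the path `t ↦ Θ(t, s)` runs down the diagonal while `1 - 2t > s`, then down the
vertical line at abscissa `s` until `t = 1/2`, and then along the bottom side to the origin. The
three lemmas describe the open regimes; the lines `t = (1 - s)/2` and `t = 1/2` are exceptional. -/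
theorem Theta_of_lt {t s : ℝ} (ht : t < 1 / 2) (hs : s < 1 - 2 * t) :
    ∀ᶠ q in 𝓝 (t, s), Theta q = (1 - 2 * q.1, 1 - 2 * q.1) := by
  have h1 : ∀ᶠ q : ℝ × ℝ in 𝓝 (t, s), q.1 < 1 / 2 ∧ q.2 < 1 - 2 * q.1 :=
    (continuousAt_fst.eventually_lt continuousAt_const ht).and
      (ContinuousAt.eventually_lt (by fun_prop) (by fun_prop) hs)
  filter_upwards [h1] with q hq
  simp only [Theta, lambdaMap, foldMap, if_pos hq.1.le, max_eq_right hq.2.le]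

theorem Theta_of_gt {t s : ℝ} (ht : t < 1 / 2) (hs : 1 - 2 * t < s) :
    ∀ᶠ q in 𝓝 (t, s), Theta q = (q.2, 1 - 2 * q.1) := by
  have h1 : ∀ᶠ q : ℝ × ℝ in 𝓝 (t, s), q.1 < 1 / 2 ∧ 1 - 2 * q.1 < q.2 :=
    (continuousAt_fst.eventually_lt continuousAt_const ht).and
      (ContinuousAt.eventually_lt (by fun_prop) (by fun_prop) hs)
  filter_upwards [h1] with q hq
  simp only [Theta, lambdaMap, foldMap, if_pos hq.1.le, max_eq_left hq.2.le]

theorem Theta_of_half_lt {t s : ℝ} (ht : 1 / 2 < t) (ht1 : t < 1) (hs : 0 < s) :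
    ∀ᶠ q in 𝓝 (t, s), Theta q = (q.2 * (2 - 2 * q.1), 0) := by
  have h1 : ∀ᶠ q : ℝ × ℝ in 𝓝 (t, s), (1 / 2 < q.1 ∧ q.1 < 1) ∧ 0 < q.2 :=
    ((continuousAt_const.eventually_lt continuousAt_fst ht).and
      (continuousAt_fst.eventually_lt continuousAt_const ht1)).and
      (continuousAt_const.eventually_lt continuousAt_snd hs)
  filter_upwards [h1] with q hq
  have h2 : 0 ≤ q.2 * (2 - 2 * q.1) := mul_nonneg hq.2.le (by linarith [hq.1.2])
  simp only [Theta, lambdaMap, foldMap, if_neg (not_le.2 hq.1.1), max_eq_left h2]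

section ThetaForms

variable {E : Type*} [NormedAddCommGroup E] [NormedSpace ℝ E]
  {M : Type*} [TopologicalSpace M] [ChartedSpace E M] [IsManifold 𝓘(ℝ, E) ∞ M]
  {W : Type*} [NormedAddCommGroup W] [NormedSpace ℝ W] {σ : ℝ × ℝ → M}

theorem mfderiv_real_apply (f : ℝ → M) (v r : ℝ) :
    mfderiv 𝓘(ℝ, ℝ) 𝓘(ℝ, E) f r v = v • vel E f r := by
  have h := (mfderiv 𝓘(ℝ, ℝ) 𝓘(ℝ, E) f r).map_smul v (1 : ℝ)
  exact (congrArg (mfderiv 𝓘(ℝ, ℝ) 𝓘(ℝ, E) f r) (mul_one v).symm).trans h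

theorem DiffForm.along_smul_one (A : DiffForm E M W 1) (f : ℝ → M) (v r : ℝ) :
    A.along f (fun _ => v) r = v • A.alongPath f r := by
  have h : (fun _ : Fin 1 => mfderiv 𝓘(ℝ, ℝ) 𝓘(ℝ, E) f r v) = fun _ : Fin 1 => v • vel E f r := by
    funext i
    exact mfderiv_real_apply f v r
  rw [DiffForm.along, DiffForm.alongPath, h]
  have := (A.toFun (f r)).map_smul_univ (fun _ => v) fun _ => vel E f r
  simpa using this

/-- Tangent vectors of a curve are proportional. Where `Θ` factors through the diagonal or the
bottom side, `α²` therefore contributes nothing, and only the vertical segments enter `β²`. -/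
theorem DiffForm.along_two_real (η : DiffForm E M W 2) (f : ℝ → M) (v w r : ℝ) :
    η.along f ![v, w] r = 0 := by
  rw [DiffForm.along]
  have h1 : (fun i => mfderiv 𝓘(ℝ, ℝ) 𝓘(ℝ, E) f r ((![v, w] : Fin 2 → ℝ) i))
      = fun i => (![v, w] : Fin 2 → ℝ) i • vel E f r := by
    funext i
    exact mfderiv_real_apply f _ r
  rw [h1]
  have h2 := (η.toFun (f r)).map_smul_univ ![v, w] fun _ => vel E f r
  refine h2.trans ?_
  rw [(η.toFun (f r)).map_eq_zero_of_eq (fun _ => vel E f r) rfl (show (0 : Fin 2) ≠ 1 by decide),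
    smul_zero]

theorem eventually_slice {p : ℝ × ℝ → Prop} {t s : ℝ} (h : ∀ᶠ q in 𝓝 (t, s), p q) :
    ∀ᶠ t' in 𝓝 t, p (t', s) :=
  (show ContinuousAt (fun t' : ℝ => (t', s)) t by fun_prop).eventually h

theorem hasDerivAt_one_sub_two_mul (t : ℝ) : HasDerivAt (fun t : ℝ => 1 - 2 * t) (-2) t := by
  simpa using ((hasDerivAt_id' t).const_mul 2).const_sub 1

theorem hasDerivAt_mul_two_sub (s t : ℝ) :
    HasDerivAt (fun t : ℝ => s * (2 - 2 * t)) (-(2 * s)) t := by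
  refine ((((hasDerivAt_id' t).const_mul 2).const_sub 2).const_mul s).congr_deriv ?_
  ring

theorem alongPath_Theta_of_lt (A : DiffForm E M W 1) {t s : ℝ} (ht : t < 1 / 2)
    (hs : s < 1 - 2 * t)
    (hd : MDifferentiableAt 𝓘(ℝ, ℝ) 𝓘(ℝ, E) (fun r => σ (r, r)) (1 - 2 * t)) :
    A.alongPath (fun t => (σ ∘ Theta) (t, s)) t
      = (-2 : ℝ) • A.alongPath (fun r => σ (r, r)) (1 - 2 * t) := by
  rw [A.alongPath_congr (c' := fun t => (fun r => σ (r, r)) (1 - 2 * t)),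
    A.alongPath_comp (f := fun r => σ (r, r)) (c := fun t => 1 - 2 * t) hd (hasDerivAt_one_sub_two_mul t), A.along_smul_one]
  filter_upwards [eventually_slice (Theta_of_lt ht hs)] with t' ht'
  simp only [Function.comp_apply, ht']

theorem alongSurface_Theta_of_lt (η : DiffForm E M W 2) {t s : ℝ} (ht : t < 1 / 2)
    (hs : s < 1 - 2 * t)
    (hd : MDifferentiableAt 𝓘(ℝ, ℝ) 𝓘(ℝ, E) (fun r => σ (r, r)) (1 - 2 * t)) :
    η.alongSurface (σ ∘ Theta) t s = 0 := by
  rw [η.alongSurface_congr (g := fun p => (fun r => σ (r, r)) (1 - 2 * p.1)),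
    η.alongSurface_comp (c := fun p => 1 - 2 * p.1) hd (hasDerivAt_one_sub_two_mul t)
      (hasDerivAt_const s (1 - 2 * t)), η.along_two_real]
  filter_upwards [Theta_of_lt ht hs] with q hq
  simp only [Function.comp_apply, hq]

theorem alongPath_Theta_of_gt (A : DiffForm E M W 1) {t s : ℝ} (ht : t < 1 / 2)
    (hs : 1 - 2 * t < s) (hd : MDifferentiableAt 𝓘(ℝ, ℝ) 𝓘(ℝ, E) (fun u => σ (s, u)) (1 - 2 * t)) :
    A.alongPath (fun t => (σ ∘ Theta) (t, s)) t
      = (-2 : ℝ) • A.alongPath (fun u => σ (s, u)) (1 - 2 * t) := by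
  rw [A.alongPath_congr (c' := fun t => (fun u => σ (s, u)) (1 - 2 * t)),
    A.alongPath_comp (f := fun u => σ (s, u)) (c := fun t => 1 - 2 * t) hd (hasDerivAt_one_sub_two_mul t), A.along_smul_one]
  filter_upwards [eventually_slice (Theta_of_gt ht hs)] with t' ht'
  simp only [Function.comp_apply, ht']

/-- The factor `2` is the determinant of `(t, s) ↦ (s, 1 - 2t)`. -/
theorem alongSurface_Theta_of_gt (η : DiffForm E M W 2) {t s : ℝ} (ht : t < 1 / 2)
    (hs : 1 - 2 * t < s)
    (hd : MDifferentiableAt 𝓘(ℝ, ℝ × ℝ) 𝓘(ℝ, E) σ (s, 1 - 2 * t)) :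
    η.alongSurface (σ ∘ Theta) t s = (2 : ℝ) • η.along σ ![(1, 0), (0, 1)] (s, 1 - 2 * t) := by
  rw [η.alongSurface_congr (g := fun p => σ ((fun p : ℝ × ℝ => (p.2, 1 - 2 * p.1)) p)),
    η.alongSurface_comp (c := fun p => (p.2, 1 - 2 * p.1)) hd
      ((hasDerivAt_const t s).prodMk (hasDerivAt_one_sub_two_mul t))
      ((hasDerivAt_id' s).prodMk (hasDerivAt_const s (1 - 2 * t)))]
  · simp only [DiffForm.along]
    set m := mfderiv 𝓘(ℝ, ℝ × ℝ) 𝓘(ℝ, E) σ (s, 1 - 2 * t) with hm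
    have h2 : m ((0, -2) : ℝ × ℝ) = (-2 : ℝ) • m ((0, 1) : ℝ × ℝ) := by
      have h := m.map_smul (-2 : ℝ) ((0, 1) : ℝ × ℝ)
      exact (congrArg m (show ((0, -2) : ℝ × ℝ) = (-2 : ℝ) • ((0, 1) : ℝ × ℝ) by simp)).trans h
    have e1 : (fun i => m ((![((0 : ℝ), (-2 : ℝ)), (1, 0)] : Fin 2 → ℝ × ℝ) i))
        = fun i => (![(-2 : ℝ), 1] : Fin 2 → ℝ) i •
          (fun i => m ((![((1 : ℝ), (0 : ℝ)), (0, 1)] : Fin 2 → ℝ × ℝ) i)) (Equiv.swap 0 1 i) := by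
      funext i
      fin_cases i
      · exact h2
      · exact (one_smul ℝ _).symm
    rw [e1]
    refine ((η.toFun _).map_smul_univ _ _).trans ?_
    have h3 := (η.toFun (σ (s, 1 - 2 * t))).toAlternatingMap.map_swap
      (fun i => m ((![((1 : ℝ), (0 : ℝ)), (0, 1)] : Fin 2 → ℝ × ℝ) i))
      (show (0 : Fin 2) ≠ 1 by decide)
    rw [Fin.prod_univ_two]
    refine (congrArg (fun z => ((![(-2 : ℝ), 1] : Fin 2 → ℝ) 0 * (![(-2 : ℝ), 1] : Fin 2 → ℝ) 1) • z)
      h3).trans ?_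
    simp
  · filter_upwards [Theta_of_gt ht hs] with q hq
    simp only [Function.comp_apply, hq]

theorem alongPath_Theta_of_half_lt (A : DiffForm E M W 1) {t s : ℝ} (ht : 1 / 2 < t) (ht1 : t < 1)
    (hs : 0 < s)
    (hd : MDifferentiableAt 𝓘(ℝ, ℝ) 𝓘(ℝ, E) (fun r => σ (r, 0)) (s * (2 - 2 * t))) :
    A.alongPath (fun t => (σ ∘ Theta) (t, s)) t
      = (-(2 * s)) • A.alongPath (fun r => σ (r, 0)) (s * (2 - 2 * t)) := by
  rw [A.alongPath_congr (c' := fun t => (fun r => σ (r, 0)) (s * (2 - 2 * t))),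
    A.alongPath_comp (f := fun r => σ (r, 0)) (c := fun t => s * (2 - 2 * t)) hd (hasDerivAt_mul_two_sub s t), A.along_smul_one]
  filter_upwards [eventually_slice (Theta_of_half_lt ht ht1 hs)] with t' ht'
  simp only [Function.comp_apply, ht']

theorem alongSurface_Theta_of_half_lt (η : DiffForm E M W 2) {t s : ℝ} (ht : 1 / 2 < t)
    (ht1 : t < 1) (hs : 0 < s)
    (hd : MDifferentiableAt 𝓘(ℝ, ℝ) 𝓘(ℝ, E) (fun r => σ (r, 0)) (s * (2 - 2 * t))) :
    η.alongSurface (σ ∘ Theta) t s = 0 := by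
  rw [η.alongSurface_congr (g := fun p => (fun r => σ (r, 0)) (p.2 * (2 - 2 * p.1))),
    η.alongSurface_comp (c := fun p => p.2 * (2 - 2 * p.1)) hd (hasDerivAt_mul_two_sub s t)
      ((hasDerivAt_id' s).mul_const (2 - 2 * t)), η.along_two_real]
  filter_upwards [Theta_of_half_lt ht ht1 hs] with q hq
  simp only [Function.comp_apply, hq]

theorem IsPath.exists_isOpen {γ : ℝ → M} (hγ : IsPath E γ) (A : DiffForm E M W 1) :
    ∃ T : Set ℝ, ∃ C, IsOpen T ∧ (∀ᶠ t in offFin, t ∈ T) ∧ ContinuousOn (A.alongPath γ) T ∧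
      ∀ t ∈ T, MDifferentiableAt 𝓘(ℝ, ℝ) 𝓘(ℝ, E) γ t ∧ ‖A.alongPath γ t‖ ≤ C := by
  obtain ⟨C, hC⟩ := (hγ.pCont_alongPath A).bdd
  obtain ⟨F, hF⟩ := eventually_offFin_iff.1
    ((hγ.eventually_contMDiffAt.and (hγ.pCont_alongPath A).cont).and hC)
  refine ⟨Ioo 0 1 \ F, C, isOpen_Ioo.sdiff F.finite_toSet.isClosed, ?_, ?_, ?_⟩
  · exact eventually_offFin_iff.2 ⟨F, fun t ht htF => ⟨ht, htF⟩⟩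
  · exact fun t ht => (hF t ht.1 ht.2).1.2.continuousWithinAt
  · exact fun t ht => ⟨(hF t ht.1 ht.2).1.1.mdifferentiableAt (by simp), (hF t ht.1 ht.2).2⟩

/-- The pull-backs of forms along `σ ∘ Θ` are continuous and bounded on an open set which meets
almost all horizontal lines in the complement of a finite set. -/
theorem PiecewiseSmoothOn.exists_isOpen_Theta (hσ : PiecewiseSmoothOn E σ unitSquare)
    (A : DiffForm E M W 1) (η : DiffForm E M W 2) :
    ∃ G : Set (ℝ × ℝ), ∃ C : ℝ, IsOpen G ∧ (∀ᶠ s in offFin, ∀ᶠ t in offFin, (t, s) ∈ G) ∧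
      ContinuousOn (fun p : ℝ × ℝ => A.alongPath (fun t => (σ ∘ Theta) (t, p.2)) p.1) G ∧
      ContinuousOn (fun p : ℝ × ℝ => η.alongSurface (σ ∘ Theta) p.1 p.2) G ∧
      (∀ p ∈ G, ‖A.alongPath (fun t => (σ ∘ Theta) (t, p.2)) p.1‖ ≤ C) ∧
      ∀ p ∈ G, ‖η.alongSurface (σ ∘ Theta) p.1 p.2‖ ≤ C := by
  obtain ⟨G, hG⟩ := hσ.exists_goodSet
  obtain ⟨T, C₁, hT, hTe, hTc, hTb⟩ := hσ.isPath_diag.exists_isOpen A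
  obtain ⟨S, C₂, hS, hSe, hSc, hSb⟩ :=
    (hσ.isPath_fst (s := 0) (by simp)).exists_isOpen A
  obtain ⟨C₃, hC₃⟩ := hG.exists_bound A fun _ => (0, 1)
  obtain ⟨C₄, hC₄⟩ := hG.exists_bound η ![(1, 0), (0, 1)]
  have hv : ∀ s u, (s, u) ∈ G →
      MDifferentiableAt 𝓘(ℝ, ℝ) 𝓘(ℝ, E) (fun u => σ (s, u)) u := fun s u h =>
    MDifferentiableAt.comp (f := fun u : ℝ => (s, u)) u (hG.mdifferentiableAt h)
      (DifferentiableAt.mdifferentiableAt (by fun_prop))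
  -- `G₁`, `G₂`, `G₃` are the regimes of the diagonal, the vertical segment and the bottom side,
  -- each restricted to the points where `σ` is well behaved at the image.
  set G₁ : Set (ℝ × ℝ) := {p | (p.1 < 1 / 2 ∧ p.2 < 1 - 2 * p.1) ∧ 1 - 2 * p.1 ∈ T} with hG₁
  set G₂ : Set (ℝ × ℝ) := {p | (p.1 < 1 / 2 ∧ 1 - 2 * p.1 < p.2) ∧ (p.2, 1 - 2 * p.1) ∈ G}
    with hG₂
  set G₃ : Set (ℝ × ℝ) := {p | ((1 / 2 < p.1 ∧ p.1 < 1) ∧ (0 < p.2 ∧ p.2 < 1)) ∧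
    p.2 * (2 - 2 * p.1) ∈ S} with hG₃
  have o₁ : IsOpen G₁ := IsOpen.and (IsOpen.and (isOpen_lt (by fun_prop) (by fun_prop))
    (isOpen_lt (by fun_prop) (by fun_prop)))
    (hT.preimage (f := fun p : ℝ × ℝ => 1 - 2 * p.1) (by fun_prop))
  have o₂ : IsOpen G₂ := IsOpen.and (IsOpen.and (isOpen_lt (by fun_prop) (by fun_prop))
    (isOpen_lt (by fun_prop) (by fun_prop)))
    (hG.isOpen.preimage (f := fun p : ℝ × ℝ => (p.2, 1 - 2 * p.1)) (by fun_prop))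
  have o₃ : IsOpen G₃ := IsOpen.and (IsOpen.and (IsOpen.and (isOpen_lt (by fun_prop) (by fun_prop))
    (isOpen_lt (by fun_prop) (by fun_prop))) (IsOpen.and (isOpen_lt (by fun_prop) (by fun_prop))
    (isOpen_lt (by fun_prop) (by fun_prop))))
    (hS.preimage (f := fun p : ℝ × ℝ => p.2 * (2 - 2 * p.1)) (by fun_prop))
  have a₁ : ∀ p ∈ G₁, A.alongPath (fun t => (σ ∘ Theta) (t, p.2)) p.1
      = (-2 : ℝ) • A.alongPath (fun r => σ (r, r)) (1 - 2 * p.1) := fun p hp =>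
    alongPath_Theta_of_lt A hp.1.1 hp.1.2 (hTb _ hp.2).1
  have b₁ : ∀ p ∈ G₁, η.alongSurface (σ ∘ Theta) p.1 p.2 = 0 := fun p hp =>
    alongSurface_Theta_of_lt η hp.1.1 hp.1.2 (hTb _ hp.2).1
  have a₂ : ∀ p ∈ G₂, A.alongPath (fun t => (σ ∘ Theta) (t, p.2)) p.1
      = (-2 : ℝ) • A.along σ (fun _ => (0, 1)) (p.2, 1 - 2 * p.1) := fun p hp => by
    rw [alongPath_Theta_of_gt A hp.1.1 hp.1.2 (hv _ _ hp.2), hG.alongPath_snd A hp.2]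
  have b₂ : ∀ p ∈ G₂, η.alongSurface (σ ∘ Theta) p.1 p.2
      = (2 : ℝ) • η.along σ ![(1, 0), (0, 1)] (p.2, 1 - 2 * p.1) := fun p hp =>
    alongSurface_Theta_of_gt η hp.1.1 hp.1.2 (hG.mdifferentiableAt hp.2)
  have a₃ : ∀ p ∈ G₃, A.alongPath (fun t => (σ ∘ Theta) (t, p.2)) p.1
      = (-(2 * p.2)) • A.alongPath (fun r => σ (r, 0)) (p.2 * (2 - 2 * p.1)) := fun p hp =>
    alongPath_Theta_of_half_lt A hp.1.1.1 hp.1.1.2 hp.1.2.1 (hSb _ hp.2).1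
  have b₃ : ∀ p ∈ G₃, η.alongSurface (σ ∘ Theta) p.1 p.2 = 0 := fun p hp =>
    alongSurface_Theta_of_half_lt η hp.1.1.1 hp.1.1.2 hp.1.2.1 (hSb _ hp.2).1
  refine ⟨(G₁ ∪ G₂) ∪ G₃, 2 * |C₁| + 2 * |C₂| + 2 * |C₃| + 2 * |C₄|, (o₁.union o₂).union o₃,
    ?_, ?_, ?_, ?_, ?_⟩
  · filter_upwards [hG.slice', eventually_offFin_mem] with s hs hsI
    filter_upwards [eventually_offFin_one_sub_two_mul hs, eventually_offFin_one_sub_two_mul hTe,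
      eventually_offFin_mul_two_sub hSe hsI, eventually_offFin_ne (1 / 2),
      eventually_offFin_ne ((1 - s) / 2), eventually_offFin_mem] with t h1 h2 h3 h4 h5 h6
    rcases lt_or_gt_of_ne h4 with h | h
    · rcases lt_or_gt_of_ne h5 with h' | h'
      · exact Or.inl (Or.inl ⟨⟨h, by simp only; linarith⟩, h2 h⟩)
      · exact Or.inl (Or.inr ⟨⟨h, by simp only; linarith⟩, h1 h⟩)
    · exact Or.inr ⟨⟨⟨h, h6.2⟩, hsI⟩, h3 h⟩
  · refine ((ContinuousOn.union_of_isOpen ?_ ?_ o₁ o₂).union_of_isOpen ?_ (o₁.union o₂) o₃)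
    · refine ContinuousOn.congr ?_ a₁
      exact (hTc.comp (by fun_prop) fun p hp => hp.2).const_smul _
    · refine ContinuousOn.congr ?_ a₂
      exact ((hG.continuousOn_along A _).comp (f := fun p : ℝ × ℝ => (p.2, 1 - 2 * p.1))
        (by fun_prop) fun p hp => hp.2).const_smul _
    · refine ContinuousOn.congr ?_ a₃
      exact ContinuousOn.smul (by fun_prop)
        (hSc.comp (f := fun p : ℝ × ℝ => p.2 * (2 - 2 * p.1)) (by fun_prop) fun p hp => hp.2)
  · refine ((ContinuousOn.union_of_isOpen ?_ ?_ o₁ o₂).union_of_isOpen ?_ (o₁.union o₂) o₃)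
    · exact continuousOn_const.congr b₁
    · refine ContinuousOn.congr ?_ b₂
      exact ((hG.continuousOn_along η _).comp (f := fun p : ℝ × ℝ => (p.2, 1 - 2 * p.1))
        (by fun_prop) fun p hp => hp.2).const_smul _
    · exact continuousOn_const.congr b₃
  · rintro p ((hp | hp) | hp)
    · rw [a₁ p hp, norm_smul]
      have := (hTb _ hp.2).2.trans (le_abs_self _)
      norm_num
      linarith [abs_nonneg C₂, abs_nonneg C₃, abs_nonneg C₄]
    · rw [a₂ p hp, norm_smul]
      have := (hC₃ _ hp.2).trans (le_abs_self _)
      norm_num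
      linarith [abs_nonneg C₁, abs_nonneg C₂, abs_nonneg C₄]
    · rw [a₃ p hp, norm_smul, norm_neg, norm_mul, Real.norm_of_nonneg hp.1.2.1.le]
      have h1 := (hSb _ hp.2).2.trans (le_abs_self _)
      have h2 : ‖(2 : ℝ)‖ * p.2 * ‖A.alongPath (fun r => σ (r, 0)) (p.2 * (2 - 2 * p.1))‖
          ≤ 2 * |C₂| := by
        norm_num
        refine mul_le_mul ?_ h1 (norm_nonneg _) (by norm_num)
        linarith [hp.1.2.2]
      linarith [abs_nonneg C₁, abs_nonneg C₃, abs_nonneg C₄]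
  · rintro p ((hp | hp) | hp)
    · rw [b₁ p hp, norm_zero]; positivity
    · rw [b₂ p hp, norm_smul]
      have := (hC₄ _ hp.2).trans (le_abs_self _)
      norm_num
      linarith [abs_nonneg C₁, abs_nonneg C₂, abs_nonneg C₃]
    · rw [b₃ p hp, norm_zero]; positivity

end ThetaForms

end HigherHol

/-! ### Transport along `Θ(-, x)` and evaluation of `β²`. -/

namespace HigherHol

open Filter

/-- The substitution `u = 1 - 2t` maps `[(1 - x)/2, 1/2]` onto `[0, x]` with reversed orientation,
and the factor `2` absorbs the Jacobian. -/
theorem integral_fold {W : Type*} [NormedAddCommGroup W] [NormedSpace ℝ W] {f k : ℝ → W} {x : ℝ}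
    (hx : x ∈ Ioo (0 : ℝ) 1) (h1 : ∀ᶠ t in offFin, t < (1 - x) / 2 → f t = 0)
    (h2 : ∀ᶠ t in offFin, (1 - x) / 2 < t → t < 1 / 2 → f t = (2 : ℝ) • k (1 - 2 * t))
    (h3 : ∀ᶠ t in offFin, 1 / 2 < t → f t = 0) :
    ∫ t in (0 : ℝ)..1, f t = ∫ u in (0 : ℝ)..x, k u := by
  have e1 : ∫ t in (0 : ℝ)..1, f t = ∫ t in (0 : ℝ)..1,
      (Ioc ((1 - x) / 2) (1 / 2)).indicator (fun t => (2 : ℝ) • k (1 - 2 * t)) t := by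
    refine intervalIntegral_congr_offFin ?_ (by simp) (by simp)
    filter_upwards [h1, h2, h3, eventually_offFin_ne (1 / 2), eventually_offFin_ne ((1 - x) / 2)]
      with t g1 g2 g3 n1 n2
    rcases lt_or_gt_of_ne n2 with h | h
    · rw [g1 h, indicator_of_notMem fun h' => lt_asymm h h'.1]
    · rcases lt_or_gt_of_ne n1 with h' | h'
      · rw [g2 h h', indicator_of_mem (show t ∈ Ioc _ _ from ⟨h, h'.le⟩)]
      · rw [g3 h', indicator_of_notMem fun h'' => not_le.2 h' h''.2]
  have hx1 := hx.1
  have hx2 := hx.2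
  rw [e1, intervalIntegral.integral_of_le zero_le_one, setIntegral_indicator measurableSet_Ioc,
    inter_eq_self_of_subset_right (Ioc_subset_Ioc (by linarith) (by norm_num)),
    ← intervalIntegral.integral_of_le (by linarith), intervalIntegral.integral_smul,
    intervalIntegral.integral_comp_sub_mul k (two_ne_zero) 1, smul_smul]
  norm_num
  congr 1
  ring

theorem ringInverse_mul_conj {R : Type*} [Ring R] {G z : R} (hG : IsUnit G) (hz : IsUnit z)
    (b : R) : Ring.inverse (G * z) * (b * (G * z))
      = Ring.inverse z * (Ring.inverse G * b * G) * z := by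
  obtain ⟨G, rfl⟩ := hG
  obtain ⟨z, rfl⟩ := hz
  rw [← Units.val_mul, Ring.inverse_unit, Ring.inverse_unit, Ring.inverse_unit, mul_inv_rev]
  simp only [Units.val_mul, mul_assoc]

theorem mul_ringInverse_conj {R : Type*} [Ring R] {z : R} (hz : IsUnit z) (b : R) :
    z * (Ring.inverse z * b * z) = b * z := by
  rw [← mul_assoc, ← mul_assoc, Ring.mul_inverse_cancel _ hz, one_mul]

section Theta

variable {E : Type*} [NormedAddCommGroup E] [NormedSpace ℝ E] [FiniteDimensional ℝ E]
  {M : Type*} [TopologicalSpace M] [ChartedSpace E M] [IsManifold 𝓘(ℝ, E) ∞ M]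

/-- A solution along `Θ(-, x)` is glued from solutions on the diagonal, the vertical line and the
bottom side, each run backwards; by the chain rule the speeds `-2`, `-2` and `-2x` appear on both
sides of the equation. Only continuity of `U` links the three pieces. -/
theorem PiecewiseSmoothOn.isSol_Theta {R : Type*} [NormedRing R] [NormedAlgebra ℝ R]
    {σ : ℝ × ℝ → M} (hσ : PiecewiseSmoothOn E σ unitSquare) (A : DiffForm E M R 1) {x : ℝ}
    (hx : x ∈ Ioo (0 : ℝ) 1) {U W₁ W₂ W₃ : ℝ → R} (h0 : U 0 = 1) (hc : ContinuousOn U (Icc 0 1))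
    (h1 : ∀ᶠ r in offFin,
      HasDerivAt W₁ (-(A.alongPath (fun r => σ (r, r)) r * W₁ r)) r)
    (h2 : ∀ᶠ r in offFin, HasDerivAt W₂ (-(A.alongPath (fun u => σ (x, u)) r * W₂ r)) r)
    (h3 : ∀ᶠ r in offFin, HasDerivAt W₃ (-(A.alongPath (fun r => σ (r, 0)) r * W₃ r)) r)
    (e1 : ∀ t < (1 - x) / 2, U t = W₁ (1 - 2 * t))
    (e2 : ∀ t, (1 - x) / 2 < t → t < 1 / 2 → U t = W₂ (1 - 2 * t))
    (e3 : ∀ t, 1 / 2 < t → t < 1 → U t = W₃ (x * (2 - 2 * t))) :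
    IsSol (A.alongPath fun t => (σ ∘ Theta) (t, x)) U := by
  refine ⟨h0, hc, ?_⟩
  have hx1 := hx.1
  have hx2 := hx.2
  filter_upwards [eventually_offFin_one_sub_two_mul h1, eventually_offFin_one_sub_two_mul h2,
    eventually_offFin_mul_two_sub h3 hx,
    eventually_offFin_one_sub_two_mul hσ.isPath_diag.eventually_contMDiffAt,
    eventually_offFin_one_sub_two_mul
      (hσ.isPath_snd (Ioo_subset_Icc_self hx)).eventually_contMDiffAt,
    eventually_offFin_mul_two_sub (hσ.isPath_fst (s := 0) (by simp)).eventually_contMDiffAt hx,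
    eventually_offFin_ne (1 / 2), eventually_offFin_ne ((1 - x) / 2), eventually_offFin_mem]
    with t d1 d2 d3 m1 m2 m3 n1 n2 htI
  rcases lt_or_gt_of_ne n1 with h | h
  · rcases lt_or_gt_of_ne n2 with h' | h'
    · rw [alongPath_Theta_of_lt A h (by linarith) ((m1 h).mdifferentiableAt (by simp)), e1 t h']
      have d := (d1 h).scomp t (hasDerivAt_one_sub_two_mul t)
      refine (d.congr_of_eventuallyEq ?_).congr_deriv ?_
      · filter_upwards [gt_mem_nhds h'] with t' ht' using e1 t' ht'
      · simp
    · rw [alongPath_Theta_of_gt A h (by linarith) ((m2 h).mdifferentiableAt (by simp)), e2 t h' h]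
      have d := (d2 h).scomp t (hasDerivAt_one_sub_two_mul t)
      refine (d.congr_of_eventuallyEq ?_).congr_deriv ?_
      · filter_upwards [gt_mem_nhds h, lt_mem_nhds h'] with t' ht' ht'' using e2 t' ht'' ht'
      · simp
  · rw [alongPath_Theta_of_half_lt A h htI.2 hx.1 ((m3 h).mdifferentiableAt (by simp)),
      e3 t h htI.2]
    have d := (d3 h).scomp t (hasDerivAt_mul_two_sub x t)
    refine (d.congr_of_eventuallyEq ?_).congr_deriv ?_
    · filter_upwards [lt_mem_nhds h, gt_mem_nhds htI.2] with t' ht' ht'' using e3 t' ht' ht''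
    · simp

variable {V : Type*} [NormedAddCommGroup V] [NormedSpace ℝ V] [FiniteDimensional ℝ V]
  {C : FinComplex V} (α : FlatSuperconnection E M C)

theorem PiecewiseSmoothOn.convergesTwo {σ : ℝ × ℝ → M} (hσ : PiecewiseSmoothOn E σ unitSquare) :
    α.ConvergesTwo σ := by
  obtain ⟨G, K, hG, hsl, ha, hb, hKa, hKb⟩ := hσ.exists_isOpen_Theta (α.form 1) (α.form 2)
  have h := dyson_surface (a := fun t s => (α.form 1).alongPath (fun t => (σ ∘ Theta) (t, s)) t)
    (b := fun t s => (α.form 2).alongSurface (σ ∘ Theta) t s) hG hsl ha hb hKa hKb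
  exact ⟨h.1, h.2.1⟩

/-- `α²` survives only on the vertical segment of `Θ(-, x)`, and the point at height `u` on it is
reached at time `t = (1 - u)/2`. -/
theorem PiecewiseSmoothOn.integrate_two {σ : ℝ × ℝ → M} (hσ : PiecewiseSmoothOn E σ unitSquare)
    {U : ℝ → ℝ → (V →L[ℝ] V)} (hU : ∀ᶠ x in offFin,
      IsSol ((α.form 1).alongPath fun t => (σ ∘ Theta) (t, x)) (U x)) :
    α.integrate.two σ = ∫ x in (0 : ℝ)..1, -(U x 1 * ∫ u in (0 : ℝ)..x,
      Ring.inverse (U x ((1 - u) / 2)) *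
        ((α.form 2).alongSurface σ x u * U x ((1 - u) / 2))) := by
  obtain ⟨G, K, hG, hsl, ha, hb, hKa, hKb⟩ := hσ.exists_isOpen_Theta (α.form 1) (α.form 2)
  have h := dyson_surface (a := fun t s => (α.form 1).alongPath (fun t => (σ ∘ Theta) (t, s)) t)
    (b := fun t s => (α.form 2).alongSurface (σ ∘ Theta) t s) hG hsl ha hb hKa hKb
  refine (h.2.2 U hU).trans ?_
  obtain ⟨G', hG'⟩ := hσ.exists_goodSet
  refine intervalIntegral_congr_offFin ?_ (by simp) (by simp)
  filter_upwards [hG'.slice', eventually_offFin_mem] with x hx hxI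
  congr 2
  refine integral_fold hxI ?_ ?_ ?_
  · filter_upwards [eventually_offFin_one_sub_two_mul hσ.isPath_diag.eventually_contMDiffAt]
      with t ht h1
    have h2 : t < 1 / 2 := by linarith [hxI.1]
    rw [alongSurface_Theta_of_lt _ h2 (by linarith) ((ht h2).mdifferentiableAt (by simp)), zero_mul,
      mul_zero]
  · filter_upwards [eventually_offFin_one_sub_two_mul hx] with t ht h1 h2
    rw [alongSurface_Theta_of_gt _ h2 (by linarith) (hG'.mdifferentiableAt (ht h2)),
      hG'.alongSurface _ (ht h2), show (1 - (1 - 2 * t)) / 2 = t by ring, smul_mul_assoc,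
      mul_smul_comm]
  · filter_upwards [eventually_offFin_mul_two_sub
      (hσ.isPath_fst (s := 0) (by simp)).eventually_contMDiffAt hxI, eventually_offFin_mem]
      with t ht htI h1
    rw [alongSurface_Theta_of_half_lt _ h1 htI.2 hxI.1 ((ht h1).mdifferentiableAt (by simp)),
      zero_mul, mul_zero]

theorem DiffForm.alongSurface_swap {W : Type*} [NormedAddCommGroup W] [NormedSpace ℝ W]
    (η : DiffForm E M W 2) (Γ : ℝ × ℝ → M) (t s : ℝ) :
    η.alongSurface (fun p => Γ (p.2, p.1)) t s = -η.alongSurface Γ s t := by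
  have h := (η.toFun (Γ (s, t))).toAlternatingMap.map_swap
    ![vel E (fun t' => Γ (t', t)) s, vel E (fun s' => Γ (s, s')) t]
    (show (0 : Fin 2) ≠ 1 by decide)
  refine Eq.trans ?_ h
  rw [DiffForm.alongSurface]
  change η.toFun (Γ (s, t)) _ = η.toFun (Γ (s, t)) _
  congr 1
  funext i
  fin_cases i <;> rfl

variable {Γ : ℝ × ℝ → M} {g : ℝ → ℝ → (V →L[ℝ] V)}

theorem GoodSet.pCont_field {G : Set (ℝ × ℝ)} (hG : GoodSet E Γ G)
    (hΓ : PiecewiseSmoothOn E Γ unitSquare)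
    (hg : ∀ s ∈ Icc (0 : ℝ) 1, IsSol ((α.form 1).alongPath fun t => Γ (t, s)) (g s))
    {s : ℝ} (hs : s ∈ Icc (0 : ℝ) 1) (hsl : ∀ᶠ t in offFin, (t, s) ∈ G) :
    PCont fun t => α.field Γ g t s := by
  obtain ⟨Cb, hCb⟩ := hG.exists_bound (α.form 2) ![(1, 0), (0, 1)]
  have hb : PCont fun t => (α.form 2).alongSurface Γ t s := by
    refine PCont.congr (f := fun t => (α.form 2).along Γ ![(1, 0), (0, 1)] (t, s)) ⟨?_, Cb, ?_⟩ ?_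
    · filter_upwards [hsl] with t ht
      exact ContinuousAt.comp (f := fun t : ℝ => (t, s))
        ((hG.continuousOn_along (α.form 2) ![(1, 0), (0, 1)]).continuousAt (hG.isOpen.mem_nhds ht))
        (by fun_prop)
    · filter_upwards [hsl] with t ht using hCb _ ht
    · filter_upwards [hsl] with t ht using hG.alongSurface _ ht
  exact ((PCont.cont_mul ((hg s hs).cont_inverse ((hΓ.isPath_fst hs).pCont_alongPath _))
    hb).mul_cont (hg s hs).cont).neg

variable {Q : ℝ → ℝ → (V →L[ℝ] V)} {D : ℝ → (V →L[ℝ] V)}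

/-- By Stokes `g r r` fails the transport equation along the diagonal by the term `g δY(r, r)`,
which the derivative of `D` cancels. The constant `c` on the right is free and is used to match
initial values. -/
theorem hasDerivAt_transport_diag (hΓ : IsTwoPath E Γ)
    (hg : ∀ s ∈ Icc (0 : ℝ) 1, IsSol ((α.form 1).alongPath fun t => Γ (t, s)) (g s))
    (hQ : GaugeSol C (α.fieldInt Γ g) Q D) (c : V →L[ℝ] V) :
    ∀ᶠ r in offFin, HasDerivAt (fun r => g r r * (D r * c))
      (-((α.form 1).alongPath (fun r => Γ (r, r)) r * (g r r * (D r * c)))) r := by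
  obtain ⟨G, hG⟩ := hΓ.1.exists_goodSet
  filter_upwards [hG.slice, hΓ.1.isPath_diag.eventually_contMDiffAt, hQ.deriv,
    eventually_offFin_mem] with r hsl hm hd hrI
  have d1 := hG.hasDerivAt_transport_field α hΓ hg hrI hsl (Ioo_subset_Icc_self hrI)
    (τ := fun s => s) (by
      filter_upwards [Icc_mem_nhds hrI.1 hrI.2] with s hs using ⟨le_rfl, hs⟩)
    (hm.mdifferentiableAt (by simp))
  refine (d1.mul (hd.mul_const c)).congr_deriv ?_
  noncomm_ring

/-- The same cancellation on the vertical line at abscissa `x`, with `Q x` in place of `D`. -/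
theorem hasDerivAt_transport_vertical (hΓ : IsTwoPath E Γ)
    (hg : ∀ s ∈ Icc (0 : ℝ) 1, IsSol ((α.form 1).alongPath fun t => Γ (t, s)) (g s))
    (hQ : GaugeSol C (α.fieldInt Γ g) Q D) (c : V →L[ℝ] V) {x : ℝ} (hx : x ∈ Icc (0 : ℝ) 1) :
    ∀ᶠ u in offFin, HasDerivAt (fun u => g u x * (Q x u * c))
      (-((α.form 1).alongPath (fun u => Γ (x, u)) u * (g u x * (Q x u * c)))) u := by
  obtain ⟨G, hG⟩ := hΓ.1.exists_goodSet
  filter_upwards [hG.slice, (hΓ.1.isPath_snd hx).eventually_contMDiffAt, (hQ.sol x hx).deriv,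
    eventually_offFin_mem] with u hsl hm hd huI
  have d1 := hG.hasDerivAt_transport_field α hΓ hg huI hsl hx
    (τ := fun _ => x) (Eventually.of_forall fun s => ⟨by simp, hx⟩)
    (hm.mdifferentiableAt (by simp))
  refine (d1.mul (hd.mul_const c)).congr_deriv ?_
  noncomm_ring

theorem transport_zero (hg : ∀ s ∈ Icc (0 : ℝ) 1,
    IsSol ((α.form 1).alongPath fun t => Γ (t, s)) (g s)) {s : ℝ} (hs : s ∈ Icc (0 : ℝ) 1) :
    g s 0 = 1 := (hg s hs).zero

/-- The parallel transport along `t ↦ Γ(Θ(t, x))`. -/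
noncomputable def lowerTransport (g Q : ℝ → ℝ → (V →L[ℝ] V)) (D : ℝ → (V →L[ℝ] V)) (x t : ℝ) :
    V →L[ℝ] V :=
  g (max (1 - 2 * t) 0) (max (x * min 1 (2 - 2 * t)) (max (1 - 2 * t) 0)) *
    (Q x (min (max (1 - 2 * t) 0) x) *
      (Ring.inverse (Q x x) * (D (max x (max (1 - 2 * t) 0)) * Ring.inverse (g 1 1))))

/-- The parallel transport along the composite of `Θ(-, x)` with the transpose of `Γ`. -/
noncomputable def upperTransport (g : ℝ → ℝ → (V →L[ℝ] V)) (D : ℝ → (V →L[ℝ] V)) (x t : ℝ) :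
    V →L[ℝ] V :=
  g (max x (max (1 - 2 * t) 0)) (max (1 - 2 * t) 0) *
    (D (max x (max (1 - 2 * t) 0)) * Ring.inverse (g 1 1))

theorem max_one_sub_two_mul_mem {t : ℝ} (ht : t ∈ Icc (0 : ℝ) 1) :
    max (1 - 2 * t) 0 ∈ Icc (0 : ℝ) 1 :=
  ⟨le_max_right _ _, max_le (by linarith [ht.1]) zero_le_one⟩

theorem max_mem_unit {a b : ℝ} (ha : a ∈ Icc (0 : ℝ) 1) (hb : b ∈ Icc (0 : ℝ) 1) :
    max a b ∈ Icc (0 : ℝ) 1 := ⟨le_max_of_le_left ha.1, max_le ha.2 hb.2⟩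

theorem min_mem_unit {a b : ℝ} (ha : a ∈ Icc (0 : ℝ) 1) (hb : b ∈ Icc (0 : ℝ) 1) :
    min a b ∈ Icc (0 : ℝ) 1 := ⟨le_min ha.1 hb.1, min_le_of_left_le ha.2⟩

/-- In `lowerTransport` the arguments of `g` are the height `max (1 - 2t) 0` and the abscissa of
`Θ(t, x)`. With `z = Q(x, x)⁻¹ D(x) g(1, 1)⁻¹` the formula reads `g D g(1, 1)⁻¹` on the diagonal, `g
Q(x, ·) z` on the vertical segment and `g z` on the bottom side. The factor `Q(x, x)⁻¹` makes the
first two agree at `(x, x)`, and `Q(x, 0) = 1` does so at the corner `(x, 0)`. -/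
theorem isSol_lowerTransport {B : ℝ} (hΓ : IsTwoPath E Γ)
    (hg : ∀ s ∈ Icc (0 : ℝ) 1, IsSol ((α.form 1).alongPath fun t => Γ (t, s)) (g s))
    (hY : GaugeData C (α.fieldInt Γ g) (α.field Γ g) B)
    (hQ : GaugeSol C (α.fieldInt Γ g) Q D) {x : ℝ} (hx : x ∈ Ioo (0 : ℝ) 1) :
    IsSol ((α.form 1).alongPath fun t => (Γ ∘ Theta) (t, x)) (lowerTransport g Q D x) := by
  have hx1 := hx.1
  have hx2 := hx.2
  have hxI := Ioo_subset_Icc_self hx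
  have h11 : (1 : ℝ) ∈ Icc (0 : ℝ) 1 := by simp
  have hcg : ContinuousOn (fun p : ℝ × ℝ => g p.2 p.1) unitSquare :=
    hΓ.1.continuousOn_transport (α.form 1) hg
  have hqx := Ring.mul_inverse_cancel _ (hQ.isUnit_Q hY hxI hxI)
  refine hΓ.1.isSol_Theta (α.form 1) hx ?_ ?_
    (hasDerivAt_transport_diag α hΓ hg hQ (Ring.inverse (g 1 1)))
    (hasDerivAt_transport_vertical α hΓ hg hQ
      (Ring.inverse (Q x x) * (D x * Ring.inverse (g 1 1))) hxI)
    (W₃ := fun r => g 0 r * (Ring.inverse (Q x x) * (D x * Ring.inverse (g 1 1)))) ?_ ?_ ?_ ?_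
  · have e : max (1 - 2 * (0 : ℝ)) 0 = 1 := by norm_num
    have e' : max (x * min 1 (2 - 2 * (0 : ℝ))) 1 = 1 := max_eq_right (by norm_num; linarith)
    rw [lowerTransport, e, e', min_eq_right hx2.le, max_eq_right hx2.le, hQ.one, one_mul,
      ← mul_assoc (Q x x), hqx, one_mul,
      Ring.mul_inverse_cancel _ (transport_isUnit α hΓ.1 hg h11 h11)]
  · have hn : ∀ t ∈ Icc (0 : ℝ) 1, x * min 1 (2 - 2 * t) ∈ Icc (0 : ℝ) 1 := fun t ht => by
      have h1 : 0 ≤ min 1 (2 - 2 * t) := le_min zero_le_one (by linarith [ht.2])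
      exact ⟨mul_nonneg hx1.le h1, mul_le_one₀ hx2.le h1 (min_le_left _ _)⟩
    refine ContinuousOn.mul (hcg.comp (f := fun t : ℝ =>
      (max (x * min 1 (2 - 2 * t)) (max (1 - 2 * t) 0), max (1 - 2 * t) 0)) (by fun_prop)
      fun t ht => ⟨max_mem_unit (hn t ht) (max_one_sub_two_mul_mem ht),
        max_one_sub_two_mul_mem ht⟩) (ContinuousOn.mul ?_ (continuousOn_const.mul
          (ContinuousOn.mul ?_ continuousOn_const)))
    · exact (hQ.sol x hxI).cont.comp (by fun_prop) fun t ht =>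
        min_mem_unit (max_one_sub_two_mul_mem ht) hxI
    · exact hQ.cont.comp (by fun_prop) fun t ht => max_mem_unit hxI (max_one_sub_two_mul_mem ht)
  · filter_upwards [(hg 0 (by simp)).deriv] with r hr
    refine (hr.mul_const _).congr_deriv ?_
    rw [neg_mul, mul_assoc]
  · intro t ht
    have e1 : max (1 - 2 * t) 0 = 1 - 2 * t := max_eq_left (by linarith)
    have e2 : min 1 (2 - 2 * t) = 1 := min_eq_left (by linarith)
    rw [lowerTransport, e1, e2, mul_one, max_eq_right (by linarith), min_eq_right (by linarith),
      ← mul_assoc (Q x x), hqx, one_mul]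
  · intro t ht ht'
    have e1 : max (1 - 2 * t) 0 = 1 - 2 * t := max_eq_left (by linarith)
    have e2 : min 1 (2 - 2 * t) = 1 := min_eq_left (by linarith)
    rw [lowerTransport, e1, e2, mul_one, max_eq_left (by linarith), min_eq_left (by linarith)]
  · intro t ht ht'
    have e1 : max (1 - 2 * t) 0 = 0 := max_eq_right (by linarith)
    have e2 : min 1 (2 - 2 * t) = 2 - 2 * t := min_eq_right (by linarith)
    rw [lowerTransport, e1, e2, max_eq_left (mul_nonneg hx1.le (by linarith)),
      min_eq_left hx1.le, max_eq_left hx1.le, (hQ.sol x hxI).zero, one_mul]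

/-- After transposition the middle segment is horizontal, from `(x, x)` back to `(0, x)`, and its
transport is `g x` itself. The last segment lies on the left side of the square, where `Γ` is
constant, so the transport stands still. -/
theorem isSol_upperTransport (hΓ : IsTwoPath E Γ)
    (hg : ∀ s ∈ Icc (0 : ℝ) 1, IsSol ((α.form 1).alongPath fun t => Γ (t, s)) (g s))
    (hQ : GaugeSol C (α.fieldInt Γ g) Q D) {x : ℝ} (hx : x ∈ Ioo (0 : ℝ) 1) :
    IsSol ((α.form 1).alongPath fun t => ((fun p => Γ (p.2, p.1)) ∘ Theta) (t, x))
      (upperTransport g D x) := by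
  have hx1 := hx.1
  have hx2 := hx.2
  have hxI := Ioo_subset_Icc_self hx
  have h11 : (1 : ℝ) ∈ Icc (0 : ℝ) 1 := by simp
  have hcg : ContinuousOn (fun p : ℝ × ℝ => g p.2 p.1) unitSquare :=
    hΓ.1.continuousOn_transport (α.form 1) hg
  refine hΓ.1.swap.isSol_Theta (α.form 1) hx ?_ ?_
    (hasDerivAt_transport_diag α hΓ hg hQ (Ring.inverse (g 1 1)))
    (W₂ := fun u => g x u * (D x * Ring.inverse (g 1 1)))
    (W₃ := fun _ => D x * Ring.inverse (g 1 1)) ?_ ?_ ?_ ?_ ?_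
  · have e : max (1 - 2 * (0 : ℝ)) 0 = 1 := by norm_num
    rw [upperTransport, e, max_eq_right hx2.le, hQ.one, one_mul,
      Ring.mul_inverse_cancel _ (transport_isUnit α hΓ.1 hg h11 h11)]
  · refine ContinuousOn.mul (hcg.comp (f := fun t : ℝ =>
      (max (1 - 2 * t) 0, max x (max (1 - 2 * t) 0))) (by fun_prop)
      fun t ht => ⟨max_one_sub_two_mul_mem ht, max_mem_unit hxI (max_one_sub_two_mul_mem ht)⟩)
      (ContinuousOn.mul ?_ continuousOn_const)
    exact hQ.cont.comp (by fun_prop) fun t ht => max_mem_unit hxI (max_one_sub_two_mul_mem ht)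
  · filter_upwards [(hg x hxI).deriv] with r hr
    refine (hr.mul_const _).congr_deriv ?_
    rw [neg_mul, mul_assoc]
  · filter_upwards [eventually_offFin_mem] with r hr
    refine (hasDerivAt_const r _).congr_deriv ?_
    rw [DiffForm.alongPath_const (x := Γ (0, 0)), zero_mul, neg_zero]
    filter_upwards [Icc_mem_nhds hr.1 hr.2] with s hs using (hΓ.2 s hs).1
  · intro t ht
    have e1 : max (1 - 2 * t) 0 = 1 - 2 * t := max_eq_left (by linarith)
    rw [upperTransport, e1, max_eq_right (by linarith)]
  · intro t ht ht'
    have e1 : max (1 - 2 * t) 0 = 1 - 2 * t := max_eq_left (by linarith)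
    rw [upperTransport, e1, max_eq_left (by linarith)]
  · intro t ht ht'
    have e1 : max (1 - 2 * t) 0 = 0 := max_eq_right (by linarith)
    rw [upperTransport, e1, max_eq_left hx1.le, transport_zero α hg hxI, one_mul]

/-- On the vertical segment the transport is `g Q z`, so conjugation turns `α²` into `-z⁻¹ (Q⁻¹ y Q)
z`. The end value of the transport is `z`, which cancels `z⁻¹` and leaves the flux times `g(1,
1)⁻¹`. -/
theorem integrate_two_lower {B : ℝ} (hΓ : IsTwoPath E Γ)
    (hg : ∀ s ∈ Icc (0 : ℝ) 1, IsSol ((α.form 1).alongPath fun t => Γ (t, s)) (g s))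
    (hY : GaugeData C (α.fieldInt Γ g) (α.field Γ g) B)
    (hQ : GaugeSol C (α.fieldInt Γ g) Q D) :
    α.integrate.two Γ
      = (∫ x in (0 : ℝ)..1, GaugeSol.flux (α.field Γ g) Q D x) * Ring.inverse (g 1 1) := by
  have h01 : (0 : ℝ) ∈ Icc (0 : ℝ) 1 := by simp
  have h11 : (1 : ℝ) ∈ Icc (0 : ℝ) 1 := by simp
  rw [hΓ.1.integrate_two α (U := lowerTransport g Q D) (by
    filter_upwards [eventually_offFin_mem] with x hx using isSol_lowerTransport α hΓ hg hY hQ hx),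
    ← intervalIntegral_mul_right ((hQ.pCont_flux hY).intervalIntegrable h01 h11)]
  refine intervalIntegral_congr_offFin ?_ h01 h11
  filter_upwards [hQ.pCont_conj hY, eventually_offFin_mem] with x hp hx
  have hxI := Ioo_subset_Icc_self hx
  have hx1 := hx.1
  set z := Ring.inverse (Q x x) * (D x * Ring.inverse (g 1 1)) with hz
  have hzu : IsUnit z := (IsUnit.ringInverse (hQ.isUnit_Q hY hxI hxI)).mul
    ((hQ.isUnit x hxI).mul (IsUnit.ringInverse (transport_isUnit α hΓ.1 hg h11 h11)))
  have e1 : lowerTransport g Q D x 1 = z := by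
    have e1 : max (1 - 2 * (1 : ℝ)) 0 = 0 := max_eq_right (by norm_num)
    have e2 : min 1 (2 - 2 * (1 : ℝ)) = 0 := by norm_num
    rw [lowerTransport, e1, e2, mul_zero, max_self, min_eq_left hx1.le, max_eq_left hx1.le,
      (hQ.sol x hxI).zero, one_mul, transport_zero α hg h01, one_mul]
  have e2 : ∫ u in (0 : ℝ)..x, Ring.inverse (lowerTransport g Q D x ((1 - u) / 2)) *
        ((α.form 2).alongSurface Γ x u * lowerTransport g Q D x ((1 - u) / 2))
      = -(Ring.inverse z * (∫ u in (0 : ℝ)..x,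
          Ring.inverse (Q x u) * α.field Γ g x u * Q x u) * z) := by
    have hi := hp.intervalIntegrable h01 hxI
    have hi' : IntervalIntegrable (fun u => Ring.inverse z *
        (Ring.inverse (Q x u) * α.field Γ g x u * Q x u)) volume 0 x :=
      (PCont.cont_mul continuousOn_const hp).intervalIntegrable h01 hxI
    rw [← intervalIntegral_mul_left hi, ← intervalIntegral_mul_right hi',
      ← intervalIntegral.integral_neg]
    refine intervalIntegral.integral_congr_ae (Eventually.of_forall fun u hu => ?_)
    rw [uIoc_of_le hx1.le] at hu
    have huI : u ∈ Icc (0 : ℝ) 1 := ⟨hu.1.le, hu.2.trans hxI.2⟩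
    have e3 : lowerTransport g Q D x ((1 - u) / 2) = g u x * (Q x u * z) := by
      have a1 : max (1 - 2 * ((1 - u) / 2)) 0 = u := by
        rw [show 1 - 2 * ((1 - u) / 2) = u by ring]; exact max_eq_left hu.1.le
      have a2 : min 1 (2 - 2 * ((1 - u) / 2)) = 1 := min_eq_left (by linarith [hu.1])
      rw [lowerTransport, a1, a2, mul_one, max_eq_left hu.2, min_eq_left hu.2]
    have hqu := hQ.isUnit_Q hY hxI huI
    rw [e3, ringInverse_mul_conj (transport_isUnit α hΓ.1 hg huI hxI) (hqu.mul hzu),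
      mul_assoc (Ring.inverse (Q x u * z)), ringInverse_mul_conj hqu hzu]
    simp only [FlatSuperconnection.field, mul_neg, neg_mul, neg_neg]
  rw [e1, e2, mul_neg, neg_neg, mul_ringInverse_conj hzu, GaugeSol.flux, hz]
  simp only [mul_assoc]

/-- Here the inserted factor moves along a horizontal segment with transport `g x · z`, so the inner
integral is already `Y(x, x)`. The sign relative to the other triangle comes from the transposition,
which reverses the orientation. -/
theorem integrate_two_upper {B : ℝ} (hΓ : IsTwoPath E Γ)
    (hg : ∀ s ∈ Icc (0 : ℝ) 1, IsSol ((α.form 1).alongPath fun t => Γ (t, s)) (g s))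
    (hY : GaugeData C (α.fieldInt Γ g) (α.field Γ g) B)
    (hQ : GaugeSol C (α.fieldInt Γ g) Q D) :
    α.integrate.two (fun p => Γ (p.2, p.1))
      = -((∫ x in (0 : ℝ)..1, α.fieldInt Γ g x x * D x) * Ring.inverse (g 1 1)) := by
  have h01 : (0 : ℝ) ∈ Icc (0 : ℝ) 1 := by simp
  have h11 : (1 : ℝ) ∈ Icc (0 : ℝ) 1 := by simp
  obtain ⟨G, hG⟩ := hΓ.1.exists_goodSet
  rw [hΓ.1.swap.integrate_two α (U := upperTransport g D) (by
    filter_upwards [eventually_offFin_mem] with x hx using isSol_upperTransport α hΓ hg hQ hx),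
    ← intervalIntegral_mul_right
      ((hY.pCont_diag.mul_cont hQ.cont).intervalIntegrable h01 h11), ← intervalIntegral.integral_neg]
  refine intervalIntegral_congr_offFin ?_ h01 h11
  filter_upwards [hG.slice, eventually_offFin_mem] with x hsl hx
  have hxI := Ioo_subset_Icc_self hx
  have hx1 := hx.1
  have hp := hG.pCont_field α hΓ.1 hg hxI hsl
  set z := D x * Ring.inverse (g 1 1) with hz
  have hzu : IsUnit z :=
    (hQ.isUnit x hxI).mul (IsUnit.ringInverse (transport_isUnit α hΓ.1 hg h11 h11))
  have e1 : upperTransport g D x 1 = z := by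
    have e1 : max (1 - 2 * (1 : ℝ)) 0 = 0 := max_eq_right (by norm_num)
    rw [upperTransport, e1, max_eq_left hx1.le, transport_zero α hg hxI, one_mul]
  have e2 : ∫ u in (0 : ℝ)..x, Ring.inverse (upperTransport g D x ((1 - u) / 2)) *
        ((α.form 2).alongSurface (fun p => Γ (p.2, p.1)) x u * upperTransport g D x ((1 - u) / 2))
      = Ring.inverse z * α.fieldInt Γ g x x * z := by
    have hi := hp.intervalIntegrable h01 hxI
    have hi' : IntervalIntegrable (fun u => Ring.inverse z * α.field Γ g u x) volume 0 x :=
      (PCont.cont_mul continuousOn_const hp).intervalIntegrable h01 hxI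
    rw [FlatSuperconnection.fieldInt, ← intervalIntegral_mul_left hi,
      ← intervalIntegral_mul_right hi']
    refine intervalIntegral.integral_congr_ae (Eventually.of_forall fun u hu => ?_)
    rw [uIoc_of_le hx1.le] at hu
    have huI : u ∈ Icc (0 : ℝ) 1 := ⟨hu.1.le, hu.2.trans hxI.2⟩
    have e3 : upperTransport g D x ((1 - u) / 2) = g x u * z := by
      have a1 : max (1 - 2 * ((1 - u) / 2)) 0 = u := by
        rw [show 1 - 2 * ((1 - u) / 2) = u by ring]; exact max_eq_left hu.1.le
      rw [upperTransport, a1, max_eq_left hu.2]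
    rw [e3, ringInverse_mul_conj (transport_isUnit α hΓ.1 hg hxI huI) hzu,
      DiffForm.alongSurface_swap]
    simp only [FlatSuperconnection.field, mul_neg, neg_mul]
  rw [e1, e2, mul_ringInverse_conj hzu, hz, mul_assoc]

end Theta

end HigherHol

namespace HigherHol

open Filter

/-! ### Lifts and sections for `GL⁰(V)` and `GL⁻¹(V)`. -/

section Algebra

variable {V : Type*} [NormedAddCommGroup V] [NormedSpace ℝ V] [FiniteDimensional ℝ V]
  (C : FinComplex V)

instance : FiniteDimensional ℝ C.glNeg :=
  inferInstanceAs (FiniteDimensional ℝ (C.endDeg (-1) ⧸ C.exact))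

theorem FinComplex.exists_GL0 {u : V →L[ℝ] V} (hu : IsUnit u) (hm : u ∈ C.gl0) :
    ∃ g : C.GL0, C.toEnd g = u := by
  obtain ⟨u, rfl⟩ := hu
  refine ⟨⟨u, hm, ?_⟩, rfl⟩
  rw [← Ring.inverse_unit]
  exact Subalgebra.ringInverse_mem _ hm

theorem FinComplex.toEnd_injective : Function.Injective C.toEnd := fun _ _ h =>
  Subtype.ext (Units.ext h)

theorem FinComplex.toEnd_inv (g : C.GL0) : C.toEnd g⁻¹ = Ring.inverse (C.toEnd g) :=
  (Ring.inverse_unit (g : (V →L[ℝ] V)ˣ)).symm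

/-- The projection to `gl⁻¹(V)` extends to all endomorphisms, and has a linear section. -/
theorem FinComplex.exists_proj_section : ∃ (P : (V →L[ℝ] V) →L[ℝ] C.glNeg)
    (S : C.glNeg →L[ℝ] (V →L[ℝ] V)), (∀ s : C.endDeg (-1), P s.1 = C.proj s) ∧
    ∀ (φ : C.gl0) (x : C.glNeg), C.sandwich 1 φ x = P (S x * φ.1) := by
  obtain ⟨L, hL⟩ := C.exists_negProj
  have hP : ∀ s : C.endDeg (-1), (-L) s.1 = C.proj s := fun s => by
    rw [neg_apply, hL, neg_neg]
  have hsurj : Function.Surjective C.exact.mkQ := C.exact.mkQ_surjective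
  obtain ⟨r, hr⟩ := LinearMap.exists_rightInverse_of_surjective C.exact.mkQ
    (LinearMap.range_eq_top.2 hsurj)
  let r' : C.glNeg →ₗ[ℝ] C.endDeg (-1) := r
  refine ⟨-L, LinearMap.toContinuousLinearMap ((C.endDeg (-1)).subtype.comp r'), hP, fun φ x => ?_⟩
  have h1 : C.proj (r' x) = x := LinearMap.congr_fun hr x
  conv_lhs => rw [← h1]
  rw [C.sandwich_proj, ← hP]
  exact congrArg (fun z => (-L) (z * φ.1)) (one_mul (r' x).1)

theorem FinComplex.map_bracket {P : (V →L[ℝ] V) →L[ℝ] C.glNeg}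
    (hP : ∀ s : C.endDeg (-1), P s.1 = C.proj s) :
    ∀ m ∈ C.endDeg (-2), P (C.d * m - m * C.d) = 0 := fun m hm =>
  (hP (C.bracketD ⟨m, hm⟩)).trans ((Submodule.Quotient.mk_eq_zero _).2 ⟨_, rfl⟩)

theorem FinComplex.exists_GLNeg {P : (V →L[ℝ] V) →L[ℝ] C.glNeg}
    (hP : ∀ s : C.endDeg (-1), P s.1 = C.proj s) {z : V →L[ℝ] V} (hz : z ∈ C.endDeg (-1))
    (hu : IsUnit (1 + C.deltaL z)) : ∃ h : C.GLNeg, h.toClass = P z :=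
  ⟨⟨C.proj ⟨z, hz⟩, hu⟩, (hP ⟨z, hz⟩).symm⟩

end Algebra

variable {E : Type*} [NormedAddCommGroup E] [NormedSpace ℝ E] [FiniteDimensional ℝ E]
  {M : Type*} [TopologicalSpace M] [ChartedSpace E M] [IsManifold 𝓘(ℝ, E) ∞ M]
  {V : Type*} [NormedAddCommGroup V] [NormedSpace ℝ V] [FiniteDimensional ℝ V]
  {C : FinComplex V} (α : FlatSuperconnection E M C)

theorem rev_rev (γ : ℝ → M) : rev (rev γ) = γ := by
  funext t
  simp [rev]

/-! ### Holonomies of paths. -/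

section Paths

variable {γ : ℝ → M}

theorem IsPath.convergesOne (hγ : IsPath E γ) : α.ConvergesOne (rev γ) := by
  have h := dyson_path (hγ.pCont_alongPath (α.form 1))
  simp only [FlatSuperconnection.ConvergesOne, FlatSuperconnection.iterOne, rev_rev]
  exact ⟨h.1, h.2.1⟩

theorem IsPath.truncPath_eq (hγ : IsPath E γ) {U : ℝ → (V →L[ℝ] V)}
    (hU : IsSol ((α.form 1).alongPath γ) U) : α.integrate.truncPath γ = U 1 := by
  have h := (dyson_path (hγ.pCont_alongPath (α.form 1))).2.2 U hU
  simp only [LowCochains.truncPath, FlatSuperconnection.integrate, FlatSuperconnection.iterOne,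
    rev_rev]
  exact h

theorem IsPath.exists_isSol (hγ : IsPath E γ) :
    ∃ U, IsSol ((α.form 1).alongPath γ) U :=
  (hγ.pCont_alongPath (α.form 1)).exists_isSol

theorem isSol_of_isTransport {g : ℝ → C.GL0} (hg : α.trunc.IsTransport γ g) :
    IsSol ((α.form 1).alongPath γ) fun t => C.toEnd (g t) :=
  ⟨by rw [hg.1]; rfl, hg.2.1, eventually_offFin_iff.2 hg.2.2⟩

theorem isTransport_of_isSol {U : ℝ → (V →L[ℝ] V)} (hU : IsSol ((α.form 1).alongPath γ) U)
    {g : ℝ → C.GL0} (hg : ∀ t ∈ Icc (0 : ℝ) 1, C.toEnd (g t) = U t) :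
    α.trunc.IsTransport γ g := by
  have h0 := hg 0 (by simp)
  refine ⟨C.toEnd_injective (h0.trans hU.zero), hU.cont.congr hg, ?_⟩
  refine eventually_offFin_iff.1 ?_
  filter_upwards [hU.deriv, eventually_offFin_mem] with t ht htI
  rw [hg t (Ioo_subset_Icc_self htI)]
  refine ht.congr_of_eventuallyEq ?_
  filter_upwards [Icc_mem_nhds htI.1 htI.2] with t' ht' using hg t' ht'

theorem IsPath.exists_transport (hγ : IsPath E γ) {U : ℝ → (V →L[ℝ] V)}
    (hU : IsSol ((α.form 1).alongPath γ) U) :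
    ∃ g : ℝ → C.GL0, ∀ t ∈ Icc (0 : ℝ) 1, C.toEnd (g t) = U t := by
  choose! g hg using fun t (ht : t ∈ Icc (0 : ℝ) 1) =>
    C.exists_GL0 (hU.isUnit (hγ.pCont_alongPath _) ht) (IsSol.mem_gl0 α hγ hU ht)
  exact ⟨g, hg⟩

theorem IsPath.hol_eq_integrate (hγ : IsPath E γ) :
    ∃ g : C.GL0, C.toEnd g = α.integrate.truncPath γ ∧
      ∀ g' : C.GL0, α.trunc.HasHol γ g' ↔ g' = g := by
  have h11 : (1 : ℝ) ∈ Icc (0 : ℝ) 1 := by simp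
  obtain ⟨U, hU⟩ := hγ.exists_isSol α
  obtain ⟨g, hg⟩ := hγ.exists_transport α hU
  refine ⟨g 1, (hg 1 h11).trans (hγ.truncPath_eq α hU).symm, fun g' => ⟨?_, ?_⟩⟩
  · rintro ⟨k, hk, rfl⟩
    refine C.toEnd_injective ?_
    rw [hg 1 h11]
    exact (isSol_of_isTransport α hk).unique (hγ.pCont_alongPath _) hU 1 h11
  · rintro rfl
    exact ⟨g, isTransport_of_isSol α hU hg, rfl⟩

end Paths

/-! ### Surface holonomies. -/

section Surfaces

variable {Γ : ℝ × ℝ → M} {g Q : ℝ → ℝ → (V →L[ℝ] V)} {D : ℝ → (V →L[ℝ] V)} {B : ℝ}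

/-- The right factor `β¹(Γ₁⁻¹)` is `g(1, 1)` and cancels the `g(1, 1)⁻¹` in both values of `β²`. -/
theorem truncSurface_eq (hΓ : IsTwoPath E Γ)
    (hg : ∀ s ∈ Icc (0 : ℝ) 1, IsSol ((α.form 1).alongPath fun t => Γ (t, s)) (g s))
    (hY : GaugeData C (α.fieldInt Γ g) (α.field Γ g) B)
    (hQ : GaugeSol C (α.fieldInt Γ g) Q D) :
    α.integrate.truncSurface Γ = (∫ x in (0 : ℝ)..1, GaugeSol.flux (α.field Γ g) Q D x)
      + ∫ x in (0 : ℝ)..1, α.fieldInt Γ g x x * D x := by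
  have h11 : (1 : ℝ) ∈ Icc (0 : ℝ) 1 := by simp
  have h1 : α.integrate.one (rev fun t => Γ (t, 1)) = g 1 1 :=
    (hΓ.1.isPath_fst h11).truncPath_eq α (hg 1 h11)
  rw [LowCochains.truncSurface, h1, integrate_two_lower α hΓ hg hY hQ,
    integrate_two_upper α hΓ hg hY hQ, sub_neg_eq_add, ← add_mul, mul_assoc,
    Ring.inverse_mul_cancel _ (transport_isUnit α hΓ.1 hg h11 h11), mul_one]

theorem truncSurface_mem (hΓ : IsTwoPath E Γ)
    (hg : ∀ s ∈ Icc (0 : ℝ) 1, IsSol ((α.form 1).alongPath fun t => Γ (t, s)) (g s))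
    (hY : GaugeData C (α.fieldInt Γ g) (α.field Γ g) B)
    (hQ : GaugeSol C (α.fieldInt Γ g) Q D) : α.integrate.truncSurface Γ ∈ C.endDeg (-1) := by
  have h01 : (0 : ℝ) ∈ Icc (0 : ℝ) 1 := by simp
  have h11 : (1 : ℝ) ∈ Icc (0 : ℝ) 1 := by simp
  rw [truncSurface_eq α hΓ hg hY hQ]
  refine (C.endDeg (-1)).add_mem (intervalIntegral_mem_submodule _
    (ae_uIoc_of_eventually_offFin ?_ h01 h11)) (intervalIntegral_mem_submodule _
    (ae_uIoc_of_eventually_offFin ?_ h01 h11))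
  · filter_upwards [hY.mem_deriv, eventually_offFin_mem] with x hx hxI
    have hxI' := Ioo_subset_Icc_self hxI
    refine C.mul_mem_endDeg_right (intervalIntegral_mem_submodule _
      (ae_uIoc_of_eventually_offFin ?_ h01 hxI')) (C.gl0.mul_mem
        (Subalgebra.ringInverse_mem _ (hQ.mem_gl0 hY hxI' hxI')) (hQ.mem x hxI'))
    filter_upwards [hx, eventually_offFin_mem] with v hv hvI
    have h := hQ.mem_gl0 hY hxI' (Ioo_subset_Icc_self hvI)
    exact C.mul_mem_endDeg_right (C.mul_mem_endDeg_left (Subalgebra.ringInverse_mem _ h) hv) h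
  · filter_upwards [eventually_offFin_mem] with x hxI
    have hxI' := Ioo_subset_Icc_self hxI
    exact C.mul_mem_endDeg_right (hY.mem x hxI' x hxI') (hQ.mem x hxI')

theorem conj_trunc_eq {P : (V →L[ℝ] V) →L[ℝ] C.glNeg}
    (hP : ∀ s : C.endDeg (-1), P s.1 = C.proj s) {k : C.GL0} {s t : ℝ}
    (hk : C.toEnd k = g s t) :
    C.conj k⁻¹ (α.trunc.B.alongSurface Γ t s) = P (α.field Γ g t s) := by
  have h1 : α.trunc.B.alongSurface Γ t s
      = -C.proj ⟨(α.form 2).alongSurface Γ t s, α.form_two_mem _ _⟩ := rfl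
  rw [h1, FinComplex.conj, map_neg, C.sandwich_proj, ← hP, FlatSuperconnection.field, map_neg]
  congr 2
  change C.toEnd k⁻¹ * _ * C.toEnd k⁻¹⁻¹ = _
  rw [inv_inv, C.toEnd_inv, hk]

theorem GoodSet.integral_conj {P : (V →L[ℝ] V) →L[ℝ] C.glNeg}
    (hP : ∀ s : C.endDeg (-1), P s.1 = C.proj s) {G : Set (ℝ × ℝ)} (hG : GoodSet E Γ G)
    (hΓ : PiecewiseSmoothOn E Γ unitSquare)
    (hg : ∀ s ∈ Icc (0 : ℝ) 1, IsSol ((α.form 1).alongPath fun t => Γ (t, s)) (g s))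
    {s : ℝ} (hs : s ∈ Icc (0 : ℝ) 1) (hsl : ∀ᶠ t in offFin, (t, s) ∈ G) {k : ℝ → C.GL0}
    (hk : ∀ t ∈ Icc (0 : ℝ) 1, C.toEnd (k t) = g s t) :
    ∫ t in (0 : ℝ)..1, C.conj (k t)⁻¹ (α.trunc.B.alongSurface Γ t s)
      = P (α.fieldInt Γ g 1 s) := by
  have h01 : (0 : ℝ) ∈ Icc (0 : ℝ) 1 := by simp
  have h11 : (1 : ℝ) ∈ Icc (0 : ℝ) 1 := by simp
  rw [FlatSuperconnection.fieldInt, ← P.intervalIntegral_comp_comm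
    ((hG.pCont_field α hΓ hg hs hsl).intervalIntegrable h01 h11)]
  exact intervalIntegral.integral_congr fun t ht =>
    conj_trunc_eq α hP (hk t (uIcc_subset_unit h01 h11 ht))

/-- With a linear section `S` the right-hand side of the holonomy equation is visibly affine in `h`,
with bounded linear part, as the uniqueness argument requires. -/
theorem leftD_eq {P : (V →L[ℝ] V) →L[ℝ] C.glNeg} {S : C.glNeg →L[ℝ] (V →L[ℝ] V)}
    (hP : ∀ s : C.endDeg (-1), P s.1 = C.proj s)
    (hS : ∀ (φ : C.gl0) (x : C.glNeg), C.sandwich 1 φ x = P (S x * φ.1)) {z : V →L[ℝ] V}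
    (hz : z ∈ C.endDeg (-1)) (h : C.GLNeg) :
    C.leftD h (P z) = P z + P (S h.toClass * C.deltaL z) := by
  rw [FinComplex.leftD, hS, hP ⟨z, hz⟩, C.delta_proj]
  rfl

/-- Any representative `w` of degree `-1` may replace the section; this is what matches the equation
in `gl⁻¹(V)` with the one satisfied by `gaugeH`. -/
theorem leftD_eq_of_lift {P : (V →L[ℝ] V) →L[ℝ] C.glNeg}
    (hP : ∀ s : C.endDeg (-1), P s.1 = C.proj s) {z w : V →L[ℝ] V}
    (hz : z ∈ C.endDeg (-1)) (hw : w ∈ C.endDeg (-1)) {h : C.GLNeg} (hh : h.toClass = P w) :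
    C.leftD h (P z) = P (z + w * C.deltaL z) := by
  rw [FinComplex.leftD, hh, hP ⟨z, hz⟩, hP ⟨w, hw⟩, C.delta_proj, C.sandwich_proj, map_add,
    hP ⟨z, hz⟩, ← hP (C.sandwichAux _ _ _)]
  exact congrArg (fun v => C.proj ⟨z, hz⟩ + P (v * C.deltaL z)) (one_mul w)

/-- The classes of `gaugeH` at `x = 1` solve the holonomy equation, and `map_gaugeH_one_one`
identifies the end value with the class computed by `truncSurface_eq`. Uniqueness holds because the
difference of two solutions satisfies a homogeneous linear equation. -/
theorem IsTwoPath.surfaceHol_eq (hΓ : IsTwoPath E Γ) :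
    ∃ hx : α.integrate.truncSurface Γ ∈ C.endDeg (-1),
      ∃ h : C.GLNeg, h.toClass = C.proj ⟨α.integrate.truncSurface Γ, hx⟩ ∧
        ∀ h' : C.GLNeg, α.trunc.HasSurfaceHol Γ h' ↔ h' = h := by
  have h11 : (1 : ℝ) ∈ Icc (0 : ℝ) 1 := by simp
  choose! g hg using fun s (hs : s ∈ Icc (0 : ℝ) 1) => (hΓ.1.isPath_fst hs).exists_isSol α
  obtain ⟨B, hY⟩ := exists_gaugeData α hΓ.1 hg
  obtain ⟨Q, D, hQ⟩ := hY.exists_sol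
  obtain ⟨P, S, hP, hS⟩ := C.exists_proj_section
  obtain ⟨G, hG⟩ := hΓ.1.exists_goodSet
  choose! k hk using fun s (hs : s ∈ Icc (0 : ℝ) 1) =>
    (hΓ.1.isPath_fst hs).exists_transport α (hg s hs)
  choose! h hh using fun s (hs : s ∈ Icc (0 : ℝ) 1) =>
    C.exists_GLNeg hP (hQ.gaugeH_mem hY h11 hs) (by
      rw [hQ.one_add_delta_gaugeH hY h11 hs]
      exact IsUnit.ringInverse (hQ.isUnit_Q hY h11 hs))
  have hcont : ContinuousOn (fun s => (h s).toClass) (Icc 0 1) :=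
    (P.continuous.comp_continuousOn (hQ.continuousOn_gaugeH hY h11)).congr hh
  have hderiv : ∀ᶠ s in offFin, HasDerivAt (fun s => (h s).toClass)
      (C.leftD (h s) (P (α.fieldInt Γ g 1 s))) s := by
    filter_upwards [hY.cont, eventually_offFin_mem] with s hs hsI
    have hsI' := Ioo_subset_Icc_self hsI
    have d := P.hasFDerivAt.comp_hasDerivAt s (hQ.hasDerivAt_gaugeH hY h11 hsI (hs 1 h11))
    refine (d.congr_of_eventuallyEq ?_).congr_deriv
      (leftD_eq_of_lift hP (hY.mem 1 h11 s hsI') (hQ.gaugeH_mem hY h11 hsI') (hh s hsI')).symm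
    filter_upwards [Icc_mem_nhds hsI.1 hsI.2] with s' hs' using hh s' hs'
  have hzero : h 0 = 1 := by
    refine Subtype.ext ((hh 0 (by simp)).trans ?_)
    rw [GaugeSol.gaugeH_zero, map_zero]
    rfl
  refine ⟨truncSurface_mem α hΓ hg hY hQ, h 1, ?_, fun h' => ⟨?_, ?_⟩⟩
  · rw [← hP, hh 1 h11, hQ.map_gaugeH_one_one hY (C.map_bracket hP)]
    exact congrArg P (truncSurface_eq α hΓ hg hY hQ).symm
  · rintro ⟨k', hk', f, hf0, hfc, hfd, rfl⟩
    -- The transports chosen in a competing solution need not be the `g s`, but uniqueness of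
    -- transport makes them agree.
    have hk'' : ∀ s ∈ Icc (0 : ℝ) 1, ∀ t ∈ Icc (0 : ℝ) 1, C.toEnd (k' s t) = g s t :=
      fun s hs t ht => (isSol_of_isTransport α (hk' s hs)).unique
        ((hΓ.1.isPath_fst hs).pCont_alongPath _) (hg s hs) t ht
    have hfd' : ∀ᶠ s in offFin, HasDerivAt (fun s => (f s).toClass)
        (C.leftD (f s) (P (α.fieldInt Γ g 1 s))) s := by
      filter_upwards [eventually_offFin_iff.2 hfd, hG.slice, eventually_offFin_mem]
        with s hs hsl hsI
      have hsI' := Ioo_subset_Icc_self hsI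
      rwa [hG.integral_conj α hP hΓ.1 hg hsI' hsl (hk'' s hsI')] at hs
    have hdc : ContinuousOn (fun s => (f s).toClass - (h s).toClass) (Icc 0 1) := hfc.sub hcont
    -- In the difference of the two solutions the inhomogeneous term `P Y(1, s)` drops out.
    have key := eq_zero_of_norm_deriv_le_offFin hdc
      (w := fun s => P (S ((f s).toClass - (h s).toClass) * C.deltaL (α.fieldInt Γ g 1 s)))
      (C := ‖P‖ * (‖S‖ * (‖C.deltaL‖ * B))) ?_
      ((PCont.cont_mul (S.continuous.comp_continuousOn hdc)
        ((hY.pCont 1 h11).clm C.deltaL)).clm P) ?_ ?_ 1 h11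
    · exact Subtype.ext (sub_eq_zero.1 key)
    · filter_upwards [hfd', hderiv, eventually_offFin_mem] with s d1 d2 hsI
      have hm := hY.mem 1 h11 s (Ioo_subset_Icc_self hsI)
      refine (d1.sub d2).congr_deriv ?_
      rw [leftD_eq hP hS hm, leftD_eq hP hS hm, add_sub_add_left_eq_sub, ← map_sub, ← sub_mul,
        ← map_sub]
    · filter_upwards [GaugeSol.norm_Y_le hY] with s hs
      have e1 := C.deltaL.le_opNorm_of_le (hs 1 h11)
      have e2 := S.le_opNorm ((f s).toClass - (h s).toClass)
      refine (P.le_opNorm_of_le ((norm_mul_le _ _).trans (mul_le_mul e2 e1 (norm_nonneg _)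
        (mul_nonneg S.opNorm_nonneg (norm_nonneg _))))).trans (le_of_eq ?_)
      ring
    · rw [hf0, hzero, sub_self]
  · rintro rfl
    refine ⟨k, fun s hs => isTransport_of_isSol α (hg s hs) (hk s hs), h, hzero, hcont, ?_, rfl⟩
    refine eventually_offFin_iff.1 ?_
    filter_upwards [hderiv, hG.slice, eventually_offFin_mem] with s hs hsl hsI
    have hsI' := Ioo_subset_Icc_self hsI
    rwa [hG.integral_conj α hP hΓ.1 hg hsI' hsl (hk s hsI')]

end Surfaces

end HigherHol

theorem mainTheorem1
    {E : Type*} [NormedAddCommGroup E] [NormedSpace ℝ E] [FiniteDimensional ℝ E]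
    {M : Type*} [TopologicalSpace M] [T2Space M] [SecondCountableTopology M]
    [ChartedSpace E M] [IsManifold 𝓘(ℝ, E) ∞ M]
    {V : Type*} [NormedAddCommGroup V] [NormedSpace ℝ V] [FiniteDimensional ℝ V]
    (C : HigherHol.FinComplex V) (α : HigherHol.FlatSuperconnection E M C) :
    (∀ γ : ℝ → M, HigherHol.IsPath E γ →
      α.ConvergesOne (HigherHol.rev γ) ∧
      ∃ g : C.GL0, C.toEnd g = α.integrate.truncPath γ ∧
        ∀ g' : C.GL0, α.trunc.HasHol γ g' ↔ g' = g) ∧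
    (∀ Γ : ℝ × ℝ → M, HigherHol.IsTwoPath E Γ →
      (α.ConvergesTwo Γ ∧ α.ConvergesTwo (fun p => Γ (p.2, p.1)) ∧
        α.ConvergesOne (HigherHol.rev fun t => Γ (t, 1))) ∧
      ∃ hx : α.integrate.truncSurface Γ ∈ C.endDeg (-1),
        ∃ h : C.GLNeg, h.toClass = C.proj ⟨α.integrate.truncSurface Γ, hx⟩ ∧
          ∀ h' : C.GLNeg, α.trunc.HasSurfaceHol Γ h' ↔ h' = h) := by
  refine ⟨fun γ hγ => ⟨hγ.convergesOne α, hγ.hol_eq_integrate α⟩, fun Γ hΓ => ⟨⟨?_, ?_, ?_⟩, ?_⟩⟩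
  · exact hΓ.1.convergesTwo α
  · exact hΓ.1.swap.convergesTwo α
  · exact (hΓ.1.isPath_fst (s := 1) (by simp)).convergesOne α
  · exact hΓ.surfaceHol_eq α
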